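/- **Setting.** Let $\mathcal H$ be a complex Hilbert space (inner product antilinear in the first variable). Linear operators are not necessarily bounded; sums and products are taken on their natural domains. Let $H_0$ be a non-negative self-adjoint operator in $\mathcal H$ with spectral measure $E_{H_0}$, and put $V_E=\operatorname{Ran}E_{H_0}([0,E])$ for $E\ge 0$, $D_{\mathrm{fin}}=\bigcup_{E\ge0}V_E$. A linear operator $A$ is in the $\mathcal C_0$ class if (I) $A$ and $A^*$ are densely defined and closed; (II) $A$ and $A^*$ are $H_0^{1/2}$-bounded; (III) there is $b\ge 0$ such that $A$ and $A^*$ map $V_E$ into $V_{E+b}$ for all $E\ge 0$. For such $A$ and $z\in\mathbb C$, let $A(z)$ be the closure of $e^{izH_0}Ae^{-izH_0}$. *Time-ordered exponentials.* Let $\Gamma$ be a piecewise $C^1$ simple (injective) curve in $\mathbb C$, parametrized by a compact interval; $\zeta\succ\zeta'$ means that $\zeta,\zeta'\in\Gamma$ and $\zeta$ is reached later than $\zeta'$. Let $F_1,\dots,F_k,F$ ($k\ge0$) be operator-valued functions on $\Gamma$ and $\zeta_1,\dots,\zeta_k\in\Gamma$. With $F_{k+1}=\dots=F_{k+n}=F$,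 put $$T\big(F_1(\zeta_1)\cdots F_{k+n}(\zeta_{k+n})\big)=\sum_{\sigma\in\mathfrak S_{k+n}}\chi_{\{\zeta_{\sigma(1)}\succ\dots\succ\zeta_{\sigma(k+n)}\}}\,F_{\sigma(1)}(\zeta_{\sigma(1)})\cdots F_{\sigma(k+n)}(\zeta_{\sigma(k+n)}),$$ $$T F_1(\zeta_1)\cdots F_k(\zeta_k)\exp\Big(\int_\Gamma d\zeta\,F(\zeta)\Big)\Psi=\sum_{n=0}^\infty\frac1{n!}\int_{\Gamma^n}d\zeta_{k+1}\cdots d\zeta_{k+n}\,T\big(F_1(\zeta_1)\cdots F_k(\zeta_k)F(\zeta_{k+1})\cdots F(\zeta_{k+n})\big)\Psi$$ (strong integrals). The domain consists of the $\Psi$ for which the series converges absolutely and for which, for all $n$, all $\sigma\in\mathfrak S_{k+n}$ and all fixed $\zeta_1,\dots,\zeta_k\in\Gamma$, the vector $F_{\sigma(1)}(\zeta_{\sigma(1)})\cdots F_{\sigma(k+n)}(\zeta_{\sigma(k+n)})\Psi$ is defined and continuous in $(\zeta_{k+1},\dots,\zeta_{k+n})\in\Gamma^n$. *Hamiltonian.*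 Let $H_1$ be symmetric and in the $\mathcal C_0$ class, and let $H=H_0+H_1$. For $\operatorname{Im}z\le\operatorname{Im}z'$ let $U(z,z')$ be the restriction to $D_{\mathrm{fin}}$ of $T\exp(-i\int_\Gamma d\zeta\,H_1(\zeta))$, with $\Gamma$ the line segment from $z'$ to $z$. For $\operatorname{Im}z\le 0$ let $W(z)=e^{-izH_0}\,\overline{U(z,0)}$. For an operator $S$ let $E_0(S)=\inf\sigma(S)$; a unit vector $\Psi$ is called a unique ground state of $S$ if $\ker(S-E_0(S))$ is one-dimensional and contains $\Psi$. **Theorem (abstract Gell-Mann–Low formula).** Assume that $\Omega_0$ is a unique ground state of $H_0$ with $E_0(H_0)=0$, that $\Omega$ is a unique ground state of $H$, and that $\langle\Omega,\Omega_0\rangle\ne0$. Let $m\ge1$ and let $A_1,\dots,A_m$ be $\mathcal C_0$-class operators such that for each $k$ there is an integer $r_k\ge0$ such that $A_k$ maps $D(H^{n+r_k})$ into $D(H^n)$ for all $n\in\mathbb N$. Let $z_1,\dots,z_m\in\mathbb C$ with $\operatorname{Im}z_1\le\dots\le\operatorname{Im}z_m$. Then the $m$-point Green's function $$G_m(z_1,\dots,z_m)=e^{i(z_1-z_m)E_0(H)}\big\langle\Omega,\,A_1W(z_1-z_2)A_2\cdots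 A_{m-1}W(z_{m-1}-z_m)A_m\Omega\big\rangle$$ is well defined, that is, $\Omega$ is in the domain of the operator product. Moreover, let $\varepsilon>0$ and, for all sufficiently large $T>0$, let $\Gamma_T^\varepsilon$ be a piecewise $C^1$ simple curve from $-T(1-i\varepsilon)$ to $T(1-i\varepsilon)$ that passes through $z_1,\dots,z_m$ with $z_1\succ\dots\succ z_m$. Then for all sufficiently large $T$ the vector $\Omega_0$ is in the domains of the two operators below, the denominator is non-zero, and $$G_m(z_1,\dots,z_m)=\lim_{T\to\infty}\frac{\Big\langle\Omega_0,\;T A_1(z_1)\cdots A_m(z_m)\exp\Big(-i\int_{\Gamma_T^\varepsilon}d\zeta\,H_1(\zeta)\Big)\Omega_0\Big\rangle}{\Big\langle\Omega_0,\;T\exp\Big(-i\int_{\Gamma_T^\varepsilon}d\zeta\,H_1(\zeta)\Big)\Omega_0\Big\rangle}.$$ -/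

import Mathlib

open MeasureTheory Filter Topology
open scoped InnerProductSpace ENNReal

noncomputable section

namespace GellMannLow

/-! ### Unbounded operators

A (not necessarily bounded) linear operator in `H` is a `LinearPMap`.  Sums, scalar multiples,
adjoints `T†`, closedness and closures are those of Mathlib. -/

section Operators

variable {H : Type*} [NormedAddCommGroup H] [InnerProductSpace ℂ H]

/-- The product `S T` on its natural domain `{ψ ∈ D(T) | T ψ ∈ D(S)}`. -/
def opMul (S T : H →ₗ.[ℂ] H) : H →ₗ.[ℂ] H where
  domain := (S.domain.comap T.toFun).map T.domain.subtype
  toFun :=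
    { toFun := fun ψ => S ⟨T ⟨ψ, by obtain ⟨_, ⟨x, _, rfl⟩⟩ := ψ; exact x.2⟩, by
        obtain ⟨_, ⟨x, hx, rfl⟩⟩ := ψ; exact hx⟩
      map_add' := fun x y => by
        rw [← LinearPMap.map_add]; congr 1; ext1
        exact T.map_add ⟨x, _⟩ ⟨y, _⟩
      map_smul' := fun c x => by
        simp only [RingHom.id_apply]
        rw [← LinearPMap.map_smul]; congr 1; ext1
        exact T.map_smul c ⟨x, _⟩ }

theorem mem_opMul_domain {S T : H →ₗ.[ℂ] H} {ψ : H} :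
    ψ ∈ (opMul S T).domain ↔ ∃ h : ψ ∈ T.domain, T ⟨ψ, h⟩ ∈ S.domain := by
  constructor
  · rintro ⟨x, hx, rfl⟩; exact ⟨x.2, hx⟩
  · rintro ⟨h, hx⟩; exact ⟨⟨ψ, h⟩, hx, rfl⟩

/-- The identity operator, defined everywhere. -/
def opOne : H →ₗ.[ℂ] H := (LinearMap.id : H →ₗ[ℂ] H).toPMap ⊤

/-- The product `T₁ T₂ ⋯ Tₙ` of a list of operators, on its natural domain. -/
def opProd (L : List (H →ₗ.[ℂ] H)) : H →ₗ.[ℂ] H := L.foldr opMul opOne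

/-- The powers `Tⁿ`, on their natural domains. -/
def opPow (T : H →ₗ.[ℂ] H) (n : ℕ) : H →ₗ.[ℂ] H := opProd (List.replicate n T)

open Classical in
/-- The value `T ψ` for `ψ ∈ D(T)` (and `0` for other `ψ`). -/
def opApply (T : H →ₗ.[ℂ] H) (ψ : H) : H := if h : ψ ∈ T.domain then T ⟨ψ, h⟩ else 0

theorem opApply_of_mem {T : H →ₗ.[ℂ] H} {ψ : H} (h : ψ ∈ T.domain) :
    opApply T ψ = T ⟨ψ, h⟩ := by
  simp [opApply, h]

theorem opApply_add {T : H →ₗ.[ℂ] H} {ψ φ : H} (hψ : ψ ∈ T.domain) (hφ : φ ∈ T.domain) :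
    opApply T (ψ + φ) = opApply T ψ + opApply T φ := by
  rw [opApply_of_mem hψ, opApply_of_mem hφ, opApply_of_mem (T.domain.add_mem hψ hφ),
    ← LinearPMap.map_add]
  rfl

theorem opApply_smul {T : H →ₗ.[ℂ] H} {ψ : H} (c : ℂ) (hψ : ψ ∈ T.domain) :
    opApply T (c • ψ) = c • opApply T ψ := by
  rw [opApply_of_mem hψ, opApply_of_mem (T.domain.smul_mem c hψ), ← LinearPMap.map_smul]
  rfl

theorem opApply_zero (T : H →ₗ.[ℂ] H) : opApply T 0 = 0 := by
  rw [opApply_of_mem T.domain.zero_mem]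
  exact T.map_zero

/-- `T` maps the set `S` into the set `S'`; in particular `S ⊆ D(T)`. -/
def OpMapsTo (T : H →ₗ.[ℂ] H) (S S' : Set H) : Prop :=
  ∀ ψ ∈ S, ∃ h : ψ ∈ T.domain, T ⟨ψ, h⟩ ∈ S'

/-- `T` is `S`-bounded: `D(S) ⊆ D(T)` and `‖T ψ‖ ≤ a ‖S ψ‖ + c ‖ψ‖` on `D(S)`. -/
def RelBounded (T S : H →ₗ.[ℂ] H) : Prop :=
  S.domain ≤ T.domain ∧
    ∃ a c : ℝ, ∀ ψ ∈ S.domain, ‖opApply T ψ‖ ≤ a * ‖opApply S ψ‖ + c * ‖ψ‖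

/-- A symmetric operator: densely defined, with `⟪T ψ, φ⟫ = ⟪ψ, T φ⟫` for `ψ, φ ∈ D(T)`. -/
def IsSymmetricOp (T : H →ₗ.[ℂ] H) : Prop :=
  Dense (T.domain : Set H) ∧ T.IsFormalAdjoint T

/-- A non-negative operator: `⟪ψ, T ψ⟫ ≥ 0` for `ψ ∈ D(T)`. -/
def IsNonnegOp (T : H →ₗ.[ℂ] H) : Prop :=
  ∀ ψ : T.domain, 0 ≤ (⟪(ψ : H), T ψ⟫_ℂ).re

/-- `μ` is in the resolvent set of `T`: `T - μ` is a bijection of `D(T)` onto `H` with a bounded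
inverse `R`. -/
def InResolventSet (T : H →ₗ.[ℂ] H) (μ : ℂ) : Prop :=
  ∃ R : H →L[ℂ] H,
    (∀ φ : H, ∃ h : R φ ∈ T.domain, T ⟨R φ, h⟩ - μ • R φ = φ) ∧
    (∀ ψ : T.domain, R (T ψ - μ • (ψ : H)) = ψ)

/-- The spectrum `σ(T)`. -/
def opSpectrum (T : H →ₗ.[ℂ] H) : Set ℂ := {μ | ¬ InResolventSet T μ}

/-- The ground energy `E₀(T) = inf σ(T)` (of a self-adjoint operator that is bounded below). -/
def groundEnergy (T : H →ₗ.[ℂ] H) : ℝ := sInf {x : ℝ | (x : ℂ) ∈ opSpectrum T}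

/-- The eigenspace `ker (T - μ)`. -/
def opEigenspace (T : H →ₗ.[ℂ] H) (μ : ℂ) : Submodule ℂ H :=
  (LinearMap.ker (T.toFun - μ • T.domain.subtype)).map T.domain.subtype

theorem mem_opEigenspace {T : H →ₗ.[ℂ] H} {μ : ℂ} {ψ : H} :
    ψ ∈ opEigenspace T μ ↔ ∃ h : ψ ∈ T.domain, T ⟨ψ, h⟩ = μ • ψ := by
  constructor
  · rintro ⟨x, hx, rfl⟩
    exact ⟨x.2, sub_eq_zero.mp hx⟩
  · rintro ⟨h, hx⟩
    exact ⟨⟨ψ, h⟩, sub_eq_zero.mpr hx, rfl⟩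

/-- `Ω` is a normalized ground state of `T`, and `T` has a unique ground state:
`dim ker (T - E₀(T)) = 1`. -/
def IsUniqueGroundState (T : H →ₗ.[ℂ] H) (Ω : H) : Prop :=
  ‖Ω‖ = 1 ∧ Ω ∈ opEigenspace T (groundEnergy T) ∧
    Module.finrank ℂ (opEigenspace T (groundEnergy T)) = 1

end Operators

/-! ### Spectral measures and the Borel functional calculus -/

section SpectralCalculus

variable (H : Type*) [NormedAddCommGroup H] [InnerProductSpace ℂ H] [CompleteSpace H]

/-- A projection-valued measure on `ℝ`.  The values on non-measurable sets are irrelevant. -/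
structure ProjValuedMeasure where
  /-- the projection attached to a Borel set -/
  proj : Set ℝ → H →L[ℂ] H
  isStarProjection : ∀ B, MeasurableSet B → IsStarProjection (proj B)
  proj_univ : proj Set.univ = 1
  proj_inter : ∀ B C, MeasurableSet B → MeasurableSet C → proj (B ∩ C) = proj B * proj C
  hasSum_proj : ∀ B : ℕ → Set ℝ, (∀ n, MeasurableSet (B n)) → Pairwise (Function.onFun Disjoint B) →
    ∀ ψ : H, HasSum (fun n => proj (B n) ψ) (proj (⋃ n, B n) ψ)

variable {H}

namespace ProjValuedMeasure

variable (P : ProjValuedMeasure H)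

theorem proj_empty : P.proj ∅ = 0 := by
  ext ψ
  have h := P.hasSum_proj (fun _ => ∅) (fun _ => MeasurableSet.empty)
    (fun _ _ _ => disjoint_bot_left) ψ
  have h1 := h.summable.tendsto_atTop_zero
  simpa using tendsto_nhds_unique tendsto_const_nhds h1

theorem inner_proj {B C : Set ℝ} (hB : MeasurableSet B) (hC : MeasurableSet C) (ψ φ : H) :
    ⟪P.proj B ψ, P.proj C φ⟫_ℂ = ⟪ψ, P.proj (B ∩ C) φ⟫_ℂ := by
  rw [P.proj_inter B C hB hC, ← ContinuousLinearMap.adjoint_inner_right]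
  have := (P.isStarProjection B hB).isSelfAdjoint.star_eq
  rw [ContinuousLinearMap.star_eq_adjoint] at this
  rw [this]; rfl

theorem norm_proj_sq {B : Set ℝ} (hB : MeasurableSet B) (ψ : H) :
    ‖P.proj B ψ‖ ^ 2 = (⟪ψ, P.proj B ψ⟫_ℂ).re := by
  have h := P.inner_proj hB hB ψ ψ
  rw [Set.inter_self] at h
  rw [← h, inner_self_eq_norm_sq_to_K]
  norm_cast

/-- The finite Borel measure `μ_ψ(B) = ‖P(B) ψ‖² = ⟪ψ, P(B) ψ⟫`. -/
def measure (ψ : H) : Measure ℝ :=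
  Measure.ofMeasurable (fun B _ => ENNReal.ofReal (‖P.proj B ψ‖ ^ 2))
    (by simp [P.proj_empty])
    (by
      intro B hB hd
      have h1 : HasSum (fun n => ‖P.proj (B n) ψ‖ ^ 2) (‖P.proj (⋃ n, B n) ψ‖ ^ 2) := by
        rw [P.norm_proj_sq (MeasurableSet.iUnion hB)]
        simp_rw [fun n => P.norm_proj_sq (hB n) ψ]
        exact Complex.hasSum_re ((innerSL ℂ ψ).hasSum (P.hasSum_proj B hB hd ψ))
      rw [← h1.tsum_eq, ENNReal.ofReal_tsum_of_nonneg (fun _ => by positivity) h1.summable])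

theorem measure_apply (ψ : H) {B : Set ℝ} (hB : MeasurableSet B) :
    P.measure ψ B = ENNReal.ofReal (‖P.proj B ψ‖ ^ 2) :=
  Measure.ofMeasurable_apply B hB

theorem measure_add_le (ψ φ : H) :
    P.measure (ψ + φ) ≤ (2 : ℝ≥0∞) • (P.measure ψ + P.measure φ) := by
  refine Measure.le_iff.mpr fun B hB => ?_
  simp only [Measure.smul_apply, Measure.add_apply, smul_eq_mul, P.measure_apply _ hB, map_add]
  rw [← ENNReal.ofReal_add (by positivity) (by positivity),
    show (2 : ℝ≥0∞) = ENNReal.ofReal 2 by simp, ← ENNReal.ofReal_mul (by norm_num)]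
  refine ENNReal.ofReal_le_ofReal ?_
  have := norm_add_le (P.proj B ψ) (P.proj B φ)
  nlinarith [sq_nonneg (‖P.proj B ψ‖ - ‖P.proj B φ‖), norm_nonneg (P.proj B ψ + P.proj B φ)]

theorem measure_smul_le (c : ℂ) (ψ : H) :
    P.measure (c • ψ) ≤ ENNReal.ofReal (‖c‖ ^ 2) • P.measure ψ := by
  refine Measure.le_iff.mpr fun B hB => ?_
  simp only [Measure.smul_apply, smul_eq_mul, P.measure_apply _ hB, map_smul, norm_smul, mul_pow]
  rw [ENNReal.ofReal_mul (by positivity)]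

instance (ψ : H) : IsFiniteMeasure (P.measure ψ) :=
  ⟨by rw [P.measure_apply _ MeasurableSet.univ]; exact ENNReal.ofReal_lt_top⟩

/-- The integral `(∫ s dP) ψ = ∑ c • P(s = c) ψ` of a simple function `s`. -/
def simpleIntegral (s : SimpleFunc ℝ ℂ) (ψ : H) : H :=
  ∑ c ∈ s.range, c • P.proj (s ⁻¹' {c}) ψ

theorem proj_union {B C : Set ℝ} (hB : MeasurableSet B) (hC : MeasurableSet C)
    (hd : Disjoint B C) (ψ : H) : P.proj (B ∪ C) ψ = P.proj B ψ + P.proj C ψ := by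
  let F : ℕ → Set ℝ := fun n => if n = 0 then B else if n = 1 then C else ∅
  have hU : (⋃ n, F n) = B ∪ C := by
    ext x
    simp only [F, Set.mem_iUnion, Set.mem_union]
    constructor
    · rintro ⟨n, hn⟩
      split_ifs at hn
      · exact Or.inl hn
      · exact Or.inr hn
      · exact hn.elim
    · rintro (h | h)
      · exact ⟨0, by simpa using h⟩
      · exact ⟨1, by simpa using h⟩
  have hs := P.hasSum_proj F (fun n => by dsimp only [F]; split_ifs <;> simp [hB, hC])
    (fun i j hij => by
      dsimp only [F, Function.onFun]
      split_ifs <;> first | omega | simp [hd.symm]) ψ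
  rw [hU] at hs
  refine hs.unique ?_
  have h2 : HasSum (fun n => P.proj (F n) ψ) (∑ n ∈ Finset.range 2, P.proj (F n) ψ) :=
    hasSum_sum_of_ne_finset_zero fun n hn => by
      have : ¬ n < 2 := fun hlt => hn (Finset.mem_range.mpr hlt)
      have h0 : n ≠ 0 := by omega
      have h1 : n ≠ 1 := by omega
      simp [F, h0, h1, P.proj_empty]
  simpa [Finset.sum_range_succ, F] using h2

theorem simpleIntegral_sub (s t : SimpleFunc ℝ ℂ) (ψ : H) :
    P.simpleIntegral (s - t) ψ = P.simpleIntegral s ψ - P.simpleIntegral t ψ := by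
  let T : Set ℝ → ℂ →L[ℝ] H := fun B =>
    (ContinuousLinearMap.id ℝ ℂ).smulRight (P.proj B ψ)
  have hT : FinMeasAdditive (P.measure ψ) T := by
    intro B C hB hC _ _ hd
    ext
    simp [T, P.proj_union hB hC hd ψ]
  exact SimpleFunc.setToSimpleFunc_sub T hT
    (SimpleFunc.integrable_of_isFiniteMeasure s) (SimpleFunc.integrable_of_isFiniteMeasure t)

theorem enorm_simpleIntegral (s : SimpleFunc ℝ ℂ) (ψ : H) :
    ‖P.simpleIntegral s ψ‖ₑ = eLpNorm s 2 (P.measure ψ) := by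
  have hm : ∀ c, MeasurableSet (s ⁻¹' {c}) := s.measurableSet_fiber
  have key : ‖P.simpleIntegral s ψ‖ ^ 2 =
      ∑ c ∈ s.range, ‖c‖ ^ 2 * ‖P.proj (s ⁻¹' {c}) ψ‖ ^ 2 := by
    have h : ⟪P.simpleIntegral s ψ, P.simpleIntegral s ψ⟫_ℂ =
        ∑ c ∈ s.range, ((‖c‖ ^ 2 * ‖P.proj (s ⁻¹' {c}) ψ‖ ^ 2 : ℝ) : ℂ) := by
      simp only [simpleIntegral, sum_inner]
      simp only [inner_sum]
      refine Finset.sum_congr rfl fun c hc => ?_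
      rw [Finset.sum_eq_single_of_mem c hc]
      · rw [inner_self_eq_norm_sq_to_K, norm_smul, ← mul_pow]
        norm_cast
      · intro d _ hdc
        have he : s ⁻¹' {c} ∩ s ⁻¹' {d} = ∅ := by
          rw [← Set.preimage_inter, Set.singleton_inter_eq_empty.mpr (by simpa using hdc.symm),
            Set.preimage_empty]
        rw [inner_smul_left, inner_smul_right, P.inner_proj (hm _) (hm _), he, P.proj_empty]
        simp
    rw [inner_self_eq_norm_sq_to_K] at h
    exact Complex.ofReal_injective (by push_cast at h ⊢; exact h)
  have h2 : ‖P.simpleIntegral s ψ‖ₑ ^ (2 : ℝ) = eLpNorm s 2 (P.measure ψ) ^ (2 : ℝ) := by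
    have h3 := eLpNorm_nnreal_pow_eq_lintegral (f := s) (μ := P.measure ψ) (p := 2) two_ne_zero
    simp only [NNReal.coe_ofNat, ENNReal.coe_ofNat] at h3
    rw [h3]
    have h4 : ∀ x, ‖s x‖ₑ ^ (2 : ℝ) = (s.map fun c => ‖c‖ₑ ^ (2 : ℝ)) x := fun x => rfl
    simp_rw [h4]
    rw [SimpleFunc.lintegral_eq_lintegral, SimpleFunc.map_lintegral]
    simp only [P.measure_apply ψ (hm _), ENNReal.rpow_ofNat]
    rw [← ofReal_norm, ← ENNReal.ofReal_pow (norm_nonneg _), key,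
      ENNReal.ofReal_sum_of_nonneg (fun _ _ => by positivity)]
    refine Finset.sum_congr rfl fun c _ => ?_
    rw [← ofReal_norm, ← ENNReal.ofReal_pow (norm_nonneg _),
      ENNReal.ofReal_mul (by positivity)]
  exact ENNReal.rpow_left_injective (two_ne_zero) h2

theorem simpleIntegral_add_right (s : SimpleFunc ℝ ℂ) (ψ φ : H) :
    P.simpleIntegral s (ψ + φ) = P.simpleIntegral s ψ + P.simpleIntegral s φ := by
  simp [simpleIntegral, Finset.sum_add_distrib]

theorem simpleIntegral_smul_right (s : SimpleFunc ℝ ℂ) (c : ℂ) (ψ : H) :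
    P.simpleIntegral s (c • ψ) = c • P.simpleIntegral s ψ := by
  simp only [simpleIntegral, map_smul, Finset.smul_sum]
  exact Finset.sum_congr rfl fun x _ => smul_comm _ _ _

/-- The standard simple functions that approximate a measurable function, pointwise and in `L²`. -/
def simpleApprox {f : ℝ → ℂ} (hf : Measurable f) (n : ℕ) : SimpleFunc ℝ ℂ :=
  SimpleFunc.approxOn f hf Set.univ 0 (Set.mem_univ 0) n

theorem exists_tendsto {f : ℝ → ℂ} (hf : Measurable f) {ψ : H} (h : MemLp f 2 (P.measure ψ)) :
    ∃ φ, Tendsto (fun n => P.simpleIntegral (simpleApprox hf n) ψ) atTop (𝓝 φ) := by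
  refine cauchySeq_tendsto_of_complete ?_
  have hlim : Tendsto (fun n => eLpNorm (⇑(simpleApprox hf n) - f) 2 (P.measure ψ)) atTop (𝓝 0) :=
    SimpleFunc.tendsto_approxOn_Lp_eLpNorm hf (Set.mem_univ 0) (by simp) (by simp)
      (by simpa using h.2)
  rw [EMetric.cauchySeq_iff]
  intro ε hε
  have hε2 : 0 < ε / 2 := ENNReal.div_pos hε.ne' (by simp)
  obtain ⟨N, hN⟩ := eventually_atTop.mp (hlim.eventually (gt_mem_nhds hε2))
  refine ⟨N, fun m hm n hn => ?_⟩
  rw [edist_eq_enorm_sub, ← P.simpleIntegral_sub, P.enorm_simpleIntegral]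
  have e : ⇑(simpleApprox hf m - simpleApprox hf n) =
      (⇑(simpleApprox hf m) - f) - (⇑(simpleApprox hf n) - f) := by
    ext x; simp
  rw [e]
  have hsm : ∀ k, AEStronglyMeasurable (⇑(simpleApprox hf k) - f) (P.measure ψ) := fun k =>
    (SimpleFunc.aestronglyMeasurable _).sub hf.aestronglyMeasurable
  calc _ ≤ _ := eLpNorm_sub_le (hsm m) (hsm n) (by norm_num)
    _ < ε / 2 + ε / 2 := ENNReal.add_lt_add (hN m hm) (hN n hn)
    _ = ε := ENNReal.add_halves ε

/-- The operator `f(T) = ∫ f dP`, with domain `{ψ | ∫ |f|² dμ_ψ < ∞}` and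
`f(T) ψ = lim (∫ fₙ dP) ψ` for the standard simple approximations `fₙ` of `f`. -/
def integralOp (f : ℝ → ℂ) (hf : Measurable f) : H →ₗ.[ℂ] H where
  domain :=
    { carrier := {ψ | MemLp f 2 (P.measure ψ)}
      zero_mem' := by
        have h : P.measure 0 = 0 := by
          refine Measure.ext fun B hB => ?_
          simp [P.measure_apply _ hB]
        simp [h]
      add_mem' := fun {ψ φ} hψ hφ =>
        MemLp.mono_measure (P.measure_add_le ψ φ) (MemLp.smul_measure
          ((memLp_two_iff_integrable_sq_norm hf.aestronglyMeasurable).mpr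
            (((memLp_two_iff_integrable_sq_norm hf.aestronglyMeasurable).mp hψ).add_measure
              ((memLp_two_iff_integrable_sq_norm hf.aestronglyMeasurable).mp hφ))) (by simp))
      smul_mem' := fun c ψ hψ =>
        MemLp.mono_measure (P.measure_smul_le c ψ) (MemLp.smul_measure hψ ENNReal.ofReal_ne_top) }
  toFun :=
    { toFun := fun ψ => limUnder atTop fun n => P.simpleIntegral (simpleApprox hf n) (ψ : H)
      map_add' := fun ψ φ => by
        have h1 := (P.exists_tendsto hf ψ.2)
        have h2 := (P.exists_tendsto hf φ.2)
        refine Tendsto.limUnder_eq ?_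
        simp only [Submodule.coe_add, simpleIntegral_add_right]
        exact (tendsto_nhds_limUnder h1).add (tendsto_nhds_limUnder h2)
      map_smul' := fun c ψ => by
        have h1 := (P.exists_tendsto hf ψ.2)
        refine Tendsto.limUnder_eq ?_
        simp only [Submodule.coe_smul, simpleIntegral_smul_right, RingHom.id_apply]
        exact (tendsto_nhds_limUnder h1).const_smul c }

end ProjValuedMeasure

/-- `P` is the spectral measure of `T`, that is, `T = ∫ x dP(x)`. -/
def IsSpectralMeasure (P : ProjValuedMeasure H) (T : H →ₗ.[ℂ] H) : Prop :=
  P.integralOp (fun x => (x : ℂ)) Complex.measurable_ofReal = T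

/-- The projection-valued measure concentrated at `0` (only a default value). -/
def ProjValuedMeasure.atZero : ProjValuedMeasure H where
  proj B := Set.indicator B (fun _ => 1) 0
  isStarProjection B _ := by
    by_cases h : (0 : ℝ) ∈ B
    · simp [h, IsStarProjection.one]
    · simp [h, IsStarProjection.zero]
  proj_univ := by simp
  proj_inter B C _ _ := by
    by_cases h : (0 : ℝ) ∈ B <;> by_cases h' : (0 : ℝ) ∈ C <;> simp [h, h']
  hasSum_proj B _ hd ψ := by
    by_cases h : ∃ n, (0 : ℝ) ∈ B n
    · obtain ⟨n, hn⟩ := h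
      have hU : (0 : ℝ) ∈ ⋃ n, B n := Set.mem_iUnion.mpr ⟨n, hn⟩
      have h1 := hasSum_single (f := fun k => (Set.indicator (B k)
        (fun _ => (1 : H →L[ℂ] H)) 0) ψ) n fun k hk => by
          have : (0 : ℝ) ∉ B k := fun h0 => Set.disjoint_left.mp (hd hk) h0 hn
          simp [this]
      simpa [hn, hU] using h1
    · push Not at h
      have hU : (0 : ℝ) ∉ ⋃ n, B n := by simpa using h
      simp only [h, hU, not_false_eq_true, Set.indicator_of_notMem]
      exact hasSum_zero

open Classical in
/-- The spectral measure `E_T` of a self-adjoint operator `T`. -/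
def spectralMeasure (T : H →ₗ.[ℂ] H) : ProjValuedMeasure H :=
  if h : ∃ P, IsSpectralMeasure P T then h.choose else ProjValuedMeasure.atZero

/-- `T^{1/2}` for a non-negative self-adjoint operator `T`. -/
def opSqrt (T : H →ₗ.[ℂ] H) : H →ₗ.[ℂ] H :=
  (spectralMeasure T).integralOp (fun x => ((√x : ℝ) : ℂ)) (by fun_prop)

/-- `e^{iwT}` for a self-adjoint operator `T` and `w ∈ ℂ`. -/
def opExp (T : H →ₗ.[ℂ] H) (w : ℂ) : H →ₗ.[ℂ] H :=
  (spectralMeasure T).integralOp (fun x => Complex.exp (Complex.I * w * x)) (by fun_prop)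

end SpectralCalculus

/-! ### The `C₀` class -/

section CZero

variable {H : Type*} [NormedAddCommGroup H] [InnerProductSpace ℂ H] [CompleteSpace H]

/-- `V_E`, the range of the spectral projection `E_{H₀}([0, E])`. -/
def VE (H₀ : H →ₗ.[ℂ] H) (E : ℝ) : Submodule ℂ H :=
  LinearMap.range ((spectralMeasure H₀).proj (Set.Icc 0 E)).toLinearMap

theorem VE_mono (H₀ : H →ₗ.[ℂ] H) {E E' : ℝ} (h : E ≤ E') : VE H₀ E ≤ VE H₀ E' := by
  rintro _ ⟨φ, rfl⟩
  refine ⟨(spectralMeasure H₀).proj (Set.Icc 0 E) φ, ?_⟩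
  have := (spectralMeasure H₀).proj_inter (Set.Icc 0 E') (Set.Icc 0 E)
    measurableSet_Icc measurableSet_Icc
  rw [Set.inter_eq_self_of_subset_right (Set.Icc_subset_Icc_right h)] at this
  exact (DFunLike.congr_fun this φ).symm

/-- `D_fin = ⋃_{E ≥ 0} V_E`. -/
def Dfin (H₀ : H →ₗ.[ℂ] H) : Submodule ℂ H where
  carrier := {ψ | ∃ E : ℝ, 0 ≤ E ∧ ψ ∈ VE H₀ E}
  zero_mem' := ⟨0, le_rfl, Submodule.zero_mem _⟩
  add_mem' := by
    rintro ψ φ ⟨E, hE, hψ⟩ ⟨E', _, hφ⟩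
    exact ⟨max E E', le_max_of_le_left hE, Submodule.add_mem _
      (VE_mono H₀ (le_max_left _ _) hψ) (VE_mono H₀ (le_max_right _ _) hφ)⟩
  smul_mem' := by
    rintro c ψ ⟨E, hE, hψ⟩
    exact ⟨E, hE, Submodule.smul_mem _ c hψ⟩

/-- The operator `A` is in the `C₀` class (with respect to `H₀`). -/
structure IsCZero (H₀ A : H →ₗ.[ℂ] H) : Prop where
  dense_domain : Dense (A.domain : Set H)
  closed : A.IsClosed
  dense_adjoint_domain : Dense (A.adjoint.domain : Set H)
  closed_adjoint : A.adjoint.IsClosed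
  relBounded : RelBounded A (opSqrt H₀)
  relBounded_adjoint : RelBounded A.adjoint (opSqrt H₀)
  exists_shift : ∃ b : ℝ, 0 ≤ b ∧ ∀ E : ℝ, 0 ≤ E →
    OpMapsTo A (VE H₀ E) (VE H₀ (E + b)) ∧ OpMapsTo A.adjoint (VE H₀ E) (VE H₀ (E + b))

/-- `A(z)`, the closure of `e^{izH₀} A e^{-izH₀}`. -/
def evolved (H₀ A : H →ₗ.[ℂ] H) (z : ℂ) : H →ₗ.[ℂ] H :=
  (opProd [opExp H₀ z, A, opExp H₀ (-z)]).closure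

end CZero

/-! ### Curves and time ordering -/

/-- A parametrized curve `γ : [α, β] → ℂ`; the values of `toFun` outside `[α, β]` are irrelevant. -/
structure Curve where
  α : ℝ
  β : ℝ
  toFun : ℝ → ℂ

namespace Curve

/-- The parameter interval. -/
def I (γ : Curve) : Set ℝ := Set.Icc γ.α γ.β

/-- The set of points of the curve. -/
def points (γ : Curve) : Set ℂ := γ.toFun '' γ.I

/-- `γ` is a piecewise continuously differentiable simple curve: it is injective and continuous on
`[α, β]`, and it is `C¹` on every closed subinterval that has no point of a suitable finite set in
its interior. -/
structure IsSimpleCurve (γ : Curve) : Prop where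
  le : γ.α ≤ γ.β
  continuousOn : ContinuousOn γ.toFun γ.I
  injOn : Set.InjOn γ.toFun γ.I
  piecewise : ∃ S : Finset ℝ, ∀ a b : ℝ, a < b → Set.Icc a b ⊆ γ.I →
    Disjoint (Set.Ioo a b) (S : Set ℝ) → ContDiffOn ℝ 1 γ.toFun (Set.Icc a b)

/-- `γ` is a piecewise continuously differentiable simple curve that starts at `z'` and ends
at `z`. -/
def IsSimpleFromTo (γ : Curve) (z' z : ℂ) : Prop :=
  γ.IsSimpleCurve ∧ γ.toFun γ.α = z' ∧ γ.toFun γ.β = z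

/-- The order `ζ₁ ≻ ζ₂` on the points of the curve: `ζ₁` is reached later than `ζ₂`. -/
def Later (γ : Curve) (ζ₁ ζ₂ : ℂ) : Prop :=
  ∃ t₁ ∈ γ.I, ∃ t₂ ∈ γ.I, γ.toFun t₁ = ζ₁ ∧ γ.toFun t₂ = ζ₂ ∧ t₂ < t₁

/-- The line segment from `z'` to `z` with unit speed (a single point if `z' = z`). -/
def segment (z' z : ℂ) : Curve where
  α := 0
  β := ‖z - z'‖
  toFun t := z' + t * ((z - z') / (‖z - z'‖ : ℂ))

theorem segment_isSimpleFromTo (z' z : ℂ) : (segment z' z).IsSimpleFromTo z' z := by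
  refine ⟨⟨norm_nonneg _, ?_, ?_, ⟨∅, fun a b _ _ _ => ?_⟩⟩, by simp [segment], ?_⟩
  · exact Continuous.continuousOn (by simp only [segment]; fun_prop)
  · by_cases h : z = z'
    · subst h
      intro s hs t ht _
      simp only [I, segment, sub_self, norm_zero, Set.mem_Icc] at hs ht
      linarith [hs.1, hs.2, ht.1, ht.2]
    · have h' : (z - z') / (‖z - z'‖ : ℂ) ≠ 0 :=
        div_ne_zero (sub_ne_zero.mpr h) (by simpa using sub_ne_zero.mpr h)
      intro s _ t _ hst
      simp only [segment] at hst
      exact Complex.ofReal_injective (mul_right_cancel₀ h' (add_left_cancel hst))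
  · refine ContDiff.contDiffOn ?_
    simp only [segment]
    exact contDiff_const.add (Complex.ofRealCLM.contDiff.mul contDiff_const)
  · by_cases h : z = z'
    · simp [segment, h]
    · have h' : (‖z - z'‖ : ℂ) ≠ 0 := by simpa using sub_ne_zero.mpr h
      simp only [segment]
      rw [mul_div_cancel₀ _ h']
      ring

end Curve

section TimeOrdering

variable {H : Type*} [NormedAddCommGroup H] [InnerProductSpace ℂ H]

/-- The product `F_{σ(1)}(ζ_{σ(1)}) ⋯ F_{σ(N)}(ζ_{σ(N)})`. -/
def permProd {N : ℕ} (F : Fin N → ℂ → H →ₗ.[ℂ] H) (σ : Equiv.Perm (Fin N)) (ζ : Fin N → ℂ) :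
    H →ₗ.[ℂ] H :=
  opProd (List.ofFn fun i => F (σ i) (ζ (σ i)))

open Classical in
/-- The time-ordered product
`∑_σ χ(ζ_{σ(1)} ≻ ⋯ ≻ ζ_{σ(N)}) F_{σ(1)}(ζ_{σ(1)}) ⋯ F_{σ(N)}(ζ_{σ(N)})` along the curve `γ`. -/
def timeOrderedProd (γ : Curve) {N : ℕ} (F : Fin N → ℂ → H →ₗ.[ℂ] H) (ζ : Fin N → ℂ) :
    H →ₗ.[ℂ] H :=
  ∑ σ : Equiv.Perm (Fin N),
    (if ∀ i j, i < j → γ.Later (ζ (σ i)) (ζ (σ j)) then (1 : ℂ) else 0) • permProd F σ ζ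

/-- The family `F₁, …, F_k, G, …, G` with `n` copies of `G`. -/
def withCopies {k : ℕ} (F : Fin k → ℂ → H →ₗ.[ℂ] H) (G : ℂ → H →ₗ.[ℂ] H) (n : ℕ) :
    Fin (k + n) → ℂ → H →ₗ.[ℂ] H :=
  Fin.append F fun _ => G

/-- The subspace `C(F₁, …, F_k, G)` of the vectors `ψ` such that, for all `n`, all permutations `σ`
and all fixed `ζ₁, …, ζ_k` on the curve, with `F_{k+1} = ⋯ = F_{k+n} = G`, the map
`(ζ_{k+1}, …, ζ_{k+n}) ↦ F_{σ(1)}(ζ_{σ(1)}) ⋯ F_{σ(k+n)}(ζ_{σ(k+n)}) ψ`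
is defined and strongly continuous on `Γⁿ`. -/
def continuityDomain (γ : Curve) {k : ℕ} (F : Fin k → ℂ → H →ₗ.[ℂ] H) (G : ℂ → H →ₗ.[ℂ] H) :
    Submodule ℂ H where
  carrier := {ψ | ∀ (n : ℕ) (σ : Equiv.Perm (Fin (k + n))) (ζ : Fin k → ℂ),
    (∀ i, ζ i ∈ γ.points) →
      (∀ τ : Fin n → ℂ, (∀ i, τ i ∈ γ.points) →
        ψ ∈ (permProd (withCopies F G n) σ (Fin.append ζ τ)).domain) ∧
      ContinuousOn (fun τ : Fin n → ℂ =>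
          opApply (permProd (withCopies F G n) σ (Fin.append ζ τ)) ψ)
        {τ | ∀ i, τ i ∈ γ.points}}
  zero_mem' := fun n σ ζ _ => ⟨fun _ _ => Submodule.zero_mem _, by
    simp only [opApply_zero]; exact continuousOn_const⟩
  add_mem' := fun {ψ φ} hψ hφ n σ ζ hζ => by
    obtain ⟨h1, h2⟩ := hψ n σ ζ hζ
    obtain ⟨h3, h4⟩ := hφ n σ ζ hζ
    exact ⟨fun τ hτ => Submodule.add_mem _ (h1 τ hτ) (h3 τ hτ),
      (h2.add h4).congr fun τ hτ => opApply_add (h1 τ hτ) (h3 τ hτ)⟩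
  smul_mem' := fun c ψ hψ n σ ζ hζ => by
    obtain ⟨h1, h2⟩ := hψ n σ ζ hζ
    exact ⟨fun τ hτ => Submodule.smul_mem _ c (h1 τ hτ),
      (h2.const_smul c).congr fun τ hτ => opApply_smul c (h1 τ hτ)⟩

/-- The vector `T(F₁(ζ₁) ⋯ F_k(ζ_k) G(γ(t₁)) ⋯ G(γ(tₙ))) ψ`, multiplied by `γ'(t₁) ⋯ γ'(tₙ)`. -/
def dysonIntegrand (γ : Curve) {k : ℕ} (F : Fin k → ℂ → H →ₗ.[ℂ] H) (ζ : Fin k → ℂ)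
    (G : ℂ → H →ₗ.[ℂ] H) (n : ℕ) (ψ : H) (t : Fin n → ℝ) : H :=
  (∏ i, deriv γ.toFun (t i)) •
    opApply (timeOrderedProd γ (withCopies F G n) (Fin.append ζ fun i => γ.toFun (t i))) ψ

/-- The `n`-th term of the series,
`(1/n!) ∫_{Γⁿ} dζ_{k+1} ⋯ dζ_{k+n} T(F₁(ζ₁) ⋯ F_k(ζ_k) G(ζ_{k+1}) ⋯ G(ζ_{k+n})) ψ`. -/
def dysonTerm (γ : Curve) {k : ℕ} (F : Fin k → ℂ → H →ₗ.[ℂ] H) (ζ : Fin k → ℂ)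
    (G : ℂ → H →ₗ.[ℂ] H) (n : ℕ) (ψ : H) : H :=
  ((n.factorial : ℂ)⁻¹) •
    ∫ t in Set.univ.pi fun _ : Fin n => γ.I, dysonIntegrand γ F ζ G n ψ t

/-- `ψ` is in `C(F₁, …, F_k, G)`, and the strong integrals in the series below exist: every
integrand is defined on `Γⁿ` and integrable.  (For points `ζᵢ` on a piecewise `C¹` simple curve the
existence of the integrals follows from membership in `C(F₁, …, F_k, G)`.) -/
def dysonDomain (γ : Curve) {k : ℕ} (F : Fin k → ℂ → H →ₗ.[ℂ] H) (ζ : Fin k → ℂ)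
    (G : ℂ → H →ₗ.[ℂ] H) : Set H :=
  {ψ | ψ ∈ continuityDomain γ F G ∧ ∀ n : ℕ,
    (∀ t ∈ Set.univ.pi fun _ : Fin n => γ.I,
      ψ ∈ (timeOrderedProd γ (withCopies F G n)
        (Fin.append ζ fun i => γ.toFun (t i))).domain) ∧
    IntegrableOn (dysonIntegrand γ F ζ G n ψ) (Set.univ.pi fun _ : Fin n => γ.I)}

section Linearity

variable {γ : Curve} {k : ℕ} {F : Fin k → ℂ → H →ₗ.[ℂ] H} {ζ : Fin k → ℂ} {G : ℂ → H →ₗ.[ℂ] H}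

theorem measurableSet_box (γ : Curve) (n : ℕ) :
    MeasurableSet (Set.univ.pi fun _ : Fin n => γ.I) :=
  MeasurableSet.univ_pi fun _ => measurableSet_Icc

theorem dysonIntegrand_add {ψ φ : H} (hψ : ψ ∈ dysonDomain γ F ζ G)
    (hφ : φ ∈ dysonDomain γ F ζ G) (n : ℕ) :
    Set.EqOn (dysonIntegrand γ F ζ G n (ψ + φ))
      (dysonIntegrand γ F ζ G n ψ + dysonIntegrand γ F ζ G n φ)
      (Set.univ.pi fun _ : Fin n => γ.I) := by
  intro t ht
  simp only [dysonIntegrand, Pi.add_apply]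
  rw [opApply_add ((hψ.2 n).1 t ht) ((hφ.2 n).1 t ht), smul_add]

theorem dysonIntegrand_smul {ψ : H} (c : ℂ) (hψ : ψ ∈ dysonDomain γ F ζ G) (n : ℕ) :
    Set.EqOn (dysonIntegrand γ F ζ G n (c • ψ)) (c • dysonIntegrand γ F ζ G n ψ)
      (Set.univ.pi fun _ : Fin n => γ.I) := by
  intro t ht
  simp only [dysonIntegrand, Pi.smul_apply]
  rw [opApply_smul c ((hψ.2 n).1 t ht), smul_comm]

theorem dysonTerm_add {ψ φ : H} (hψ : ψ ∈ dysonDomain γ F ζ G)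
    (hφ : φ ∈ dysonDomain γ F ζ G) (n : ℕ) :
    dysonTerm γ F ζ G n (ψ + φ) = dysonTerm γ F ζ G n ψ + dysonTerm γ F ζ G n φ := by
  simp only [dysonTerm]
  rw [setIntegral_congr_fun (measurableSet_box γ n) (dysonIntegrand_add hψ hφ n),
    ← smul_add, ← integral_add (hψ.2 n).2 (hφ.2 n).2]
  rfl

theorem dysonTerm_smul {ψ : H} (c : ℂ) (hψ : ψ ∈ dysonDomain γ F ζ G) (n : ℕ) :
    dysonTerm γ F ζ G n (c • ψ) = c • dysonTerm γ F ζ G n ψ := by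
  simp only [dysonTerm]
  rw [setIntegral_congr_fun (measurableSet_box γ n) (dysonIntegrand_smul c hψ n),
    smul_comm c]
  simp only [Pi.smul_apply]
  rw [integral_smul]

theorem dysonDomain_add {ψ φ : H} (hψ : ψ ∈ dysonDomain γ F ζ G)
    (hφ : φ ∈ dysonDomain γ F ζ G) : ψ + φ ∈ dysonDomain γ F ζ G :=
  ⟨Submodule.add_mem _ hψ.1 hφ.1, fun n =>
    ⟨fun t ht => Submodule.add_mem _ ((hψ.2 n).1 t ht) ((hφ.2 n).1 t ht),
      ((hψ.2 n).2.add (hφ.2 n).2).congr_fun (dysonIntegrand_add hψ hφ n).symm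
        (measurableSet_box γ n)⟩⟩

theorem dysonDomain_smul {ψ : H} (c : ℂ) (hψ : ψ ∈ dysonDomain γ F ζ G) :
    c • ψ ∈ dysonDomain γ F ζ G :=
  ⟨Submodule.smul_mem _ c hψ.1, fun n =>
    ⟨fun t ht => Submodule.smul_mem _ c ((hψ.2 n).1 t ht),
      IntegrableOn.congr_fun (Integrable.smul c (hψ.2 n).2) (dysonIntegrand_smul c hψ n).symm
        (measurableSet_box γ n)⟩⟩

theorem zero_mem_dysonDomain : (0 : H) ∈ dysonDomain γ F ζ G := by
  refine ⟨Submodule.zero_mem _, fun n => ⟨fun _ _ => Submodule.zero_mem _, ?_⟩⟩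
  have h : dysonIntegrand γ F ζ G n 0 = 0 := by
    funext t
    simp [dysonIntegrand, opApply_zero]
  rw [h]
  exact integrableOn_zero

theorem dysonTerm_zero (n : ℕ) : dysonTerm γ F ζ G n (0 : H) = 0 := by
  have h := dysonTerm_smul (n := n) (0 : ℂ) (zero_mem_dysonDomain (γ := γ) (F := F) (ζ := ζ) (G := G))
  simpa using h

end Linearity

/-- The time-ordered exponential `T F₁(ζ₁) ⋯ F_k(ζ_k) exp(∫_Γ dζ G(ζ))`: the sum of the series of
the vectors `dysonTerm`, on the domain where this series converges absolutely. -/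
def timeOrderedExp [CompleteSpace H] (γ : Curve) {k : ℕ} (F : Fin k → ℂ → H →ₗ.[ℂ] H)
    (ζ : Fin k → ℂ) (G : ℂ → H →ₗ.[ℂ] H) : H →ₗ.[ℂ] H where
  domain :=
    { carrier := {ψ | ψ ∈ dysonDomain γ F ζ G ∧ Summable fun n => ‖dysonTerm γ F ζ G n ψ‖}
      zero_mem' := ⟨zero_mem_dysonDomain, by simp [dysonTerm_zero]⟩
      add_mem' := fun {ψ φ} hψ hφ => ⟨dysonDomain_add hψ.1 hφ.1, by
        refine Summable.of_nonneg_of_le (fun _ => norm_nonneg _) (fun n => ?_) (hψ.2.add hφ.2)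
        rw [dysonTerm_add hψ.1 hφ.1]
        exact norm_add_le _ _⟩
      smul_mem' := fun c ψ hψ => ⟨dysonDomain_smul c hψ.1, by
        simp only [dysonTerm_smul c hψ.1, norm_smul]
        exact hψ.2.mul_left _⟩ }
  toFun :=
    { toFun := fun ψ => ∑' n, dysonTerm γ F ζ G n (ψ : H)
      map_add' := fun ψ φ => by
        simp only [Submodule.coe_add, dysonTerm_add ψ.2.1 φ.2.1]
        exact ψ.2.2.of_norm.tsum_add φ.2.2.of_norm
      map_smul' := fun c ψ => by
        simp only [Submodule.coe_smul, dysonTerm_smul c ψ.2.1, RingHom.id_apply]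
        exact ψ.2.2.of_norm.tsum_const_smul c }

end TimeOrdering

/-! ### Complex time evolution and Green's functions -/

section Green

variable {H : Type*} [NormedAddCommGroup H] [InnerProductSpace ℂ H] [CompleteSpace H]

/-- `T A₁(z₁) ⋯ A_k(z_k) exp(-i ∫_Γ dζ B(ζ))`, where the arguments `zᵢ` and `ζ` denote the
evolution by `H₀`. -/
def timeOrderedExpWith (H₀ B : H →ₗ.[ℂ] H) (γ : Curve) {k : ℕ} (A : Fin k → H →ₗ.[ℂ] H)
    (z : Fin k → ℂ) : H →ₗ.[ℂ] H :=
  timeOrderedExp γ (fun j ζ => evolved H₀ (A j) ζ) z fun ζ => (-Complex.I) • evolved H₀ B ζ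

/-- `T exp(-i ∫_Γ dζ B(ζ))`. -/
def timeOrderedExpOf (H₀ B : H →ₗ.[ℂ] H) (γ : Curve) : H →ₗ.[ℂ] H :=
  timeOrderedExpWith H₀ B γ (k := 0) Fin.elim0 Fin.elim0

/-- `U(B; z, z')`, the restriction of `T exp(-i ∫_Γ dζ B(ζ))` to `D_fin`, with `Γ` the line segment
from `z'` to `z`. -/
def propagator (H₀ B : H →ₗ.[ℂ] H) (z z' : ℂ) : H →ₗ.[ℂ] H :=
  (timeOrderedExpOf H₀ B (Curve.segment z' z)).domRestrict (Dfin H₀)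

/-- The complex time evolution `W(z) = e^{-izH₀} U(H₁; z, 0)⁻`, where `⁻` is the closure. -/
def complexEvolution (H₀ H₁ : H →ₗ.[ℂ] H) (z : ℂ) : H →ₗ.[ℂ] H :=
  opMul (opExp H₀ (-z)) (propagator H₀ H₁ z 0).closure

/-- The operator `A₁ W(z₁ - z₂) A₂ ⋯ W(z_{m-1} - z_m) A_m`; here `m = l + 1`, and the indices run
from `0` to `l`. -/
def greenOp (H₀ H₁ : H →ₗ.[ℂ] H) {l : ℕ} (A : Fin (l + 1) → H →ₗ.[ℂ] H) (z : Fin (l + 1) → ℂ) :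
    H →ₗ.[ℂ] H :=
  opProd ((List.ofFn fun j : Fin l =>
    opMul (A j.castSucc) (complexEvolution H₀ H₁ (z j.castSucc - z j.succ))) ++ [A (Fin.last l)])

/-- The Green's function
`G(z₁, …, z_m) = e^{i(z₁ - z_m)E₀(H)} ⟪Ω, A₁ W(z₁ - z₂) A₂ ⋯ W(z_{m-1} - z_m) A_m Ω⟫`
for `H = H₀ + H₁`; it is well defined if `Ω` is in the domain of `greenOp`. -/
def greenFunction (H₀ H₁ : H →ₗ.[ℂ] H) (Ω : H) {l : ℕ} (A : Fin (l + 1) → H →ₗ.[ℂ] H)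
    (z : Fin (l + 1) → ℂ) : ℂ :=
  Complex.exp (Complex.I * (z 0 - z (Fin.last l)) * groundEnergy (H₀ + H₁)) *
    ⟪Ω, opApply (greenOp H₀ H₁ A z) Ω⟫_ℂ

end Green

end GellMannLow

end

open GellMannLow

/-!
The Dyson series solves an evolution equation, so a time-ordered exponential along a curve from `z'`
to `z` is, up to free evolutions at both ends, a product of the operators `e^{-iwH}`, `H = H₀ + H₁`,
over the pieces into which the fixed times `zⱼ` cut the curve, with the `Aⱼ` in between. As the
endpoints move to `±∞(1 - iε)`, the outermost factors project onto the ground state `Ω`, and the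
normalization cancels in the quotient. The following facts make this rigorous for unbounded
operators.

*Spectral measures.* A symmetric operator with a real point `c` in its resolvent set has a spectral
measure (`exists_isSpectralMeasure`): the continuous functional calculus of the bounded self-adjoint
operator `R = (T - c)⁻¹` and the Riesz–Markov theorem give a projection-valued measure, which is
transported along `x ↦ x⁻¹ + c`. It applies to `H₀`, and to `H` because a perturbation bounded
relative to `H₀^{1/2}` is absorbed by a Neumann series (`exists_inResolventSet_add`). Both operators
are bounded below, so that `e^{-iwH₀}` and `e^{-iwH}` are bounded for `Im w ≤ 0` (`evolution`).

*Finite energies.* On `V_E` an operator of the `C₀` class is bounded by `C √(E + 1)`, and it raises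
the energy by at most `b`. On a vector of finite energy, the term of order `n` of the Dyson series
therefore involves only the truncations of `H₀`, `H₁` and the `Aⱼ` to a fixed `V_F`, that is,
elements of a Banach algebra. There, the integral of the ordered product equals `n!` times the
`n`-th coefficient, in powers of `λ`, of a product of exponentials `e^{-iw(a + λb)}` and fixed
factors, again up to free evolutions at both ends, since both satisfy the same integral equation
(`cubeIntegral_eq_chainCoeff`, `dysonTerm_spec`).

*Graded sequences.* A sequence is graded if its `n`-th term has energy at most `(n + d) b` and norm
at most `M^{n+1} / √n!`. The operators of the `C₀` class and the Dyson expansion of `e^{-iwH}`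
preserve graded sequences, and the terms of the expansion sum up to `e^{-iwH}` (`hasSum_dysonVec`);
the latter is checked after multiplication by a spectral projection of `H`, where both sides are
exponential series. Hence vectors of finite energy are in the domain of the time-ordered
exponentials (`timeOrderedExpWith_spec`, `hasSum_chainVec`). The ground state `Ω` is itself the sum
of a graded sequence: its components in energy shells of width `b` decay like `1 / √n!`, because
`H₁` couples a shell only to nearby shells while `H₀` grows (`exists_isGradedSeq_eigenvector`). So
`Ω` is in the domain of the operator product in the Green's function, on which `W(z)` acts as
`e^{-izH}` (`greenOp_spec`).

*The limit.* The operator `A₁ e^{-i(z₁-z₂)H} A₂ ⋯ A_m e^{-H}` is everywhere defined, as `e^{-H}`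
maps into the smooth vectors of `H`, and it is bounded by the closed graph theorem
(`exists_clm_greenVec`). Between two evolutions `e^{-iwH}` with `Im w → -∞` it converges, up to
phases, to its expectation value in `Ω` (`tendsto_inner_evolution`); the factor `e^{-H}` is taken
from the evolution next to it.
-/

noncomputable section

namespace GellMannLow

/-! ### Functional calculus of a projection-valued measure -/

namespace ProjValuedMeasure

variable {H : Type*} [NormedAddCommGroup H] [InnerProductSpace ℂ H] [CompleteSpace H]
variable (P : ProjValuedMeasure H)

open Classical in
/-- The vector `f(T) ψ = (∫ f dP) ψ`, as a total function of `f` and `ψ`; its value is `0` if `f` is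
not measurable or `ψ` is not in the domain of `∫ f dP`. -/
def fn (f : ℝ → ℂ) (ψ : H) : H :=
  if hf : Measurable f then opApply (P.integralOp f hf) ψ else 0

variable {P} {f g : ℝ → ℂ} {ψ φ : H} {B : Set ℝ}

theorem mem_integralOp_domain (hf : Measurable f) :
    ψ ∈ (P.integralOp f hf).domain ↔ MemLp f 2 (P.measure ψ) := Iff.rfl

theorem fn_eq_opApply (hf : Measurable f) : P.fn f ψ = opApply (P.integralOp f hf) ψ := by
  simp [fn, hf]

theorem fn_eq_limUnder (hf : Measurable f) (h : MemLp f 2 (P.measure ψ)) :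
    P.fn f ψ = limUnder atTop fun n => P.simpleIntegral (simpleApprox hf n) ψ := by
  rw [fn_eq_opApply hf, opApply_of_mem ((mem_integralOp_domain hf).mpr h)]
  rfl

theorem tendsto_simpleApprox (hf : Measurable f) (h : MemLp f 2 (P.measure ψ)) :
    Tendsto (fun n => eLpNorm (⇑(simpleApprox hf n) - f) 2 (P.measure ψ)) atTop (𝓝 0) :=
  SimpleFunc.tendsto_approxOn_Lp_eLpNorm hf (Set.mem_univ 0) (by simp) (by simp)
    (by simpa using h.2)

/-- The value of the functional calculus does not depend on the choice of the approximating simple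
functions. -/
theorem fn_tendsto_of_simple (hf : Measurable f) (h : MemLp f 2 (P.measure ψ))
    {s : ℕ → SimpleFunc ℝ ℂ}
    (hs : Tendsto (fun n => eLpNorm (⇑(s n) - f) 2 (P.measure ψ)) atTop (𝓝 0)) :
    Tendsto (fun n => P.simpleIntegral (s n) ψ) atTop (𝓝 (P.fn f ψ)) := by
  have h1 : Tendsto (fun n => P.simpleIntegral (simpleApprox hf n) ψ) atTop (𝓝 (P.fn f ψ)) := by
    rw [fn_eq_limUnder hf h]
    exact tendsto_nhds_limUnder (P.exists_tendsto hf h)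
  refine (tendsto_iff_of_dist ?_).mp h1
  have hsm : ∀ t : SimpleFunc ℝ ℂ, AEStronglyMeasurable (⇑t - f) (P.measure ψ) := fun k =>
    (SimpleFunc.aestronglyMeasurable _).sub hf.aestronglyMeasurable
  have h2 : Tendsto (fun n => edist (P.simpleIntegral (simpleApprox hf n) ψ)
      (P.simpleIntegral (s n) ψ)) atTop (𝓝 0) := by
    refine tendsto_of_tendsto_of_tendsto_of_le_of_le tendsto_const_nhds
      (by simpa using (tendsto_simpleApprox hf h).add hs) (fun _ => zero_le) fun n => ?_
    rw [edist_eq_enorm_sub, ← P.simpleIntegral_sub, P.enorm_simpleIntegral]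
    have e : ⇑(simpleApprox hf n - s n) =
        (⇑(simpleApprox hf n) - f) - (⇑(s n) - f) := by
      ext x; simp
    rw [e]
    exact eLpNorm_sub_le (hsm _) (hsm _) (by norm_num)
  simp only [edist_dist] at h2
  have h3 := (ENNReal.tendsto_toReal ENNReal.zero_ne_top).comp h2
  simpa [Function.comp_def, ENNReal.toReal_ofReal dist_nonneg] using h3

theorem fn_simple (s : SimpleFunc ℝ ℂ) (ψ : H) : P.fn s ψ = P.simpleIntegral s ψ := by
  refine tendsto_nhds_unique (fn_tendsto_of_simple (s := fun _ => s) s.measurable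
    (s.memLp_of_isFiniteMeasure 2 _) ?_) tendsto_const_nhds
  simp

theorem enorm_fn (hf : Measurable f) (h : MemLp f 2 (P.measure ψ)) :
    ‖P.fn f ψ‖ₑ = eLpNorm f 2 (P.measure ψ) := by
  have h1 := (fn_tendsto_of_simple hf h (tendsto_simpleApprox hf h)).enorm
  simp only [P.enorm_simpleIntegral] at h1
  have hm : ∀ n, MemLp (simpleApprox hf n) 2 (P.measure ψ) :=
    fun n => SimpleFunc.memLp_of_isFiniteMeasure _ 2 _
  have h2 := (Lp.tendsto_Lp_iff_tendsto_eLpNorm'' _ hm f h).mpr (tendsto_simpleApprox hf h)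
  have h3 := h2.enorm
  simp only [Lp.enorm_toLp] at h3
  exact tendsto_nhds_unique h1 h3

theorem fn_indicator_const (hB : MeasurableSet B) (c : ℂ) (ψ : H) :
    P.fn (B.indicator fun _ => c) ψ = c • P.proj B ψ := by
  let T : Set ℝ → ℂ →L[ℝ] H := fun B =>
    (ContinuousLinearMap.id ℝ ℂ).smulRight (P.proj B ψ)
  have h := SimpleFunc.setToSimpleFunc_indicator T (by ext; simp [T, P.proj_empty]) hB c
  have e : (B.indicator fun _ => c) =
      ⇑(SimpleFunc.piecewise B hB (SimpleFunc.const ℝ c) (SimpleFunc.const ℝ 0)) := by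
    ext x; simp [SimpleFunc.coe_piecewise, Set.piecewise, Set.indicator]
  rw [e, fn_simple]
  exact h

theorem fn_one (ψ : H) : P.fn (fun _ => 1) ψ = ψ := by
  have := fn_indicator_const (P := P) MeasurableSet.univ 1 ψ
  simpa [P.proj_univ] using this

theorem fn_sub (hf : Measurable f) (hg : Measurable g) (h : MemLp f 2 (P.measure ψ))
    (h' : MemLp g 2 (P.measure ψ)) : P.fn (f - g) ψ = P.fn f ψ - P.fn g ψ := by
  have h1 := fn_tendsto_of_simple hf h (tendsto_simpleApprox hf h)
  have h2 := fn_tendsto_of_simple hg h' (tendsto_simpleApprox hg h')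
  have hsm : ∀ {f}, Measurable f → ∀ t : SimpleFunc ℝ ℂ,
    AEStronglyMeasurable (⇑t - f) (P.measure ψ) := fun hf k =>
    (SimpleFunc.aestronglyMeasurable _).sub hf.aestronglyMeasurable
  refine tendsto_nhds_unique (fn_tendsto_of_simple (hf.sub hg) (h.sub h')
    (s := fun n => simpleApprox hf n - simpleApprox hg n) ?_) ?_
  · refine tendsto_of_tendsto_of_tendsto_of_le_of_le tendsto_const_nhds
      (by simpa using (tendsto_simpleApprox hf h).add (tendsto_simpleApprox hg h'))
      (fun _ => zero_le) fun n => ?_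
    have e : ⇑(simpleApprox hf n - simpleApprox hg n) - (f - g) =
        (⇑(simpleApprox hf n) - f) - (⇑(simpleApprox hg n) - g) := by
      ext x; simp; ring
    rw [e]
    exact eLpNorm_sub_le (hsm hf _) (hsm hg _) (by norm_num)
  · simp only [P.simpleIntegral_sub]
    exact h1.sub h2

theorem fn_zero (ψ : H) : P.fn 0 ψ = 0 := by
  have := fn_sub (P := P) (ψ := ψ) (f := 0) (g := 0) measurable_zero measurable_zero
    MemLp.zero MemLp.zero
  simpa using this

theorem fn_neg (hf : Measurable f) (h : MemLp f 2 (P.measure ψ)) :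
    P.fn (-f) ψ = - P.fn f ψ := by
  have := fn_sub (P := P) (ψ := ψ) (f := 0) (g := f) measurable_zero hf MemLp.zero h
  simpa [fn_zero] using this

theorem fn_add (hf : Measurable f) (hg : Measurable g) (h : MemLp f 2 (P.measure ψ))
    (h' : MemLp g 2 (P.measure ψ)) : P.fn (f + g) ψ = P.fn f ψ + P.fn g ψ := by
  have := fn_sub (P := P) (ψ := ψ) (f := f) (g := -g) hf hg.neg h h'.neg
  simpa [fn_neg hg h'] using this

theorem fn_finset_sum {ι : Type*} (s : Finset ι) {f : ι → ℝ → ℂ} (hf : ∀ i ∈ s, Measurable (f i))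
    (h : ∀ i ∈ s, MemLp (f i) 2 (P.measure ψ)) :
    P.fn (fun x => ∑ i ∈ s, f i x) ψ = ∑ i ∈ s, P.fn (f i) ψ := by
  classical
  induction s using Finset.induction_on with
  | empty => exact fn_zero (P := P) ψ
  | insert a s ha ih =>
    simp only [Finset.sum_insert ha]
    rw [← ih (fun i hi => hf i (Finset.mem_insert_of_mem hi))
      (fun i hi => h i (Finset.mem_insert_of_mem hi))]
    refine fn_add (hf a (Finset.mem_insert_self _ _))
      (Finset.measurable_fun_sum s fun i hi => hf i (Finset.mem_insert_of_mem hi))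
      (h a (Finset.mem_insert_self _ _))
      (memLp_finsetSum s fun i hi => h i (Finset.mem_insert_of_mem hi))

theorem enorm_fn_sub (hf : Measurable f) (hg : Measurable g) (h : MemLp f 2 (P.measure ψ))
    (h' : MemLp g 2 (P.measure ψ)) :
    ‖P.fn f ψ - P.fn g ψ‖ₑ = eLpNorm (f - g) 2 (P.measure ψ) := by
  rw [← fn_sub hf hg h h', enorm_fn (hf.sub hg) (h.sub h')]

theorem fn_congr_ae (hf : Measurable f) (hg : Measurable g) (h : MemLp f 2 (P.measure ψ))
    (hfg : f =ᵐ[P.measure ψ] g) : P.fn f ψ = P.fn g ψ := by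
  have h1 := enorm_fn_sub hf hg h (h.ae_eq hfg)
  rw [eLpNorm_congr_ae (g := 0) (by filter_upwards [hfg] with x hx; simp [hx]), eLpNorm_zero,
    enorm_eq_zero, sub_eq_zero] at h1
  exact h1

theorem tendsto_fn {ι : Type*} {l : Filter ι} {F : ι → ℝ → ℂ} (hF : ∀ n, Measurable (F n))
    (hf : Measurable f) (hFm : ∀ n, MemLp (F n) 2 (P.measure ψ)) (h : MemLp f 2 (P.measure ψ))
    (hlim : Tendsto (fun n => eLpNorm (F n - f) 2 (P.measure ψ)) l (𝓝 0)) :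
    Tendsto (fun n => P.fn (F n) ψ) l (𝓝 (P.fn f ψ)) := by
  rw [tendsto_iff_edist_tendsto_0]
  simpa only [edist_eq_enorm_sub, enorm_fn_sub (hF _) hf (hFm _) h] using hlim

theorem norm_sq_fn (hf : Measurable f) (h : MemLp f 2 (P.measure ψ)) :
    ‖P.fn f ψ‖ ^ 2 = ∫ x, ‖f x‖ ^ 2 ∂P.measure ψ := by
  have h1 := enorm_fn hf h
  rw [eLpNorm_eq_lintegral_rpow_enorm_toReal (by simp) (by simp)] at h1
  have h2 : ENNReal.ofReal (‖P.fn f ψ‖ ^ 2) = ∫⁻ x, ENNReal.ofReal (‖f x‖ ^ 2) ∂P.measure ψ := by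
    rw [ENNReal.ofReal_pow (norm_nonneg _), ofReal_norm, h1, ← ENNReal.rpow_natCast,
      ← ENNReal.rpow_mul]
    simp only [ENNReal.toReal_ofNat, one_div, Nat.cast_ofNat]
    rw [inv_mul_cancel₀ (by norm_num), ENNReal.rpow_one]
    refine lintegral_congr fun x => ?_
    rw [ENNReal.ofReal_pow (norm_nonneg _), ofReal_norm]
    norm_cast
  rw [integral_eq_lintegral_of_nonneg_ae (Eventually.of_forall fun x => by positivity)
    (by fun_prop), ← h2, ENNReal.toReal_ofReal (by positivity)]

/-- Dominated convergence for the functional calculus. -/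
theorem tendsto_fn_of_dominated {ι : Type*} {l : Filter ι} [l.IsCountablyGenerated]
    {F : ι → ℝ → ℂ} (hF : ∀ n, Measurable (F n))
    (hf : Measurable f) {b : ℝ → ℂ} (hb : MemLp b 2 (P.measure ψ)) (hfb : ∀ᵐ x ∂P.measure ψ, ‖f x‖ ≤ ‖b x‖)
    (hFb : ∀ᶠ n in l, ∀ᵐ x ∂P.measure ψ, ‖F n x‖ ≤ ‖b x‖)
    (hlim : ∀ᵐ x ∂P.measure ψ, Tendsto (fun n => F n x) l (𝓝 (f x))) :
    Tendsto (fun n => P.fn (F n) ψ) l (𝓝 (P.fn f ψ)) := by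
  have hFm : ∀ᶠ n in l, MemLp (F n) 2 (P.measure ψ) := hFb.mono fun n hn =>
    hb.mono (hF n).aestronglyMeasurable hn
  have hfm : MemLp f 2 (P.measure ψ) := hb.mono hf.aestronglyMeasurable hfb
  rw [tendsto_iff_norm_sub_tendsto_zero]
  have h1 : ∀ᶠ n in l, ∫ x, ‖F n x - f x‖ ^ 2 ∂P.measure ψ = ‖P.fn (F n) ψ - P.fn f ψ‖ ^ 2 := by
    filter_upwards [hFm] with n hn
    rw [← fn_sub (hF n) hf hn hfm, norm_sq_fn ((hF n).sub hf) (hn.sub hfm)]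
    rfl
  have h2 : Tendsto (fun n => ‖P.fn (F n) ψ - P.fn f ψ‖ ^ 2) l (𝓝 0) := by
    have := tendsto_integral_filter_of_dominated_convergence (μ := P.measure ψ) (l := l)
      (F := fun n x => ‖F n x - f x‖ ^ 2) (f := fun _ => (0 : ℝ)) (fun x => (2 * ‖b x‖) ^ 2)
      (Eventually.of_forall fun n =>
        (((hF n).sub hf).norm.pow_const 2).aestronglyMeasurable) ?_ ?_ ?_
    · rw [integral_zero] at this
      exact this.congr' h1
    · filter_upwards [hFb] with n hn
      filter_upwards [hn, hfb] with x h3 h4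
      rw [Real.norm_of_nonneg (by positivity)]
      gcongr
      exact (norm_sub_le _ _).trans (by linarith)
    · simp only [mul_pow]
      exact ((memLp_two_iff_integrable_sq_norm hb.1).mp hb).const_mul _
    · filter_upwards [hlim] with x h3
      have := ((h3.sub_const (f x)).norm.pow 2)
      simpa using this
  have h3 := h2.sqrt
  simpa [Real.sqrt_sq (norm_nonneg _)] using h3

theorem fn_add_right (hf : Measurable f) (h : MemLp f 2 (P.measure ψ))
    (h' : MemLp f 2 (P.measure φ)) : P.fn f (ψ + φ) = P.fn f ψ + P.fn f φ := by
  simp only [fn_eq_opApply hf]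
  exact opApply_add ((mem_integralOp_domain hf).mpr h) ((mem_integralOp_domain hf).mpr h')

theorem fn_smul_right (hf : Measurable f) (c : ℂ) (h : MemLp f 2 (P.measure ψ)) :
    P.fn f (c • ψ) = c • P.fn f ψ := by
  simp only [fn_eq_opApply hf]
  exact opApply_smul c ((mem_integralOp_domain hf).mpr h)

theorem fn_smul (c : ℂ) (hf : Measurable f) (h : MemLp f 2 (P.measure ψ)) :
    P.fn (c • f) ψ = c • P.fn f ψ := by
  have h1 := fn_tendsto_of_simple hf h (tendsto_simpleApprox hf h)
  refine tendsto_nhds_unique (fn_tendsto_of_simple (hf.const_smul c) (h.const_smul c)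
    (s := fun n => c • simpleApprox hf n) ?_) ((h1.const_smul c).congr fun n => ?_)
  · have h2 := ENNReal.Tendsto.const_mul (a := ‖c‖ₑ) (tendsto_simpleApprox hf h) (by simp)
    rw [mul_zero] at h2
    refine h2.congr fun n => ?_
    rw [← eLpNorm_const_smul]
    congr 1
    ext x
    simp [mul_sub]
  · let T : Set ℝ → ℂ →L[ℝ] H := fun B =>
      (ContinuousLinearMap.id ℝ ℂ).smulRight (P.proj B ψ)
    have hT : FinMeasAdditive (P.measure ψ) T := by
      intro B C hB hC _ _ hd
      ext
      simp [T, P.proj_union hB hC hd ψ]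
    exact (SimpleFunc.setToSimpleFunc_smul T hT (fun c s x => by simp [T, smul_smul]) c
      (SimpleFunc.integrable_of_isFiniteMeasure _)).symm

theorem simpleFunc_eq_sum (s : SimpleFunc ℝ ℂ) :
    ⇑s = fun x => ∑ c ∈ s.range, (s ⁻¹' {c}).indicator (fun _ => c) x := by
  ext x
  rw [Finset.sum_eq_single_of_mem (s x) (SimpleFunc.mem_range_self s x)]
  · simp
  · intro c _ hc
    simp [Set.indicator, Ne.symm hc]

theorem proj_fn (hB : MeasurableSet B) (hf : Measurable f) (h : MemLp f 2 (P.measure ψ)) :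
    P.proj B (P.fn f ψ) = P.fn (B.indicator f) ψ := by
  have h1 := fn_tendsto_of_simple hf h (tendsto_simpleApprox hf h)
  have h2 := ((P.proj B).continuous.tendsto _).comp h1
  have key : ∀ s : SimpleFunc ℝ ℂ, P.proj B (P.simpleIntegral s ψ) = P.fn (B.indicator s) ψ := by
    intro s
    have e : B.indicator s = fun x => ∑ c ∈ s.range,
        (B ∩ (s ⁻¹' {c})).indicator (fun _ => c) x := by
      ext x
      by_cases hx : x ∈ B
      · rw [Set.indicator_of_mem hx]
        conv_lhs => rw [simpleFunc_eq_sum s]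
        refine Finset.sum_congr rfl fun c _ => ?_
        simp [Set.indicator, hx]
      · rw [Set.indicator_of_notMem hx]
        simp [Set.indicator, hx]
    have hm : ∀ c, MeasurableSet (B ∩ (s ⁻¹' {c})) := fun c => hB.inter (s.measurableSet_fiber c)
    rw [e, fn_finset_sum _ (fun c _ => measurable_const.indicator (hm c))
      (fun c _ => (memLp_const c).indicator (hm c))]
    simp only [fn_indicator_const (hm _), simpleIntegral, map_sum, map_smul]
    refine Finset.sum_congr rfl fun c _ => ?_
    rw [P.proj_inter _ _ hB (s.measurableSet_fiber c)]
    rfl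
  refine tendsto_nhds_unique h2 ?_
  simp only [Function.comp_def, key]
  refine tendsto_fn (fun n => (SimpleFunc.measurable _).indicator hB) (hf.indicator hB)
    (fun n => (SimpleFunc.memLp_of_isFiniteMeasure _ 2 _).indicator hB) (h.indicator hB) ?_
  refine tendsto_of_tendsto_of_tendsto_of_le_of_le tendsto_const_nhds (tendsto_simpleApprox hf h)
      (fun _ => zero_le) fun n => ?_
  have e : B.indicator (simpleApprox hf n) - B.indicator f =
    B.indicator (⇑(simpleApprox hf n) - f) := by
    rw [Set.indicator_sub']
  simp only []
  rw [e]
  exact eLpNorm_indicator_le _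

theorem proj_fn_comm (hB : MeasurableSet B) (hf : Measurable f) (h : MemLp f 2 (P.measure ψ)) :
    P.fn f (P.proj B ψ) = P.fn (B.indicator f) ψ ∧ MemLp f 2 (P.measure (P.proj B ψ)) := by
  have hm : P.measure (P.proj B ψ) = (P.measure ψ).restrict B := by
    refine Measure.ext fun C hC => ?_
    rw [Measure.restrict_apply hC, P.measure_apply _ hC, P.measure_apply _ (hC.inter hB),
      P.proj_inter _ _ hC hB]
    rfl
  have h' : MemLp f 2 (P.measure (P.proj B ψ)) := by rw [hm]; exact h.restrict B
  refine ⟨?_, h'⟩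
  have h1 := fn_tendsto_of_simple hf h' (tendsto_simpleApprox hf h')
  have h2 := fn_tendsto_of_simple hf h (tendsto_simpleApprox hf h)
  have h3 := ((P.proj B).continuous.tendsto _).comp h2
  rw [← proj_fn hB hf h]
  refine tendsto_nhds_unique h1 (h3.congr fun n => ?_)
  simp only [Function.comp_apply, simpleIntegral, map_sum, map_smul]
  refine Finset.sum_congr rfl fun c _ => ?_
  rw [← mul_apply_eq_comp, ← mul_apply_eq_comp,
    ← P.proj_inter _ _ hB (SimpleFunc.measurableSet_fiber _ c),
    ← P.proj_inter _ _ (SimpleFunc.measurableSet_fiber _ c) hB, Set.inter_comm]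

/-- The spectral measure of `f(T) ψ` has density `‖f‖²` with respect to the spectral measure of `ψ`. -/
theorem eLpNorm_measure_fn (hf : Measurable f) (h : MemLp f 2 (P.measure ψ))
    (hg : Measurable g) :
    eLpNorm g 2 (P.measure (P.fn f ψ)) = eLpNorm (g * f) 2 (P.measure ψ) := by
  have hm : P.measure (P.fn f ψ) = (P.measure ψ).withDensity fun x => ‖f x‖ₑ ^ 2 := by
    refine Measure.ext fun B hB => ?_
    rw [P.measure_apply _ hB, withDensity_apply _ hB, proj_fn hB hf h,
      norm_sq_fn (hf.indicator hB) (h.indicator hB),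
      integral_eq_lintegral_of_nonneg_ae (Eventually.of_forall fun x => by positivity)
        ((hf.indicator hB).norm.pow_const 2).aestronglyMeasurable, ENNReal.ofReal_toReal]
    · rw [← lintegral_indicator hB]
      refine lintegral_congr fun x => ?_
      by_cases hx : x ∈ B
      · simp [hx, ENNReal.ofReal_pow, ofReal_norm]
      · simp [hx]
    · have := ((memLp_two_iff_integrable_sq_norm (h.indicator hB).1).mp (h.indicator hB)).2
      refine ne_of_lt ?_
      refine lt_of_le_of_lt (lintegral_mono fun x => ?_) this
      rw [Real.enorm_eq_ofReal (by positivity)]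
  rw [hm, eLpNorm_eq_lintegral_rpow_enorm_toReal (by simp) (by simp),
    eLpNorm_eq_lintegral_rpow_enorm_toReal (by simp) (by simp),
    lintegral_withDensity_eq_lintegral_mul _ (by fun_prop) (by fun_prop)]
  congr 1
  refine lintegral_congr fun x => ?_
  simp [mul_pow, mul_comm]

theorem memLp_measure_fn (hf : Measurable f) (h : MemLp f 2 (P.measure ψ))
    (hg : Measurable g) : MemLp g 2 (P.measure (P.fn f ψ)) ↔ MemLp (g * f) 2 (P.measure ψ) := by
  simp only [MemLp, eLpNorm_measure_fn hf h hg, hg.aestronglyMeasurable,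
    (hg.mul hf).aestronglyMeasurable, true_and]

/-- Multiplicativity of the functional calculus. -/
theorem fn_fn (hf : Measurable f) (h : MemLp f 2 (P.measure ψ)) (hg : Measurable g)
    (hgf : MemLp (g * f) 2 (P.measure ψ)) : P.fn g (P.fn f ψ) = P.fn (g * f) ψ := by
  have hg' := (memLp_measure_fn hf h hg).mpr hgf
  have h1 := fn_tendsto_of_simple hg hg' (tendsto_simpleApprox hg hg')
  have hb : ∀ s : SimpleFunc ℝ ℂ, MemLp (⇑s * f) 2 (P.measure ψ) := fun s => by
    rw [← memLp_measure_fn hf h s.measurable]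
    exact s.memLp_of_isFiniteMeasure 2 _
  have key : ∀ s : SimpleFunc ℝ ℂ, P.simpleIntegral s (P.fn f ψ) = P.fn (⇑s * f) ψ := by
    intro s
    have e : ⇑s * f = fun x => ∑ c ∈ s.range, (c • (s ⁻¹' {c}).indicator f) x := by
      ext x
      rw [Pi.mul_apply]
      conv_lhs => rw [simpleFunc_eq_sum s]
      simp only [Finset.sum_mul]
      refine Finset.sum_congr rfl fun c _ => ?_
      by_cases hx : s x = c <;> simp [Set.indicator, hx]
    have hm : ∀ c, MeasurableSet (s ⁻¹' {c}) := fun c => s.measurableSet_fiber c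
    rw [e, fn_finset_sum _ (fun c _ => (hf.indicator (hm c)).const_smul c)
      (fun c _ => (h.indicator (hm c)).const_smul c)]
    simp only [simpleIntegral, proj_fn (hm _) hf h,
      fn_smul _ (hf.indicator (hm _)) (h.indicator (hm _))]
  simp only [key] at h1
  refine tendsto_nhds_unique h1 (tendsto_fn (fun n => (SimpleFunc.measurable _).mul hf)
    (hg.mul hf) (fun n => hb _) hgf ?_)
  refine (tendsto_simpleApprox hg hg').congr fun n => ?_
  rw [eLpNorm_measure_fn hf h ((SimpleFunc.measurable _).sub hg), sub_mul]

theorem proj_inner_symm (hB : MeasurableSet B) (ψ φ : H) :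
    ⟪P.proj B ψ, φ⟫_ℂ = ⟪ψ, P.proj B φ⟫_ℂ := by
  have h := P.inner_proj hB MeasurableSet.univ ψ φ
  simpa [P.proj_univ] using h

theorem inner_fn (hf : Measurable f) (h : MemLp f 2 (P.measure ψ)) (h' : MemLp f 2 (P.measure φ)) :
    ⟪P.fn f ψ, φ⟫_ℂ = ⟪ψ, P.fn (fun x => star (f x)) φ⟫_ℂ := by
  have h1 := (fn_tendsto_of_simple hf h (tendsto_simpleApprox hf h)).inner
    (tendsto_const_nhds (x := φ)) (𝕜 := ℂ)
  have hc : Measurable fun x => star (f x) := continuous_star.measurable.comp hf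
  have hmc : MemLp (fun x => star (f x)) 2 (P.measure φ) :=
    h'.of_le hc.aestronglyMeasurable (Eventually.of_forall fun x => by simp)
  have h2 : Tendsto (fun n => P.simpleIntegral ((simpleApprox hf n).map star) φ) atTop
      (𝓝 (P.fn (fun x => star (f x)) φ)) := by
    refine fn_tendsto_of_simple hc hmc ((tendsto_simpleApprox hf h').congr fun n => ?_)
    refine eLpNorm_congr_norm_ae (Eventually.of_forall fun x => ?_)
    simp [← map_sub]
  have h3 := (tendsto_const_nhds (x := ψ)).inner h2 (𝕜 := ℂ)
  refine tendsto_nhds_unique h1 (h3.congr fun n => ?_)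
  generalize simpleApprox hf n = s
  rw [← fn_simple]
  have e : ⇑(s.map star) = fun x => ∑ c ∈ s.range, (s ⁻¹' {c}).indicator (fun _ => star c) x := by
    ext x
    rw [SimpleFunc.map_apply, simpleFunc_eq_sum s, ← starRingEnd_apply, map_sum]
    refine Finset.sum_congr rfl fun c _ => ?_
    by_cases hx : s x = c <;> simp [Set.indicator, hx]
  have hm : ∀ c, MeasurableSet (s ⁻¹' {c}) := fun c => s.measurableSet_fiber c
  rw [e, fn_finset_sum _ (fun c _ => measurable_const.indicator (hm c))
      (fun c _ => (memLp_const _).indicator (hm c)), simpleIntegral, inner_sum, sum_inner]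
  refine Finset.sum_congr rfl fun c _ => ?_
  rw [fn_indicator_const (hm c), inner_smul_left, inner_smul_right, proj_inner_symm (hm c)]
  rfl

theorem norm_fn_le_of_le (hf : Measurable f) (hg : Measurable g) (h' : MemLp g 2 (P.measure ψ))
    (hle : ∀ᵐ x ∂P.measure ψ, ‖f x‖ ≤ ‖g x‖) : ‖P.fn f ψ‖ ≤ ‖P.fn g ψ‖ := by
  have h : MemLp f 2 (P.measure ψ) := h'.of_le hf.aestronglyMeasurable hle
  refine le_of_sq_le_sq ?_ (norm_nonneg _)
  rw [norm_sq_fn hf h, norm_sq_fn hg h']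
  refine integral_mono_ae ((memLp_two_iff_integrable_sq_norm h.1).mp h)
    ((memLp_two_iff_integrable_sq_norm h'.1).mp h') ?_
  filter_upwards [hle] with x hx
  gcongr

theorem norm_fn_le_ae (hf : Measurable f) {C : ℝ} (hC0 : 0 ≤ C)
    (hC : ∀ᵐ x ∂P.measure ψ, ‖f x‖ ≤ C) : ‖P.fn f ψ‖ ≤ C * ‖ψ‖ := by
  have h := norm_fn_le_of_le (P := P) (ψ := ψ) hf (g := fun _ => (C : ℂ)) measurable_const
    (memLp_const _) (by simpa [abs_of_nonneg hC0] using hC)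
  have h2 := fn_smul (P := P) (ψ := ψ) (C : ℂ) (f := fun _ => 1) measurable_const (memLp_const _)
  have e : ((C : ℂ) • fun _ : ℝ => (1 : ℂ)) = fun _ => (C : ℂ) := by ext; simp
  rw [e, fn_one] at h2
  rwa [h2, norm_smul, Complex.norm_real, Real.norm_of_nonneg hC0] at h

theorem norm_fn_le (hf : Measurable f) {C : ℝ} (hC : ∀ x, ‖f x‖ ≤ C) (ψ : H) :
    ‖P.fn f ψ‖ ≤ C * ‖ψ‖ :=
  norm_fn_le_ae hf ((norm_nonneg (f 0)).trans (hC 0)) (Eventually.of_forall hC)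

theorem memLp_of_ae_bounded (hf : Measurable f) {C : ℝ} (hC : ∀ᵐ x ∂P.measure ψ, ‖f x‖ ≤ C) :
    MemLp f 2 (P.measure ψ) :=
  MemLp.of_bound hf.aestronglyMeasurable C hC

variable (P) in
/-- The bounded operator `∫ f dP` for an essentially bounded Borel function `f`. -/
def clm (f : ℝ → ℂ) (hf : Measurable f) {C : ℝ} (hC0 : 0 ≤ C)
    (hC : ∀ ψ, ∀ᵐ x ∂P.measure ψ, ‖f x‖ ≤ C) : H →L[ℂ] H :=
  LinearMap.mkContinuous
    { toFun := P.fn f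
      map_add' := fun _ _ => fn_add_right hf (memLp_of_ae_bounded hf (hC _))
        (memLp_of_ae_bounded hf (hC _))
      map_smul' := fun _ _ => fn_smul_right hf _ (memLp_of_ae_bounded hf (hC _)) } C
    fun ψ => norm_fn_le_ae hf hC0 (hC ψ)

@[simp]
theorem clm_apply (hf : Measurable f) {C : ℝ} (hC0 : 0 ≤ C)
    (hC : ∀ ψ, ∀ᵐ x ∂P.measure ψ, ‖f x‖ ≤ C) (ψ : H) :
    P.clm f hf hC0 hC ψ = P.fn f ψ := rfl

theorem proj_eq_fn (hB : MeasurableSet B) (ψ : H) :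
    P.proj B ψ = P.fn (B.indicator fun _ => 1) ψ := by
  rw [fn_indicator_const hB, one_smul]

theorem ae_mem_of_proj_eq (hB : MeasurableSet B) (h : P.proj B ψ = ψ) :
    ∀ᵐ x ∂P.measure ψ, x ∈ B := by
  rw [ae_iff]
  change P.measure ψ Bᶜ = 0
  rw [P.measure_apply _ hB.compl, ← h, ← mul_apply_eq_comp,
    ← P.proj_inter _ _ hB.compl hB, Set.compl_inter_self, P.proj_empty]
  simp

theorem proj_eq_of_ae_mem (hB : MeasurableSet B) (h : ∀ᵐ x ∂P.measure ψ, x ∈ B) :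
    P.proj B ψ = ψ := by
  rw [proj_eq_fn hB]
  conv_rhs => rw [← fn_one (P := P) ψ]
  refine fn_congr_ae (measurable_const.indicator hB) measurable_const
    ((memLp_const _).indicator hB) ?_
  filter_upwards [h] with x hx
  simp [hx]

theorem proj_idem (hB : MeasurableSet B) (ψ : H) : P.proj B (P.proj B ψ) = P.proj B ψ := by
  rw [← mul_apply_eq_comp, ← P.proj_inter _ _ hB hB, Set.inter_self]

theorem norm_proj_le (hB : MeasurableSet B) (ψ : H) : ‖P.proj B ψ‖ ≤ ‖ψ‖ := by
  rw [proj_eq_fn hB]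
  have := norm_fn_le (P := P) (C := 1) ((measurable_const (a := (1 : ℂ))).indicator hB) (fun x => by
    by_cases hx : x ∈ B <;> simp [hx]) ψ
  simpa using this

theorem memLp_of_ae_mem (hf : Measurable f) (h : ∀ᵐ x ∂P.measure ψ, x ∈ B) {C : ℝ}
    (hC : ∀ x ∈ B, ‖f x‖ ≤ C) : MemLp f 2 (P.measure ψ) :=
  MemLp.of_bound hf.aestronglyMeasurable C (by filter_upwards [h] with x hx using hC x hx)

theorem proj_fn_eq_self (hB : MeasurableSet B) (hf : Measurable f) (hm : MemLp f 2 (P.measure ψ))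
    (h : ∀ᵐ x ∂P.measure ψ, x ∈ B) : P.proj B (P.fn f ψ) = P.fn f ψ := by
  rw [proj_fn hB hf hm]
  refine fn_congr_ae (hf.indicator hB) hf (hm.indicator hB) ?_
  filter_upwards [h] with x hx
  simp [hx]

end ProjValuedMeasure

/-! ### The spectral theorem for symmetric operators with a real point in the resolvent set -/

section BoundedSpectral

variable {H : Type*} [NormedAddCommGroup H] [InnerProductSpace ℂ H] [CompleteSpace H]
variable {R : H →L[ℂ] H} (hR : IsSelfAdjoint R)

/-- The operator `f(R)` for a real continuous function `f` on the spectrum of `R`. -/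
def ctsCalc : C(spectrum ℝ R, ℝ) →⋆ₐ[ℝ] (H →L[ℂ] H) := cfcHom (p := IsSelfAdjoint) hR

theorem ctsCalc_inner_symm (f : C(spectrum ℝ R, ℝ)) (ψ φ : H) :
    ⟪ctsCalc hR f ψ, φ⟫_ℂ = ⟪ψ, ctsCalc hR f φ⟫_ℂ := by
  have h : star (ctsCalc hR f) = ctsCalc hR f := by
    rw [← map_star]; congr 1
  rw [ContinuousLinearMap.star_eq_adjoint] at h
  rw [← ContinuousLinearMap.adjoint_inner_right, h]

theorem ctsCalc_norm_sq (f : C(spectrum ℝ R, ℝ)) (ψ : H) :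
    ‖ctsCalc hR f ψ‖ ^ 2 = (⟪ψ, ctsCalc hR (f * f) ψ⟫_ℂ).re := by
  rw [map_mul, mul_apply_eq_comp, ← ctsCalc_inner_symm, inner_self_eq_norm_sq_to_K]
  norm_cast

/-- The positive functional `f ↦ ⟪ψ, f(R) ψ⟫`. -/
def stateFunctional (ψ : H) : CompactlySupportedContinuousMap (spectrum ℝ R) ℝ →ₚ[ℝ] ℝ :=
  PositiveLinearMap.mk₀
    { toFun := fun f => (⟪ψ, ctsCalc hR (f : C(spectrum ℝ R, ℝ)) ψ⟫_ℂ).re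
      map_add' := fun f g => by
        have : ((f + g : CompactlySupportedContinuousMap (spectrum ℝ R) ℝ) : C(spectrum ℝ R, ℝ))
          = f + g := rfl
        rw [this, map_add]
        simp
      map_smul' := fun c f => by
        have : ((c • f : CompactlySupportedContinuousMap (spectrum ℝ R) ℝ) : C(spectrum ℝ R, ℝ))
          = c • (f : C(spectrum ℝ R, ℝ)) := rfl
        rw [this, map_smul]
        simp [inner_smul_right_eq_smul] }
    (fun f hf => by
      let g : C(spectrum ℝ R, ℝ) := ⟨fun x => √(f x), by fun_prop⟩
      have hg : (f : C(spectrum ℝ R, ℝ)) = g * g := by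
        ext x
        exact (Real.mul_self_sqrt (hf x)).symm
      change 0 ≤ (⟪ψ, ctsCalc hR (f : C(spectrum ℝ R, ℝ)) ψ⟫_ℂ).re
      rw [hg, ← ctsCalc_norm_sq]
      positivity)

/-- The measure on the spectrum of `R` that represents `f ↦ ⟪ψ, f(R) ψ⟫`. -/
def stateMeasure (ψ : H) : Measure (spectrum ℝ R) := RealRMK.rieszMeasure (stateFunctional hR ψ)

instance (ψ : H) : IsFiniteMeasure (stateMeasure hR ψ) := by
  unfold stateMeasure; infer_instance

theorem integral_stateMeasure (ψ : H) (f : C(spectrum ℝ R, ℝ)) :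
    ∫ x, f x ∂stateMeasure hR ψ = (⟪ψ, ctsCalc hR f ψ⟫_ℂ).re :=
  RealRMK.integral_rieszMeasure (stateFunctional hR ψ)
    (CompactlySupportedContinuousMap.continuousMapEquiv f)

theorem ctsCalc_norm_sq_eq_integral (f : C(spectrum ℝ R, ℝ)) (ψ : H) :
    ‖ctsCalc hR f ψ‖ ^ 2 = ∫ x, f x ^ 2 ∂stateMeasure hR ψ := by
  rw [ctsCalc_norm_sq, ← integral_stateMeasure]
  simp [pow_two]

theorem integrable_of_cts (f : C(spectrum ℝ R, ℝ)) (ψ : H) : Integrable f (stateMeasure hR ψ) :=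
  f.continuous.integrable_of_hasCompactSupport (HasCompactSupport.of_compactSpace f)

/-- The continuous functions `fₙ` with values in `[0, 1]` approximate the indicator function of `S`
in `L¹` of the measure of `ψ`. -/
def ApproxInd (S : Set (spectrum ℝ R)) (ψ : H) (f : ℕ → C(spectrum ℝ R, ℝ)) : Prop :=
  (∀ n x, f n x ∈ Set.Icc (0 : ℝ) 1) ∧
    Tendsto (fun n => ∫ x, |f n x - S.indicator 1 x| ∂stateMeasure hR ψ) atTop (𝓝 0)

variable {S S' : Set (spectrum ℝ R)}

theorem integrable_ind (hS : MeasurableSet S) (ψ : H) :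
    Integrable (S.indicator (1 : spectrum ℝ R → ℝ)) (stateMeasure hR ψ) :=
  (integrable_const (1 : ℝ)).indicator hS

theorem integrable_abs_sub (hS : MeasurableSet S) (ψ : H) (f : C(spectrum ℝ R, ℝ)) :
    Integrable (fun x => |f x - S.indicator 1 x|) (stateMeasure hR ψ) :=
  ((integrable_of_cts hR f ψ).sub (integrable_ind hR hS ψ)).abs

/-- One sequence of continuous functions approximates an indicator function in `L¹` of finitely
many measures at once. -/
theorem exists_approxInd (hS : MeasurableSet S) (s : Finset H) :
    ∃ f : ℕ → C(spectrum ℝ R, ℝ), ∀ ψ ∈ s, ApproxInd hR S ψ f := by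
  let ν : Measure (spectrum ℝ R) := ∑ ψ ∈ s, stateMeasure hR ψ
  have hν : Integrable (S.indicator (1 : spectrum ℝ R → ℝ)) ν :=
    (integrable_const (1 : ℝ)).indicator hS
  have hle : ∀ ψ ∈ s, stateMeasure hR ψ ≤ ν := fun ψ hψ =>
    Finset.single_le_sum (f := fun ψ => stateMeasure hR ψ) (fun _ _ => Measure.zero_le _) hψ
  have h : ∀ n : ℕ, ∃ g : C(spectrum ℝ R, ℝ), (∀ x, g x ∈ Set.Icc (0 : ℝ) 1) ∧
      ∫ x, |g x - S.indicator 1 x| ∂ν ≤ 1 / ((n : ℝ) + 1) := fun n => by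
    obtain ⟨g, hg, hgi⟩ := hν.exists_boundedContinuous_integral_sub_le
      (ε := 1 / ((n : ℝ) + 1)) (by positivity)
    refine ⟨⟨fun x => max 0 (min 1 (g x)), by fun_prop⟩, fun x => ?_, ?_⟩
    · exact ⟨le_max_left _ _, max_le zero_le_one (min_le_left _ _)⟩
    · refine le_trans (integral_mono_of_nonneg (Eventually.of_forall fun x => abs_nonneg _)
        (hν.sub hgi).norm (Eventually.of_forall fun x => ?_)) hg
      have h2 : S.indicator (1 : spectrum ℝ R → ℝ) x =
          max 0 (min 1 (S.indicator (1 : spectrum ℝ R → ℝ) x)) := by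
        by_cases hx : x ∈ S <;> simp [hx]
      simp only [ContinuousMap.coe_mk, Pi.sub_apply, Real.norm_eq_abs]
      rw [h2, abs_sub_comm]
      refine (abs_max_sub_max_le_max _ _ _ _).trans ?_
      refine max_le (by simp) ?_
      refine (abs_min_sub_min_le_max _ _ _ _).trans ?_
      refine max_le (by simp) ?_
      by_cases hx : x ∈ S <;> simp [hx]
  choose f hf01 hf using h
  refine ⟨f, fun ψ hψ => ⟨hf01, ?_⟩⟩
  refine squeeze_zero (fun n => integral_nonneg fun x => abs_nonneg _) (fun n => ?_)
    tendsto_one_div_add_atTop_nhds_zero_nat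
  refine le_trans (integral_mono_measure (hle ψ hψ) (Eventually.of_forall fun x => abs_nonneg _)
    ?_) (hf n)
  exact (Integrable.sub ((f n).continuous.integrable_of_hasCompactSupport
    (HasCompactSupport.of_compactSpace _)) hν).abs

variable {hR}

theorem ctsCalc_sub_norm_sq_le (hS : MeasurableSet S) (ψ : H) {f g : C(spectrum ℝ R, ℝ)}
    (hf : ∀ x, f x ∈ Set.Icc (0 : ℝ) 1) (hg : ∀ x, g x ∈ Set.Icc (0 : ℝ) 1) :
    ‖ctsCalc hR f ψ - ctsCalc hR g ψ‖ ^ 2 ≤ ∫ x, |f x - S.indicator 1 x| ∂stateMeasure hR ψ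
      + ∫ x, |g x - S.indicator 1 x| ∂stateMeasure hR ψ := by
  rw [← sub_apply, ← map_sub, ctsCalc_norm_sq_eq_integral,
    ← integral_add (integrable_abs_sub hR hS ψ f) (integrable_abs_sub hR hS ψ g)]
  refine integral_mono_of_nonneg (Eventually.of_forall fun x => by positivity)
    ((integrable_abs_sub hR hS ψ f).add (integrable_abs_sub hR hS ψ g))
    (Eventually.of_forall fun x => ?_)
  simp only [ContinuousMap.sub_apply]
  have h1 := hf x
  have h2 := hg x
  have h3 : |f x - g x| ≤ 1 := by rw [abs_le]; constructor <;> linarith [h1.1, h1.2, h2.1, h2.2]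
  calc (f x - g x) ^ 2 = |f x - g x| * |f x - g x| := by rw [← sq, sq_abs]
    _ ≤ 1 * |f x - g x| := by gcongr
    _ = |(f x - S.indicator 1 x) - (g x - S.indicator 1 x)| := by rw [one_mul]; ring_nf
    _ ≤ _ := abs_sub _ _

theorem ApproxInd.exists_tendsto (hS : MeasurableSet S) {ψ : H} {f : ℕ → C(spectrum ℝ R, ℝ)}
    (hf : ApproxInd hR S ψ f) : ∃ χ, Tendsto (fun n => ctsCalc hR (f n) ψ) atTop (𝓝 χ) := by
  refine cauchySeq_tendsto_of_complete (Metric.cauchySeq_iff.mpr fun ε hε => ?_)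
  obtain ⟨N, hN⟩ := eventually_atTop.mp (hf.2.eventually (gt_mem_nhds (show 0 < ε ^ 2 / 2 by
    positivity)))
  refine ⟨N, fun m hm n hn => ?_⟩
  rw [dist_eq_norm]
  refine lt_of_pow_lt_pow_left₀ 2 hε.le ?_
  have := ctsCalc_sub_norm_sq_le (hR := hR) hS ψ (hf.1 m) (hf.1 n)
  linarith [hN m hm, hN n hn]

theorem ApproxInd.tendsto_unique (hS : MeasurableSet S) {ψ : H} {f g : ℕ → C(spectrum ℝ R, ℝ)}
    (hf : ApproxInd hR S ψ f) (hg : ApproxInd hR S ψ g) {χ : H}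
    (h : Tendsto (fun n => ctsCalc hR (f n) ψ) atTop (𝓝 χ)) :
    Tendsto (fun n => ctsCalc hR (g n) ψ) atTop (𝓝 χ) := by
  refine (tendsto_iff_of_dist ?_).mp h
  have h1 : Tendsto (fun n => ‖ctsCalc hR (f n) ψ - ctsCalc hR (g n) ψ‖ ^ 2) atTop (𝓝 0) :=
    squeeze_zero (fun n => by positivity)
      (fun n => ctsCalc_sub_norm_sq_le hS ψ (hf.1 n) (hg.1 n)) (by simpa using hf.2.add hg.2)
  simpa [dist_eq_norm, Real.sqrt_sq (norm_nonneg _)] using h1.sqrt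

variable (hR)

open Classical in
/-- The vector `1_S(R) ψ`. -/
def specProjFun (S : Set (spectrum ℝ R)) (ψ : H) : H :=
  if hS : MeasurableSet S then
    (((exists_approxInd hR hS {ψ}).choose_spec ψ (Finset.mem_singleton_self ψ)).exists_tendsto
      hS).choose
  else 0

variable {hR}

theorem ApproxInd.tendsto (hS : MeasurableSet S) {ψ : H} {f : ℕ → C(spectrum ℝ R, ℝ)}
    (hf : ApproxInd hR S ψ f) :
    Tendsto (fun n => ctsCalc hR (f n) ψ) atTop (𝓝 (specProjFun hR S ψ)) := by
  have h := (exists_approxInd hR hS {ψ}).choose_spec ψ (Finset.mem_singleton_self ψ)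
  refine h.tendsto_unique hS hf ?_
  rw [specProjFun, dif_pos hS]
  exact (h.exists_tendsto hS).choose_spec

theorem norm_sq_specProjFun (hS : MeasurableSet S) (ψ : H) :
    ‖specProjFun hR S ψ‖ ^ 2 = (stateMeasure hR ψ).real S := by
  obtain ⟨f, hf⟩ := exists_approxInd hR hS {ψ}
  replace hf := hf ψ (Finset.mem_singleton_self ψ)
  have h1 := ((hf.tendsto hS).norm.pow 2)
  refine tendsto_nhds_unique h1 ?_
  simp only [ctsCalc_norm_sq_eq_integral]
  rw [← integral_indicator_one hS, tendsto_iff_norm_sub_tendsto_zero]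
  refine squeeze_zero (fun _ => norm_nonneg _) (fun n => ?_) (by simpa using hf.2.const_mul 2)
  have hi : Integrable (fun x => f n x ^ 2) (stateMeasure hR ψ) := by
    have h2 := integrable_of_cts hR (f n * f n) ψ
    refine h2.congr (Eventually.of_forall fun x => ?_)
    simp [pow_two]
  rw [← integral_sub hi (integrable_ind hR hS ψ), ← integral_const_mul]
  refine (norm_integral_le_integral_norm _).trans (integral_mono_of_nonneg
    (Eventually.of_forall fun x => norm_nonneg _) ((integrable_abs_sub hR hS ψ _).const_mul 2)
    (Eventually.of_forall fun x => ?_))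
  have h01 := hf.1 n x
  have h2 : f n x ^ 2 - S.indicator 1 x = (f n x - S.indicator 1 x) * (f n x + S.indicator 1 x) := by
    by_cases hx : x ∈ S <;> simp [hx] <;> ring
  simp only [Real.norm_eq_abs]
  rw [h2, abs_mul, mul_comm]
  gcongr
  rw [abs_le]
  by_cases hx : x ∈ S <;> simp [hx] <;> constructor <;> linarith [h01.1, h01.2]

theorem specProjFun_add (hS : MeasurableSet S) (ψ φ : H) :
    specProjFun hR S (ψ + φ) = specProjFun hR S ψ + specProjFun hR S φ := by
  classical
  obtain ⟨f, hf⟩ := exists_approxInd hR hS {ψ, φ, ψ + φ}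
  have h1 := (hf ψ (by simp)).tendsto hS
  have h2 := (hf φ (by simp)).tendsto hS
  have h3 := (hf (ψ + φ) (by simp)).tendsto hS
  simp only [map_add] at h3
  exact tendsto_nhds_unique h3 (h1.add h2)

theorem specProjFun_smul (hS : MeasurableSet S) (c : ℂ) (ψ : H) :
    specProjFun hR S (c • ψ) = c • specProjFun hR S ψ := by
  classical
  obtain ⟨f, hf⟩ := exists_approxInd hR hS {ψ, c • ψ}
  have h1 := (hf ψ (by simp)).tendsto hS
  have h3 := (hf (c • ψ) (by simp)).tendsto hS
  simp only [map_smul] at h3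
  exact tendsto_nhds_unique h3 (h1.const_smul c)

theorem approxInd_univ (ψ : H) : ApproxInd hR Set.univ ψ fun _ => 1 :=
  ⟨fun _ _ => by simp, by simp⟩

theorem specProjFun_univ (ψ : H) : specProjFun hR Set.univ ψ = ψ := by
  have := (approxInd_univ (hR := hR) ψ).tendsto MeasurableSet.univ
  simp only [map_one, one_apply_eq_self] at this
  exact (tendsto_nhds_unique this tendsto_const_nhds)

theorem norm_specProjFun_le (hS : MeasurableSet S) (ψ : H) :
    ‖specProjFun hR S ψ‖ ≤ 1 * ‖ψ‖ := by
  rw [one_mul]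
  refine le_of_sq_le_sq ?_ (norm_nonneg _)
  nth_rewrite 2 [← specProjFun_univ (hR := hR) ψ]
  rw [norm_sq_specProjFun hS, norm_sq_specProjFun MeasurableSet.univ]
  exact measureReal_mono (Set.subset_univ S)

theorem norm_ctsCalc_le {f : C(spectrum ℝ R, ℝ)} (hf : ∀ x, f x ∈ Set.Icc (0 : ℝ) 1) (ψ : H) :
    ‖ctsCalc hR f ψ‖ ≤ ‖ψ‖ := by
  refine le_of_sq_le_sq ?_ (norm_nonneg _)
  have h1 := ctsCalc_norm_sq_eq_integral hR 1 ψ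
  simp only [map_one, one_apply_eq_self] at h1
  rw [h1, ctsCalc_norm_sq_eq_integral]
  refine integral_mono_of_nonneg (Eventually.of_forall fun x => by positivity)
    (by simp) (Eventually.of_forall fun x => ?_)
  have := hf x
  simp only [ContinuousMap.one_apply, one_pow]
  exact pow_le_one₀ this.1 this.2

/-- Multiplicativity, from approximating sequences whose products approximate the indicator function of
the intersection. -/
theorem specProjFun_inter (hS : MeasurableSet S) (hS' : MeasurableSet S') (ψ : H) :
    specProjFun hR (S ∩ S') ψ = specProjFun hR S (specProjFun hR S' ψ) := by
  classical
  set χ := specProjFun hR S' ψ with hχ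
  obtain ⟨f, hf⟩ := exists_approxInd hR hS' {ψ}
  replace hf := hf ψ (by simp)
  obtain ⟨g, hg⟩ := exists_approxInd hR hS {ψ, χ}
  have hg1 := hg ψ (by simp)
  have hg2 := hg χ (by simp)
  have hfg : ApproxInd hR (S ∩ S') ψ fun n => g n * f n := by
    refine ⟨fun n x => ⟨mul_nonneg (hg1.1 n x).1 (hf.1 n x).1,
      mul_le_one₀ (hg1.1 n x).2 (hf.1 n x).1 (hf.1 n x).2⟩, ?_⟩
    refine squeeze_zero (fun n => integral_nonneg fun x => abs_nonneg _) (fun n => ?_)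
      (by simpa using hg1.2.add hf.2)
    rw [← integral_add (integrable_abs_sub hR hS ψ _) (integrable_abs_sub hR hS' ψ _)]
    refine integral_mono_of_nonneg (Eventually.of_forall fun x => abs_nonneg _)
      ((integrable_abs_sub hR hS ψ _).add (integrable_abs_sub hR hS' ψ _))
      (Eventually.of_forall fun x => ?_)
    have h1 := hg1.1 n x
    have h2 := hf.1 n x
    simp only [ContinuousMap.mul_apply]
    have e : g n x * f n x - (S ∩ S').indicator 1 x =
        g n x * (f n x - S'.indicator 1 x) + (g n x - S.indicator 1 x) * S'.indicator 1 x := by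
      by_cases hx : x ∈ S <;> by_cases hx' : x ∈ S' <;> simp [hx, hx'] <;> ring
    rw [e, add_comm]
    refine (abs_add_le _ _).trans (add_le_add ?_ ?_)
    · rw [abs_mul]
      refine mul_le_of_le_one_right (abs_nonneg _) ?_
      by_cases hx' : x ∈ S' <;> simp [hx']
    · rw [abs_mul]
      exact mul_le_of_le_one_left (abs_nonneg _) (by rw [abs_of_nonneg h1.1]; exact h1.2)
  have h1 := hfg.tendsto (hS.inter hS')
  have h2 := hg2.tendsto hS
  have h3 := hf.tendsto hS'
  refine tendsto_nhds_unique h1 ((tendsto_iff_of_dist ?_).mp h2)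
  refine squeeze_zero (fun _ => dist_nonneg) (fun n => ?_) (tendsto_iff_dist_tendsto_zero.mp h3)
  rw [map_mul, mul_apply_eq_comp, dist_eq_norm, ← map_sub, dist_comm, dist_eq_norm]
  exact norm_ctsCalc_le (hg2.1 n) _

theorem specProjFun_compl (hS : MeasurableSet S) (ψ : H) :
    specProjFun hR Sᶜ ψ = ψ - specProjFun hR S ψ := by
  obtain ⟨f, hf⟩ := exists_approxInd hR hS {ψ}
  replace hf := hf ψ (by simp)
  have hf' : ApproxInd hR Sᶜ ψ fun n => 1 - f n := by
    refine ⟨fun n x => ?_, ?_⟩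
    · have := hf.1 n x
      simp only [ContinuousMap.sub_apply, ContinuousMap.one_apply, Set.mem_Icc]
      constructor <;> linarith [this.1, this.2]
    · refine hf.2.congr fun n => integral_congr_ae (Eventually.of_forall fun x => ?_)
      by_cases hx : x ∈ S <;> simp [hx, abs_sub_comm]
  have h1 := hf'.tendsto hS.compl
  simp only [map_sub, map_one, sub_apply, one_apply_eq_self] at h1
  exact tendsto_nhds_unique h1 (tendsto_const_nhds.sub (hf.tendsto hS))

theorem specProjFun_empty (ψ : H) : specProjFun hR ∅ ψ = 0 := by
  have := specProjFun_compl (hR := hR) MeasurableSet.univ ψ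
  rwa [specProjFun_univ, sub_self, Set.compl_univ] at this

theorem specProjFun_union (hS : MeasurableSet S) (hS' : MeasurableSet S') (hd : Disjoint S S')
    (ψ : H) : specProjFun hR (S ∪ S') ψ = specProjFun hR S ψ + specProjFun hR S' ψ := by
  have h1 := specProjFun_compl (hR := hR) (hS.compl.inter hS'.compl) ψ
  rw [Set.compl_inter, compl_compl, compl_compl, specProjFun_inter hS.compl hS'.compl,
    specProjFun_compl hS, specProjFun_compl hS', sub_eq_add_neg ψ (specProjFun hR S' ψ),
    specProjFun_add hS,
    ← neg_one_smul ℂ (specProjFun hR S' ψ), specProjFun_smul hS, ← specProjFun_inter hS hS',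
    hd.inter_eq, specProjFun_empty] at h1
  rw [h1, smul_zero, neg_one_smul]
  abel

theorem specProjFun_inner_symm (hS : MeasurableSet S) (ψ φ : H) :
    ⟪specProjFun hR S ψ, φ⟫_ℂ = ⟪ψ, specProjFun hR S φ⟫_ℂ := by
  classical
  obtain ⟨f, hf⟩ := exists_approxInd hR hS {ψ, φ}
  have h1 := ((hf ψ (by simp)).tendsto hS).inner (tendsto_const_nhds (x := φ)) (𝕜 := ℂ)
  have h2 := (tendsto_const_nhds (x := ψ)).inner ((hf φ (by simp)).tendsto hS) (𝕜 := ℂ)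
  simp only [ctsCalc_inner_symm] at h1
  exact tendsto_nhds_unique h1 h2

variable (hR)

open Classical in
/-- The projection-valued measure of `g(R)`, for a Borel function `g` on the spectrum of `R`. -/
def pvmMap (g : spectrum ℝ R → ℝ) (hg : Measurable g) : ProjValuedMeasure H where
  proj B :=
    if hB : MeasurableSet B then
      LinearMap.mkContinuous
        { toFun := specProjFun hR (g ⁻¹' B)
          map_add' := specProjFun_add (hg hB)
          map_smul' := specProjFun_smul (hg hB) } 1 (norm_specProjFun_le (hg hB))
    else 0
  isStarProjection B hB := by
    rw [dif_pos hB]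
    refine ⟨?_, ?_⟩
    · ext ψ
      change specProjFun hR (g ⁻¹' B) (specProjFun hR (g ⁻¹' B) ψ) = specProjFun hR (g ⁻¹' B) ψ
      rw [← specProjFun_inter (hg hB) (hg hB), Set.inter_self]
    · rw [ContinuousLinearMap.isSelfAdjoint_iff_isSymmetric]
      exact fun ψ φ => specProjFun_inner_symm (hg hB) ψ φ
  proj_univ := by
    rw [dif_pos MeasurableSet.univ]
    ext ψ
    exact specProjFun_univ ψ
  proj_inter B C hB hC := by
    rw [dif_pos hB, dif_pos hC, dif_pos (hB.inter hC)]
    ext ψ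
    exact specProjFun_inter (hg hB) (hg hC) ψ
  hasSum_proj B hB hd ψ := by
    simp only [dif_pos (hB _), dif_pos (MeasurableSet.iUnion hB)]
    change HasSum (fun n => specProjFun hR (g ⁻¹' (B n)) ψ) (specProjFun hR (g ⁻¹' (⋃ n, B n)) ψ)
    have hm : ∀ n, MeasurableSet (g ⁻¹' (B n)) := fun n => hg (hB n)
    have hd' : Pairwise (Function.onFun Disjoint fun n => g ⁻¹' (B n)) :=
      fun i j hij => (hd hij).preimage g
    rw [Set.preimage_iUnion]
    generalize hS : (fun n => g ⁻¹' (B n)) = S at *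
    replace hS := fun n => congrFun hS n
    simp only [hS] at hm ⊢
    have hfin : ∀ s : Finset ℕ, ∑ n ∈ s, specProjFun hR (S n) ψ =
        specProjFun hR (⋃ n ∈ s, S n) ψ := by
      intro s
      induction s using Finset.induction_on with
      | empty => simp [specProjFun_empty]
      | insert a s ha ih =>
        rw [Finset.sum_insert ha, ih, Finset.set_biUnion_insert, specProjFun_union (hm a)
          (Finset.measurableSet_biUnion s fun n _ => hm n)]
        rw [Set.disjoint_iUnion₂_right]
        exact fun i hi => hd' fun h => ha (h ▸ hi)
    have hreal : HasSum (fun n => (stateMeasure hR ψ).real (S n))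
        ((stateMeasure hR ψ).real (⋃ n, S n)) := by
      have h1 : (stateMeasure hR ψ).real (⋃ n, S n) = ∑' n, (stateMeasure hR ψ).real (S n) := by
        simp only [measureReal_def, measure_iUnion hd' hm]
        exact ENNReal.tsum_toReal_eq fun n => measure_ne_top _ _
      rw [h1]
      refine Summable.hasSum (ENNReal.summable_toReal ?_)
      rw [← measure_iUnion hd' hm]
      exact measure_ne_top _ _
    have hU : MeasurableSet (⋃ n, S n) := MeasurableSet.iUnion hm
    have key : ∀ s : Finset ℕ, ‖∑ n ∈ s, specProjFun hR (S n) ψ - specProjFun hR (⋃ n, S n) ψ‖ ^ 2 =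
        (stateMeasure hR ψ).real (⋃ n, S n) - ∑ n ∈ s, (stateMeasure hR ψ).real (S n) := by
      intro s
      have hs : MeasurableSet (⋃ n ∈ s, S n) := Finset.measurableSet_biUnion s fun n _ => hm n
      have hsub : (⋃ n ∈ s, S n) ⊆ ⋃ n, S n := Set.iUnion₂_subset_iUnion _ _
      have h1 := specProjFun_union (hR := hR) hs (hU.diff hs) Set.disjoint_sdiff_right ψ
      rw [Set.union_sdiff_cancel hsub] at h1
      rw [hfin, h1, sub_add_cancel_left, norm_neg, norm_sq_specProjFun (hU.diff hs),
        measureReal_sdiff hsub hs, measureReal_biUnion_finset (fun i _ j _ hij => hd' hij)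
          fun n _ => hm n]
    rw [HasSum, SummationFilter.unconditional_filter, tendsto_iff_norm_sub_tendsto_zero]
    have h0 : Tendsto (fun s : Finset ℕ => (stateMeasure hR ψ).real (⋃ n, S n) -
        ∑ n ∈ s, (stateMeasure hR ψ).real (S n)) atTop (𝓝 0) := by
      have := hreal.const_sub ((stateMeasure hR ψ).real (⋃ n, S n))
      rw [sub_self] at this
      exact this
    simp only [← key] at h0
    simpa [Real.sqrt_sq (norm_nonneg _)] using h0.sqrt

variable {hR}

/-- The scalar measures of `pvmMap` are the images of the Riesz–Markov measures. -/
theorem pvmMap_measure {g : spectrum ℝ R → ℝ} (hg : Measurable g) (ψ : H) :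
    (pvmMap hR g hg).measure ψ = (stateMeasure hR ψ).map g := by
  refine Measure.ext fun B hB => ?_
  rw [Measure.map_apply hg hB, ProjValuedMeasure.measure_apply _ _ hB]
  simp only [pvmMap, dif_pos hB]
  change ENNReal.ofReal (‖specProjFun hR (g ⁻¹' B) ψ‖ ^ 2) = _
  rw [norm_sq_specProjFun (hg hB), measureReal_def, ENNReal.ofReal_toReal (measure_ne_top _ _)]

end BoundedSpectral

namespace ProjValuedMeasure
variable {H : Type*} [NormedAddCommGroup H] [InnerProductSpace ℂ H] [CompleteSpace H]
variable {P : ProjValuedMeasure H}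

/-- The expectation value of `k(T)`, obtained from `‖(1 + k(T)) ψ‖²`. -/
theorem re_inner_fn_ofReal {k : ℝ → ℝ} (hk : Measurable k) {ψ : H}
    (h : MemLp (fun x => (k x : ℂ)) 2 (P.measure ψ)) :
    (⟪ψ, P.fn (fun x => (k x : ℂ)) ψ⟫_ℂ).re = ∫ x, k x ∂P.measure ψ := by
  have hk' : Measurable fun x => (k x : ℂ) := by fun_prop
  have h1 := fn_add (P := P) (ψ := ψ) (f := fun _ => 1) measurable_const hk' (memLp_const _) h
  have h2 := norm_sq_fn (P := P) (ψ := ψ) (measurable_const.add hk') ((memLp_const (1 : ℂ)).add h)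
  rw [h1, fn_one, @norm_add_sq ℂ, norm_sq_fn hk' h] at h2
  have h0 : ‖ψ‖ ^ 2 = ∫ x, 1 ∂P.measure ψ := by
    have := norm_sq_fn (P := P) (ψ := ψ) (f := fun _ => 1) measurable_const (memLp_const _)
    rw [fn_one] at this
    simpa using this
  have hi : Integrable k (P.measure ψ) := by
    have := (h.integrable (by norm_num)).re
    simpa using this
  have hi2 : Integrable (fun x => ‖(k x : ℂ)‖ ^ 2) (P.measure ψ) :=
    (memLp_two_iff_integrable_sq_norm h.1).mp h
  have h3 : ∫ x, ‖((fun _ => (1 : ℂ) : ℝ → ℂ) + fun x => (k x : ℂ)) x‖ ^ 2 ∂P.measure ψ =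
      (∫ x, 1 ∂P.measure ψ) + 2 * (∫ x, k x ∂P.measure ψ) + ∫ x, ‖(k x : ℂ)‖ ^ 2 ∂P.measure ψ := by
    have h4 : Integrable (fun x => (1 : ℝ) + 2 * k x) (P.measure ψ) :=
      (integrable_const _).add (hi.const_mul 2)
    rw [← integral_const_mul, ← integral_add (integrable_const _) (hi.const_mul 2),
      ← integral_add h4 hi2]
    refine integral_congr_ae (Eventually.of_forall fun x => ?_)
    simp only [Pi.add_apply]
    rw [Complex.norm_real, Real.norm_eq_abs, sq_abs,
      show (1 : ℂ) + (k x : ℂ) = ((1 + k x : ℝ) : ℂ) by push_cast; ring, Complex.norm_real,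
      Real.norm_eq_abs, sq_abs]
    ring
  rw [h3, h0] at h2
  have : RCLike.re ⟪ψ, P.fn (fun x => (k x : ℂ)) ψ⟫_ℂ = ∫ x, k x ∂P.measure ψ := by linarith
  exact this

end ProjValuedMeasure

section UnboundedSpectral

variable {H : Type*} [NormedAddCommGroup H] [InnerProductSpace ℂ H] [CompleteSpace H]

open ProjValuedMeasure in
/-- A bounded self-adjoint operator `R` is `∫ (y - c)⁻¹ dP(y)` for a suitable `P`. -/
theorem exists_pvm_of_isSelfAdjoint {R : H →L[ℂ] H} (hR : IsSelfAdjoint R) (c : ℝ) :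
    ∃ P : ProjValuedMeasure H, ∀ ψ,
      MemLp (fun y : ℝ => (((y - c)⁻¹ : ℝ) : ℂ)) 2 (P.measure ψ) ∧
      P.fn (fun y : ℝ => (((y - c)⁻¹ : ℝ) : ℂ)) ψ = R ψ := by
  let g : spectrum ℝ R → ℝ := fun x => (x : ℝ)⁻¹ + c
  have hg : Measurable g := by fun_prop
  let P := pvmMap hR g hg
  let r : ℝ → ℝ := fun y => (y - c)⁻¹
  have hr : Measurable r := by fun_prop
  have hrc : Measurable fun y => (r y : ℂ) := by fun_prop
  have hrg : ∀ x, r (g x) = x := fun x => by simp [r, g]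
  let ι : C(spectrum ℝ R, ℝ) := ⟨fun x => x, by fun_prop⟩
  have hι : ctsCalc hR ι = R := cfcHom_id (p := IsSelfAdjoint) hR
  have hm : ∀ ψ, MemLp (fun y => (r y : ℂ)) 2 (P.measure ψ) := fun ψ => by
    rw [pvmMap_measure hg, memLp_map_measure_iff hrc.aestronglyMeasurable hg.aemeasurable]
    obtain ⟨C, hC⟩ := (isCompact_univ (X := spectrum ℝ R)).exists_bound_of_continuousOn
      (f := fun x => (x : ℝ)) (by fun_prop)
    refine MemLp.of_bound (hrc.comp hg).aestronglyMeasurable C (Eventually.of_forall fun x => ?_)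
    simpa [hrg] using hC x (Set.mem_univ x)
  have hbd : ∀ ψ, ‖P.fn (fun y => (r y : ℂ)) ψ‖ ≤ ‖R‖ * ‖ψ‖ := fun ψ => by
    refine le_trans (le_of_sq_le_sq ?_ (norm_nonneg _)) (R.le_opNorm ψ)
    rw [norm_sq_fn hrc (hm ψ), pvmMap_measure hg, integral_map hg.aemeasurable
      (hrc.norm.pow_const 2).aestronglyMeasurable]
    conv_rhs => rw [← hι, ctsCalc_norm_sq_eq_integral]
    refine le_of_eq (integral_congr_ae (Eventually.of_forall fun x => ?_))
    simp only [hrg, Complex.norm_real, Real.norm_eq_abs, sq_abs]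
    rfl
  have hfnR : ∀ ψ, P.fn (fun y => (r y : ℂ)) ψ = R ψ := by
    obtain ⟨Rf, hRf⟩ : ∃ Rf : H →L[ℂ] H, ∀ ψ, Rf ψ = P.fn (fun y => (r y : ℂ)) ψ :=
      ⟨LinearMap.mkContinuous
        { toFun := P.fn (fun y => (r y : ℂ))
          map_add' := fun _ _ => fn_add_right hrc (hm _) (hm _)
          map_smul' := fun c ψ => fn_smul_right hrc c (hm ψ) } ‖R‖ hbd, fun _ => rfl⟩
    have hsym : ∀ φ ψ, ⟪Rf φ, ψ⟫_ℂ = ⟪φ, Rf ψ⟫_ℂ := fun φ ψ => by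
      have := inner_fn (P := P) (ψ := φ) (φ := ψ) hrc (hm φ) (hm ψ)
      simpa [hRf] using this
    have hsR : ∀ φ ψ, ⟪R φ, ψ⟫_ℂ = ⟪φ, R ψ⟫_ℂ :=
      fun φ ψ => (ContinuousLinearMap.isSelfAdjoint_iff_isSymmetric.mp hR) φ ψ
    have : Rf = R := by
      have h := (LinearMap.IsSymmetric.inner_map_self_eq_zero
        (T := ((Rf - R : H →L[ℂ] H) : H →ₗ[ℂ] H)) ?_).mp ?_
      · ext ψ
        have := LinearMap.congr_fun h ψ
        simpa [sub_eq_zero] using this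
      · intro φ ψ
        simp only [ContinuousLinearMap.coe_coe, sub_apply, inner_sub_left, inner_sub_right, hsym, hsR]
      · intro ψ
        have h1 := re_inner_fn_ofReal (P := P) hr (hm ψ)
        rw [pvmMap_measure hg, integral_map hg.aemeasurable hr.aestronglyMeasurable] at h1
        simp only [hrg] at h1
        have h2 := integral_stateMeasure hR ψ ι
        rw [hι] at h2
        have h3 : (⟪ψ, Rf ψ⟫_ℂ).re = (⟪ψ, R ψ⟫_ℂ).re := by rw [hRf]; exact h1.trans h2
        have him : ∀ z : ℂ, star z = z → (z.re : ℂ) = z := fun z hz => Complex.conj_eq_iff_re.mp hz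
        simp only [ContinuousLinearMap.coe_coe, sub_apply, inner_sub_left]
        rw [hsym, hsR, sub_eq_zero,
          ← him _ ((inner_conj_symm _ _).trans (hsym ψ ψ)),
          ← him ⟪ψ, R ψ⟫_ℂ ((inner_conj_symm _ _).trans (hsR ψ ψ)), h3]
    intro ψ
    rw [← hRf, this]
  exact ⟨P, fun ψ => ⟨hm ψ, hfnR ψ⟩⟩

open ProjValuedMeasure in
/-- The **spectral theorem** for a symmetric operator with a real point in its resolvent set. -/
theorem exists_isSpectralMeasure {T : H →ₗ.[ℂ] H} (hT : T.IsFormalAdjoint T) {c : ℝ}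
    (hc : InResolventSet T c) : ∃ P, IsSpectralMeasure P T := by
  obtain ⟨R, hR1, hR2⟩ := hc
  have hR : IsSelfAdjoint R := by
    rw [ContinuousLinearMap.isSelfAdjoint_iff_isSymmetric]
    intro ψ φ
    obtain ⟨h, hψ⟩ := hR1 ψ
    obtain ⟨h', hφ⟩ := hR1 φ
    have := hT ⟨R ψ, h⟩ ⟨R φ, h'⟩
    simp only [ContinuousLinearMap.coe_coe]
    nth_rewrite 2 [← hψ]
    nth_rewrite 1 [← hφ]
    rw [inner_sub_left, inner_sub_right, ← this, inner_smul_left, inner_smul_right]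
    simp
  obtain ⟨P, hP⟩ := exists_pvm_of_isSelfAdjoint hR c
  obtain ⟨r, hrd⟩ : ∃ r : ℝ → ℝ, ∀ y, r y = (y - c)⁻¹ := ⟨_, fun _ => rfl⟩
  have hr : Measurable r := by
    rw [funext hrd]
    fun_prop
  simp only [← hrd] at hP
  have hrc : Measurable fun y => (r y : ℂ) := by fun_prop
  have hm : ∀ ψ, MemLp (fun y => (r y : ℂ)) 2 (P.measure ψ) := fun ψ => (hP ψ).1
  have hfnR : ∀ ψ, P.fn (fun y => (r y : ℂ)) ψ = R ψ := fun ψ => (hP ψ).2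
  -- `R = (T - c)⁻¹` is injective, so the spectral measures do not charge the point `c`, where `r` has
  -- the junk value `0`
  have hinj : ∀ ψ, R ψ = 0 → ψ = 0 := fun ψ h0 => by
    obtain ⟨h, hψ⟩ := hR1 ψ
    have hz : (⟨R ψ, h⟩ : T.domain) = 0 := Subtype.ext h0
    rw [hz, T.map_zero, h0] at hψ
    simpa using hψ.symm
  have hae : ∀ ψ, ∀ᵐ y ∂P.measure ψ, y ≠ c := fun ψ => by
    have h1 : P.proj {c} ψ = 0 := by
      apply hinj
      have h2 := proj_fn_comm (P := P) (measurableSet_singleton c) hrc (hm ψ)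
      rw [← hfnR, h2.1]
      have : ({c} : Set ℝ).indicator (fun y => (r y : ℂ)) = 0 := by
        ext y
        by_cases hy : y = c <;> simp [hy, hrd]
      rw [this, fn_zero]
    rw [ae_iff]
    simp only [not_not]
    change P.measure ψ {c} = 0
    rw [P.measure_apply _ (measurableSet_singleton c), h1]
    simp
  have hid : Measurable fun x : ℝ => (x : ℂ) := Complex.measurable_ofReal
  -- `(∫ y dP(y)) R = 1 + c R`, from `y (y - c)⁻¹ = 1 + c (y - c)⁻¹`
  have key : ∀ χ, MemLp (fun x : ℝ => (x : ℂ)) 2 (P.measure (R χ)) ∧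
      P.fn (fun x : ℝ => (x : ℂ)) (R χ) = χ + (c : ℂ) • R χ := fun χ => by
    have hcr : MemLp (fun y => (c : ℂ) * (r y : ℂ)) 2 (P.measure χ) := (hm χ).const_mul _
    have hs : MemLp (fun y => 1 + (c : ℂ) * (r y : ℂ)) 2 (P.measure χ) := (memLp_const (1 : ℂ)).add hcr
    have hms : Measurable fun y => 1 + (c : ℂ) * (r y : ℂ) := by fun_prop
    have he : ((fun x : ℝ => (x : ℂ)) * fun y => (r y : ℂ)) =ᵐ[P.measure χ]
        fun y => 1 + (c : ℂ) * (r y : ℂ) := by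
      filter_upwards [hae χ] with y hy
      have : ((y : ℂ) - c) ≠ 0 := by
        rw [← Complex.ofReal_sub]; simpa [sub_eq_zero] using hy
      simp only [Pi.mul_apply, hrd]
      push_cast
      field_simp
      ring
    have hp := hs.ae_eq he.symm
    have hadd : P.fn (fun y => 1 + (c : ℂ) * (r y : ℂ)) χ =
        P.fn (fun _ => 1) χ + P.fn (fun y => (c : ℂ) * (r y : ℂ)) χ :=
      fn_add measurable_const (by fun_prop) (memLp_const (1 : ℂ)) hcr
    have hsm : P.fn (fun y => (c : ℂ) * (r y : ℂ)) χ = (c : ℂ) • P.fn (fun y => (r y : ℂ)) χ :=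
      fn_smul (c : ℂ) hrc (hm χ)
    rw [← hfnR, memLp_measure_fn hrc (hm χ) hid]
    refine ⟨hp, ?_⟩
    rw [fn_fn hrc (hm χ) hid hp, fn_congr_ae (hid.mul hrc) hms hp he, hadd, fn_one, hsm]
  refine ⟨P, ?_⟩
  refine LinearPMap.ext ?_ ?_
  · ext ψ
    rw [mem_integralOp_domain]
    constructor
    · intro hψ
      -- a vector in the domain of `∫ y dP(y)` is in the range of `R`, as it is equal to
      -- `R (∫ (y - c) dP(y)) ψ`
      have hs : MemLp ((fun x : ℝ => (x : ℂ)) + fun _ => -(c : ℂ)) 2 (P.measure ψ) :=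
        hψ.add (memLp_const _)
      have hms : Measurable ((fun x : ℝ => (x : ℂ)) + fun _ => -(c : ℂ)) := hid.add measurable_const
      have he : ((fun y => (r y : ℂ)) * ((fun x : ℝ => (x : ℂ)) + fun _ => -(c : ℂ)))
          =ᵐ[P.measure ψ] fun _ => 1 := by
        filter_upwards [hae ψ] with y hy
        have : ((y : ℂ) - c) ≠ 0 := by
          rw [← Complex.ofReal_sub]; simpa [sub_eq_zero] using hy
        simp only [Pi.mul_apply, Pi.add_apply, hrd]
        push_cast
        rw [← sub_eq_add_neg, inv_mul_cancel₀ this]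
      have h1 := (memLp_const (1 : ℂ) (μ := P.measure ψ) (p := 2)).ae_eq he.symm
      have h2 := fn_fn hms hs hrc h1
      rw [fn_congr_ae (hrc.mul hms) measurable_const h1 he, fn_one, hfnR] at h2
      obtain ⟨h3, -⟩ := hR1 (P.fn ((fun x : ℝ => (x : ℂ)) + fun _ => -(c : ℂ)) ψ)
      rwa [h2] at h3
    · intro hψ
      have h1 := (key (T ⟨ψ, hψ⟩ - (c : ℂ) • ψ)).1
      rwa [hR2 ⟨ψ, hψ⟩] at h1
  · intro ψ hψ hψ'
    have h1 := (key (T ⟨ψ, hψ'⟩ - (c : ℂ) • ψ)).2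
    rw [hR2 ⟨ψ, hψ'⟩, sub_add_cancel, fn_eq_opApply hid, opApply_of_mem hψ] at h1
    exact h1

theorem isSpectralMeasure_spectralMeasure {T : H →ₗ.[ℂ] H} (h : ∃ P, IsSpectralMeasure P T) :
    IsSpectralMeasure (spectralMeasure T) T := by
  rw [spectralMeasure, dif_pos h]
  exact h.choose_spec

end UnboundedSpectral

/-! ### Spectra and spectral measures of unbounded operators -/

section SpectralOps

variable {H : Type*} [NormedAddCommGroup H] [InnerProductSpace ℂ H] [CompleteSpace H]
variable {T : H →ₗ.[ℂ] H} {P : ProjValuedMeasure H} {ψ φ : H}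

open ProjValuedMeasure

theorem IsSpectralMeasure.mem_domain (hP : IsSpectralMeasure P T) :
    ψ ∈ T.domain ↔ MemLp (fun x : ℝ => (x : ℂ)) 2 (P.measure ψ) := by
  rw [← hP]; rfl

theorem IsSpectralMeasure.opApply_eq (hP : IsSpectralMeasure P T) (ψ : H) :
    opApply T ψ = P.fn (fun x : ℝ => (x : ℂ)) ψ := by
  rw [fn_eq_opApply Complex.measurable_ofReal, hP]

theorem IsSpectralMeasure.mem_domain_of_ae (hP : IsSpectralMeasure P T) {C : ℝ}
    (h : ∀ᵐ x ∂P.measure ψ, |x| ≤ C) : ψ ∈ T.domain := by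
  rw [hP.mem_domain]
  exact MemLp.of_bound Complex.measurable_ofReal.aestronglyMeasurable C (by simpa using h)

theorem fn_ofReal_sub (hψ : MemLp (fun x : ℝ => (x : ℂ)) 2 (P.measure ψ)) (c : ℂ) :
    P.fn (fun x : ℝ => (x : ℂ) - c) ψ = P.fn (fun x : ℝ => (x : ℂ)) ψ - c • ψ := by
  have h1 : P.fn (fun x : ℝ => (x : ℂ) - c) ψ =
      P.fn (fun x : ℝ => (x : ℂ)) ψ - P.fn (fun _ => c) ψ :=
    fn_sub Complex.measurable_ofReal measurable_const hψ (memLp_const c)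
  have h2 : P.fn (fun _ => c) ψ = c • P.fn (fun _ => 1) ψ := by
    rw [← fn_smul c measurable_const (memLp_const (1 : ℂ))]
    congr 1
    ext
    simp
  rw [h1, h2, fn_one]

/-- The spectral measure vanishes on a half-line that is contained in the resolvent set: a unit
vector in the spectral subspace of a short interval around `x` is almost an eigenvector. -/
theorem IsSpectralMeasure.ae_ge (hP : IsSpectralMeasure P T) {a : ℝ}
    (h : ∀ x < a, InResolventSet T (x : ℂ)) (ψ : H) : ∀ᵐ x ∂P.measure ψ, a ≤ x := by
  rw [ae_iff]
  simp only [not_le]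
  refine measure_null_of_locally_null _ fun x hx => ?_
  obtain ⟨R, -, hR⟩ := h x hx
  set δ : ℝ := (‖R‖ + 1)⁻¹ with hδ
  have hδ0 : 0 < δ := by positivity
  refine ⟨Set.Ioo (x - δ) (x + δ), mem_nhdsWithin_of_mem_nhds
    (Ioo_mem_nhds (by linarith) (by linarith)), ?_⟩
  set χ := P.proj (Set.Ioo (x - δ) (x + δ)) ψ with hχ
  have hm : MeasurableSet (Set.Ioo (x - δ) (x + δ)) := measurableSet_Ioo
  have hae : ∀ᵐ y ∂P.measure χ, y ∈ Set.Ioo (x - δ) (x + δ) :=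
    ae_mem_of_proj_eq hm (proj_idem hm ψ)
  have hid : MemLp (fun y : ℝ => (y : ℂ)) 2 (P.measure χ) :=
    memLp_of_ae_mem (C := |x| + δ) Complex.measurable_ofReal hae fun y hy => by
      rw [Complex.norm_real, Real.norm_eq_abs]
      have h1 : |y - x| ≤ δ := abs_le.mpr ⟨by linarith [hy.1], by linarith [hy.2]⟩
      have h2 := abs_add_le (y - x) x
      rw [sub_add_cancel] at h2
      linarith
  have hdom : χ ∈ T.domain := hP.mem_domain.mpr hid
  have h1 := hR ⟨χ, hdom⟩
  simp only at h1
  rw [← opApply_of_mem, hP.opApply_eq, ← fn_ofReal_sub hid] at h1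
  have h2 : ‖P.fn (fun y : ℝ => (y : ℂ) - (x : ℂ)) χ‖ ≤ δ * ‖χ‖ :=
    norm_fn_le_ae (by fun_prop) hδ0.le (by
      filter_upwards [hae] with y hy
      rw [← Complex.ofReal_sub, Complex.norm_real, Real.norm_eq_abs]
      exact abs_le.mpr ⟨by linarith [hy.1], by linarith [hy.2]⟩)
  have h3 : ‖χ‖ ≤ ‖R‖ * (δ * ‖χ‖) := by
    calc ‖χ‖ = ‖R (P.fn (fun y : ℝ => (y : ℂ) - (x : ℂ)) χ)‖ := by rw [h1]
      _ ≤ _ := (R.le_opNorm _).trans (by gcongr)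
  have h4 : ‖R‖ * δ < 1 := by
    rw [hδ, ← div_eq_mul_inv, div_lt_one (by positivity)]
    linarith
  have h5 : ‖χ‖ = 0 := by
    have := norm_nonneg χ
    nlinarith
  rw [P.measure_apply _ hm, ← hχ, h5]
  simp

/-- A non-negative self-adjoint operator has the negative half-line in its resolvent set. -/
theorem inResolventSet_of_nonneg (hT : IsSelfAdjoint T) (hpos : IsNonnegOp T) {κ : ℝ} (hκ : 0 < κ) :
    InResolventSet T ((-κ : ℝ) : ℂ) := by
  have hdense := hT.dense_domain
  have hclosed := hT.isClosed
  have hadj : T.adjoint = T := LinearPMap.isSelfAdjoint_def.mp hT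
  let L : T.domain →ₗ[ℂ] H := T.toFun + (κ : ℂ) • T.domain.subtype
  have hL : ∀ x : T.domain, L x = T x + (κ : ℂ) • (x : H) := fun x => rfl
  -- by non-negativity, `T + κ` is bounded below by `κ`; so it is injective and has closed range
  have hbound : ∀ x : T.domain, κ * ‖(x : H)‖ ≤ ‖L x‖ := fun x => by
    have h1 : κ * ‖(x : H)‖ ^ 2 ≤ (⟪(x : H), L x⟫_ℂ).re := by
      rw [hL, inner_add_right, inner_smul_right, inner_self_eq_norm_sq_to_K, Complex.add_re]
      have := hpos x
      have h2 : ((κ : ℂ) * ((‖(x : H)‖ : ℂ)) ^ 2).re = κ * ‖(x : H)‖ ^ 2 := by norm_cast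
      simp only [Complex.coe_algebraMap]
      linarith
    have h2 : (⟪(x : H), L x⟫_ℂ).re ≤ ‖(x : H)‖ * ‖L x‖ :=
      (Complex.re_le_norm _).trans (norm_inner_le_norm _ _)
    rcases (norm_nonneg (x : H)).eq_or_lt with h0 | h0
    · rw [← h0]; simp
    · nlinarith
  have hinj : Function.Injective L := by
    rw [← LinearMap.ker_eq_bot, LinearMap.ker_eq_bot']
    intro x hx
    have := hbound x
    rw [hx, norm_zero] at this
    have h0 : ‖(x : H)‖ = 0 := le_antisymm (by nlinarith) (norm_nonneg _)
    exact Subtype.ext (norm_eq_zero.mp h0)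
  have hrc : IsClosed (LinearMap.range L : Set H) := by
    rw [← isSeqClosed_iff_isClosed]
    intro u y hu hy
    choose x hx using hu
    have hc : CauchySeq fun n => (x n : H) := by
      rw [Metric.cauchySeq_iff']
      intro ε hε
      obtain ⟨N, hN⟩ := Metric.cauchySeq_iff'.mp hy.cauchySeq (κ * ε) (by positivity)
      refine ⟨N, fun n hn => ?_⟩
      have h1 := hbound (x n - x N)
      rw [map_sub, hx, hx, ← dist_eq_norm] at h1
      have h2 := hN n hn
      rw [dist_eq_norm]
      have h3 : ‖((x n - x N : T.domain) : H)‖ = ‖(x n : H) - x N‖ := rfl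
      rw [h3] at h1
      by_contra hcon
      push Not at hcon
      nlinarith
    obtain ⟨ξ, hξ⟩ := cauchySeq_tendsto_of_complete hc
    have hT2 : Tendsto (fun n => T (x n)) atTop (𝓝 (y - (κ : ℂ) • ξ)) := by
      have := hy.sub (hξ.const_smul (κ : ℂ))
      refine this.congr fun n => ?_
      rw [← hx, hL, add_sub_cancel_right]
    have hg : (ξ, y - (κ : ℂ) • ξ) ∈ T.graph :=
      hclosed.mem_of_tendsto (hξ.prodMk_nhds hT2) (Eventually.of_forall fun n => T.mem_graph (x n))
    obtain ⟨ξ', h1, h2⟩ := T.mem_graph_iff.mp hg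
    simp only at h1 h2
    exact ⟨ξ', by rw [hL, h2, h1, sub_add_cancel]⟩
  -- a vector orthogonal to the range of `T + κ` is an eigenvector of `T` at `-κ`, hence zero
  have hsurj : Function.Surjective L := by
    rw [← LinearMap.range_eq_top]
    have : (LinearMap.range L).topologicalClosure = LinearMap.range L :=
      hrc.submodule_topologicalClosure_eq
    rw [← this, Submodule.topologicalClosure_eq_top_iff, Submodule.eq_bot_iff]
    intro φ hφ
    have h1 : ∀ x : T.domain, ⟪-((κ : ℂ) • φ), (x : H)⟫_ℂ = ⟪φ, T x⟫_ℂ := fun x => by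
      have h2 := (Submodule.mem_orthogonal' _ _).mp hφ (L x) ⟨x, rfl⟩
      rw [hL, inner_add_right, inner_smul_right] at h2
      rw [inner_neg_left, inner_smul_left, eq_comm, Complex.conj_ofReal]
      exact eq_neg_of_add_eq_zero_left h2
    have hmem : φ ∈ T.adjoint.domain :=
      LinearPMap.mem_adjoint_domain_of_exists φ ⟨_, h1⟩
    have hval : T.adjoint ⟨φ, hmem⟩ = -((κ : ℂ) • φ) :=
      LinearPMap.adjoint_apply_eq hdense ⟨φ, hmem⟩ h1
    have hmem' : φ ∈ T.domain := hadj ▸ hmem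
    have hval' : T ⟨φ, hmem'⟩ = -((κ : ℂ) • φ) := by
      rw [← hval, ← opApply_of_mem, ← opApply_of_mem, hadj]
    have h3 := hbound ⟨φ, hmem'⟩
    rw [hL, hval'] at h3
    simp only [neg_add_cancel, norm_zero] at h3
    have h0 : ‖φ‖ = 0 := le_antisymm (by nlinarith) (norm_nonneg _)
    exact norm_eq_zero.mp h0
  let e := LinearEquiv.ofBijective L ⟨hinj, hsurj⟩
  have he : ∀ φ, L (e.symm φ) = φ := fun φ => e.apply_symm_apply φ
  refine ⟨LinearMap.mkContinuous (T.domain.subtype ∘ₗ e.symm.toLinearMap) κ⁻¹ fun φ => ?_, ?_, ?_⟩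
  · have := hbound (e.symm φ)
    rw [he] at this
    rw [inv_mul_eq_div, le_div_iff₀ hκ, mul_comm]
    exact this
  · intro φ
    refine ⟨(e.symm φ).2, ?_⟩
    have := he φ
    rw [hL] at this
    simpa using this
  · intro x
    have h1 : T x - ((-κ : ℝ) : ℂ) • (x : H) = L x := by
      rw [hL]
      simp
    rw [h1]
    change ((e.symm (e x) : T.domain) : H) = x
    rw [e.symm_apply_apply]

/-- The spectral measure of a non-negative self-adjoint operator. -/
theorem isSpectralMeasure_of_nonneg (hT : IsSelfAdjoint T) (hpos : IsNonnegOp T) :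
    IsSpectralMeasure (spectralMeasure T) T := by
  refine isSpectralMeasure_spectralMeasure (exists_isSpectralMeasure (c := -1) ?_
    (inResolventSet_of_nonneg hT hpos one_pos))
  have h := LinearPMap.adjoint_isFormalAdjoint (T := T) hT.dense_domain
  rwa [LinearPMap.isSelfAdjoint_def.mp hT] at h

theorem ae_nonneg_of_nonneg (hT : IsSelfAdjoint T) (hpos : IsNonnegOp T) (ψ : H) :
    ∀ᵐ x ∂(spectralMeasure T).measure ψ, 0 ≤ x :=
  (isSpectralMeasure_of_nonneg hT hpos).ae_ge (fun x hx => by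
    have := inResolventSet_of_nonneg hT hpos (κ := -x) (by linarith)
    rwa [neg_neg] at this) ψ

end SpectralOps

/-! ### Complex time evolution generated by an operator that is bounded below -/

section Evolution

variable {H : Type*} [NormedAddCommGroup H] [InnerProductSpace ℂ H] [CompleteSpace H]

open ProjValuedMeasure

/-- `T` has a spectral measure, and this spectral measure is concentrated on `[a, ∞)`. -/
structure IsBoundedBelowBy (T : H →ₗ.[ℂ] H) (a : ℝ) : Prop where
  spec : IsSpectralMeasure (spectralMeasure T) T
  ae_ge : ∀ ψ, ∀ᵐ x ∂(spectralMeasure T).measure ψ, a ≤ x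

variable {T : H →ₗ.[ℂ] H} {a : ℝ} {ψ φ : H} {w w' : ℂ}

theorem isBoundedBelowBy_zero (hT : IsSelfAdjoint T) (hpos : IsNonnegOp T) :
    IsBoundedBelowBy T 0 :=
  ⟨isSpectralMeasure_of_nonneg hT hpos, ae_nonneg_of_nonneg hT hpos⟩

theorem norm_exp_I_mul (w : ℂ) (x : ℝ) :
    ‖Complex.exp (Complex.I * -w * x)‖ = Real.exp (w.im * x) := by
  rw [Complex.norm_exp]
  congr 1
  simp

theorem IsBoundedBelowBy.exp_bound (hT : IsBoundedBelowBy T a) (hw : w.im ≤ 0) (ψ : H) :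
    ∀ᵐ x : ℝ ∂(spectralMeasure T).measure ψ,
      ‖Complex.exp (Complex.I * -w * (x : ℂ))‖ ≤ Real.exp (w.im * a) := by
  filter_upwards [hT.ae_ge ψ] with x hx
  rw [norm_exp_I_mul, Real.exp_le_exp]
  nlinarith

open Classical in
/-- The bounded operator `e^{-iwT}`, for `Im w ≤ 0` and `T` bounded below (and `0` otherwise). -/
def evolution (T : H →ₗ.[ℂ] H) (w : ℂ) : H →L[ℂ] H :=
  if h : ∃ C : ℝ, 0 ≤ C ∧ ∀ ψ, ∀ᵐ x : ℝ ∂(spectralMeasure T).measure ψ,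
      ‖Complex.exp (Complex.I * -w * (x : ℂ))‖ ≤ C then
    (spectralMeasure T).clm (fun x => Complex.exp (Complex.I * -w * x)) (by fun_prop)
      h.choose_spec.1 h.choose_spec.2
  else 0

theorem measurable_cexp (w : ℂ) : Measurable fun x : ℝ => Complex.exp (Complex.I * w * x) := by
  fun_prop

theorem IsBoundedBelowBy.evolution_apply (hT : IsBoundedBelowBy T a) (hw : w.im ≤ 0) (ψ : H) :
    evolution T w ψ = (spectralMeasure T).fn (fun x => Complex.exp (Complex.I * -w * x)) ψ := by
  rw [evolution, dif_pos ⟨_, (Real.exp_pos _).le, hT.exp_bound hw⟩, clm_apply]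

theorem IsBoundedBelowBy.memLp_exp (hT : IsBoundedBelowBy T a) (hw : w.im ≤ 0) (ψ : H) :
    MemLp (fun x : ℝ => Complex.exp (Complex.I * -w * x)) 2 ((spectralMeasure T).measure ψ) :=
  memLp_of_ae_bounded (measurable_cexp _) (hT.exp_bound hw ψ)

theorem IsBoundedBelowBy.evolution_add (hT : IsBoundedBelowBy T a) (hw : w.im ≤ 0)
    (hw' : w'.im ≤ 0) (ψ : H) : evolution T w (evolution T w' ψ) = evolution T (w + w') ψ := by
  have hadd : (w + w').im ≤ 0 := by rw [Complex.add_im]; linarith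
  have e : ((fun x : ℝ => Complex.exp (Complex.I * -w * x)) *
      fun x : ℝ => Complex.exp (Complex.I * -w' * x)) =
      fun x : ℝ => Complex.exp (Complex.I * -(w + w') * x) := by
    ext x
    rw [Pi.mul_apply, ← Complex.exp_add]
    ring_nf
  rw [hT.evolution_apply hw, hT.evolution_apply hw', hT.evolution_apply hadd,
    fn_fn (measurable_cexp _) (hT.memLp_exp hw' ψ) (measurable_cexp _), e]
  rw [e]
  exact hT.memLp_exp hadd ψ

theorem IsBoundedBelowBy.inner_evolution (hT : IsBoundedBelowBy T a) (hw : w.im ≤ 0) (ψ φ : H) :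
    ⟪evolution T (-star w) ψ, φ⟫_ℂ = ⟪ψ, evolution T w φ⟫_ℂ := by
  have hw' : (-star w).im ≤ 0 := by simpa using hw
  rw [hT.evolution_apply hw, hT.evolution_apply hw', inner_fn (measurable_cexp _)
    (hT.memLp_exp hw' ψ) (hT.memLp_exp hw' φ)]
  congr 2
  ext x
  rw [← starRingEnd_apply, ← Complex.exp_conj]
  simp

theorem IsBoundedBelowBy.mem_opExp_domain (hT : IsBoundedBelowBy T a) (hw : w.im ≤ 0) (ψ : H) :
    ψ ∈ (opExp T (-w)).domain := hT.memLp_exp hw ψ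

theorem IsBoundedBelowBy.opApply_opExp (hT : IsBoundedBelowBy T a) (hw : w.im ≤ 0) (ψ : H) :
    opApply (opExp T (-w)) ψ = evolution T w ψ := by
  rw [hT.evolution_apply hw, fn_eq_opApply (measurable_cexp _)]
  rfl

end Evolution

/-! ### Relatively bounded perturbations and ground states -/

section FormalAdjoint

variable {H : Type*} [NormedAddCommGroup H] [InnerProductSpace ℂ H] {H₀ H₁ : H →ₗ.[ℂ] H}

theorem isFormalAdjoint_add (h : H₀.IsFormalAdjoint H₀) (h' : H₁.IsFormalAdjoint H₁) :
    (H₀ + H₁).IsFormalAdjoint (H₀ + H₁) := by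
  rintro ⟨ψ, h1, h2⟩ ⟨φ, h3, h4⟩
  rw [LinearPMap.add_apply, LinearPMap.add_apply]
  simp only [inner_add_left, inner_add_right]
  exact congrArg₂ _ (h ⟨ψ, h1⟩ ⟨φ, h3⟩) (h' ⟨ψ, h2⟩ ⟨φ, h4⟩)

end FormalAdjoint

section KatoRellich

variable {H : Type*} [NormedAddCommGroup H] [InnerProductSpace ℂ H] [CompleteSpace H]

open ProjValuedMeasure

variable {H₀ H₁ T : H →ₗ.[ℂ] H} {a : ℝ} {ψ φ : H}

theorem mem_opSqrt_domain :
    ψ ∈ (opSqrt H₀).domain ↔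
      MemLp (fun x : ℝ => ((√x : ℝ) : ℂ)) 2 ((spectralMeasure H₀).measure ψ) := Iff.rfl

theorem opApply_opSqrt (ψ : H) :
    opApply (opSqrt H₀) ψ = (spectralMeasure H₀).fn (fun x : ℝ => ((√x : ℝ) : ℂ)) ψ :=
  (fn_eq_opApply _).symm

theorem IsBoundedBelowBy.domain_le_opSqrt (h₀ : IsBoundedBelowBy H₀ 0) :
    H₀.domain ≤ (opSqrt H₀).domain := by
  intro ψ hψ
  rw [h₀.spec.mem_domain] at hψ
  rw [mem_opSqrt_domain]
  have h1 : MemLp (fun x : ℝ => (x : ℂ) + 1) 2 ((spectralMeasure H₀).measure ψ) :=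
    hψ.add (memLp_const (1 : ℂ))
  refine h1.of_le (by fun_prop) ?_
  filter_upwards [h₀.ae_ge ψ] with x hx
  rw [Complex.norm_real, Real.norm_of_nonneg (Real.sqrt_nonneg _),
    show ((x : ℂ) + 1) = ((x + 1 : ℝ) : ℂ) by push_cast; ring, Complex.norm_real,
    Real.norm_of_nonneg (by linarith)]
  nlinarith [Real.sq_sqrt hx, Real.sqrt_nonneg x, sq_nonneg (√x - 1)]

/-- A perturbation that is bounded relative to `H₀^{1/2}` has `H₀`-bound `0`; the resolvent of
`H₀ + H₁` at `-κ` is `(H₀ + κ)⁻¹ (1 + H₁ (H₀ + κ)⁻¹)⁻¹` for large `κ`. -/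
theorem exists_inResolventSet_add (h₀ : IsBoundedBelowBy H₀ 0) (h₁ : RelBounded H₁ (opSqrt H₀)) :
    ∃ κ₀ : ℝ, 0 < κ₀ ∧ ∀ κ ≥ κ₀, InResolventSet (H₀ + H₁) ((-κ : ℝ) : ℂ) := by
  obtain ⟨hdom, a, c, hac⟩ := h₁
  refine ⟨1 + 4 * a ^ 2 + 4 * |c|, by positivity, fun κ hκ => ?_⟩
  have hκ0 : 0 < κ := lt_of_lt_of_le (by positivity) hκ
  set P := spectralMeasure H₀ with hP
  let r : ℝ → ℂ := fun x => ((x + κ)⁻¹ : ℝ)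
  have hr : Measurable r := by fun_prop
  have hrb : ∀ ψ, ∀ᵐ x ∂P.measure ψ, ‖r x‖ ≤ κ⁻¹ := fun ψ => by
    filter_upwards [h₀.ae_ge ψ] with x hx
    simp only [r]
    rw [Complex.norm_real, Real.norm_of_nonneg (inv_nonneg.mpr (by linarith))]
    exact inv_anti₀ hκ0 (by linarith)
  -- `R = (H₀ + κ)⁻¹`
  let R := P.clm r hr (inv_nonneg.mpr hκ0.le) hrb
  have hRfn : ∀ φ, R φ = P.fn r φ := fun φ => rfl
  have hmr : ∀ φ, MemLp r 2 (P.measure φ) := fun φ => memLp_of_ae_bounded hr (hrb φ)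
  have hx : Measurable fun x : ℝ => (x : ℂ) := Complex.measurable_ofReal
  have hxr : ∀ φ, MemLp ((fun x : ℝ => (x : ℂ)) * r) 2 (P.measure φ) := fun φ =>
    memLp_of_ae_bounded (C := 1) (hx.mul hr) (by
      filter_upwards [h₀.ae_ge φ] with x hx
      simp only [Pi.mul_apply, r, norm_mul, Complex.norm_real]
      rw [Real.norm_of_nonneg hx, Real.norm_of_nonneg (inv_nonneg.mpr (by linarith)),
        ← div_eq_mul_inv, div_le_one (by linarith)]
      linarith)
  have hRdom : ∀ φ, R φ ∈ H₀.domain := fun φ => by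
    rw [h₀.spec.mem_domain, hRfn, memLp_measure_fn hr (hmr φ) hx]
    exact hxr φ
  have hRH : ∀ φ, opApply H₀ (R φ) + (κ : ℂ) • R φ = φ := fun φ => by
    have h1 : P.fn ((fun x : ℝ => (x : ℂ)) * r + (κ : ℂ) • r) φ = φ := by
      have h2 : P.fn (fun _ => 1) φ = P.fn ((fun x : ℝ => (x : ℂ)) * r + (κ : ℂ) • r) φ := by
        refine fn_congr_ae measurable_const ((hx.mul hr).add (hr.const_smul _))
          (memLp_const (1 : ℂ)) ?_
        filter_upwards [h₀.ae_ge φ] with x hx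
        have : ((x + κ : ℝ) : ℂ) ≠ 0 := by
          rw [Complex.ofReal_ne_zero]; linarith
        simp only [Pi.add_apply, Pi.mul_apply, Pi.smul_apply, smul_eq_mul, r]
        rw [← add_mul, Complex.ofReal_inv, ← Complex.ofReal_add, mul_inv_cancel₀ this]
      rw [← h2, fn_one]
    rw [h₀.spec.opApply_eq, ← hP, hRfn, fn_fn hr (hmr φ) hx (hxr φ), ← fn_smul _ hr (hmr φ),
      ← fn_add (hx.mul hr) (hr.const_smul _) (hxr φ) ((hmr φ).const_smul _), h1]
  have hRinv : ∀ ψ ∈ H₀.domain, R (opApply H₀ ψ + (κ : ℂ) • ψ) = ψ := fun ψ hψ => by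
    rw [h₀.spec.mem_domain] at hψ
    have h0 := fn_ofReal_sub hψ (-(κ : ℂ))
    rw [neg_smul, sub_neg_eq_add] at h0
    have hm : MemLp (fun x : ℝ => (x : ℂ) - -(κ : ℂ)) 2 (P.measure ψ) :=
      hψ.sub (memLp_const (-(κ : ℂ)))
    have he : (r * fun x : ℝ => (x : ℂ) - -(κ : ℂ)) =ᵐ[P.measure ψ] fun _ => (1 : ℂ) := by
      filter_upwards [h₀.ae_ge ψ] with x hx
      have : ((x + κ : ℝ) : ℂ) ≠ 0 := by
        rw [Complex.ofReal_ne_zero]; linarith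
      simp only [Pi.mul_apply, r]
      rw [sub_neg_eq_add, Complex.ofReal_inv, ← Complex.ofReal_add, inv_mul_cancel₀ this]
    have hm1 := (memLp_const (1 : ℂ)).ae_eq he.symm (p := 2)
    rw [h₀.spec.opApply_eq, ← h0, hRfn, fn_fn (by fun_prop) hm hr hm1,
      fn_congr_ae (hr.mul (by fun_prop)) measurable_const hm1 he, fn_one]
  have hR1 : ∀ φ, R φ ∈ H₁.domain := fun φ => hdom (h₀.domain_le_opSqrt (hRdom φ))
  -- `‖H₀^{1/2} R‖ ≤ (2 √κ)⁻¹` and `‖R‖ ≤ κ⁻¹`, which makes `B = H₁ R` small for large `κ`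
  have hBb : ∀ φ, ‖opApply H₁ (R φ)‖ ≤ 1 / 2 * ‖φ‖ := fun φ => by
    have h1 := hac (R φ) (h₀.domain_le_opSqrt (hRdom φ))
    have hs : Measurable fun x : ℝ => ((√x : ℝ) : ℂ) := by fun_prop
    have hsκ : 0 < √κ := Real.sqrt_pos.mpr hκ0
    have hsb : ∀ᵐ x ∂P.measure φ, ‖((fun x : ℝ => ((√x : ℝ) : ℂ)) * r) x‖ ≤ (2 * √κ)⁻¹ := by
      filter_upwards [h₀.ae_ge φ] with x hx
      simp only [Pi.mul_apply, r, norm_mul, Complex.norm_real]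
      rw [Real.norm_of_nonneg (Real.sqrt_nonneg _),
        Real.norm_of_nonneg (inv_nonneg.mpr (by linarith)), ← div_eq_mul_inv,
        div_le_iff₀ (by linarith), inv_mul_eq_div, le_div_iff₀ (by positivity)]
      nlinarith [Real.sq_sqrt hx, Real.sq_sqrt hκ0.le, sq_nonneg (√x - √κ)]
    have h2 : ‖opApply (opSqrt H₀) (R φ)‖ ≤ (2 * √κ)⁻¹ * ‖φ‖ := by
      rw [opApply_opSqrt, hRfn, ← hP, fn_fn hr (hmr φ) hs
        (memLp_of_ae_bounded (hs.mul hr) hsb)]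
      exact norm_fn_le_ae (hs.mul hr) (by positivity) hsb
    have h3 : ‖R φ‖ ≤ κ⁻¹ * ‖φ‖ := norm_fn_le_ae hr (by positivity) (hrb φ)
    have h4 : |a| * (2 * √κ)⁻¹ ≤ 1 / 4 := by
      rw [← div_eq_mul_inv, div_le_iff₀ (by positivity)]
      have : |2 * a| ≤ √κ := by
        apply Real.abs_le_sqrt
        nlinarith [abs_nonneg c]
      rw [abs_mul, abs_two] at this
      linarith
    have h5 : |c| * κ⁻¹ ≤ 1 / 4 := by
      rw [← div_eq_mul_inv, div_le_iff₀ hκ0]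
      nlinarith [sq_nonneg a]
    calc _ ≤ _ := h1
      _ ≤ |a| * ((2 * √κ)⁻¹ * ‖φ‖) + |c| * (κ⁻¹ * ‖φ‖) := by
        gcongr <;> exact le_abs_self _
      _ ≤ 1 / 4 * ‖φ‖ + 1 / 4 * ‖φ‖ := by
        rw [← mul_assoc, ← mul_assoc]
        gcongr
      _ = _ := by ring
  let B : H →L[ℂ] H := LinearMap.mkContinuous
    { toFun := fun φ => opApply H₁ (R φ)
      map_add' := fun φ χ => by rw [map_add, opApply_add (hR1 _) (hR1 _)]
      map_smul' := fun c φ => by rw [map_smul, opApply_smul _ (hR1 _)]; rfl } (1 / 2) hBb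
  have hB : ∀ φ, B φ = opApply H₁ (R φ) := fun φ => rfl
  have hBn : ‖-B‖ < 1 := by
    rw [norm_neg]
    exact lt_of_le_of_lt (ContinuousLinearMap.opNorm_le_bound _ (by norm_num) hBb) (by norm_num)
  -- `S = (1 + B)⁻¹`, by the Neumann series
  let u := Units.oneSub (-B) hBn
  have hu : (u : H →L[ℂ] H) = 1 + B := by simp [u]
  let S : H →L[ℂ] H := ((u⁻¹ : (H →L[ℂ] H)ˣ) : H →L[ℂ] H)
  have hS1 : ∀ φ, S φ + B (S φ) = φ := fun φ => by
    have : (u : H →L[ℂ] H) * S = 1 := u.mul_inv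
    rw [hu] at this
    have := DFunLike.congr_fun this φ
    simpa [add_mul] using this
  have hS2 : ∀ φ, S (φ + B φ) = φ := fun φ => by
    have : S * (u : H →L[ℂ] H) = 1 := u.inv_mul
    rw [hu] at this
    have := DFunLike.congr_fun this φ
    simpa [mul_add] using this
  refine ⟨R * S, fun φ => ?_, fun ψ => ?_⟩
  · refine ⟨⟨hRdom _, hR1 _⟩, ?_⟩
    rw [LinearPMap.add_apply]
    simp only [mul_apply_eq_comp]
    rw [← opApply_of_mem (hRdom _), ← opApply_of_mem (hR1 _), ← hB]
    have h1 := hRH (S φ)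
    have h2 := hS1 φ
    rw [Complex.ofReal_neg, neg_smul, sub_neg_eq_add]
    nth_rewrite 4 [← h2]
    nth_rewrite 4 [← h1]
    abel
  · obtain ⟨ψ, h1, h2⟩ := ψ
    rw [LinearPMap.add_apply]
    simp only [mul_apply_eq_comp]
    rw [← opApply_of_mem h1, ← opApply_of_mem h2, Complex.ofReal_neg, neg_smul, sub_neg_eq_add]
    have h3 := hRinv ψ h1
    set χ := opApply H₀ ψ + (κ : ℂ) • ψ with hχ
    have h4 : opApply H₀ ψ + opApply H₁ ψ + (κ : ℂ) • ψ = χ + B χ := by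
      rw [hB, h3, hχ]
      abel
    rw [h4, hS2, h3]

/-- An operator with a spectral measure whose real spectrum is bounded below is bounded below by its
ground energy. -/
theorem isBoundedBelowBy_groundEnergy (hT : IsSpectralMeasure (spectralMeasure T) T) {κ₀ : ℝ}
    (h : ∀ κ ≥ κ₀, InResolventSet T ((-κ : ℝ) : ℂ)) : IsBoundedBelowBy T (groundEnergy T) := by
  refine ⟨hT, hT.ae_ge fun x hx => ?_⟩
  have hb : BddBelow {x : ℝ | (x : ℂ) ∈ opSpectrum T} := by
    refine ⟨-κ₀, fun y hy => ?_⟩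
    by_contra hlt
    push Not at hlt
    refine hy ?_
    have := h (-y) (by linarith)
    rwa [neg_neg] at this
  have := notMem_of_lt_csInf hx hb
  simpa [opSpectrum] using this

/-- The spectral projection of the ground energy is the projection onto the ground state. -/
theorem proj_groundEnergy (hT : IsSpectralMeasure (spectralMeasure T) T) {Ω : H}
    (hΩ : IsUniqueGroundState T Ω) (ψ : H) :
    (spectralMeasure T).proj {groundEnergy T} ψ = ⟪Ω, ψ⟫_ℂ • Ω := by
  obtain ⟨hn, he, hd⟩ := hΩ
  set E := groundEnergy T
  set P := spectralMeasure T
  have hmE : MeasurableSet ({E} : Set ℝ) := measurableSet_singleton E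
  have hPΩ : P.proj {E} Ω = Ω := by
    obtain ⟨h1, h2⟩ := mem_opEigenspace.mp he
    rw [← opApply_of_mem h1, hT.opApply_eq] at h2
    have h3 := hT.mem_domain.mp h1
    have h4 := fn_ofReal_sub h3 (E : ℂ)
    rw [h2, sub_self] at h4
    have hm : MemLp (fun x : ℝ => (x : ℂ) - (E : ℂ)) 2 (P.measure Ω) :=
      h3.sub (memLp_const (E : ℂ))
    have h5 := norm_sq_fn (P := P) (by fun_prop) hm
    rw [h4] at h5
    simp only [norm_zero, ne_eq, OfNat.ofNat_ne_zero, not_false_eq_true, zero_pow] at h5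
    rw [eq_comm, integral_eq_zero_iff_of_nonneg (fun x => by positivity)
      ((memLp_two_iff_integrable_sq_norm hm.1).mp hm)] at h5
    refine proj_eq_of_ae_mem hmE ?_
    filter_upwards [h5] with x hx
    simp only [Pi.zero_apply, ne_eq, OfNat.ofNat_ne_zero, not_false_eq_true, pow_eq_zero_iff,
      norm_eq_zero, sub_eq_zero] at hx
    exact_mod_cast hx
  have hmem : P.proj {E} ψ ∈ opEigenspace T (E : ℂ) := by
    set χ := P.proj {E} ψ
    have hae : ∀ᵐ y ∂P.measure χ, y ∈ ({E} : Set ℝ) := ae_mem_of_proj_eq hmE (proj_idem hmE ψ)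
    have hdom : χ ∈ T.domain := hT.mem_domain_of_ae (C := |E|) (by
      filter_upwards [hae] with y hy
      rw [Set.mem_singleton_iff.mp hy])
    refine mem_opEigenspace.mpr ⟨hdom, ?_⟩
    rw [← opApply_of_mem hdom, hT.opApply_eq, ← sub_eq_zero,
      ← fn_ofReal_sub (hT.mem_domain.mp hdom), ← norm_eq_zero]
    refine le_antisymm ?_ (norm_nonneg _)
    have := norm_fn_le_ae (P := P) (ψ := χ) (f := fun y : ℝ => (y : ℂ) - (E : ℂ)) (by fun_prop)
      le_rfl (by
        filter_upwards [hae] with y hy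
        rw [Set.mem_singleton_iff.mp hy]
        simp)
    simpa using this
  have hΩ0 : (⟨Ω, he⟩ : opEigenspace T (E : ℂ)) ≠ 0 := by
    intro h0
    have : Ω = 0 := congrArg Subtype.val h0
    rw [this, norm_zero] at hn
    exact zero_ne_one hn
  obtain ⟨c, hc⟩ := (finrank_eq_one_iff_of_nonzero' _ hΩ0).mp hd ⟨_, hmem⟩
  have hc' : c • Ω = P.proj {E} ψ := congrArg Subtype.val hc
  have h1 : ⟪Ω, P.proj {E} ψ⟫_ℂ = ⟪Ω, ψ⟫_ℂ := by
    rw [← proj_inner_symm hmE, hPΩ]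
  rw [← hc', inner_smul_right, inner_self_eq_norm_sq_to_K, hn] at h1
  rw [← hc', ← h1]
  simp

/-- `e^{-iw(T - E)}` converges strongly to the projection onto the ground state as `Im w → -∞`. -/
theorem tendsto_evolution {Ω : H} (hT : IsBoundedBelowBy T (groundEnergy T))
    (hΩ : IsUniqueGroundState T Ω) {w : ℝ → ℂ} (hw : Tendsto (fun t => (w t).im) atTop atBot)
    (ψ : H) :
    Tendsto (fun t => Complex.exp (Complex.I * w t * groundEnergy T) • evolution T (w t) ψ) atTop
      (𝓝 (⟪Ω, ψ⟫_ℂ • Ω)) := by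
  rw [← proj_groundEnergy hT.spec hΩ, proj_eq_fn (measurableSet_singleton _)]
  set E := groundEnergy T
  set P := spectralMeasure T
  have hexp : ∀ t (x : ℝ), Complex.exp (Complex.I * w t * E) * Complex.exp (Complex.I * -(w t) * x) =
      Complex.exp (Complex.I * -(w t) * ((x - E : ℝ) : ℂ)) := fun t x => by
    rw [← Complex.exp_add]
    push_cast
    ring_nf
  have h1 : Tendsto (fun t => P.fn (fun x => Complex.exp (Complex.I * w t * E) *
      Complex.exp (Complex.I * -(w t) * x)) ψ) atTop
      (𝓝 (P.fn (({E} : Set ℝ).indicator fun _ => 1) ψ)) := by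
    refine tendsto_fn_of_dominated (b := fun _ => 1) (fun t => by fun_prop)
      (measurable_const.indicator (measurableSet_singleton _)) (memLp_const (1 : ℂ))
      (Eventually.of_forall fun x => ?_) ?_ ?_
    · by_cases hx : x = E <;> simp [hx]
    · filter_upwards [hw.eventually_le_atBot 0] with t ht
      filter_upwards [hT.ae_ge ψ] with x hx
      rw [hexp, norm_exp_I_mul, norm_one, Real.exp_le_one_iff]
      exact mul_nonpos_of_nonpos_of_nonneg ht (by linarith)
    · filter_upwards [hT.ae_ge ψ] with x hx
      simp only [hexp]
      rcases hx.eq_or_lt with h | h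
      · rw [← h]
        simp
      · rw [Set.indicator_of_notMem (by simpa using h.ne'), tendsto_zero_iff_norm_tendsto_zero]
        simp only [norm_exp_I_mul]
        exact Real.tendsto_exp_atBot.comp (hw.atBot_mul_const (by linarith))
  refine h1.congr' ?_
  filter_upwards [hw.eventually_le_atBot 0] with t ht
  rw [hT.evolution_apply ht, ← fn_smul _ (measurable_cexp _) (hT.memLp_exp ht ψ)]
  rfl

end KatoRellich

/-! ### The Dyson coefficients in a Banach algebra -/

section WordSum

variable {R : Type*} [Ring R]

/-- The sum of all words of length `N` in the letters `a` and `b` with exactly `p` letters `b`, that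
is, the coefficient of `λᵖ` in `(a + λ b)ᴺ`. -/
def wordSum (a b : R) : ℕ → ℕ → R
  | 0, 0 => 1
  | 0, _ + 1 => 0
  | N + 1, 0 => a * wordSum a b N 0
  | N + 1, p + 1 => a * wordSum a b N (p + 1) + b * wordSum a b N p

end WordSum

section ExpSeries

variable {F : Type*} [NormedAddCommGroup F] [NormedSpace ℂ F]

theorem norm_expSeries_term (c : ℂ) (N : ℕ) (x : F) :
    ‖(c ^ N / N.factorial : ℂ) • x‖ = ‖c‖ ^ N / N.factorial * ‖x‖ := by
  rw [norm_smul, norm_div, norm_pow, Complex.norm_natCast]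

theorem summable_expSeries {s : ℕ → F} {C r : ℝ} (hs : ∀ N, ‖s N‖ ≤ C * r ^ N) (c : ℂ) :
    Summable fun N => ‖(c ^ N / N.factorial : ℂ) • s N‖ := by
  have h := (Real.summable_pow_div_factorial (‖c‖ * r)).mul_left C
  refine Summable.of_nonneg_of_le (fun _ => norm_nonneg _) (fun N => ?_) h
  rw [norm_expSeries_term, mul_pow]
  calc _ ≤ ‖c‖ ^ N / N.factorial * (C * r ^ N) := by gcongr; exact hs N
    _ = _ := by ring

/-- The derivative of the exponential series of a sequence is the series of the shifted sequence. -/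
theorem hasDerivAt_expSeries [CompleteSpace F] {s : ℕ → F} {C r : ℝ} (hr : 0 ≤ r)
    (hs : ∀ N, ‖s N‖ ≤ C * r ^ N) (c w : ℂ) :
    HasDerivAt (fun w : ℂ => ∑' N : ℕ, ((c * w) ^ N / N.factorial : ℂ) • s N)
      (c • ∑' N : ℕ, ((c * w) ^ N / N.factorial : ℂ) • s (N + 1)) w := by
  have hC : 0 ≤ C := by simpa using (norm_nonneg _).trans (hs 0)
  have hs' : ∀ N, ‖s (N + 1)‖ ≤ C * r * r ^ N := fun N => (hs (N + 1)).trans (by rw [pow_succ]; linarith)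
  set ρ : ℝ := ‖w‖ + 1 with hρ
  let g' : ℕ → ℂ → F := fun N w => match N with
    | 0 => 0
    | N + 1 => c • (((c * w) ^ N / N.factorial : ℂ) • s (N + 1))
  let u : ℕ → ℝ := fun N => match N with
    | 0 => 0
    | N + 1 => ‖c‖ * (C * r * ((‖c‖ * ρ * r) ^ N / N.factorial))
  have hu : Summable u := by
    rw [← summable_nat_add_iff 1]
    exact ((Real.summable_pow_div_factorial _).mul_left _).mul_left _
  have hg : ∀ (N : ℕ) (y : ℂ), y ∈ Metric.ball (0 : ℂ) ρ →
      HasDerivAt (fun w : ℂ => ((c * w) ^ N / N.factorial : ℂ) • s N) (g' N y) y := by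
    intro N y _
    cases N with
    | zero => simpa [g'] using hasDerivAt_const y (s 0)
    | succ N =>
      have h1 : HasDerivAt (fun w : ℂ => (c * w) ^ (N + 1) / ((N + 1).factorial : ℂ))
          (c * ((c * y) ^ N / N.factorial)) y := by
        have h2 := (((hasDerivAt_id y).const_mul c).pow (N + 1)).div_const ((N + 1).factorial : ℂ)
        refine h2.congr_deriv ?_
        rw [Nat.factorial_succ]
        have h3 : ((N : ℂ) + 1) ≠ 0 := Nat.cast_add_one_ne_zero N
        have h4 : (N.factorial : ℂ) ≠ 0 := by exact_mod_cast N.factorial_ne_zero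
        push_cast
        field_simp
        simp
      have h5 := h1.smul_const (s (N + 1))
      rwa [mul_smul] at h5
  have hg' : ∀ (N : ℕ) (y : ℂ), y ∈ Metric.ball (0 : ℂ) ρ → ‖g' N y‖ ≤ u N := by
    intro N y hy
    have hy' : ‖y‖ ≤ ρ := (mem_ball_zero_iff.mp hy).le
    cases N with
    | zero => simp [g', u]
    | succ N =>
      simp only [g', u]
      rw [norm_smul, norm_expSeries_term, norm_mul]
      refine mul_le_mul_of_nonneg_left ?_ (norm_nonneg c)
      calc (‖c‖ * ‖y‖) ^ N / N.factorial * ‖s (N + 1)‖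
          ≤ (‖c‖ * ρ) ^ N / N.factorial * (C * r * r ^ N) :=
            mul_le_mul (by gcongr) (hs' N) (norm_nonneg _) (by positivity)
        _ = _ := by rw [mul_pow (‖c‖ * ρ) r]; ring
  have hw : w ∈ Metric.ball (0 : ℂ) ρ := by
    rw [mem_ball_zero_iff]; linarith
  have hsum0 := (summable_expSeries hs (c * w)).of_norm
  have h := hasDerivAt_tsum_of_isPreconnected hu Metric.isOpen_ball
    (convex_ball (0 : ℂ) ρ).isPreconnected hg hg' hw hsum0 hw
  refine h.congr_deriv ?_
  have hsg : Summable fun N => g' N w := (hu.of_norm_bounded fun N => hg' N w hw)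
  rw [hsg.tsum_eq_zero_add]
  simp only [g', zero_add]
  rw [tsum_const_smul'']

end ExpSeries

section DysonCoeff

variable {𝔅 : Type*} [NormedRing 𝔅] [NormedAlgebra ℂ 𝔅] [CompleteSpace 𝔅] (a b : 𝔅)

omit [NormedAlgebra ℂ 𝔅] [CompleteSpace 𝔅] in
theorem norm_wordSum_le (N p : ℕ) :
    ‖wordSum a b N p‖ ≤ ‖(1 : 𝔅)‖ * (‖a‖ + ‖b‖) ^ N := by
  induction N generalizing p with
  | zero => cases p <;> simp [wordSum]
  | succ N ih =>
    cases p with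
    | zero =>
      rw [wordSum, pow_succ]
      calc _ ≤ ‖a‖ * (‖(1 : 𝔅)‖ * (‖a‖ + ‖b‖) ^ N) := (norm_mul_le _ _).trans (by gcongr; exact ih 0)
        _ ≤ (‖a‖ + ‖b‖) * (‖(1 : 𝔅)‖ * (‖a‖ + ‖b‖) ^ N) := by
          gcongr
          linarith [norm_nonneg b]
        _ = _ := by ring
    | succ p =>
      rw [wordSum, pow_succ]
      calc _ ≤ ‖a‖ * (‖(1 : 𝔅)‖ * (‖a‖ + ‖b‖) ^ N) + ‖b‖ * (‖(1 : 𝔅)‖ * (‖a‖ + ‖b‖) ^ N) :=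
            (norm_add_le _ _).trans (add_le_add ((norm_mul_le _ _).trans (by gcongr; exact ih _))
              ((norm_mul_le _ _).trans (by gcongr; exact ih _)))
        _ = _ := by ring

/-- The coefficient of `λᵖ` in `e^{-iw(a + λ b)}`. -/
def dysonCoeff (p : ℕ) (w : ℂ) : 𝔅 :=
  ∑' N : ℕ, ((-Complex.I * w) ^ N / N.factorial : ℂ) • wordSum a b N p

theorem summable_dysonCoeff (p : ℕ) (w : ℂ) :
    Summable fun N : ℕ => ((-Complex.I * w) ^ N / N.factorial : ℂ) • wordSum a b N p :=
  (summable_expSeries (fun N => norm_wordSum_le a b N p) _).of_norm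

theorem hasDerivAt_dysonCoeff_zero (w : ℂ) :
    HasDerivAt (dysonCoeff a b 0) (-Complex.I • (a * dysonCoeff a b 0 w)) w := by
  refine (hasDerivAt_expSeries (by positivity) (fun N => norm_wordSum_le a b N 0)
    (-Complex.I) w).congr_deriv ?_
  simp only [wordSum]
  rw [dysonCoeff, ← (summable_dysonCoeff a b 0 w).tsum_mul_left]
  simp only [mul_smul_comm]

theorem hasDerivAt_dysonCoeff_succ (p : ℕ) (w : ℂ) :
    HasDerivAt (dysonCoeff a b (p + 1))
      (-Complex.I • (a * dysonCoeff a b (p + 1) w + b * dysonCoeff a b p w)) w := by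
  refine (hasDerivAt_expSeries (by positivity) (fun N => norm_wordSum_le a b N (p + 1))
    (-Complex.I) w).congr_deriv ?_
  simp only [wordSum]
  rw [dysonCoeff, dysonCoeff, ← (summable_dysonCoeff a b (p + 1) w).tsum_mul_left,
    ← (summable_dysonCoeff a b p w).tsum_mul_left, ← Summable.tsum_add
      ((summable_dysonCoeff a b (p + 1) w).mul_left a) ((summable_dysonCoeff a b p w).mul_left b)]
  simp only [mul_smul_comm, smul_add]

omit [CompleteSpace 𝔅] in
theorem dysonCoeff_at_zero (p : ℕ) : dysonCoeff a b p 0 = if p = 0 then 1 else 0 := by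
  rw [dysonCoeff, tsum_eq_single 0 (fun N hN => by simp [hN])]
  cases p <;> simp [wordSum]

/-- The group `e^{iza}`. -/
def expI (z : ℂ) : 𝔅 := NormedSpace.exp (z • (Complex.I • a))

theorem hasDerivAt_expI (z : ℂ) : HasDerivAt (expI a) (expI a z * (Complex.I • a)) z :=
  hasDerivAt_exp_smul_const (𝕂 := ℂ) (Complex.I • a) z

theorem expI_add (z z' : ℂ) : expI a (z + z') = expI a z * expI a z' := by
  have hc : Commute (z • (Complex.I • a)) (z' • (Complex.I • a)) :=
    ((Commute.refl (Complex.I • a)).smul_left z).smul_right z'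
  rw [expI, add_smul, NormedSpace.exp_add_of_commute_of_mem_ball (𝕂 := ℂ) hc]
  · rfl
  all_goals
    rw [NormedSpace.expSeries_radius_eq_top]
    exact edist_lt_top _ _

omit [CompleteSpace 𝔅] in
theorem expI_zero : expI a 0 = 1 := by
  simp [expI]

theorem expI_mul_neg (z : ℂ) : expI a z * expI a (-z) = 1 := by
  rw [← expI_add, add_neg_cancel, expI_zero]

theorem expI_neg_mul (z : ℂ) : expI a (-z) * expI a z = 1 := by
  rw [← expI_add, neg_add_cancel, expI_zero]

variable (γ : ℝ → ℂ)

/-- The coefficient of `λⁿ` in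
`e^{-i(w - z₁)(a + λb)} c₁ e^{-i(z₁ - z₂)(a + λb)} c₂ ⋯ c_m e^{-i(z_m - z₀)(a + λb)} e^{-iz₀a}`,
where `z₀ = γ α` and `zⱼ = γ τⱼ` for the list `[(τ₁, c₁), …, (τ_m, c_m)]`. -/
def chainCoeff (α : ℝ) : List (ℝ × 𝔅) → ℕ → ℂ → 𝔅
  | [], n, w => dysonCoeff a b n (w - γ α) * expI a (-γ α)
  | (τ, c) :: L, n, w => ∑ pq ∈ Finset.HasAntidiagonal.antidiagonal n,
      dysonCoeff a b pq.1 (w - γ τ) * (c * chainCoeff α L pq.2 (γ τ))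

theorem hasDerivAt_chainCoeff_zero (α : ℝ) (L : List (ℝ × 𝔅)) (w : ℂ) :
    HasDerivAt (chainCoeff a b γ α L 0) (-Complex.I • (a * chainCoeff a b γ α L 0 w)) w := by
  cases L with
  | nil =>
    have h := ((hasDerivAt_dysonCoeff_zero a b (w - γ α)).comp_sub_const w (γ α)).mul_const
      (expI a (-γ α))
    refine h.congr_deriv ?_
    simp only [chainCoeff, smul_mul_assoc, mul_assoc]
  | cons x L =>
    obtain ⟨τ, c⟩ := x
    simp only [chainCoeff, Finset.Nat.antidiagonal_zero, Finset.sum_singleton]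
    have h := ((hasDerivAt_dysonCoeff_zero a b (w - γ τ)).comp_sub_const w (γ τ)).mul_const
      (c * chainCoeff a b γ α L 0 (γ τ))
    refine h.congr_deriv ?_
    simp only [smul_mul_assoc, mul_assoc]

/-- The coefficient of `λⁿ⁺¹` in the differential equation `y' = -i (a + λb) y`. -/
theorem hasDerivAt_chainCoeff_succ (α : ℝ) (L : List (ℝ × 𝔅)) (n : ℕ) (w : ℂ) :
    HasDerivAt (chainCoeff a b γ α L (n + 1))
      (-Complex.I • (a * chainCoeff a b γ α L (n + 1) w + b * chainCoeff a b γ α L n w)) w := by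
  cases L with
  | nil =>
    have h := ((hasDerivAt_dysonCoeff_succ a b n (w - γ α)).comp_sub_const w (γ α)).mul_const
      (expI a (-γ α))
    refine h.congr_deriv ?_
    simp only [chainCoeff, smul_mul_assoc, add_mul, mul_assoc]
  | cons x L =>
    obtain ⟨τ, c⟩ := x
    have h : HasDerivAt (fun w => ∑ pq ∈ Finset.HasAntidiagonal.antidiagonal (n + 1),
        dysonCoeff a b pq.1 (w - γ τ) * (c * chainCoeff a b γ α L pq.2 (γ τ)))
        (∑ pq ∈ Finset.HasAntidiagonal.antidiagonal (n + 1), (-Complex.I • (a * dysonCoeff a b pq.1 (w - γ τ) +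
          if pq.1 = 0 then 0 else b * dysonCoeff a b (pq.1 - 1) (w - γ τ))) *
            (c * chainCoeff a b γ α L pq.2 (γ τ))) w := by
      refine HasDerivAt.fun_sum fun pq _ => HasDerivAt.mul_const ?_ _
      obtain ⟨p, q⟩ := pq
      cases p with
      | zero => simpa using (hasDerivAt_dysonCoeff_zero a b (w - γ τ)).comp_sub_const w (γ τ)
      | succ p => simpa using (hasDerivAt_dysonCoeff_succ a b p (w - γ τ)).comp_sub_const w (γ τ)
    refine HasDerivAt.congr_deriv (f := chainCoeff a b γ α ((τ, c) :: L) (n + 1)) h ?_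
    simp only [smul_mul_assoc, add_mul, ← Finset.smul_sum, Finset.sum_add_distrib, mul_assoc]
    congr 2
    · simp only [chainCoeff, Finset.mul_sum]
    · rw [Finset.Nat.sum_antidiagonal_succ]
      simp only [chainCoeff, Finset.mul_sum, Nat.add_sub_cancel, Nat.add_eq_zero_iff, one_ne_zero,
        and_false, if_false, if_true, zero_mul, zero_add, mul_assoc]

omit [CompleteSpace 𝔅] in
/-- At the latest fixed time, the latest evolution factor is the identity. -/
theorem chainCoeff_cons_at (α : ℝ) (τ : ℝ) (c : 𝔅) (L : List (ℝ × 𝔅)) (n : ℕ) :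
    chainCoeff a b γ α ((τ, c) :: L) n (γ τ) = c * chainCoeff a b γ α L n (γ τ) := by
  rw [chainCoeff, Finset.sum_eq_single_of_mem (0, n) (by simp)]
  · simp [dysonCoeff_at_zero]
  · rintro ⟨p, q⟩ hpq hne
    have hp : p ≠ 0 := by
      rintro rfl
      simp only [Finset.HasAntidiagonal.mem_antidiagonal, zero_add] at hpq
      exact hne (by rw [hpq])
    simp [dysonCoeff_at_zero, hp]

theorem hasDerivAt_expI_mul_chainCoeff_zero (α : ℝ) (L : List (ℝ × 𝔅)) (w : ℂ) :
    HasDerivAt (fun w => expI a w * chainCoeff a b γ α L 0 w) 0 w := by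
  refine ((hasDerivAt_expI a w).mul (hasDerivAt_chainCoeff_zero a b γ α L w)).congr_deriv ?_
  simp only [smul_mul_assoc, mul_smul_comm, neg_smul, mul_neg, mul_assoc]
  abel

/-- The equation of motion in the interaction picture: conjugation with `e^{iwa}` removes the term with
`a` from the differential equation. -/
theorem hasDerivAt_expI_mul_chainCoeff_succ (α : ℝ) (L : List (ℝ × 𝔅)) (n : ℕ) (w : ℂ) :
    HasDerivAt (fun w => expI a w * chainCoeff a b γ α L (n + 1) w)
      ((-Complex.I • (expI a w * b * expI a (-w))) * (expI a w * chainCoeff a b γ α L n w)) w := by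
  refine ((hasDerivAt_expI a w).mul
    (hasDerivAt_chainCoeff_succ a b γ α L n w)).congr_deriv ?_
  have h : expI a w * b * expI a (-w) * (expI a w * chainCoeff a b γ α L n w) =
      expI a w * (b * chainCoeff a b γ α L n w) := by
    rw [mul_assoc (expI a w * b), ← mul_assoc (expI a (-w)), expI_neg_mul, one_mul, mul_assoc]
  rw [smul_mul_assoc, h]
  simp only [smul_mul_assoc, mul_smul_comm, neg_smul, mul_neg, mul_assoc, mul_add, smul_add]
  abel

end DysonCoeff

/-! ### Ordered products and their integrals over cubes -/

section OrdProd

variable {M : Type*} [Monoid M]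

/-- The product of the values `op x`, `x ∈ s`, with the larger `x` to the left. -/
def ordProd (op : ℝ → M) (s : Finset ℝ) : M := ((s.sort (· ≥ ·)).map op).prod

theorem ordProd_empty (op : ℝ → M) : ordProd op ∅ = 1 := by simp [ordProd]

theorem ordProd_insert (op : ℝ → M) {s : Finset ℝ} {u : ℝ} (h : ∀ x ∈ s, x < u) :
    ordProd op (insert u s) = op u * ordProd op s := by
  rw [ordProd, Finset.sort_insert (r := (· ≥ ·)) (fun x hx => (h x hx).le)
    (fun hu => lt_irrefl u (h u hu))]
  simp [ordProd]

theorem exists_strictAnti_comp {N : ℕ} {x : Fin N → ℝ} (hx : Function.Injective x) :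
    ∃ σ : Equiv.Perm (Fin N), StrictAnti (x ∘ σ) := by
  refine ⟨Tuple.sort (OrderDual.toDual ∘ x), ?_⟩
  have h : Antitone (x ∘ Tuple.sort (OrderDual.toDual ∘ x)) := fun i j hij =>
    Tuple.monotone_sort (OrderDual.toDual ∘ x) hij
  exact h.strictAnti_of_injective (hx.comp (Equiv.injective _))

theorem sort_image_eq_ofFn {N : ℕ} {x : Fin N → ℝ} {σ : Equiv.Perm (Fin N)}
    (h : StrictAnti (x ∘ σ)) :
    (Finset.univ.image x).sort (· ≥ ·) = List.ofFn (x ∘ σ) := by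
  have h1 : (List.ofFn (x ∘ σ)).toFinset = Finset.univ.image x := by
    ext y
    simp only [List.mem_toFinset, List.mem_ofFn, Finset.mem_image, Finset.mem_univ, true_and,
      Function.comp_apply]
    constructor
    · rintro ⟨i, hi⟩
      exact ⟨σ i, hi⟩
    · rintro ⟨i, hi⟩
      exact ⟨σ.symm i, by simpa using hi⟩
  rw [← h1]
  exact (List.toFinset_sort (r := (· ≥ ·)) (List.nodup_ofFn.mpr h.injective)).mpr
    (List.pairwise_ofFn.mpr fun i j hij => (h hij).le)

/-- The ordered product of distinct points as a sum over permutations, all of whose terms but one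
vanish. -/
theorem sum_perm_eq_of_strictAnti {V : Type*} [AddCommMonoid V] {N : ℕ} {x : Fin N → ℝ}
    (hx : Function.Injective x) (g : List ℝ → V) :
    ∑ σ : Equiv.Perm (Fin N), (open Classical in
      if StrictAnti (x ∘ σ) then g (List.ofFn (x ∘ σ)) else 0) =
      g ((Finset.univ.image x).sort (· ≥ ·)) := by
  classical
  obtain ⟨σ₀, h₀⟩ := exists_strictAnti_comp hx
  rw [Finset.sum_eq_single σ₀]
  · rw [if_pos h₀, sort_image_eq_ofFn h₀]
  · intro σ _ hσ
    refine if_neg fun h => hσ ?_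
    have h1 := (sort_image_eq_ofFn h).symm.trans (sort_image_eq_ofFn h₀)
    have h2 := List.ofFn_injective h1
    ext i
    exact congrArg Fin.val (hx (congrFun h2 i))
  · simp

end OrdProd

theorem ae_injective_pi (n : ℕ) : ∀ᵐ t : Fin n → ℝ, Function.Injective t := by
  have h : ∀ i j : Fin n, i ≠ j → ∀ᵐ t : Fin n → ℝ, t i ≠ t j := by
    intro i j hij
    let V : Submodule ℝ (Fin n → ℝ) :=
      LinearMap.ker ((LinearMap.proj i : (Fin n → ℝ) →ₗ[ℝ] ℝ) - LinearMap.proj j)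
    have hV : V ≠ ⊤ := by
      intro hV
      have h1 : Pi.single i (1 : ℝ) ∈ V := by rw [hV]; trivial
      simp [V, LinearMap.mem_ker, hij.symm] at h1
    have h2 := Measure.addHaar_submodule (volume : Measure (Fin n → ℝ)) V hV
    rw [ae_iff]
    convert h2 using 2
    ext t
    simp [V, LinearMap.mem_ker, sub_eq_zero]
  have h' : ∀ᵐ t : Fin n → ℝ, ∀ i j : Fin n, i ≠ j → t i ≠ t j := by
    rw [ae_all_iff]; intro i
    rw [ae_all_iff]; intro j
    by_cases hij : i = j
    · simp [hij]
    · filter_upwards [h i j hij] with t ht _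
      exact ht
  filter_upwards [h'] with t ht i j hij
  by_contra hne
  exact ht i j hne hij

theorem ae_injective_append {k : ℕ} {τ : Fin k → ℝ} (hτ : Function.Injective τ) (n : ℕ) :
    ∀ᵐ t : Fin n → ℝ, Function.Injective (Fin.append τ t) := by
  have h' : ∀ᵐ t : Fin n → ℝ, ∀ (j : Fin k) (i : Fin n), t i ≠ τ j := by
    rw [ae_all_iff]; intro j
    rw [ae_all_iff]; intro i
    exact Measure.ae_eval_ne (fun _ : Fin n => (volume : Measure ℝ)) i (τ j)
  filter_upwards [ae_injective_pi n, h'] with t h1 h2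
  rw [Fin.append_injective_iff]
  exact ⟨hτ, h1, fun i j => (h2 i j).symm⟩

theorem image_append {k n : ℕ} (τ : Fin k → ℝ) (t : Fin n → ℝ) :
    Finset.univ.image (Fin.append τ t) = Finset.univ.image t ∪ Finset.univ.image τ := by
  ext y
  simp only [Finset.mem_image, Finset.mem_univ, true_and, Finset.mem_union]
  constructor
  · rintro ⟨i, rfl⟩
    refine Fin.addCases (fun i => ?_) (fun i => ?_) i
    · exact Or.inr ⟨i, by simp⟩
    · exact Or.inl ⟨i, by simp⟩
  · rintro (⟨i, rfl⟩ | ⟨i, rfl⟩)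
    · exact ⟨Fin.natAdd k i, by simp⟩
    · exact ⟨Fin.castAdd n i, by simp⟩

section Cube

variable {𝔅 : Type*} [NormedRing 𝔅] [NormedAlgebra ℂ 𝔅] {op : ℝ → 𝔅} {C : ℝ}

omit [NormedAlgebra ℂ 𝔅] in
theorem stronglyMeasurable_list_prod {X : Type*} [MeasurableSpace X] {L : List (X → 𝔅)}
    (hL : ∀ f ∈ L, StronglyMeasurable f) : StronglyMeasurable fun x => (L.map fun f => f x).prod := by
  induction L with
  | nil => simpa using stronglyMeasurable_const
  | cons f L ih =>
    simp only [List.map_cons, List.prod_cons]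
    exact (hL f (by simp)).mul (ih fun g hg => hL g (by simp [hg]))

omit [NormedAlgebra ℂ 𝔅] in
theorem aestronglyMeasurable_ordProd (hop : StronglyMeasurable op) (s : Finset ℝ) (n : ℕ) :
    AEStronglyMeasurable (fun t : Fin n → ℝ => ordProd op (Finset.univ.image t ∪ s)) := by
  classical
  let τ : Fin s.card → ℝ := s.orderEmbOfFin rfl
  have hτ : Function.Injective τ := (s.orderEmbOfFin rfl).injective
  have hs : Finset.univ.image τ = s := by
    apply Finset.coe_injective
    simp [τ]
  have hx : ∀ i, Measurable fun t : Fin n → ℝ => Fin.append τ t i := by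
    intro i
    refine Fin.addCases (fun i => ?_) (fun i => ?_) i
    · simp
    · simpa using measurable_pi_apply i
  have hm : StronglyMeasurable fun t : Fin n → ℝ => ∑ σ : Equiv.Perm (Fin (s.card + n)),
      if StrictAnti (Fin.append τ t ∘ σ) then
        ((List.ofFn (Fin.append τ t ∘ σ)).map op).prod else 0 := by
    refine Finset.stronglyMeasurable_fun_sum _ fun σ _ => ?_
    refine StronglyMeasurable.ite ?_ ?_ stronglyMeasurable_const
    · have : {t : Fin n → ℝ | StrictAnti (Fin.append τ t ∘ σ)} =
          ⋂ i, ⋂ j, {t | i < j → Fin.append τ t (σ j) < Fin.append τ t (σ i)} := by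
        ext t
        simp [StrictAnti]
      rw [this]
      refine MeasurableSet.iInter fun i => MeasurableSet.iInter fun j => ?_
      by_cases hij : i < j
      · simpa [hij] using measurableSet_lt (hx (σ j)) (hx (σ i))
      · simp [hij]
    · have h := stronglyMeasurable_list_prod (X := Fin n → ℝ)
        (L := List.ofFn fun i t => op (Fin.append τ t (σ i))) (by
          intro f hf
          obtain ⟨i, rfl⟩ := (List.mem_ofFn' _ _).mp hf
          exact hop.comp_measurable (hx (σ i)))
      convert h using 2
      simp [List.map_ofFn, Function.comp_def]
  refine hm.aestronglyMeasurable.congr ?_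
  filter_upwards [ae_injective_append hτ n] with t ht
  have h := sum_perm_eq_of_strictAnti ht fun L => (L.map op).prod
  rw [image_append, hs] at h
  rw [ordProd, ← h]

omit [NormedAlgebra ℂ 𝔅] in
theorem norm_ordProd_le (hC : ∀ t, ‖op t‖ ≤ C) (h1 : 1 ≤ C) (s : Finset ℝ) {m : ℕ}
    (hm : s.card ≤ m) : ‖ordProd op s‖ ≤ ‖(1 : 𝔅)‖ * C ^ m := by
  have h : ∀ L : List ℝ, ‖(L.map op).prod‖ ≤ ‖(1 : 𝔅)‖ * C ^ L.length := by
    intro L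
    induction L with
    | nil => simp
    | cons x L ih =>
      rw [List.map_cons, List.prod_cons, List.length_cons, pow_succ]
      calc _ ≤ C * (‖(1 : 𝔅)‖ * C ^ L.length) :=
            (norm_mul_le _ _).trans (mul_le_mul (hC x) ih (norm_nonneg _) (by linarith))
        _ = _ := by ring
  refine (h _).trans ?_
  rw [Finset.length_sort]
  gcongr

omit [NormedAlgebra ℂ 𝔅] in
theorem integrableOn_ordProd (hop : StronglyMeasurable op) (hC : ∀ t, ‖op t‖ ≤ C) (s : Finset ℝ)
    (n : ℕ) {B : Set (Fin n → ℝ)} (hB : volume B ≠ ∞) :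
    IntegrableOn (fun t : Fin n → ℝ => ordProd op (Finset.univ.image t ∪ s)) B := by
  refine Measure.integrableOn_of_bounded (M := ‖(1 : 𝔅)‖ * max C 1 ^ (n + s.card)) hB
    (aestronglyMeasurable_ordProd hop s n) (Eventually.of_forall fun t => ?_)
  refine norm_ordProd_le (fun t => (hC t).trans (le_max_left _ _)) (le_max_right _ _) _ ?_
  refine (Finset.card_union_le _ _).trans (Nat.add_le_add_right ?_ _)
  exact Finset.card_image_le.trans (by simp)

/-- The integral over the cube `[α, β]ⁿ` of the ordered product of `n` variable points and the fixed
points of `s`. -/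
def cubeIntegral (op : ℝ → 𝔅) (α : ℝ) (n : ℕ) (s : Finset ℝ) (β : ℝ) : 𝔅 :=
  ∫ t in Set.univ.pi fun _ : Fin n => Set.Icc α β, ordProd op (Finset.univ.image t ∪ s)

theorem cubeIntegral_zero (op : ℝ → 𝔅) (α : ℝ) [CompleteSpace 𝔅] (s : Finset ℝ) (β : ℝ) :
    cubeIntegral op α 0 s β = ordProd op s := by
  have h : (Set.univ.pi fun _ : Fin 0 => Set.Icc α β) = Set.univ := by ext; simp
  have h2 : (volume : Measure (Fin 0 → ℝ)) = Measure.dirac default := by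
    rw [volume_pi, Measure.pi_of_empty (fun _ : Fin 0 => (volume : Measure ℝ)) default]
  rw [cubeIntegral, h, Measure.restrict_univ, h2, integral_dirac]
  simp

theorem cubeIntegral_eq_Ico (op : ℝ → 𝔅) (α : ℝ) (n : ℕ) (s : Finset ℝ) (β : ℝ) :
    cubeIntegral op α n s β =
      ∫ t in Set.univ.pi fun _ : Fin n => Set.Ico α β, ordProd op (Finset.univ.image t ∪ s) := by
  rw [cubeIntegral]
  refine setIntegral_congr_set ?_
  have h := Measure.univ_pi_Ico_ae_eq_Icc (μ := fun _ : Fin n => (volume : Measure ℝ))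
    (f := fun _ => α) (g := fun _ => β)
  rw [Set.pi_univ_Icc]
  exact h.symm

theorem cubeIntegral_succ_self (op : ℝ → 𝔅) (α : ℝ) (n : ℕ) (s : Finset ℝ) :
    cubeIntegral op α (n + 1) s α = 0 := by
  rw [cubeIntegral_eq_Ico]
  simp

theorem integral_const_mul_of_bounded [CompleteSpace 𝔅] {X : Type*} [MeasurableSpace X] {μ : Measure X} (c : 𝔅)
    {f : X → 𝔅} (hf : Integrable f μ) : ∫ x, c * f x ∂μ = c * ∫ x, f x ∂μ :=
  ((ContinuousLinearMap.mul ℝ 𝔅) c).integral_comp_comm hf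

theorem volume_cube_ne_top {n : ℕ} (α β : ℝ) :
    volume (Set.univ.pi fun _ : Fin n => Set.Icc α β) ≠ ∞ := by
  rw [Set.pi_univ_Icc]
  exact isCompact_Icc.measure_ne_top

theorem volume_cube_Ico_ne_top {n : ℕ} (α β : ℝ) :
    volume (Set.univ.pi fun _ : Fin n => Set.Ico α β) ≠ ∞ :=
  measure_ne_top_of_subset (Set.pi_mono fun _ _ => Set.Ico_subset_Icc_self) (volume_cube_ne_top α β)

omit [NormedAlgebra ℂ 𝔅] in
theorem ordProd_image_insert (op : ℝ → 𝔅) {α u : ℝ} {n : ℕ} {t : Fin n → ℝ}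
    (ht : t ∈ Set.univ.pi fun _ : Fin n => Set.Ico α u) {s : Finset ℝ} (hs : ∀ x ∈ s, x < u) :
    ordProd op (insert u (Finset.univ.image t ∪ s)) =
      op u * ordProd op (Finset.univ.image t ∪ s) := by
  refine ordProd_insert op fun x hx => ?_
  rcases Finset.mem_union.mp hx with h | h
  · obtain ⟨i, _, rfl⟩ := Finset.mem_image.mp h
    exact (ht i trivial).2
  · exact hs x h

/-- A fixed point at the upper end of the cube can be pulled out of the ordered product. -/
theorem cubeIntegral_insert [CompleteSpace 𝔅] (hop : StronglyMeasurable op)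
    (hC : ∀ t, ‖op t‖ ≤ C) (α : ℝ) (n : ℕ) {s : Finset ℝ} {u : ℝ} (hs : ∀ x ∈ s, x < u) :
    cubeIntegral op α n (insert u s) u = op u * cubeIntegral op α n s u := by
  rw [cubeIntegral_eq_Ico, cubeIntegral_eq_Ico, ← integral_const_mul_of_bounded _
    (integrableOn_ordProd hop hC s n (volume_cube_Ico_ne_top α u))]
  refine setIntegral_congr_fun (MeasurableSet.univ_pi fun _ => measurableSet_Ico) fun t ht => ?_
  rw [Finset.union_insert, ordProd_image_insert op ht hs]

/-- The part of the cube `[α, β]ⁿ⁺¹` where the `i`-th coordinate is larger than `τ` and than all the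
other coordinates. -/
def maxRegion (α τ β : ℝ) (n : ℕ) (i : Fin (n + 1)) : Set (Fin (n + 1) → ℝ) :=
  {t | t i ∈ Set.Ioc τ β ∧ ∀ j : Fin n, t (i.succAbove j) ∈ Set.Ico α (t i)}

theorem measurableSet_maxRegion (α τ β : ℝ) (n : ℕ) (i : Fin (n + 1)) :
    MeasurableSet (maxRegion α τ β n i) := by
  have h : maxRegion α τ β n i = (fun t => t i) ⁻¹' Set.Ioc τ β ∩
      ⋂ j : Fin n, ({t | α ≤ t (i.succAbove j)} ∩ {t | t (i.succAbove j) < t i}) := by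
    ext t
    simp [maxRegion]
  rw [h]
  refine (measurable_pi_apply i measurableSet_Ioc).inter (MeasurableSet.iInter fun j => ?_)
  exact (measurableSet_le measurable_const (measurable_pi_apply _)).inter
    (measurableSet_lt (measurable_pi_apply _) (measurable_pi_apply _))

theorem maxRegion_subset {α τ β : ℝ} (hα : α ≤ τ) (n : ℕ) (i : Fin (n + 1)) :
    maxRegion α τ β n i ⊆ Set.univ.pi fun _ : Fin (n + 1) => Set.Icc α β := by
  rintro t ⟨h1, h2⟩ j _
  by_cases hj : j = i
  · subst hj
    exact ⟨hα.trans h1.1.le, h1.2⟩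
  · obtain ⟨k, rfl⟩ := Fin.exists_succAbove_eq hj
    exact ⟨(h2 k).1, (h2 k).2.le.trans h1.2⟩

/-- Up to a null set, the cube is divided according to which coordinate is the largest one. -/
theorem cube_ae_eq {α τ β : ℝ} (hα : α ≤ τ) (hβ : τ ≤ β) (n : ℕ) :
    (Set.univ.pi fun _ : Fin (n + 1) => Set.Icc α β) =ᵐ[volume]
      ((Set.univ.pi fun _ : Fin (n + 1) => Set.Icc α τ) ∪ ⋃ i, maxRegion α τ β n i : Set _) := by
  filter_upwards [ae_injective_pi (n + 1)] with t ht
  apply propext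
  change (t ∈ Set.univ.pi fun _ : Fin (n + 1) => Set.Icc α β) ↔
    t ∈ (Set.univ.pi fun _ : Fin (n + 1) => Set.Icc α τ) ∪ ⋃ i, maxRegion α τ β n i
  constructor
  · intro h
    by_cases h' : t ∈ Set.univ.pi fun _ : Fin (n + 1) => Set.Icc α τ
    · exact Or.inl h'
    · right
      obtain ⟨i, hi⟩ := Finite.exists_max t
      refine Set.mem_iUnion.mpr ⟨i, ⟨?_, (h i trivial).2⟩, fun j => ⟨(h _ trivial).1, ?_⟩⟩
      · by_contra hlt
        exact h' fun j _ => ⟨(h j trivial).1, (hi j).trans (not_lt.mp hlt)⟩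
      · exact lt_of_le_of_ne (hi _) fun he => Fin.succAbove_ne i j (ht he)
  · rintro (h | h)
    · exact fun j _ => ⟨(h j trivial).1, (h j trivial).2.trans hβ⟩
    · obtain ⟨i, hi⟩ := Set.mem_iUnion.mp h
      exact maxRegion_subset hα n i hi

/-- Fubini's theorem in the largest variable, which is the leftmost one in the ordered product. -/
theorem setIntegral_maxRegion [CompleteSpace 𝔅] (hop : StronglyMeasurable op)
    (hC : ∀ t, ‖op t‖ ≤ C) {α τ β : ℝ} (hα : α ≤ τ) (hβ : τ ≤ β) (n : ℕ) {s : Finset ℝ}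
    (hs : ∀ x ∈ s, x ≤ τ) (i : Fin (n + 1)) :
    ∫ t in maxRegion α τ β n i, ordProd op (Finset.univ.image t ∪ s) =
      ∫ u in τ..β, op u * cubeIntegral op α n s u := by
  classical
  let e := MeasurableEquiv.piFinSuccAbove (fun _ : Fin (n + 1) => ℝ) i
  have he : MeasurePreserving e volume volume :=
    volume_preserving_piFinSuccAbove (fun _ : Fin (n + 1) => ℝ) i
  let R : Set (ℝ × (Fin n → ℝ)) := {p | p.1 ∈ Set.Ioc τ β ∧ ∀ j, p.2 j ∈ Set.Ico α p.1}
  let f : ℝ × (Fin n → ℝ) → 𝔅 := fun p => ordProd op (insert p.1 (Finset.univ.image p.2 ∪ s))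
  have hR : MeasurableSet R := by
    have h : R = Prod.fst ⁻¹' Set.Ioc τ β ∩
        ⋂ j : Fin n, ({p : ℝ × (Fin n → ℝ) | α ≤ p.2 j} ∩ {p | p.2 j < p.1}) := by
      ext p
      simp [R]
    rw [h]
    refine (measurable_fst measurableSet_Ioc).inter (MeasurableSet.iInter fun j => ?_)
    exact (measurableSet_le measurable_const (by fun_prop)).inter
      (measurableSet_lt (by fun_prop) (by fun_prop))
  have hpre : e ⁻¹' R = maxRegion α τ β n i := rfl
  have hf : ∀ t, f (e t) = ordProd op (Finset.univ.image t ∪ s) := by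
    intro t
    have h : Finset.univ.image t = insert (t i) (Finset.univ.image fun j => t (i.succAbove j)) := by
      rw [Fin.univ_succAbove n i, Finset.cons_eq_insert, Finset.image_insert]
      congr 1
      ext y
      simp only [Finset.mem_image, Finset.mem_map, Finset.mem_univ, true_and, Fin.succAboveEmb_apply,
        exists_exists_eq_and]
    rw [h, Finset.insert_union]
    rfl
  have hint : IntegrableOn f R := by
    rw [← he.integrableOn_comp_preimage e.measurableEmbedding, hpre]
    have h1 : f ∘ e = fun t => ordProd op (Finset.univ.image t ∪ s) := funext hf
    rw [h1]
    exact integrableOn_ordProd hop hC s (n + 1)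
      (measure_ne_top_of_subset (maxRegion_subset hα n i) (volume_cube_ne_top α β))
  have h1 : ∫ t in maxRegion α τ β n i, ordProd op (Finset.univ.image t ∪ s) = ∫ p in R, f p := by
    rw [← he.setIntegral_preimage_emb e.measurableEmbedding f R, hpre]
    exact setIntegral_congr_fun (measurableSet_maxRegion α τ β n i) fun t _ => (hf t).symm
  rw [h1, ← integral_indicator hR, Measure.volume_eq_prod,
    integral_prod _ ((integrable_indicator_iff hR).mpr hint), intervalIntegral.integral_of_le hβ,
    ← integral_indicator measurableSet_Ioc]
  refine integral_congr_ae (Eventually.of_forall fun u => ?_)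
  beta_reduce
  by_cases hu : u ∈ Set.Ioc τ β
  · rw [Set.indicator_of_mem hu, cubeIntegral_eq_Ico, ← integral_const_mul_of_bounded _
      (integrableOn_ordProd hop hC s n (volume_cube_Ico_ne_top α u)),
      ← integral_indicator (MeasurableSet.univ_pi fun _ => measurableSet_Ico)]
    refine integral_congr_ae (Eventually.of_forall fun t => ?_)
    beta_reduce
    by_cases ht : t ∈ Set.univ.pi fun _ : Fin n => Set.Ico α u
    · have hmem : (u, t) ∈ R := ⟨hu, fun j => ht j trivial⟩
      rw [Set.indicator_of_mem ht, Set.indicator_of_mem hmem]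
      exact ordProd_image_insert op ht fun x hx => (hs x hx).trans_lt hu.1
    · have hmem : (u, t) ∉ R := fun h => ht fun j _ => h.2 j
      rw [Set.indicator_of_notMem ht, Set.indicator_of_notMem hmem]
  · rw [Set.indicator_of_notMem hu]
    refine integral_eq_zero_of_ae (Eventually.of_forall fun t => ?_)
    exact Set.indicator_of_notMem (fun h : (u, t) ∈ R => hu h.1) _

/-- The recursion for the integrals of ordered products: all the variables are at most `τ`, or one
of them, `u`, is the largest and exceeds `τ`. -/
theorem cubeIntegral_succ [CompleteSpace 𝔅] (hop : StronglyMeasurable op)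
    (hC : ∀ t, ‖op t‖ ≤ C) {α τ β : ℝ} (hα : α ≤ τ) (hβ : τ ≤ β) (n : ℕ) {s : Finset ℝ}
    (hs : ∀ x ∈ s, x ≤ τ) :
    cubeIntegral op α (n + 1) s β = cubeIntegral op α (n + 1) s τ +
      (n + 1 : ℕ) • ∫ u in τ..β, op u * cubeIntegral op α n s u := by
  have hint : ∀ i, IntegrableOn (fun t : Fin (n + 1) → ℝ => ordProd op (Finset.univ.image t ∪ s))
      (maxRegion α τ β n i) := fun i => integrableOn_ordProd hop hC s (n + 1)
    (measure_ne_top_of_subset (maxRegion_subset hα n i) (volume_cube_ne_top α β))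
  have hdisj : Pairwise (Function.onFun Disjoint (maxRegion α τ β n)) := by
    intro i j hij
    refine Set.disjoint_left.mpr fun t hi hj => ?_
    obtain ⟨k, hk⟩ := Fin.exists_succAbove_eq hij.symm
    obtain ⟨l, hl⟩ := Fin.exists_succAbove_eq hij
    have h1 := (hi.2 k).2
    have h2 := (hj.2 l).2
    rw [hk] at h1
    rw [hl] at h2
    exact lt_asymm h1 h2
  rw [cubeIntegral, setIntegral_congr_set (cube_ae_eq hα hβ n), setIntegral_union]
  · rw [integral_iUnion_fintype (measurableSet_maxRegion α τ β n) hdisj hint,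
      Finset.sum_congr rfl fun i _ => setIntegral_maxRegion hop hC hα hβ n hs i,
      Finset.sum_const, Finset.card_univ, Fintype.card_fin]
    rfl
  · refine Set.disjoint_iUnion_right.mpr fun i => Set.disjoint_left.mpr fun t h h' => ?_
    exact absurd (h i trivial).2 (not_le.mpr h'.1.1)
  · exact MeasurableSet.iUnion fun i => measurableSet_maxRegion α τ β n i
  · exact integrableOn_ordProd hop hC s (n + 1) (volume_cube_ne_top α τ)
  · exact (integrableOn_finite_iUnion).mpr hint

end Cube

/-! ### The integrals of ordered products along a curve -/

section CurveIntegral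

variable {𝔅 : Type*} [NormedRing 𝔅] [NormedAlgebra ℂ 𝔅] [CompleteSpace 𝔅] {a b : 𝔅}
  {γ : ℝ → ℂ} {op : ℝ → 𝔅} {C α β : ℝ}

theorem differentiable_expI_mul_chainCoeff (a b : 𝔅) (γ : ℝ → ℂ) (α : ℝ) (L : List (ℝ × 𝔅))
    (n : ℕ) : Differentiable ℂ fun w => expI a w * chainCoeff a b γ α L n w := by
  cases n with
  | zero => exact fun w => (hasDerivAt_expI_mul_chainCoeff_zero a b γ α L w).differentiableAt
  | succ n => exact fun w => (hasDerivAt_expI_mul_chainCoeff_succ a b γ α L n w).differentiableAt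

theorem expI_mul_chainCoeff_zero_const (L : List (ℝ × 𝔅)) (w w' : ℂ) :
    expI a w * chainCoeff a b γ α L 0 w = expI a w' * chainCoeff a b γ α L 0 w' :=
  is_const_of_deriv_eq_zero (differentiable_expI_mul_chainCoeff a b γ α L 0)
    (fun w => (hasDerivAt_expI_mul_chainCoeff_zero a b γ α L w).deriv) w w'

/-- If the integrals of ordered products agree with the algebraic coefficients at `τ`, then they do
so at all later parameters, since both satisfy the same integral equation. -/
theorem cubeIntegral_eq_of_eq_at (hγ : ContinuousOn γ (Set.Icc α β)) (hop : StronglyMeasurable op)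
    (hC : ∀ t, ‖op t‖ ≤ C) {γ' : ℝ → ℂ} {S : Set ℝ} (hS : S.Countable)
    (hγ' : ∀ t ∈ Set.Ioo α β \ S, HasDerivAt γ (γ' t) t ∧
      op t = γ' t • (-Complex.I • (expI a (γ t) * b * expI a (-γ t))))
    {L : List (ℝ × 𝔅)} {s : Finset ℝ} {τ : ℝ} (hα : α ≤ τ) (hs : ∀ x ∈ s, x ≤ τ)
    (h : ∀ n, cubeIntegral op α n s τ =
      (n.factorial : ℂ) • (expI a (γ τ) * chainCoeff a b γ α L n (γ τ)))
    (n : ℕ) {t : ℝ} (hτt : τ ≤ t) (htβ : t ≤ β) :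
    cubeIntegral op α n s t =
      (n.factorial : ℂ) • (expI a (γ t) * chainCoeff a b γ α L n (γ t)) := by
  induction n generalizing t with
  | zero =>
    rw [cubeIntegral_zero, ← cubeIntegral_zero op α s τ, h 0,
      expI_mul_chainCoeff_zero_const L (γ τ) (γ t)]
  | succ n ih =>
    have hsub : Set.Icc τ t ⊆ Set.Icc α β := Set.Icc_subset_Icc hα htβ
    have hcont : ∀ m, ContinuousOn (fun u => expI a (γ u) * chainCoeff a b γ α L m (γ u))
        (Set.Icc τ t) := fun m =>
      (differentiable_expI_mul_chainCoeff a b γ α L m).continuous.comp_continuousOn (hγ.mono hsub)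
    have hint : IntervalIntegrable
        (fun u => op u * (expI a (γ u) * chainCoeff a b γ α L n (γ u))) volume τ t := by
      refine IntervalIntegrable.mul_continuousOn ?_ (by rw [Set.uIcc_of_le hτt]; exact hcont n)
      rw [intervalIntegrable_iff]
      exact Measure.integrableOn_of_bounded (M := C) (by simp) hop.aestronglyMeasurable
        (Eventually.of_forall hC)
    have hftc := integral_eq_of_hasDerivAt_off_countable_of_le
      (fun u => expI a (γ u) * chainCoeff a b γ α L (n + 1) (γ u))
      (fun u => op u * (expI a (γ u) * chainCoeff a b γ α L n (γ u))) hτt hS (hcont (n + 1))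
      (fun u hu => by
        obtain ⟨h1, h2⟩ := hγ' u ⟨⟨hα.trans_lt hu.1.1, hu.1.2.trans_le htβ⟩, hu.2⟩
        have h3 := (hasDerivAt_expI_mul_chainCoeff_succ a b γ α L n (γ u)).scomp u h1
        refine h3.congr_deriv ?_
        rw [h2, smul_mul_assoc (γ' u)]) hint
    have hcongr : ∫ u in τ..t, op u * cubeIntegral op α n s u =
        ∫ u in τ..t, (n.factorial : ℂ) • (op u * (expI a (γ u) * chainCoeff a b γ α L n (γ u))) := by
      refine intervalIntegral.integral_congr fun u hu => ?_
      rw [Set.uIcc_of_le hτt] at hu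
      rw [ih hu.1 (hu.2.trans htβ), mul_smul_comm]
    rw [cubeIntegral_succ hop hC hα hτt n hs, h (n + 1), hcongr, intervalIntegral.integral_smul,
      hftc, ← Nat.cast_smul_eq_nsmul ℂ, smul_smul, ← Nat.cast_mul, ← Nat.factorial_succ, smul_sub,
      add_sub_cancel]

/-- The integrals of ordered products along a curve are given by the algebraic coefficients. The fixed
points are passed one by one: up to the first of them, and from each one to the next, both sides
satisfy the same integral equation, and at a fixed point both are multiplied by the same factor. -/
theorem cubeIntegral_eq_chainCoeff (hγ : ContinuousOn γ (Set.Icc α β)) (hop : StronglyMeasurable op)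
    (hC : ∀ t, ‖op t‖ ≤ C) {γ' : ℝ → ℂ} {S : Set ℝ} (hS : S.Countable)
    (hγ' : ∀ t ∈ Set.Ioo α β \ S, HasDerivAt γ (γ' t) t ∧
      op t = γ' t • (-Complex.I • (expI a (γ t) * b * expI a (-γ t))))
    {L : List (ℝ × 𝔅)} (hL : L.Pairwise fun x y => y.1 < x.1)
    (hLop : ∀ x ∈ L, α ≤ x.1 ∧ op x.1 = expI a (γ x.1) * x.2 * expI a (-γ x.1))
    (n : ℕ) {t : ℝ} (hαt : α ≤ t) (htβ : t ≤ β) (hLt : ∀ x ∈ L, x.1 ≤ t) :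
    cubeIntegral op α n (L.map Prod.fst).toFinset t =
      (n.factorial : ℂ) • (expI a (γ t) * chainCoeff a b γ α L n (γ t)) := by
  induction L generalizing n t with
  | nil =>
    refine cubeIntegral_eq_of_eq_at hγ hop hC hS hγ' le_rfl (by simp) (fun n => ?_) n hαt htβ
    cases n with
    | zero => simp [cubeIntegral_zero, ordProd_empty, chainCoeff, dysonCoeff_at_zero, expI_mul_neg]
    | succ n => simp [cubeIntegral_succ_self, chainCoeff, dysonCoeff_at_zero]
  | cons x L ih =>
    obtain ⟨τ, c⟩ := x
    obtain ⟨hx, hL'⟩ := List.pairwise_cons.mp hL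
    have hτt : τ ≤ t := hLt (τ, c) (by simp)
    obtain ⟨hατ, hopτ⟩ := hLop (τ, c) (by simp)
    have hs : ∀ y ∈ (L.map Prod.fst).toFinset, y < τ := by
      intro y hy
      rw [List.mem_toFinset, List.mem_map] at hy
      obtain ⟨z, hz, rfl⟩ := hy
      exact hx z hz
    rw [List.map_cons, List.toFinset_cons]
    refine cubeIntegral_eq_of_eq_at hγ hop hC hS hγ' hατ (fun y hy => ?_) (fun n => ?_) n hτt htβ
    · rcases Finset.mem_insert.mp hy with rfl | hy
      · exact le_rfl
      · exact (hs y hy).le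
    · have hih := ih hL' (fun x hx => hLop x (by simp [hx])) n hατ (hτt.trans htβ)
        fun y hy => (hx y hy).le
      rw [cubeIntegral_insert hop hC α n hs, hih, hopτ, chainCoeff_cons_at, mul_smul_comm,
        mul_assoc (expI a (γ τ) * c), ← mul_assoc (expI a (-γ τ)), expI_neg_mul, one_mul, mul_assoc]

end CurveIntegral

/-! ### Operators on the spectral subspaces of `H₀` -/

section SpectralSubspaces

variable {H : Type*} [NormedAddCommGroup H] [InnerProductSpace ℂ H] [CompleteSpace H]

open ProjValuedMeasure

/-- The exponential series of `z T` converges on vectors with bounded spectral support. -/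
theorem hasSum_exp_fn {P : ProjValuedMeasure H} {ψ : H} {R : ℝ}
    (h : ∀ᵐ x ∂P.measure ψ, |x| ≤ R) (z : ℂ) :
    HasSum (fun N : ℕ => (z ^ N / N.factorial : ℂ) • P.fn (fun x => (x : ℂ) ^ N) ψ)
      (P.fn (fun x => Complex.exp (z * x)) ψ) := by
  have hm : ∀ N : ℕ, Measurable fun x : ℝ => (x : ℂ) ^ N := fun N => by fun_prop
  have hL : ∀ N : ℕ, MemLp (fun x : ℝ => (x : ℂ) ^ N) 2 (P.measure ψ) := fun N => by
    refine memLp_of_ae_bounded (hm N) (C := R ^ N) ?_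
    filter_upwards [h] with x hx
    rw [norm_pow, Complex.norm_real, Real.norm_eq_abs]
    gcongr
  have hterm : ∀ N : ℕ, (z ^ N / N.factorial : ℂ) • P.fn (fun x => (x : ℂ) ^ N) ψ =
      P.fn ((z ^ N / N.factorial : ℂ) • fun x : ℝ => (x : ℂ) ^ N) ψ := fun N =>
    (fn_smul _ (hm N) (hL N)).symm
  have hbound : ∀ x : ℝ, |x| ≤ R → ∀ n : ℕ,
      ‖∑ N ∈ Finset.range n, ((z ^ N / N.factorial : ℂ) • fun x : ℝ => (x : ℂ) ^ N) x‖ ≤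
        Real.exp (‖z‖ * R) := by
    intro x hx n
    have hR : 0 ≤ R := (abs_nonneg x).trans hx
    refine (norm_sum_le _ _).trans (le_trans ?_ (Real.sum_le_exp_of_nonneg (by positivity) n))
    refine Finset.sum_le_sum fun N _ => ?_
    rw [Pi.smul_apply, norm_expSeries_term, norm_pow, Complex.norm_real, Real.norm_eq_abs, mul_pow,
      div_mul_eq_mul_div]
    gcongr
  have hlim : ∀ x : ℝ, Tendsto (fun n : ℕ => ∑ N ∈ Finset.range n,
      ((z ^ N / N.factorial : ℂ) • fun x : ℝ => (x : ℂ) ^ N) x) atTop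
      (𝓝 (Complex.exp (z * x))) := by
    intro x
    have h1 := NormedSpace.expSeries_div_hasSum_exp (𝔸 := ℂ) (z * x)
    rw [← Complex.exp_eq_exp_ℂ] at h1
    refine h1.tendsto_sum_nat.congr fun n => Finset.sum_congr rfl fun N _ => ?_
    simp only [Pi.smul_apply, smul_eq_mul, mul_pow]
    ring
  have hexp : Measurable fun x : ℝ => Complex.exp (z * x) := by fun_prop
  have hsumm : Summable fun N : ℕ => (z ^ N / N.factorial : ℂ) • P.fn (fun x => (x : ℂ) ^ N) ψ := by
    refine Summable.of_norm (summable_expSeries (C := ‖ψ‖) (r := |R|) (fun N => ?_) z)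
    rw [mul_comm]
    refine norm_fn_le_ae (hm N) (by positivity) ?_
    filter_upwards [h] with x hx
    rw [norm_pow, Complex.norm_real, Real.norm_eq_abs]
    exact pow_le_pow_left₀ (abs_nonneg x) (hx.trans (le_abs_self R)) N
  refine (hsumm.hasSum_iff_tendsto_nat).mpr ?_
  have h2 := tendsto_fn_of_dominated (P := P) (ψ := ψ) (l := atTop)
    (F := fun n : ℕ => fun x : ℝ => ∑ N ∈ Finset.range n,
      ((z ^ N / N.factorial : ℂ) • fun x : ℝ => (x : ℂ) ^ N) x)
    (f := fun x : ℝ => Complex.exp (z * x)) (b := fun _ => (Real.exp (‖z‖ * R) : ℂ))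
    (fun n => Finset.measurable_fun_sum _ fun N _ => (hm N).const_smul _) hexp
    (memLp_const (Real.exp (‖z‖ * R) : ℂ))
    (by
      filter_upwards [h] with x hx
      rw [Complex.norm_real, Real.norm_of_nonneg (Real.exp_nonneg _)]
      exact le_of_tendsto' (hlim x).norm fun n => hbound x hx n)
    (Eventually.of_forall fun n => by
      filter_upwards [h] with x hx
      rw [Complex.norm_real, Real.norm_of_nonneg (Real.exp_nonneg _)]
      exact hbound x hx n)
    (Eventually.of_forall hlim)
  refine h2.congr fun n => ?_
  rw [fn_finset_sum _ (fun N _ => (hm N).const_smul _) (fun N _ => (hL N).const_smul _)]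
  exact Finset.sum_congr rfl fun N _ => (hterm N).symm

variable {H₀ A : H →ₗ.[ℂ] H} {E F : ℝ} {ψ : H}

theorem mem_VE_iff : ψ ∈ VE H₀ E ↔ (spectralMeasure H₀).proj (Set.Icc 0 E) ψ = ψ := by
  constructor
  · rintro ⟨φ, rfl⟩
    exact proj_idem measurableSet_Icc φ
  · intro h
    exact ⟨ψ, h⟩

theorem mem_VE_iff_ae : ψ ∈ VE H₀ E ↔ ∀ᵐ x ∂(spectralMeasure H₀).measure ψ, x ∈ Set.Icc 0 E :=
  mem_VE_iff.trans ⟨ae_mem_of_proj_eq measurableSet_Icc, proj_eq_of_ae_mem measurableSet_Icc⟩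

theorem isClosed_VE (H₀ : H →ₗ.[ℂ] H) (E : ℝ) : IsClosed (VE H₀ E : Set H) := by
  have h : (VE H₀ E : Set H) = {ψ | (spectralMeasure H₀).proj (Set.Icc 0 E) ψ = ψ} := by
    ext ψ
    exact mem_VE_iff
  rw [h]
  exact isClosed_eq (ContinuousLinearMap.continuous _) continuous_id

theorem proj_mem_VE (H₀ : H →ₗ.[ℂ] H) (E : ℝ) (φ : H) :
    (spectralMeasure H₀).proj (Set.Icc 0 E) φ ∈ VE H₀ E := ⟨φ, rfl⟩

theorem abs_le_of_mem_VE (h : ψ ∈ VE H₀ E) :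
    ∀ᵐ x ∂(spectralMeasure H₀).measure ψ, |x| ≤ E := by
  filter_upwards [mem_VE_iff_ae.mp h] with x hx
  rw [abs_of_nonneg hx.1]
  exact hx.2

theorem fn_mem_VE {f : ℝ → ℂ} (hf : Measurable f)
    (hm : MemLp f 2 ((spectralMeasure H₀).measure ψ)) (h : ψ ∈ VE H₀ E) :
    (spectralMeasure H₀).fn f ψ ∈ VE H₀ E :=
  mem_VE_iff.mpr (proj_fn_eq_self measurableSet_Icc hf hm (mem_VE_iff_ae.mp h))

/-- `A` is defined on `V_F` and bounded there by `K`. -/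
structure IsBoundedOnVE (H₀ A : H →ₗ.[ℂ] H) (F K : ℝ) : Prop where
  le_domain : VE H₀ F ≤ A.domain
  norm_le : ∀ ψ ∈ VE H₀ F, ‖opApply A ψ‖ ≤ K * ‖ψ‖

open Classical in
/-- The bounded operator `A E_{H₀}([0, F])`, if there is such an operator. -/
def trunc (H₀ A : H →ₗ.[ℂ] H) (F : ℝ) : H →L[ℂ] H :=
  if h : ∃ B : H →L[ℂ] H, ∀ ψ, B ψ = opApply A ((spectralMeasure H₀).proj (Set.Icc 0 F) ψ) then
    h.choose else 0

theorem IsBoundedOnVE.trunc_apply {K : ℝ} (hA : IsBoundedOnVE H₀ A F K) (ψ : H) :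
    trunc H₀ A F ψ = opApply A ((spectralMeasure H₀).proj (Set.Icc 0 F) ψ) := by
  have h : ∃ B : H →L[ℂ] H,
      ∀ ψ, B ψ = opApply A ((spectralMeasure H₀).proj (Set.Icc 0 F) ψ) := by
    have hd : ∀ ψ, (spectralMeasure H₀).proj (Set.Icc 0 F) ψ ∈ A.domain := fun ψ =>
      hA.le_domain (proj_mem_VE H₀ F ψ)
    refine ⟨LinearMap.mkContinuous
      { toFun := fun ψ => opApply A ((spectralMeasure H₀).proj (Set.Icc 0 F) ψ)
        map_add' := fun ψ φ => by rw [map_add, opApply_add (hd ψ) (hd φ)]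
        map_smul' := fun c ψ => by rw [map_smul, opApply_smul c (hd ψ), RingHom.id_apply] } |K|
      fun ψ => ?_, fun ψ => rfl⟩
    refine (hA.norm_le _ (proj_mem_VE H₀ F ψ)).trans ?_
    gcongr
    · exact le_abs_self K
    · exact norm_proj_le measurableSet_Icc ψ
  rw [trunc, dif_pos h]
  exact h.choose_spec ψ

theorem IsBoundedOnVE.trunc_of_mem {K : ℝ} (hA : IsBoundedOnVE H₀ A F K) (hψ : ψ ∈ VE H₀ F) :
    trunc H₀ A F ψ = opApply A ψ := by
  rw [hA.trunc_apply, mem_VE_iff.mp hψ]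

theorem IsBoundedBelowBy.isBoundedOnVE (h₀ : IsBoundedBelowBy H₀ 0) (hE : 0 ≤ E) :
    IsBoundedOnVE H₀ H₀ E E := by
  refine ⟨fun ψ hψ => h₀.spec.mem_domain_of_ae (abs_le_of_mem_VE hψ), fun ψ hψ => ?_⟩
  rw [h₀.spec.opApply_eq]
  refine norm_fn_le_ae Complex.measurable_ofReal hE ?_
  filter_upwards [abs_le_of_mem_VE hψ] with x hx
  rwa [Complex.norm_real, Real.norm_eq_abs]

theorem IsBoundedBelowBy.opApply_mem_VE (h₀ : IsBoundedBelowBy H₀ 0) (hψ : ψ ∈ VE H₀ E) :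
    opApply H₀ ψ ∈ VE H₀ E := by
  rw [h₀.spec.opApply_eq]
  exact fn_mem_VE Complex.measurable_ofReal
    (h₀.spec.mem_domain.mp (h₀.spec.mem_domain_of_ae (abs_le_of_mem_VE hψ))) hψ

theorem memLp_exp_of_mem_VE (hψ : ψ ∈ VE H₀ E) (z : ℂ) :
    MemLp (fun x : ℝ => Complex.exp (Complex.I * z * x)) 2 ((spectralMeasure H₀).measure ψ) := by
  refine memLp_of_ae_bounded (measurable_cexp z) (C := Real.exp (‖z‖ * E)) ?_
  filter_upwards [abs_le_of_mem_VE hψ] with x hx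
  rw [Complex.norm_exp]
  refine Real.exp_le_exp.mpr ((Complex.re_le_norm _).trans ?_)
  rw [norm_mul, norm_mul, Complex.norm_I, one_mul, Complex.norm_real, Real.norm_eq_abs]
  gcongr

theorem mem_opExp_domain_of_mem_VE (hψ : ψ ∈ VE H₀ E) (z : ℂ) : ψ ∈ (opExp H₀ z).domain :=
  memLp_exp_of_mem_VE hψ z

theorem opApply_opExp_eq_fn (z : ℂ) (ψ : H) :
    opApply (opExp H₀ z) ψ = (spectralMeasure H₀).fn (fun x => Complex.exp (Complex.I * z * x)) ψ :=
  (fn_eq_opApply (measurable_cexp z)).symm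

theorem opApply_opExp_mem_VE (hψ : ψ ∈ VE H₀ E) (z : ℂ) : opApply (opExp H₀ z) ψ ∈ VE H₀ E := by
  rw [opApply_opExp_eq_fn]
  exact fn_mem_VE (measurable_cexp z) (memLp_exp_of_mem_VE hψ z) hψ

theorem norm_opApply_opExp_le (hψ : ψ ∈ VE H₀ E) (z : ℂ) :
    ‖opApply (opExp H₀ z) ψ‖ ≤ Real.exp (‖z‖ * E) * ‖ψ‖ := by
  rw [opApply_opExp_eq_fn]
  refine norm_fn_le_ae (measurable_cexp z) (Real.exp_nonneg _) ?_
  filter_upwards [abs_le_of_mem_VE hψ] with x hx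
  rw [Complex.norm_exp]
  refine Real.exp_le_exp.mpr ((Complex.re_le_norm _).trans ?_)
  rw [norm_mul, norm_mul, Complex.norm_I, one_mul, Complex.norm_real, Real.norm_eq_abs]
  gcongr

theorem memLp_pow_of_abs_le {P : ProjValuedMeasure H} {R : ℝ}
    (h : ∀ᵐ x ∂P.measure ψ, |x| ≤ R) (N : ℕ) :
    MemLp (fun x : ℝ => (x : ℂ) ^ N) 2 (P.measure ψ) := by
  refine memLp_of_ae_bounded (by fun_prop) (C := R ^ N) ?_
  filter_upwards [h] with x hx
  rw [norm_pow, Complex.norm_real, Real.norm_eq_abs]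
  gcongr

theorem fn_ofReal_fn_pow {P : ProjValuedMeasure H} {R : ℝ}
    (h : ∀ᵐ x ∂P.measure ψ, |x| ≤ R) (N : ℕ) :
    P.fn (fun x : ℝ => (x : ℂ)) (P.fn (fun x : ℝ => (x : ℂ) ^ N) ψ) =
      P.fn (fun x : ℝ => (x : ℂ) ^ (N + 1)) ψ := by
  have he : (fun x : ℝ => (x : ℂ) ^ (N + 1)) =
      (fun x : ℝ => (x : ℂ)) * fun x : ℝ => (x : ℂ) ^ N := by
    funext x
    simp [pow_succ']
  rw [he]
  refine fn_fn (by fun_prop) (memLp_pow_of_abs_le h N) Complex.measurable_ofReal ?_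
  rw [← he]
  exact memLp_pow_of_abs_le h (N + 1)

/-- On `V_E`, the unbounded group `e^{izH₀}` is the exponential of the truncation of `H₀`. -/
theorem IsBoundedBelowBy.expI_trunc_apply (h₀ : IsBoundedBelowBy H₀ 0) (hψ : ψ ∈ VE H₀ E)
    (hEF : E ≤ F) (hF : 0 ≤ F) (z : ℂ) :
    expI (trunc H₀ H₀ F) z ψ = opApply (opExp H₀ z) ψ := by
  have hpow : ∀ N : ℕ, ((trunc H₀ H₀ F) ^ N) ψ =
      (spectralMeasure H₀).fn (fun x : ℝ => (x : ℂ) ^ N) ψ := by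
    intro N
    induction N with
    | zero => simp [fn_one]
    | succ N ih =>
      rw [pow_succ', mul_apply_eq_comp, ih,
        (h₀.isBoundedOnVE hF).trunc_of_mem (VE_mono H₀ hEF (fn_mem_VE (by fun_prop)
          (memLp_pow_of_abs_le (abs_le_of_mem_VE hψ) N) hψ)),
        h₀.spec.opApply_eq, fn_ofReal_fn_pow (abs_le_of_mem_VE hψ)]
  have h1 := NormedSpace.exp_series_hasSum_exp' (𝕂 := ℂ) (z • (Complex.I • trunc H₀ H₀ F))
  have h2 := ((ContinuousLinearMap.apply ℂ H ψ).hasSum h1)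
  refine h2.unique ?_
  rw [opApply_opExp_eq_fn]
  refine (hasSum_exp_fn (abs_le_of_mem_VE hψ) (Complex.I * z)).congr_fun fun N => ?_
  rw [ContinuousLinearMap.apply_apply, smul_apply, smul_smul, smul_pow, smul_apply, hpow, smul_smul,
    mul_comm Complex.I, div_eq_inv_mul]

end SpectralSubspaces

/-! ### Values of sums, products and closures of operators -/

section OpAlgebra

variable {H : Type*} [NormedAddCommGroup H] [InnerProductSpace ℂ H]
  {S T : H →ₗ.[ℂ] H} {ψ : H}

theorem OpMapsTo.mem_domain {X Y : Set H} (h : OpMapsTo T X Y) (hψ : ψ ∈ X) : ψ ∈ T.domain :=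
  (h ψ hψ).1

theorem OpMapsTo.opApply_mem {X Y : Set H} (h : OpMapsTo T X Y) (hψ : ψ ∈ X) : opApply T ψ ∈ Y := by
  obtain ⟨h1, h2⟩ := h ψ hψ
  rwa [opApply_of_mem h1]

theorem mem_opMul (h : ψ ∈ T.domain) (h' : opApply T ψ ∈ S.domain) : ψ ∈ (opMul S T).domain := by
  rw [opApply_of_mem h] at h'
  exact mem_opMul_domain.mpr ⟨h, h'⟩

theorem opApply_opMul (h : ψ ∈ T.domain) (h' : opApply T ψ ∈ S.domain) :
    opApply (opMul S T) ψ = opApply S (opApply T ψ) := by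
  have h2 : T ⟨ψ, h⟩ ∈ S.domain := by rwa [← opApply_of_mem h]
  rw [opApply_of_mem (mem_opMul h h'), opApply_of_mem h, opApply_of_mem h2]
  rfl

theorem mem_opOne (ψ : H) : ψ ∈ (opOne : H →ₗ.[ℂ] H).domain := trivial

theorem opApply_opOne (ψ : H) : opApply (opOne : H →ₗ.[ℂ] H) ψ = ψ := by
  rw [opApply_of_mem (mem_opOne ψ)]
  rfl

theorem mem_opProd_nil (ψ : H) : ψ ∈ (opProd ([] : List (H →ₗ.[ℂ] H))).domain := trivial

theorem opApply_opProd_nil (ψ : H) : opApply (opProd ([] : List (H →ₗ.[ℂ] H))) ψ = ψ :=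
  opApply_opOne ψ

theorem mem_opProd_cons {L : List (H →ₗ.[ℂ] H)} (h : ψ ∈ (opProd L).domain)
    (h' : opApply (opProd L) ψ ∈ S.domain) : ψ ∈ (opProd (S :: L)).domain :=
  mem_opMul h h'

theorem opApply_opProd_cons {L : List (H →ₗ.[ℂ] H)} (h : ψ ∈ (opProd L).domain)
    (h' : opApply (opProd L) ψ ∈ S.domain) :
    opApply (opProd (S :: L)) ψ = opApply S (opApply (opProd L) ψ) :=
  opApply_opMul h h'

theorem opApply_eq_of_le (h : S ≤ T) (hψ : ψ ∈ S.domain) : opApply T ψ = opApply S ψ := by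
  rw [opApply_of_mem hψ, opApply_of_mem (h.1 hψ)]
  exact (h.2 rfl).symm

theorem opApply_add_op (hS : ψ ∈ S.domain) (hT : ψ ∈ T.domain) :
    opApply (S + T) ψ = opApply S ψ + opApply T ψ := by
  have h : ψ ∈ (S + T).domain := ⟨hS, hT⟩
  rw [opApply_of_mem h, opApply_of_mem hS, opApply_of_mem hT]
  rfl

theorem opApply_smul_op (c : ℂ) (T : H →ₗ.[ℂ] H) (ψ : H) :
    opApply (c • T) ψ = c • opApply T ψ := by
  by_cases hT : ψ ∈ T.domain
  · have h : ψ ∈ (c • T).domain := hT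
    rw [opApply_of_mem h, opApply_of_mem hT]
    rfl
  · have h : ψ ∉ (c • T).domain := hT
    simp [opApply, hT]

theorem opApply_sum_op {ι : Type*} (s : Finset ι) {T : ι → H →ₗ.[ℂ] H}
    (h : ∀ i ∈ s, ψ ∈ (T i).domain) :
    ψ ∈ (∑ i ∈ s, T i).domain ∧ opApply (∑ i ∈ s, T i) ψ = ∑ i ∈ s, opApply (T i) ψ := by
  classical
  induction s using Finset.induction_on with
  | empty =>
    have h0 : ψ ∈ (0 : H →ₗ.[ℂ] H).domain := trivial
    refine ⟨h0, ?_⟩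
    rw [Finset.sum_empty, Finset.sum_empty, opApply_of_mem h0]
    rfl
  | insert i s hi ih =>
    obtain ⟨h1, h2⟩ := ih fun j hj => h j (Finset.mem_insert_of_mem hj)
    have h3 := h i (Finset.mem_insert_self i s)
    rw [Finset.sum_insert hi, Finset.sum_insert hi]
    exact ⟨⟨h3, h1⟩, by rw [opApply_add_op h3 h1, h2]⟩

theorem opApply_finset_sum {T : H →ₗ.[ℂ] H} {ι : Type*} (s : Finset ι) {u : ι → H}
    (hu : ∀ i ∈ s, u i ∈ T.domain) :
    opApply T (∑ i ∈ s, u i) = ∑ i ∈ s, opApply T (u i) := by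
  classical
  induction s using Finset.induction_on with
  | empty => simp [opApply_zero]
  | insert i s hi ih =>
    have h : ∀ j ∈ s, u j ∈ T.domain := fun j hj => hu j (Finset.mem_insert_of_mem hj)
    rw [Finset.sum_insert hi, Finset.sum_insert hi,
      opApply_add (hu i (Finset.mem_insert_self i s)) (Submodule.sum_mem _ h), ih h]

end OpAlgebra

/-! ### Products of operators of the `C₀` class on vectors of finite energy -/

section Graded

variable {H : Type*} [NormedAddCommGroup H] [InnerProductSpace ℂ H] [CompleteSpace H]
  {H₀ A : H →ₗ.[ℂ] H} {b C E F : ℝ} {ψ : H}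

open ProjValuedMeasure

/-- The closed operator `A` raises the energy by at most `b`, and its norm on `V_E` is at most
`C √(E + 1)`. -/
structure IsGradedOp (H₀ A : H →ₗ.[ℂ] H) (b C : ℝ) : Prop where
  mapsTo : ∀ E, 0 ≤ E → OpMapsTo A (VE H₀ E) (VE H₀ (E + b))
  norm_le : ∀ E, 0 ≤ E → ∀ ψ ∈ VE H₀ E, ‖opApply A ψ‖ ≤ C * √(E + 1) * ‖ψ‖
  closed : A.IsClosed

theorem IsGradedOp.mono (h : IsGradedOp H₀ A b C) {b' C' : ℝ} (hb : b ≤ b') (hC : C ≤ C') :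
    IsGradedOp H₀ A b' C' where
  mapsTo E hE ψ hψ := by
    obtain ⟨h1, h2⟩ := h.mapsTo E hE ψ hψ
    exact ⟨h1, VE_mono H₀ (by linarith) h2⟩
  norm_le E hE ψ hψ := (h.norm_le E hE ψ hψ).trans (by gcongr)
  closed := h.closed

/-- On `V_E` the operator `H₀^{1/2}` is bounded by `√E`. -/
theorem IsCZero.exists_isGradedOp (hA : IsCZero H₀ A) : ∃ b C : ℝ, IsGradedOp H₀ A b C := by
  obtain ⟨b, -, hb⟩ := hA.exists_shift
  obtain ⟨-, a, c, hac⟩ := hA.relBounded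
  refine ⟨b, |a| + |c|, ⟨fun E hE => (hb E hE).1, fun E hE ψ hψ => ?_, hA.closed⟩⟩
  have hsq : ∀ᵐ x ∂(spectralMeasure H₀).measure ψ, ‖((√x : ℝ) : ℂ)‖ ≤ √(E + 1) := by
    filter_upwards [mem_VE_iff_ae.mp hψ] with x hx
    rw [Complex.norm_real, Real.norm_of_nonneg (Real.sqrt_nonneg x)]
    exact Real.sqrt_le_sqrt (by linarith [hx.2])
  have hm : ψ ∈ (opSqrt H₀).domain :=
    mem_opSqrt_domain.mpr (memLp_of_ae_bounded (by fun_prop) hsq)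
  have h1 : ‖opApply (opSqrt H₀) ψ‖ ≤ √(E + 1) * ‖ψ‖ := by
    rw [opApply_opSqrt]
    exact norm_fn_le_ae (by fun_prop) (Real.sqrt_nonneg _) hsq
  have h2 : 1 ≤ √(E + 1) := Real.one_le_sqrt.mpr (by linarith)
  calc ‖opApply A ψ‖ ≤ a * ‖opApply (opSqrt H₀) ψ‖ + c * ‖ψ‖ := hac ψ hm
    _ ≤ |a| * (√(E + 1) * ‖ψ‖) + |c| * (√(E + 1) * ‖ψ‖) := by
      refine add_le_add ?_ ?_
      · exact mul_le_mul (le_abs_self a) h1 (norm_nonneg _) (abs_nonneg a)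
      · exact mul_le_mul (le_abs_self c) (le_mul_of_one_le_left (norm_nonneg _) h2) (norm_nonneg _)
          (abs_nonneg c)
    _ = _ := by ring

/-- Finitely many `C₀`-class operators are graded with common constants. -/
theorem exists_isGradedOp_common {ι : Type*} [Finite ι] {A : ι → H →ₗ.[ℂ] H}
    (hA : ∀ i, IsCZero H₀ (A i)) :
    ∃ b C : ℝ, 0 < b ∧ 0 ≤ C ∧ ∀ i, IsGradedOp H₀ (A i) b C := by
  cases nonempty_fintype ι
  choose b C h using fun i => (hA i).exists_isGradedOp
  refine ⟨1 + ∑ i, |b i|, ∑ i, |C i|, by positivity, by positivity, fun i => (h i).mono ?_ ?_⟩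
  · have := Finset.single_le_sum (f := fun i => |b i|) (fun j _ => abs_nonneg _) (Finset.mem_univ i)
    have h2 := le_abs_self (b i)
    linarith
  · exact (le_abs_self _).trans (Finset.single_le_sum (f := fun i => |C i|)
      (fun j _ => abs_nonneg _) (Finset.mem_univ i))

theorem IsGradedOp.isBoundedOnVE (hA : IsGradedOp H₀ A b C) (hE : 0 ≤ E) :
    IsBoundedOnVE H₀ A E (C * √(E + 1)) :=
  ⟨fun _ hψ => (hA.mapsTo E hE).mem_domain hψ, hA.norm_le E hE⟩

/-- On `V_E` with `E + b ≤ F`, the operator `T` is defined, agrees with the bounded operator `B`, and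
takes values in `V_{E+b}`. -/
def AgreesBelow (H₀ : H →ₗ.[ℂ] H) (b F : ℝ) (T : H →ₗ.[ℂ] H) (B : H →L[ℂ] H) : Prop :=
  ∀ E, 0 ≤ E → E + b ≤ F → ∀ ψ ∈ VE H₀ E, ψ ∈ T.domain ∧ opApply T ψ = B ψ ∧ B ψ ∈ VE H₀ (E + b)

theorem AgreesBelow.smul {T : H →ₗ.[ℂ] H} {B : H →L[ℂ] H} (h : AgreesBelow H₀ b F T B) (c : ℂ) :
    AgreesBelow H₀ b F (c • T) (c • B) := by
  intro E hE hEF ψ hψ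
  obtain ⟨h1, h2, h3⟩ := h E hE hEF ψ hψ
  exact ⟨h1, by rw [opApply_smul_op, h2, smul_apply], Submodule.smul_mem _ c h3⟩

/-- A product of operators that raise the energy by at most `b` can be computed with the truncated
operators, if there is enough room between the energy of the vector and the cut-off. -/
theorem agreesBelow_opProd {ι : Type*} {T : ι → H →ₗ.[ℂ] H} {B : ι → H →L[ℂ] H} (hb : 0 ≤ b)
    (L : List ι) (h : ∀ i ∈ L, AgreesBelow H₀ b F (T i) (B i)) (hE : 0 ≤ E)
    (hEF : E + L.length * b ≤ F) (hψ : ψ ∈ VE H₀ E) :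
    ψ ∈ (opProd (L.map T)).domain ∧ opApply (opProd (L.map T)) ψ = (L.map B).prod ψ ∧
      (L.map B).prod ψ ∈ VE H₀ (E + L.length * b) := by
  induction L with
  | nil =>
    refine ⟨mem_opOne ψ, opApply_opOne ψ, ?_⟩
    simpa using hψ
  | cons i L ih =>
    have hlen : E + (L.length : ℝ) * b + b ≤ F := by
      rw [List.length_cons] at hEF
      push_cast at hEF
      linarith
    obtain ⟨h1, h2, h3⟩ := ih (fun j hj => h j (by simp [hj])) (by linarith)
    obtain ⟨h4, h5, h6⟩ := h i (by simp) _ (by positivity) hlen _ h3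
    rw [← h2] at h4
    have hcons : opProd ((i :: L).map T) = opMul (T i) (opProd (L.map T)) := rfl
    rw [hcons]
    refine ⟨mem_opMul h1 h4, ?_, ?_⟩
    · rw [opApply_opMul h1 h4, h2, h5]
      simp
    · rw [List.map_cons, List.prod_cons, mul_apply_eq_comp, List.length_cons]
      push_cast
      rwa [add_one_mul, ← add_assoc]

theorem IsGradedOp.agreesBelow_trunc (hA : IsGradedOp H₀ A b C) (hb : 0 ≤ b) :
    AgreesBelow H₀ b F A (trunc H₀ A F) := by
  intro E hE hEF ψ hψ
  have h1 : trunc H₀ A F ψ = opApply A ψ :=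
    (hA.isBoundedOnVE (by linarith)).trunc_of_mem (VE_mono H₀ (by linarith) hψ)
  exact ⟨(hA.mapsTo E hE).mem_domain hψ, h1.symm, by
    rw [h1]; exact (hA.mapsTo E hE).opApply_mem hψ⟩

/-- The truncated version of `A(z) = e^{izH₀} A e^{-izH₀}`. -/
def truncEvolved (H₀ A : H →ₗ.[ℂ] H) (F : ℝ) (z : ℂ) : H →L[ℂ] H :=
  expI (trunc H₀ H₀ F) z * trunc H₀ A F * expI (trunc H₀ H₀ F) (-z)

theorem IsGradedOp.agreesBelow_evolved (h₀ : IsBoundedBelowBy H₀ 0) (hA : IsGradedOp H₀ A b C)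
    (hb : 0 ≤ b) (z : ℂ) : AgreesBelow H₀ b F (evolved H₀ A z) (truncEvolved H₀ A F z) := by
  intro E hE hEF ψ hψ
  have hF : 0 ≤ F := by linarith
  have h1 := mem_opExp_domain_of_mem_VE hψ (-z)
  have h2 := opApply_opExp_mem_VE hψ (-z)
  obtain ⟨h3, h4, h5⟩ := hA.agreesBelow_trunc (F := F) hb E hE hEF _ h2
  have h6 := mem_opExp_domain_of_mem_VE h5 z
  have h7 := opApply_opExp_mem_VE h5 z
  have h1' : opApply (opProd []) ψ ∈ (opExp H₀ (-z)).domain := by rwa [opApply_opProd_nil]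
  have e1 : opApply (opProd [opExp H₀ (-z)]) ψ = opApply (opExp H₀ (-z)) ψ := by
    rw [opApply_opProd_cons (mem_opProd_nil ψ) h1', opApply_opProd_nil]
  have m1 := mem_opProd_cons (mem_opProd_nil ψ) h1'
  have h3' : opApply (opProd [opExp H₀ (-z)]) ψ ∈ A.domain := by rwa [e1]
  have e3 : opApply (opProd [A, opExp H₀ (-z)]) ψ = trunc H₀ A F (opApply (opExp H₀ (-z)) ψ) := by
    rw [opApply_opProd_cons m1 h3', e1, h4]
  have m3 := mem_opProd_cons m1 h3'
  have h6' : opApply (opProd [A, opExp H₀ (-z)]) ψ ∈ (opExp H₀ z).domain := by rwa [e3]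
  have e6 : opApply (opProd [opExp H₀ z, A, opExp H₀ (-z)]) ψ =
      opApply (opExp H₀ z) (trunc H₀ A F (opApply (opExp H₀ (-z)) ψ)) := by
    rw [opApply_opProd_cons m3 h6', e3]
  have m6 := mem_opProd_cons m3 h6'
  have hle : opProd [opExp H₀ z, A, opExp H₀ (-z)] ≤ evolved H₀ A z := LinearPMap.le_closure _
  have hval : truncEvolved H₀ A F z ψ =
      opApply (opExp H₀ z) (trunc H₀ A F (opApply (opExp H₀ (-z)) ψ)) := by
    rw [truncEvolved, mul_apply_eq_comp, mul_apply_eq_comp,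
      h₀.expI_trunc_apply hψ (by linarith) hF, h₀.expI_trunc_apply h5 hEF hF]
  refine ⟨hle.1 m6, ?_, ?_⟩
  · rw [opApply_eq_of_le hle m6, e6, hval]
  · rw [hval]
    exact h7

end Graded

/-! ### Piecewise `C¹` curves -/

section CurveDeriv

variable {γ : Curve}

theorem exists_pos_forall_abs_sub_lt (S : Finset ℝ) (t : ℝ) :
    ∃ δ > 0, ∀ x, |x - t| < δ → x ∈ S → x = t := by
  have h : ((S.erase t : Finset ℝ) : Set ℝ)ᶜ ∈ 𝓝 t :=
    (Finset.finite_toSet _).isClosed.isOpen_compl.mem_nhds (by simp)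
  obtain ⟨δ, hδ, hsub⟩ := Metric.mem_nhds_iff.mp h
  refine ⟨δ, hδ, fun x hx hxS => ?_⟩
  by_contra hne
  exact hsub (Metric.mem_ball.mpr (by rwa [Real.dist_eq])) (by simp [hne, hxS])

theorem Curve.IsSimpleCurve.exists_hasDerivAt (hγ : γ.IsSimpleCurve) :
    ∃ S : Finset ℝ, ∀ t ∈ Set.Ioo γ.α γ.β, t ∉ S → HasDerivAt γ.toFun (deriv γ.toFun t) t := by
  obtain ⟨S, hS⟩ := hγ.piecewise
  refine ⟨S, fun t ht htS => ?_⟩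
  obtain ⟨δ, hδ, hsep⟩ := exists_pos_forall_abs_sub_lt S t
  have h1 : max γ.α (t - δ) < t := max_lt ht.1 (by linarith)
  have h2 : t < min γ.β (t + δ) := lt_min ht.2 (by linarith)
  have h := hS (max γ.α (t - δ)) (min γ.β (t + δ)) (h1.trans h2)
    (Set.Icc_subset_Icc (le_max_left _ _) (min_le_left _ _))
    (Set.disjoint_left.mpr fun x hx hxS => htS (by
      have hx1 := (le_max_right γ.α (t - δ)).trans_lt hx.1
      have hx2 := hx.2.trans_le (min_le_right γ.β (t + δ))
      rwa [← hsep x (abs_lt.mpr ⟨by linarith, by linarith⟩) hxS]))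
  exact ((h.contDiffAt (Icc_mem_nhds h1 h2)).differentiableAt one_ne_zero).hasDerivAt

theorem exists_bound_deriv_of_contDiffOn {f : ℝ → ℂ} {a b : ℝ} (hab : a < b)
    (hf : ContDiffOn ℝ 1 f (Set.Icc a b)) : ∃ M, ∀ t ∈ Set.Ioo a b, ‖deriv f t‖ ≤ M := by
  have hc := hf.continuousOn_derivWithin (uniqueDiffOn_Icc hab) le_rfl
  obtain ⟨M, hM⟩ := isCompact_Icc.exists_bound_of_continuousOn hc
  refine ⟨M, fun t ht => ?_⟩
  rw [← derivWithin_of_mem_nhds (Icc_mem_nhds ht.1 ht.2)]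
  exact hM t (Set.Ioo_subset_Icc_self ht)

/-- The derivative is bounded near every parameter, on each of its two sides; compactness does the
rest. -/
theorem Curve.IsSimpleCurve.exists_bound_deriv (hγ : γ.IsSimpleCurve) :
    ∃ M, ∀ t ∈ Set.Ioo γ.α γ.β, ‖deriv γ.toFun t‖ ≤ M := by
  obtain ⟨S, hS⟩ := hγ.piecewise
  suffices h : ∃ M, ∀ t ∈ Set.Icc γ.α γ.β, t ∈ Set.Ioo γ.α γ.β → ‖deriv γ.toFun t‖ ≤ M by
    obtain ⟨M, hM⟩ := h
    exact ⟨M, fun t ht => hM t (Set.Ioo_subset_Icc_self ht) ht⟩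
  refine isCompact_Icc.induction_on
    (p := fun s => ∃ M, ∀ t ∈ s, t ∈ Set.Ioo γ.α γ.β → ‖deriv γ.toFun t‖ ≤ M) ⟨0, by simp⟩
    (fun s s' hss' ⟨M, hM⟩ => ⟨M, fun t ht => hM t (hss' ht)⟩)
    (fun s s' ⟨M, hM⟩ ⟨M', hM'⟩ => ⟨max M M', fun t ht ht' => ht.elim
      (fun h => (hM t h ht').trans (le_max_left _ _))
      fun h => (hM' t h ht').trans (le_max_right _ _)⟩) fun t ht => ?_
  obtain ⟨δ, hδ, hsep⟩ := exists_pos_forall_abs_sub_lt S t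
  have hright : ∃ M, ∀ x, t < x → x < t + δ → x < γ.β → ‖deriv γ.toFun x‖ ≤ M := by
    by_cases htβ : t < γ.β
    · have h2 : t < min γ.β (t + δ) := lt_min htβ (by linarith)
      obtain ⟨M, hM⟩ := exists_bound_deriv_of_contDiffOn h2 (hS _ _ h2
        (Set.Icc_subset_Icc ht.1 (min_le_left _ _)) (Set.disjoint_left.mpr fun x hx hxS => by
          have hx2 := hx.2.trans_le (min_le_right γ.β (t + δ))
          have hx1 := hx.1
          have := hsep x (abs_lt.mpr ⟨by linarith, by linarith⟩) hxS
          linarith))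
      exact ⟨M, fun x h1 h3 h4 => hM x ⟨h1, lt_min h4 h3⟩⟩
    · exact ⟨0, fun x h1 _ h3 => absurd (h1.trans h3) htβ⟩
  have hleft : ∃ M, ∀ x, x < t → t - δ < x → γ.α < x → ‖deriv γ.toFun x‖ ≤ M := by
    by_cases htα : γ.α < t
    · have h2 : max γ.α (t - δ) < t := max_lt htα (by linarith)
      obtain ⟨M, hM⟩ := exists_bound_deriv_of_contDiffOn h2 (hS _ _ h2
        (Set.Icc_subset_Icc (le_max_left _ _) ht.2) (Set.disjoint_left.mpr fun x hx hxS => by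
          have hx2 := (le_max_right γ.α (t - δ)).trans_lt hx.1
          have hx1 := hx.2
          have := hsep x (abs_lt.mpr ⟨by linarith, by linarith⟩) hxS
          linarith))
      exact ⟨M, fun x h1 h3 h4 => hM x ⟨max_lt h4 h3, h1⟩⟩
    · exact ⟨0, fun x h1 _ h3 => absurd (h3.trans h1) htα⟩
  obtain ⟨M₁, h₁⟩ := hright
  obtain ⟨M₂, h₂⟩ := hleft
  refine ⟨Set.Ioo (t - δ) (t + δ), mem_nhdsWithin_of_mem_nhds
    (Ioo_mem_nhds (by linarith) (by linarith)), max (max M₁ M₂) ‖deriv γ.toFun t‖,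
    fun x hx hx' => ?_⟩
  rcases lt_trichotomy x t with h | h | h
  · exact (h₂ x h hx.1 hx'.1).trans ((le_max_right _ _).trans (le_max_left _ _))
  · rw [h]
    exact le_max_right _ _
  · exact (h₁ x h hx.2 hx'.2).trans ((le_max_left _ _).trans (le_max_left _ _))

end CurveDeriv

/-! ### The terms of the Dyson series on vectors of finite energy -/

section DysonTerm

variable {H : Type*} [NormedAddCommGroup H] [InnerProductSpace ℂ H] [CompleteSpace H]
  {H₀ H₁ : H →ₗ.[ℂ] H} {b C E F : ℝ} {ψ : H} {k : ℕ} {A : Fin k → H →ₗ.[ℂ] H} {γ : Curve}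

theorem differentiable_expI {𝔅 : Type*} [NormedRing 𝔅] [NormedAlgebra ℂ 𝔅] [CompleteSpace 𝔅]
    (a : 𝔅) : Differentiable ℂ (expI a) := fun z => (hasDerivAt_expI a z).differentiableAt

theorem continuous_truncEvolved (H₀ A : H →ₗ.[ℂ] H) (F : ℝ) :
    Continuous (truncEvolved H₀ A F) := by
  have h := (differentiable_expI (trunc H₀ H₀ F)).continuous
  exact (h.mul continuous_const).mul (h.comp continuous_neg)

/-- The truncated versions of the operators `A₁(ζ), …, A_k(ζ), -i H₁(ζ), …, -i H₁(ζ)`. -/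
def truncFamily (H₀ H₁ : H →ₗ.[ℂ] H) (A : Fin k → H →ₗ.[ℂ] H) (F : ℝ) (n : ℕ) :
    Fin (k + n) → ℂ → H →L[ℂ] H :=
  Fin.append (fun j ζ => truncEvolved H₀ (A j) F ζ)
    fun _ ζ => (-Complex.I) • truncEvolved H₀ H₁ F ζ

theorem continuous_truncFamily (F : ℝ) (n : ℕ) (i : Fin (k + n)) :
    Continuous (truncFamily H₀ H₁ A F n i) := by
  refine Fin.addCases (fun j => ?_) (fun j => ?_) i
  · simpa [truncFamily] using continuous_truncEvolved H₀ (A j) F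
  · have h : truncFamily H₀ H₁ A F n (Fin.natAdd k j) =
        fun ζ => (-Complex.I) • truncEvolved H₀ H₁ F ζ := Fin.append_right _ _ j
    rw [h]
    exact (continuous_truncEvolved H₀ H₁ F).const_smul (-Complex.I)

/-- The operator-valued functions in the definition of `timeOrderedExpWith`. -/
abbrev evolvedFamily (H₀ H₁ : H →ₗ.[ℂ] H) (A : Fin k → H →ₗ.[ℂ] H) (n : ℕ) :
    Fin (k + n) → ℂ → H →ₗ.[ℂ] H :=
  withCopies (fun j ζ => evolved H₀ (A j) ζ) (fun ζ => (-Complex.I) • evolved H₀ H₁ ζ) n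

theorem agreesBelow_family (h₀ : IsBoundedBelowBy H₀ 0) (hb : 0 ≤ b)
    (h₁ : IsGradedOp H₀ H₁ b C) (hA : ∀ j, IsGradedOp H₀ (A j) b C) (n : ℕ) (i : Fin (k + n))
    (ζ : ℂ) :
    AgreesBelow H₀ b F (evolvedFamily H₀ H₁ A n i ζ) (truncFamily H₀ H₁ A F n i ζ) := by
  refine Fin.addCases (fun j => ?_) (fun j => ?_) i
  · simpa [truncFamily, withCopies] using (hA j).agreesBelow_evolved h₀ hb ζ
  · have := (h₁.agreesBelow_evolved (F := F) h₀ hb ζ).smul (-Complex.I)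
    simpa [truncFamily, withCopies] using this

/-- The operator products in the definition of time ordering are defined on vectors of finite energy,
and are products of truncated operators there. -/
theorem permProd_spec (h₀ : IsBoundedBelowBy H₀ 0) (hb : 0 ≤ b)
    (h₁ : IsGradedOp H₀ H₁ b C) (hA : ∀ j, IsGradedOp H₀ (A j) b C) (hE : 0 ≤ E)
    (hψ : ψ ∈ VE H₀ E) {n : ℕ} (hF : E + (k + n : ℕ) * b ≤ F) (σ : Equiv.Perm (Fin (k + n)))
    (ζ : Fin (k + n) → ℂ) :
    ψ ∈ (permProd (evolvedFamily H₀ H₁ A n) σ ζ).domain ∧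
      opApply (permProd (evolvedFamily H₀ H₁ A n) σ ζ) ψ =
        (List.ofFn fun i => truncFamily H₀ H₁ A F n (σ i) (ζ (σ i))).prod ψ := by
  have h := agreesBelow_opProd (H₀ := H₀) (F := F) (ψ := ψ) hb (List.finRange (k + n))
    (T := fun i => evolvedFamily H₀ H₁ A n (σ i) (ζ (σ i)))
    (B := fun i => truncFamily H₀ H₁ A F n (σ i) (ζ (σ i)))
    (fun i _ => agreesBelow_family h₀ hb h₁ hA n _ _) hE (by rwa [List.length_finRange]) hψ
  rw [permProd, List.ofFn_eq_map, List.ofFn_eq_map]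
  exact ⟨h.1, h.2.1⟩

/-- All vectors of finite energy are in the continuity domain of the time-ordered exponential. -/
theorem mem_continuityDomain (h₀ : IsBoundedBelowBy H₀ 0) (hb : 0 ≤ b)
    (h₁ : IsGradedOp H₀ H₁ b C) (hA : ∀ j, IsGradedOp H₀ (A j) b C) (hE : 0 ≤ E)
    (hψ : ψ ∈ VE H₀ E) :
    ψ ∈ continuityDomain γ (fun j ζ => evolved H₀ (A j) ζ)
      (fun ζ => (-Complex.I) • evolved H₀ H₁ ζ) := by
  intro n σ ζ _
  have h := fun τ : Fin n → ℂ => permProd_spec h₀ hb h₁ hA hE hψ le_rfl σ (Fin.append ζ τ)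
  refine ⟨fun τ _ => (h τ).1, ?_⟩
  refine ContinuousOn.congr (Continuous.continuousOn ?_) fun τ _ => (h τ).2
  have hc : Continuous fun τ : Fin n → ℂ => ((List.finRange (k + n)).map fun i =>
      truncFamily H₀ H₁ A (E + (k + n : ℕ) * b) n (σ i) (Fin.append ζ τ (σ i))).prod := by
    refine continuous_list_prod _ fun i _ => (continuous_truncFamily _ _ _).comp ?_
    refine Fin.addCases (fun j => ?_) (fun j => ?_) (σ i)
    · simpa using continuous_const
    · simpa using continuous_apply j
  simp only [List.ofFn_eq_map]
  exact hc.clm_apply continuous_const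

theorem timeOrderedProd_spec (h₀ : IsBoundedBelowBy H₀ 0) (hb : 0 ≤ b)
    (h₁ : IsGradedOp H₀ H₁ b C) (hA : ∀ j, IsGradedOp H₀ (A j) b C) (hE : 0 ≤ E)
    (hψ : ψ ∈ VE H₀ E) {n : ℕ} (hF : E + (k + n : ℕ) * b ≤ F) (ζ : Fin (k + n) → ℂ) :
    ψ ∈ (timeOrderedProd γ (evolvedFamily H₀ H₁ A n) ζ).domain ∧
      opApply (timeOrderedProd γ (evolvedFamily H₀ H₁ A n) ζ) ψ =
        ∑ σ : Equiv.Perm (Fin (k + n)), (open Classical in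
          if ∀ i j, i < j → γ.Later (ζ (σ i)) (ζ (σ j)) then
            (List.ofFn fun i => truncFamily H₀ H₁ A F n (σ i) (ζ (σ i))).prod ψ else 0) := by
  classical
  have h := opApply_sum_op (ψ := ψ) (Finset.univ : Finset (Equiv.Perm (Fin (k + n))))
    (T := fun σ => (if ∀ i j, i < j → γ.Later (ζ (σ i)) (ζ (σ j)) then (1 : ℂ) else 0) •
      permProd (evolvedFamily H₀ H₁ A n) σ ζ)
    fun σ _ => (permProd_spec h₀ hb h₁ hA hE hψ hF σ ζ).1
  rw [timeOrderedProd]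
  refine ⟨h.1, h.2.trans (Finset.sum_congr rfl fun σ _ => ?_)⟩
  rw [opApply_smul_op, (permProd_spec h₀ hb h₁ hA hE hψ hF σ ζ).2]
  split_ifs <;> simp

theorem Curve.IsSimpleCurve.later_iff (hγ : γ.IsSimpleCurve) {s t : ℝ} (hs : s ∈ γ.I)
    (ht : t ∈ γ.I) : γ.Later (γ.toFun s) (γ.toFun t) ↔ t < s := by
  constructor
  · rintro ⟨s', hs', t', ht', h1, h2, hlt⟩
    rwa [hγ.injOn hs' hs h1, hγ.injOn ht' ht h2] at hlt
  · exact fun h => ⟨s, hs, t, ht, rfl, rfl, h⟩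

theorem list_prod_smul {ι 𝔅 : Type*} [Ring 𝔅] [Algebra ℂ 𝔅] (L : List ι) (d : ι → ℂ) (B : ι → 𝔅) :
    (L.map fun i => d i • B i).prod = (L.map d).prod • (L.map B).prod := by
  induction L with
  | nil => simp
  | cons i L ih => simp only [List.map_cons, List.prod_cons, ih, smul_mul_smul_comm]

/-- Along the curve, off a null set, the integrand of the Dyson series is an ordered product. -/
theorem dysonIntegrand_eq_ordProd (h₀ : IsBoundedBelowBy H₀ 0) (hb : 0 ≤ b)
    (h₁ : IsGradedOp H₀ H₁ b C) (hA : ∀ j, IsGradedOp H₀ (A j) b C) (hE : 0 ≤ E)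
    (hψ : ψ ∈ VE H₀ E) {n : ℕ} (hF : E + (k + n : ℕ) * b ≤ F) (hγ : γ.IsSimpleCurve)
    {τ : Fin k → ℝ} (hτ : ∀ j, τ j ∈ γ.I) {op : ℝ → H →L[ℂ] H}
    (hopτ : ∀ j, op (τ j) = truncEvolved H₀ (A j) F (γ.toFun (τ j))) {t : Fin n → ℝ}
    (ht : ∀ i, t i ∈ γ.I)
    (hopt : ∀ i, op (t i) =
      deriv γ.toFun (t i) • (-Complex.I • truncEvolved H₀ H₁ F (γ.toFun (t i))))
    (hinj : Function.Injective (Fin.append τ t)) :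
    dysonIntegrand γ (fun j ζ => evolved H₀ (A j) ζ) (fun j => γ.toFun (τ j))
      (fun ζ => (-Complex.I) • evolved H₀ H₁ ζ) n ψ t =
      ordProd op (Finset.univ.image t ∪ Finset.univ.image τ) ψ := by
  classical
  set x := Fin.append τ t with hx
  have hxI : ∀ i, x i ∈ γ.I := by
    intro i
    refine Fin.addCases (fun j => ?_) (fun j => ?_) i
    · simpa [hx] using hτ j
    · simpa [hx] using ht j
  have hζ : (Fin.append (fun j => γ.toFun (τ j)) fun i => γ.toFun (t i)) =
      fun i => γ.toFun (x i) := by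
    funext i
    refine Fin.addCases (fun j => ?_) (fun j => ?_) i <;> simp [hx]
  let d : Fin (k + n) → ℂ := Fin.append (fun _ => 1) fun i => deriv γ.toFun (t i)
  have hd : ∏ i, d i = ∏ i, deriv γ.toFun (t i) := by
    rw [Fin.prod_univ_add]
    simp [d]
  have hop : ∀ i, op (x i) = d i • truncFamily H₀ H₁ A F n i (γ.toFun (x i)) := by
    intro i
    refine Fin.addCases (fun j => ?_) (fun j => ?_) i
    · simpa [hx, d, truncFamily] using hopτ j
    · simpa [hx, d, truncFamily] using hopt j
  have hprod : ∀ σ : Equiv.Perm (Fin (k + n)), ((List.ofFn (x ∘ σ)).map op).prod =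
      (∏ i, deriv γ.toFun (t i)) •
        (List.ofFn fun i => truncFamily H₀ H₁ A F n (σ i) (γ.toFun (x (σ i)))).prod := by
    intro σ
    have h1 : (List.ofFn (x ∘ σ)).map op = (List.finRange (k + n)).map fun i =>
        d (σ i) • truncFamily H₀ H₁ A F n (σ i) (γ.toFun (x (σ i))) := by
      rw [List.ofFn_eq_map, List.map_map]
      exact List.map_congr_left fun i _ => hop (σ i)
    rw [h1, list_prod_smul, ← List.ofFn_eq_map, ← List.ofFn_eq_map, List.prod_ofFn,
      Equiv.prod_comp σ d, hd]
  rw [dysonIntegrand, hζ, (timeOrderedProd_spec h₀ hb h₁ hA hE hψ hF _).2, ← image_append]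
  have h := sum_perm_eq_of_strictAnti hinj fun L => (L.map op).prod ψ
  rw [ordProd, ← h, Finset.smul_sum]
  refine Finset.sum_congr rfl fun σ _ => ?_
  have hiff : (∀ i j, i < j → γ.Later (γ.toFun (x (σ i))) (γ.toFun (x (σ j)))) ↔
      StrictAnti (x ∘ σ) :=
    ⟨fun h i j hij => (hγ.later_iff (hxI _) (hxI _)).mp (h i j hij),
      fun h i j hij => (hγ.later_iff (hxI _) (hxI _)).mpr (h hij)⟩
  simp only [hiff]
  by_cases hσ : StrictAnti (x ∘ σ)
  · rw [if_pos hσ, if_pos hσ, hprod, smul_apply]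
  · rw [if_neg hσ, if_neg hσ, smul_zero]

/-- A bounded measurable function with the prescribed values at the points `τⱼ`, and equal to
`γ'(u) K(γ(u))` at the other parameters. -/
theorem exists_measurable_op {𝔅 : Type*} [NormedRing 𝔅] [NormedAlgebra ℂ 𝔅] (hγ : γ.IsSimpleCurve)
    {τ : Fin k → ℝ} (hτ : Function.Injective τ) (c : Fin k → 𝔅) {K : ℂ → 𝔅}
    (hK : Continuous K) :
    ∃ op : ℝ → 𝔅, StronglyMeasurable op ∧ (∃ C, ∀ u, ‖op u‖ ≤ C) ∧ (∀ j, op (τ j) = c j) ∧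
      ∀ u ∈ Set.Ioo γ.α γ.β, (∀ j, u ≠ τ j) →
        op u = deriv γ.toFun u • K (γ.toFun u) := by
  classical
  obtain ⟨M, hM⟩ := hγ.exists_bound_deriv
  -- a continuous extension of the curve, for the sake of measurability
  let γe : ℝ → ℂ := Set.IccExtend hγ.le (Set.domRestrict γ.I γ.toFun)
  have hγe : Continuous γe := (continuousOn_iff_continuous_domRestrict.mp hγ.continuousOn).Icc_extend'
  have hγe_eq : ∀ u ∈ γ.I, γe u = γ.toFun u := fun u hu => Set.IccExtend_of_mem hγ.le _ hu
  obtain ⟨M', hM'⟩ := (isCompact_Icc (a := γ.α) (b := γ.β)).exists_bound_of_continuousOn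
    (hK.comp hγe).continuousOn
  let R : Set ℝ := Set.Ioo γ.α γ.β ∩ (Set.range τ)ᶜ
  have hR : MeasurableSet R :=
    measurableSet_Ioo.inter (Set.finite_range τ).measurableSet.compl
  refine ⟨fun u => ∑ j, ({τ j} : Set ℝ).indicator (fun _ => c j) u +
    R.indicator (fun u => deriv γ.toFun u • K (γe u)) u, ?_, ?_, ?_, ?_⟩
  · refine StronglyMeasurable.add (Finset.stronglyMeasurable_fun_sum _ fun j _ =>
      stronglyMeasurable_const.indicator (measurableSet_singleton _)) ?_
    exact ((measurable_deriv γ.toFun).stronglyMeasurable.smul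
      (hK.comp hγe).stronglyMeasurable).indicator hR
  · refine ⟨∑ j, ‖c j‖ + |M| * |M'|, fun u => (norm_add_le _ _).trans (add_le_add ?_ ?_)⟩
    · refine (norm_sum_le _ _).trans (Finset.sum_le_sum fun j _ => ?_)
      exact norm_indicator_le_norm_self (fun _ => c j) u
    · by_cases hu : u ∈ R
      · rw [Set.indicator_of_mem hu, norm_smul]
        exact mul_le_mul ((hM u hu.1).trans (le_abs_self M))
          ((hM' u (Set.Ioo_subset_Icc_self hu.1)).trans (le_abs_self M')) (norm_nonneg _)
          (abs_nonneg M)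
      · rw [Set.indicator_of_notMem hu, norm_zero]
        positivity
  · intro j
    have h1 : τ j ∉ R := fun h => h.2 ⟨j, rfl⟩
    simp only [Set.indicator_of_notMem h1, add_zero]
    rw [Finset.sum_eq_single_of_mem j (Finset.mem_univ j)]
    · simp
    · intro i _ hij
      exact Set.indicator_of_notMem (fun h => hij (hτ h.symm)) _
  · intro u hu huτ
    have h1 : u ∈ R := ⟨hu, by rintro ⟨j, rfl⟩; exact huτ j rfl⟩
    simp only [Set.indicator_of_mem h1]
    rw [Finset.sum_eq_zero, zero_add, hγe_eq u (Set.Ioo_subset_Icc_self hu)]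
    exact fun j _ => Set.indicator_of_notMem (s := {τ j}) (fun h => huτ j h) _

/-- The terms of the Dyson series are well defined on vectors of finite energy, and are given by
the algebraic coefficients of the truncated operators. -/
theorem dysonTerm_spec (h₀ : IsBoundedBelowBy H₀ 0) (hb : 0 ≤ b)
    (h₁ : IsGradedOp H₀ H₁ b C) (hA : ∀ j, IsGradedOp H₀ (A j) b C) (hE : 0 ≤ E)
    (hψ : ψ ∈ VE H₀ E) {n : ℕ} (hF : E + (k + n : ℕ) * b ≤ F) (hγ : γ.IsSimpleCurve)
    {τ : Fin k → ℝ} (hτ : ∀ j, τ j ∈ γ.I) (hτanti : StrictAnti τ) :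
    IntegrableOn (dysonIntegrand γ (fun j ζ => evolved H₀ (A j) ζ) (fun j => γ.toFun (τ j))
      (fun ζ => (-Complex.I) • evolved H₀ H₁ ζ) n ψ) (Set.univ.pi fun _ : Fin n => γ.I) ∧
    dysonTerm γ (fun j ζ => evolved H₀ (A j) ζ) (fun j => γ.toFun (τ j))
      (fun ζ => (-Complex.I) • evolved H₀ H₁ ζ) n ψ =
      (expI (trunc H₀ H₀ F) (γ.toFun γ.β) * chainCoeff (trunc H₀ H₀ F) (trunc H₀ H₁ F) γ.toFun γ.α
        (List.ofFn fun j => (τ j, trunc H₀ (A j) F)) n (γ.toFun γ.β)) ψ := by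
  classical
  obtain ⟨S, hS⟩ := hγ.exists_hasDerivAt
  obtain ⟨op, hop, ⟨C', hC'⟩, hopτ, hopt⟩ := exists_measurable_op hγ hτanti.injective
    (fun j => truncEvolved H₀ (A j) F (γ.toFun (τ j)))
    ((continuous_truncEvolved H₀ H₁ F).const_smul (-Complex.I))
  -- coincidences of the variables among each other, with the fixed points, or with the endpoints of
  -- the curve form a null set
  have hae : ∀ᵐ t : Fin n → ℝ, t ∈ (Set.univ.pi fun _ : Fin n => γ.I) →
      dysonIntegrand γ (fun j ζ => evolved H₀ (A j) ζ) (fun j => γ.toFun (τ j))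
        (fun ζ => (-Complex.I) • evolved H₀ H₁ ζ) n ψ t =
      ordProd op (Finset.univ.image t ∪ Finset.univ.image τ) ψ := by
    have hne : ∀ᵐ t : Fin n → ℝ, ∀ (x : ({γ.α, γ.β} : Finset ℝ)) (i : Fin n),
        t i ≠ x := by
      rw [ae_all_iff]; intro x
      rw [ae_all_iff]; intro i
      exact Measure.ae_eval_ne (fun _ : Fin n => (volume : Measure ℝ)) i (x : ℝ)
    filter_upwards [hne, ae_injective_append hτanti.injective n] with t h1 h2 h3
    have h3' : ∀ i, t i ∈ γ.I := fun i => h3 i trivial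
    refine dysonIntegrand_eq_ordProd h₀ hb h₁ hA hE hψ hF hγ hτ hopτ h3' (fun i => ?_) h2
    refine hopt (t i) ⟨lt_of_le_of_ne (h3' i).1 fun h => ?_, lt_of_le_of_ne (h3' i).2 fun h => ?_⟩
      fun j h => ?_
    · exact h1 ⟨γ.α, by simp⟩ i h.symm
    · exact h1 ⟨γ.β, by simp⟩ i h
    · exact (Fin.append_injective_iff.mp h2).2.2 j i h.symm
  have hcube := integrableOn_ordProd hop hC' (Finset.univ.image τ) n
    (volume_cube_ne_top (n := n) γ.α γ.β)
  have hcube' : IntegrableOn (fun t : Fin n → ℝ =>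
      ordProd op (Finset.univ.image t ∪ Finset.univ.image τ) ψ)
      (Set.univ.pi fun _ : Fin n => γ.I) :=
    (ContinuousLinearMap.apply ℂ H ψ).integrable_comp hcube
  have hae' := (ae_restrict_iff' (measurableSet_box γ n)).mpr hae
  refine ⟨hcube'.congr_fun_ae (hae'.mono fun t ht => ht.symm), ?_⟩
  have hint := ContinuousLinearMap.integral_apply hcube ψ
  rw [dysonTerm, integral_congr_ae hae']
  have hL : (List.ofFn fun j => (τ j, trunc H₀ (A j) F)).map Prod.fst = List.ofFn τ := by
    rw [List.map_ofFn]; rfl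
  have himg : (List.ofFn τ).toFinset = Finset.univ.image τ := by
    ext x
    simp [List.mem_ofFn]
  have h := cubeIntegral_eq_chainCoeff (a := trunc H₀ H₀ F) (b := trunc H₀ H₁ F) (op := op)
    (γ := γ.toFun) (α := γ.α) (β := γ.β) hγ.continuousOn hop hC'
    (γ' := deriv γ.toFun) (S := (↑S ∪ Set.range τ)) (S.countable_toSet.union (Set.countable_range τ))
    (fun t ht => ⟨hS t ht.1 fun h => ht.2 (Or.inl h), hopt t ht.1
      fun j h => ht.2 (Or.inr ⟨j, h.symm⟩)⟩)
    (L := List.ofFn fun j => (τ j, trunc H₀ (A j) F))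
    (List.pairwise_ofFn.mpr fun i j hij => hτanti hij)
    (fun x hx => by
      obtain ⟨j, rfl⟩ := (List.mem_ofFn' _ _).mp hx
      exact ⟨(hτ j).1, hopτ j⟩) n hγ.le le_rfl
    (fun x hx => by
      obtain ⟨j, rfl⟩ := (List.mem_ofFn' _ _).mp hx
      exact (hτ j).2)
  rw [hL, himg] at h
  refine (congrArg _ hint.symm).trans ?_
  change _ • cubeIntegral op γ.α n (Finset.univ.image τ) γ.β ψ = _
  rw [h, smul_apply, smul_smul, inv_mul_cancel₀ (by exact_mod_cast n.factorial_ne_zero), one_smul]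

end DysonTerm

/-! ### The Dyson series of the complex time evolution -/

section WordSumComm

/-- For commuting letters, the words are counted by binomial coefficients. -/
theorem wordSum_eq_choose {R : Type*} [CommRing R] (x y : R) (N p : ℕ) :
    wordSum x y N p = N.choose p * x ^ (N - p) * y ^ p := by
  induction N generalizing p with
  | zero => cases p <;> simp [wordSum]
  | succ N ih =>
    cases p with
    | zero => simp [wordSum, ih, pow_succ']
    | succ p =>
      rw [wordSum, ih, ih, Nat.choose_succ_succ, Nat.add_sub_add_right]
      rcases Nat.lt_or_ge p N with h | h
      · have h1 : N - p = (N - (p + 1)) + 1 := by omega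
        rw [h1]
        push_cast
        ring
      · rw [Nat.choose_eq_zero_of_lt (by omega : N < p + 1)]
        push_cast
        ring

/-- The coefficient of `λᵖ` in `e^{t(x + λy)}`. -/
theorem hasSum_wordSum (t x y : ℝ) (p : ℕ) :
    HasSum (fun N : ℕ => t ^ N / N.factorial * wordSum x y N p)
      (Real.exp (t * x) * ((t * y) ^ p / p.factorial)) := by
  have h1 : HasSum (fun N : ℕ => (t * x) ^ N / N.factorial) (Real.exp (t * x)) := by
    rw [Real.exp_eq_exp_ℝ]
    exact NormedSpace.expSeries_div_hasSum_exp (𝔸 := ℝ) (t * x)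
  refine ((add_left_injective p).hasSum_iff ?_).mp
    ((h1.mul_right ((t * y) ^ p / p.factorial)).congr_fun fun N => ?_)
  · intro N hN
    have : N < p := by
      by_contra h
      exact hN ⟨N - p, by simp only; omega⟩
    rw [wordSum_eq_choose, Nat.choose_eq_zero_of_lt this]
    simp
  · have h2 : ((N + p).factorial : ℝ) = ((N + p).choose p : ℝ) * N.factorial * p.factorial := by
      have := Nat.add_choose_mul_factorial_mul_factorial N p
      exact_mod_cast this.symm
    have h3 : ((N + p).choose p : ℝ) ≠ 0 := by
      exact_mod_cast (Nat.choose_pos (Nat.le_add_left p N)).ne'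
    have h4 : (N.factorial : ℝ) ≠ 0 := by exact_mod_cast N.factorial_ne_zero
    have h5 : (p.factorial : ℝ) ≠ 0 := by exact_mod_cast p.factorial_ne_zero
    simp only [Function.comp_apply]
    rw [wordSum_eq_choose, Nat.add_sub_cancel, h2]
    field_simp
    ring

end WordSumComm

section WordVec

variable {H : Type*} [NormedAddCommGroup H] [InnerProductSpace ℂ H] [CompleteSpace H]

/-- The sum of all words of length `N` in the operators `H₀` and `H₁` with exactly `p` letters `H₁`,
applied to `ψ`. -/
def wordVec (H₀ H₁ : H →ₗ.[ℂ] H) (ψ : H) : ℕ → ℕ → H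
  | 0, 0 => ψ
  | 0, _ + 1 => 0
  | N + 1, 0 => opApply H₀ (wordVec H₀ H₁ ψ N 0)
  | N + 1, p + 1 => opApply H₀ (wordVec H₀ H₁ ψ N (p + 1)) + opApply H₁ (wordVec H₀ H₁ ψ N p)

/-- The term of order `p` in `H₁` of the expansion of `e^{-iw(H₀ + H₁)} ψ`. -/
def dysonVec (H₀ H₁ : H →ₗ.[ℂ] H) (p : ℕ) (w : ℂ) (ψ : H) : H :=
  ∑' N : ℕ, ((-Complex.I * w) ^ N / N.factorial : ℂ) • wordVec H₀ H₁ ψ N p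

variable {H₀ H₁ : H →ₗ.[ℂ] H} {b C E F : ℝ} {ψ : H}

omit [CompleteSpace H] in
theorem wordVec_eq_zero {N p : ℕ} (h : N < p) (ψ : H) : wordVec H₀ H₁ ψ N p = 0 := by
  induction N generalizing p with
  | zero =>
    cases p with
    | zero => omega
    | succ p => rfl
  | succ N ih =>
    cases p with
    | zero => omega
    | succ p => rw [wordVec, ih (by omega), ih (by omega), opApply_zero, opApply_zero, add_zero]

theorem wordVec_mem_VE (h₀ : IsBoundedBelowBy H₀ 0) (hb : 0 ≤ b) (h₁ : IsGradedOp H₀ H₁ b C)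
    (hE : 0 ≤ E) (hψ : ψ ∈ VE H₀ E) (N p : ℕ) : wordVec H₀ H₁ ψ N p ∈ VE H₀ (E + p * b) := by
  induction N generalizing p with
  | zero =>
    cases p with
    | zero => simpa [wordVec] using hψ
    | succ p => exact Submodule.zero_mem _
  | succ N ih =>
    cases p with
    | zero => exact h₀.opApply_mem_VE (ih 0)
    | succ p =>
      refine Submodule.add_mem _ (h₀.opApply_mem_VE (ih (p + 1))) ?_
      have := (h₁.mapsTo (E + p * b) (by positivity)).opApply_mem (ih p)
      push_cast
      rwa [add_one_mul, ← add_assoc]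

/-- Words with `p` letters `H₁` can be computed with the operators truncated to `V_{E + pb}`. -/
theorem wordVec_eq_wordSum (h₀ : IsBoundedBelowBy H₀ 0) (hb : 0 ≤ b) (h₁ : IsGradedOp H₀ H₁ b C)
    (hE : 0 ≤ E) (hψ : ψ ∈ VE H₀ E) (N : ℕ) {p : ℕ} (hF : E + p * b ≤ F) :
    wordVec H₀ H₁ ψ N p = wordSum (trunc H₀ H₀ F) (trunc H₀ H₁ F) N p ψ := by
  have hF0 : 0 ≤ F := le_trans (by positivity) hF
  have hH₀ : ∀ N p : ℕ, E + p * b ≤ F → trunc H₀ H₀ F (wordVec H₀ H₁ ψ N p) =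
      opApply H₀ (wordVec H₀ H₁ ψ N p) := fun N p h =>
    (h₀.isBoundedOnVE hF0).trunc_of_mem (VE_mono H₀ h (wordVec_mem_VE h₀ hb h₁ hE hψ N p))
  have hH₁ : ∀ N p : ℕ, E + p * b ≤ F → trunc H₀ H₁ F (wordVec H₀ H₁ ψ N p) =
      opApply H₁ (wordVec H₀ H₁ ψ N p) := fun N p h =>
    (h₁.isBoundedOnVE hF0).trunc_of_mem (VE_mono H₀ h (wordVec_mem_VE h₀ hb h₁ hE hψ N p))
  induction N generalizing p with
  | zero => cases p <;> simp [wordVec, wordSum]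
  | succ N ih =>
    cases p with
    | zero => rw [wordVec, wordSum, mul_apply_eq_comp, ← ih hF, hH₀ N 0 hF]
    | succ p =>
      have hF' : E + p * b ≤ F := by
        push_cast at hF
        linarith
      rw [wordVec, wordSum, add_apply, mul_apply_eq_comp, mul_apply_eq_comp, ← ih hF, ← ih hF',
        hH₀ N (p + 1) hF, hH₁ N p hF']

/-- All the vectors that occur in words with `p` letters `H₁` have energy at most `X`, so the letters can
be replaced by the bounds `X` and `C √(X + 1)` on `V_X`. -/
theorem norm_wordVec_le (h₀ : IsBoundedBelowBy H₀ 0) (hb : 0 ≤ b) (hC : 0 ≤ C)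
    (h₁ : IsGradedOp H₀ H₁ b C) (hE : 0 ≤ E) (hψ : ψ ∈ VE H₀ E) (N : ℕ) {p : ℕ} {X : ℝ}
    (hX : E + p * b ≤ X) :
    ‖wordVec H₀ H₁ ψ N p‖ ≤ wordSum X (C * √(X + 1)) N p * ‖ψ‖ := by
  have hX0 : 0 ≤ X := le_trans (by positivity) hX
  have hH₀ : ∀ N p : ℕ, E + p * b ≤ X → ‖opApply H₀ (wordVec H₀ H₁ ψ N p)‖ ≤
      X * ‖wordVec H₀ H₁ ψ N p‖ := fun N p h =>
    (h₀.isBoundedOnVE hX0).norm_le _ (VE_mono H₀ h (wordVec_mem_VE h₀ hb h₁ hE hψ N p))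
  have hH₁ : ∀ N p : ℕ, E + p * b ≤ X → ‖opApply H₁ (wordVec H₀ H₁ ψ N p)‖ ≤
      C * √(X + 1) * ‖wordVec H₀ H₁ ψ N p‖ := fun N p h =>
    h₁.norm_le X hX0 _ (VE_mono H₀ h (wordVec_mem_VE h₀ hb h₁ hE hψ N p))
  induction N generalizing p with
  | zero => cases p <;> simp [wordVec, wordSum]
  | succ N ih =>
    cases p with
    | zero =>
      rw [wordVec, wordSum, mul_assoc]
      exact (hH₀ N 0 hX).trans (mul_le_mul_of_nonneg_left (ih hX) hX0)
    | succ p =>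
      have hX' : E + p * b ≤ X := by
        push_cast at hX
        linarith
      rw [wordVec, wordSum, add_mul, mul_assoc, mul_assoc (C * √(X + 1))]
      exact (norm_add_le _ _).trans (add_le_add
        ((hH₀ N (p + 1) hX).trans (mul_le_mul_of_nonneg_left (ih hX) hX0))
        ((hH₁ N p hX').trans (mul_le_mul_of_nonneg_left (ih hX') (by positivity))))

/-- The bound for the term of order `p` of the expansion on `V_E`. -/
def dysonBound (b C t : ℝ) (p : ℕ) (E : ℝ) : ℝ :=
  Real.exp (t * (E + p * b)) * ((t * (C * √(E + p * b + 1))) ^ p / p.factorial)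

theorem summable_norm_dysonVec_term (h₀ : IsBoundedBelowBy H₀ 0) (hb : 0 ≤ b) (hC : 0 ≤ C)
    (h₁ : IsGradedOp H₀ H₁ b C) (hE : 0 ≤ E) (hψ : ψ ∈ VE H₀ E) (p : ℕ) (w : ℂ) :
    Summable (fun N : ℕ => ‖((-Complex.I * w) ^ N / N.factorial : ℂ) • wordVec H₀ H₁ ψ N p‖) ∧
    ∑' N : ℕ, ‖((-Complex.I * w) ^ N / N.factorial : ℂ) • wordVec H₀ H₁ ψ N p‖ ≤
      dysonBound b C ‖w‖ p E * ‖ψ‖ := by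
  have h := (hasSum_wordSum ‖w‖ (E + p * b) (C * √(E + p * b + 1)) p).mul_right ‖ψ‖
  have hle : ∀ N : ℕ, ‖((-Complex.I * w) ^ N / N.factorial : ℂ) • wordVec H₀ H₁ ψ N p‖ ≤
      ‖w‖ ^ N / N.factorial * wordSum (E + p * b) (C * √(E + p * b + 1)) N p * ‖ψ‖ := by
    intro N
    rw [norm_expSeries_term, norm_mul, norm_neg, Complex.norm_I, one_mul, mul_assoc]
    exact mul_le_mul_of_nonneg_left (norm_wordVec_le h₀ hb hC h₁ hE hψ N le_rfl) (by positivity)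
  have hs := Summable.of_nonneg_of_le (fun _ => norm_nonneg _) hle h.summable
  exact ⟨hs, (hs.tsum_le_tsum hle h.summable).trans_eq h.tsum_eq⟩

theorem norm_dysonVec_le (h₀ : IsBoundedBelowBy H₀ 0) (hb : 0 ≤ b) (hC : 0 ≤ C)
    (h₁ : IsGradedOp H₀ H₁ b C) (hE : 0 ≤ E) (hψ : ψ ∈ VE H₀ E) (p : ℕ) (w : ℂ) :
    ‖dysonVec H₀ H₁ p w ψ‖ ≤ dysonBound b C ‖w‖ p E * ‖ψ‖ := by
  obtain ⟨h1, h2⟩ := summable_norm_dysonVec_term h₀ hb hC h₁ hE hψ p w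
  exact (norm_tsum_le_tsum_norm h1).trans h2

theorem tsum_mem_VE {f : ℕ → H} (hf : ∀ n, f n ∈ VE H₀ E) : ∑' n, f n ∈ VE H₀ E := by
  by_cases h : Summable f
  · exact (isClosed_VE H₀ E).mem_of_tendsto h.hasSum
      (Eventually.of_forall fun s => Submodule.sum_mem _ fun n _ => hf n)
  · rw [tsum_eq_zero_of_not_summable h]
    exact Submodule.zero_mem _

theorem dysonVec_mem_VE (h₀ : IsBoundedBelowBy H₀ 0) (hb : 0 ≤ b) (h₁ : IsGradedOp H₀ H₁ b C)
    (hE : 0 ≤ E) (hψ : ψ ∈ VE H₀ E) (p : ℕ) (w : ℂ) :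
    dysonVec H₀ H₁ p w ψ ∈ VE H₀ (E + p * b) :=
  tsum_mem_VE fun N => Submodule.smul_mem _ _ (wordVec_mem_VE h₀ hb h₁ hE hψ N p)

theorem dysonVec_eq_dysonCoeff (h₀ : IsBoundedBelowBy H₀ 0) (hb : 0 ≤ b)
    (h₁ : IsGradedOp H₀ H₁ b C) (hE : 0 ≤ E) (hψ : ψ ∈ VE H₀ E) {p : ℕ} (hF : E + p * b ≤ F)
    (w : ℂ) : dysonVec H₀ H₁ p w ψ = dysonCoeff (trunc H₀ H₀ F) (trunc H₀ H₁ F) p w ψ := by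
  have h := (ContinuousLinearMap.apply ℂ H ψ).hasSum
    (summable_dysonCoeff (trunc H₀ H₀ F) (trunc H₀ H₁ F) p w).hasSum
  refine Eq.trans (tsum_congr fun N => ?_) h.tsum_eq
  rw [wordVec_eq_wordSum h₀ hb h₁ hE hψ N hF]
  rfl

open ProjValuedMeasure

theorem Dfin_le_domain_add (h₀ : IsBoundedBelowBy H₀ 0) (h₁ : IsGradedOp H₀ H₁ b C) (hE : 0 ≤ E)
    (hψ : ψ ∈ VE H₀ E) : ψ ∈ (H₀ + H₁).domain :=
  ⟨(h₀.isBoundedOnVE hE).le_domain hψ, (h₁.isBoundedOnVE hE).le_domain hψ⟩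

/-- The words of length `N` sum up to `(H₀ + H₁)ᴺ`; here this identity is multiplied by a spectral
projection of `H₀ + H₁`. -/
theorem proj_sum_wordVec {a : ℝ} (h₀ : IsBoundedBelowBy H₀ 0) (hb : 0 ≤ b)
    (h₁ : IsGradedOp H₀ H₁ b C) (h : IsBoundedBelowBy (H₀ + H₁) a) (hE : 0 ≤ E) (hψ : ψ ∈ VE H₀ E)
    (c : ℝ) (N : ℕ) :
    (spectralMeasure (H₀ + H₁)).proj (Set.Icc a c)
      (∑ p ∈ Finset.range (N + 1), wordVec H₀ H₁ ψ N p) =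
      (spectralMeasure (H₀ + H₁)).fn (fun x : ℝ => (x : ℂ) ^ N)
        ((spectralMeasure (H₀ + H₁)).proj (Set.Icc a c) ψ) := by
  have hm : MeasurableSet (Set.Icc a c) := measurableSet_Icc
  have habs : ∀ᵐ x ∂(spectralMeasure (H₀ + H₁)).measure
      ((spectralMeasure (H₀ + H₁)).proj (Set.Icc a c) ψ), |x| ≤ |a| + |c| := by
    filter_upwards [ae_mem_of_proj_eq hm (proj_idem hm ψ)] with x hx
    refine abs_le.mpr ⟨?_, ?_⟩
    · linarith [hx.1, neg_abs_le a, abs_nonneg c]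
    · linarith [hx.2, le_abs_self c, abs_nonneg a]
  induction N with
  | zero => simp [wordVec, fn_one]
  | succ N ih =>
    set φ := ∑ p ∈ Finset.range (N + 1), wordVec H₀ H₁ ψ N p with hφ
    have hmem : ∀ p ∈ Finset.range (N + 1), wordVec H₀ H₁ ψ N p ∈ VE H₀ (E + N * b) := fun p hp =>
      VE_mono H₀ (by
        have : (p : ℝ) ≤ N := by exact_mod_cast Finset.mem_range_succ_iff.mp hp
        gcongr) (wordVec_mem_VE h₀ hb h₁ hE hψ N p)
    have hφV : φ ∈ VE H₀ (E + N * b) := Submodule.sum_mem _ hmem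
    have hE' : 0 ≤ E + N * b := by positivity
    have hφd : φ ∈ (H₀ + H₁).domain := Dfin_le_domain_add h₀ h₁ hE' hφV
    have hlin : ∀ {T : H →ₗ.[ℂ] H}, VE H₀ (E + N * b) ≤ T.domain →
        ∑ p ∈ Finset.range (N + 1), opApply T (wordVec H₀ H₁ ψ N p) = opApply T φ := fun hT =>
      (opApply_finset_sum _ fun p hp => hT (hmem p hp)).symm
    have hsum : ∑ p ∈ Finset.range (N + 1 + 1), wordVec H₀ H₁ ψ (N + 1) p =
        opApply (H₀ + H₁) φ := by
      have hd₀ := (h₀.isBoundedOnVE hE').le_domain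
      have hd₁ := (h₁.isBoundedOnVE hE').le_domain
      rw [opApply_add_op (hd₀ hφV) (hd₁ hφV), ← hlin hd₀, ← hlin hd₁, Finset.sum_range_succ']
      simp only [wordVec, Finset.sum_add_distrib]
      rw [add_right_comm, ← Finset.sum_range_succ' (fun p => opApply H₀ (wordVec H₀ H₁ ψ N p)),
        Finset.sum_range_succ, wordVec_eq_zero (Nat.lt_succ_self N), opApply_zero, add_zero]
    rw [hsum, h.spec.opApply_eq, proj_fn hm Complex.measurable_ofReal (h.spec.mem_domain.mp hφd),
      ← (proj_fn_comm hm Complex.measurable_ofReal (h.spec.mem_domain.mp hφd)).1, ih,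
      fn_ofReal_fn_pow habs]

end WordVec

/-! ### Factorial estimates -/

section Estimates

theorem summable_pow_div_sqrt_factorial {M : ℝ} (hM : 0 ≤ M) :
    Summable fun n : ℕ => M ^ n / √(n.factorial : ℝ) := by
  have h1 := (Real.summable_pow_div_factorial (2 * M ^ 2)).add
    (summable_geometric_of_lt_one (r := (1 / 2 : ℝ)) (by norm_num) (by norm_num))
  refine Summable.of_nonneg_of_le (fun n => by positivity) (fun n => ?_) h1
  -- the arithmetic-geometric mean inequality for `(2 M²)ⁿ / n!` and `2⁻ⁿ`
  have h2 : (0 : ℝ) ≤ (2 * M ^ 2) ^ n / n.factorial := by positivity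
  have h3 : (0 : ℝ) ≤ (1 / 2) ^ n := by positivity
  have h4 : (M ^ n / √(n.factorial : ℝ)) ^ 2 = (2 * M ^ 2) ^ n / n.factorial * (1 / 2) ^ n := by
    rw [div_pow, Real.sq_sqrt (by positivity), mul_pow, div_pow, one_pow, ← pow_mul, ← pow_mul,
      mul_comm n 2]
    field_simp
  refine abs_le_of_sq_le_sq' ?_ (by positivity) |>.2
  rw [h4]
  nlinarith [mul_nonneg h2 h3]

/-- The factorial of the order `p` of perturbation theory compensates both the growth `√(n + 1)ᵖ` of the
operator norms and the passage from `√q!` to `√(p + q)!`. -/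
theorem sqrt_pow_div_factorial_le (p q : ℕ) :
    √((p + q : ℕ) + 1 : ℝ) ^ p / (p.factorial * √(q.factorial : ℝ)) ≤
      Real.exp 1 ^ (p + q + 1) * 2 ^ (p + q) / √((p + q).factorial : ℝ) := by
  set n := p + q with hn
  have hq : (0 : ℝ) < q.factorial := by exact_mod_cast q.factorial_pos
  have hp : (0 : ℝ) < p.factorial := by exact_mod_cast p.factorial_pos
  have hnf : (0 : ℝ) < n.factorial := by exact_mod_cast n.factorial_pos
  have h1 : √((n : ℝ) + 1) ^ p * √(q.factorial : ℝ) ≤ Real.exp 1 ^ (n + 1) * √(n.factorial : ℝ) := by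
    refine abs_le_of_sq_le_sq' ?_ (by positivity) |>.2
    rw [mul_pow, mul_pow, Real.sq_sqrt hq.le, Real.sq_sqrt hnf.le, ← pow_mul, mul_comm p 2, pow_mul,
      Real.sq_sqrt (by positivity)]
    have h2 : (q.factorial : ℝ) ≤ ((n : ℝ) + 1) ^ q := by
      have : q.factorial ≤ (n + 1) ^ q :=
        (Nat.factorial_le_pow q).trans (Nat.pow_le_pow_left (by omega) q)
      exact_mod_cast this
    have h3 : ((n : ℝ) + 1) ^ n ≤ Real.exp 1 ^ (n + 1) * n.factorial := by
      have h4 := Real.pow_div_factorial_le_exp ((n : ℝ) + 1) (by positivity) (n + 1)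
      rw [div_le_iff₀ (by positivity), Nat.factorial_succ] at h4
      have h5 : Real.exp 1 ^ (n + 1) = Real.exp ((n : ℝ) + 1) := by
        rw [← Real.exp_nat_mul]
        push_cast
        ring_nf
      rw [h5]
      push_cast at h4
      rw [pow_succ] at h4
      have h6 : (0 : ℝ) < (n : ℝ) + 1 := by positivity
      refine le_of_mul_le_mul_right ?_ h6
      linarith
    have h7 : (1 : ℝ) ≤ Real.exp 1 ^ (n + 1) := one_le_pow₀ (Real.one_le_exp zero_le_one)
    calc ((n : ℝ) + 1) ^ p * q.factorial ≤ ((n : ℝ) + 1) ^ p * ((n : ℝ) + 1) ^ q := by gcongr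
      _ = ((n : ℝ) + 1) ^ n := by rw [← pow_add]
      _ ≤ 1 * (Real.exp 1 ^ (n + 1) * n.factorial) := by rw [one_mul]; exact h3
      _ ≤ Real.exp 1 ^ (n + 1) * (Real.exp 1 ^ (n + 1) * n.factorial) := by gcongr
      _ = _ := by ring
  have h8 : (n.factorial : ℝ) ≤ 2 ^ n * (p.factorial * q.factorial) := by
    have h9 := Nat.add_choose_mul_factorial_mul_factorial p q
    have h10 : (n.factorial : ℕ) ≤ 2 ^ n * (p.factorial * q.factorial) := by
      rw [hn, ← h9, mul_assoc]
      exact Nat.mul_le_mul_right _ (Nat.choose_le_two_pow _ _)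
    exact_mod_cast h10
  rw [div_le_div_iff₀ (by positivity) (by positivity)]
  have hsq : √(q.factorial : ℝ) * √(q.factorial : ℝ) = q.factorial := Real.mul_self_sqrt hq.le
  have hsn : √(n.factorial : ℝ) * √(n.factorial : ℝ) = n.factorial := Real.mul_self_sqrt hnf.le
  refine le_of_mul_le_mul_right ?_ (Real.sqrt_pos.mpr hq)
  calc √((n : ℝ) + 1) ^ p * √(n.factorial : ℝ) * √(q.factorial : ℝ)
      = (√((n : ℝ) + 1) ^ p * √(q.factorial : ℝ)) * √(n.factorial : ℝ) := by ring
    _ ≤ (Real.exp 1 ^ (n + 1) * √(n.factorial : ℝ)) * √(n.factorial : ℝ) := by gcongr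
    _ = Real.exp 1 ^ (n + 1) * n.factorial := by rw [mul_assoc, hsn]
    _ ≤ Real.exp 1 ^ (n + 1) * (2 ^ n * (p.factorial * q.factorial)) := by gcongr
    _ = Real.exp 1 ^ (n + 1) * 2 ^ n * p.factorial * (√(q.factorial : ℝ) * √(q.factorial : ℝ)) := by
      rw [hsq]; ring
    _ = _ := by ring

/-- The bounds `Mᑫ⁺¹ / √q!` of the graded components are reproduced by the terms of the Dyson
series. -/
theorem exists_dysonBound_le {b C t M : ℝ} (hb : 0 ≤ b) (hC : 0 ≤ C) (ht : 0 ≤ t) (hM : 0 ≤ M)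
    (d : ℕ) : ∃ Λ : ℝ, 0 ≤ Λ ∧ ∀ p q : ℕ,
      dysonBound b C t p ((q + d : ℕ) * b) * (M ^ (q + 1) / √(q.factorial : ℝ)) ≤
        Λ ^ (p + q + 1) / √((p + q).factorial : ℝ) := by
  set κ : ℝ := d * b + b + 1 with hκ
  set K : ℝ := t * (C * √κ) with hK
  have hκ0 : 0 ≤ κ := by positivity
  have hK0 : 0 ≤ K := by positivity
  refine ⟨Real.exp (t * b * d) * Real.exp (t * b) * (K + M + 1) * Real.exp 1 * 2, by positivity,
    fun p q => ?_⟩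
  set n := p + q with hn
  have hq : (0 : ℝ) < q.factorial := by exact_mod_cast q.factorial_pos
  have hp : (0 : ℝ) < p.factorial := by exact_mod_cast p.factorial_pos
  have hE : ((q + d : ℕ) : ℝ) * b + p * b = ((n : ℝ) + d) * b := by
    rw [hn]; push_cast; ring
  have h1 : Real.exp (t * (((q + d : ℕ) : ℝ) * b + p * b)) =
      Real.exp (t * b * d) * Real.exp (t * b) ^ n := by
    rw [hE, ← Real.exp_nat_mul, ← Real.exp_add]
    ring_nf
  have h2 : √(((q + d : ℕ) : ℝ) * b + p * b + 1) ≤ √κ * √((n : ℝ) + 1) := by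
    rw [← Real.sqrt_mul hκ0, hE]
    refine Real.sqrt_le_sqrt ?_
    have h3 : 0 ≤ (n : ℝ) * (d * b) := by positivity
    have h4 : 0 ≤ (n : ℝ) := by positivity
    rw [hκ]
    nlinarith
  have h5 : (t * (C * √(((q + d : ℕ) : ℝ) * b + p * b + 1))) ^ p ≤ K ^ p * √((n : ℝ) + 1) ^ p := by
    rw [← mul_pow]
    refine pow_le_pow_left₀ (by positivity) ?_ p
    calc t * (C * √(((q + d : ℕ) : ℝ) * b + p * b + 1)) ≤ t * (C * (√κ * √((n : ℝ) + 1))) := by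
          gcongr
      _ = _ := by rw [hK]; ring
  have h6 : K ^ p * M ^ (q + 1) ≤ (K + M + 1) ^ (n + 1) := by
    calc K ^ p * M ^ (q + 1) ≤ (K + M + 1) ^ p * (K + M + 1) ^ (q + 1) := by
          gcongr <;> linarith
      _ = _ := by rw [← pow_add]; congr 1
  have hA : (1 : ℝ) ≤ Real.exp (t * b * d) := Real.one_le_exp (by positivity)
  have hB : (1 : ℝ) ≤ Real.exp (t * b) := Real.one_le_exp (by positivity)
  rw [dysonBound, h1]
  calc Real.exp (t * b * d) * Real.exp (t * b) ^ n *
        ((t * (C * √(((q + d : ℕ) : ℝ) * b + p * b + 1))) ^ p / p.factorial) *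
        (M ^ (q + 1) / √(q.factorial : ℝ))
      ≤ Real.exp (t * b * d) * Real.exp (t * b) ^ n *
        (K ^ p * √((n : ℝ) + 1) ^ p / p.factorial) * (M ^ (q + 1) / √(q.factorial : ℝ)) := by
        gcongr
    _ = Real.exp (t * b * d) * Real.exp (t * b) ^ n * (K ^ p * M ^ (q + 1)) *
        (√((n : ℝ) + 1) ^ p / (p.factorial * √(q.factorial : ℝ))) := by
        field_simp
    _ ≤ Real.exp (t * b * d) * Real.exp (t * b) ^ n * (K + M + 1) ^ (n + 1) *
        (Real.exp 1 ^ (n + 1) * 2 ^ n / √(n.factorial : ℝ)) := by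
        have h7 := sqrt_pow_div_factorial_le p q
        rw [← hn] at h7
        gcongr
    _ ≤ Real.exp (t * b * d) ^ (n + 1) * Real.exp (t * b) ^ (n + 1) * (K + M + 1) ^ (n + 1) *
        (Real.exp 1 ^ (n + 1) * 2 ^ (n + 1) / √(n.factorial : ℝ)) := by
        gcongr
        · exact le_self_pow₀ hA (Nat.succ_ne_zero n)
        · omega
        · norm_num
        · omega
    _ = _ := by
        rw [mul_pow, mul_pow, mul_pow, mul_pow]
        ring

end Estimates

/-! ### The Dyson series on vectors of finite energy -/

section DysonSeries

variable {H : Type*} [NormedAddCommGroup H] [InnerProductSpace ℂ H] [CompleteSpace H]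
  {H₀ H₁ : H →ₗ.[ℂ] H} {a b C E F : ℝ} {ψ : H} {w : ℂ}

open ProjValuedMeasure

theorem exists_mem_VE_nat_mul (hb : 0 < b) (hψ : ψ ∈ VE H₀ E) : ∃ d : ℕ, ψ ∈ VE H₀ (d * b) := by
  obtain ⟨d, hd⟩ := exists_nat_ge (E / b)
  exact ⟨d, VE_mono H₀ ((div_le_iff₀ hb).mp hd) hψ⟩

theorem summable_dysonBound (hb : 0 ≤ b) (hC : 0 ≤ C) (t : ℝ) (ht : 0 ≤ t) (d : ℕ) :
    Summable fun p : ℕ => dysonBound b C t p (d * b) := by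
  obtain ⟨Λ, hΛ, h⟩ := exists_dysonBound_le hb hC ht zero_le_one d
  refine Summable.of_nonneg_of_le (fun p => ?_) (fun p => ?_)
    ((summable_pow_div_sqrt_factorial hΛ).mul_left Λ)
  · unfold dysonBound
    positivity
  · have := h p 0
    simp only [zero_add, one_pow, Nat.factorial_zero, Nat.cast_one, Real.sqrt_one, div_one, mul_one,
      add_zero] at this
    rwa [← mul_div_assoc, ← pow_succ']

/-- The bounded spectral projections of an operator that is bounded below separate vectors. -/
theorem eq_zero_of_proj_Icc_eq_zero {T : H →ₗ.[ℂ] H} (h : IsBoundedBelowBy T a)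
    (hψ : ∀ n : ℕ, (spectralMeasure T).proj (Set.Icc a n) ψ = 0) : ψ = 0 := by
  have h1 : (spectralMeasure T).measure ψ (⋃ n : ℕ, Set.Icc a n) = 0 := by
    refine measure_iUnion_null fun n => ?_
    rw [measure_apply _ _ measurableSet_Icc, hψ n]
    simp
  have h2 : (spectralMeasure T).measure ψ Set.univ = 0 := by
    refine measure_mono_null (fun x _ => ?_) (measure_union_null h1 (ae_iff.mp (h.ae_ge ψ)))
    by_cases hx : a ≤ x
    · obtain ⟨n, hn⟩ := exists_nat_ge x
      exact Or.inl (Set.mem_iUnion.mpr ⟨n, hx, hn⟩)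
    · exact Or.inr hx
  rw [measure_apply _ _ MeasurableSet.univ, (spectralMeasure T).proj_univ, one_apply_eq_self,
    ENNReal.ofReal_eq_zero] at h2
  have h3 : ‖ψ‖ = 0 := pow_eq_zero_iff two_ne_zero |>.mp (le_antisymm h2 (sq_nonneg _))
  exact norm_eq_zero.mp h3

/-- The Dyson series converges to the complex time evolution on vectors of finite energy. The
equality is checked after multiplication by spectral projections of `H₀ + H₁`, which turn both sides
into convergent power series in `H₀ + H₁`. -/
theorem hasSum_dysonVec (h₀ : IsBoundedBelowBy H₀ 0) (hb : 0 < b) (hC : 0 ≤ C)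
    (h₁ : IsGradedOp H₀ H₁ b C) (h : IsBoundedBelowBy (H₀ + H₁) a) (hw : w.im ≤ 0)
    (hψ : ψ ∈ VE H₀ E) :
    HasSum (fun p : ℕ => dysonVec H₀ H₁ p w ψ) (evolution (H₀ + H₁) w ψ) := by
  obtain ⟨d, hd⟩ := exists_mem_VE_nat_mul hb hψ
  have hd0 : 0 ≤ (d : ℝ) * b := by positivity
  have hterm := fun p => summable_norm_dysonVec_term h₀ hb.le hC h₁ hd0 hd p w
  have hsB := (summable_dysonBound hb.le hC ‖w‖ (norm_nonneg w) d).mul_right ‖ψ‖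
  obtain ⟨g, hgdef⟩ : ∃ g : ℕ × ℕ → H, ∀ p N, g (p, N) =
      ((-Complex.I * w) ^ N / N.factorial : ℂ) • wordVec H₀ H₁ ψ N p :=
    ⟨fun x => ((-Complex.I * w) ^ x.2 / x.2.factorial : ℂ) • wordVec H₀ H₁ ψ x.2 x.1,
      fun _ _ => rfl⟩
  have hg : Summable fun x => ‖g x‖ := by
    refine (summable_prod_of_nonneg fun x => norm_nonneg _).mpr ?_
    simp only [hgdef]
    exact ⟨fun p => (hterm p).1, Summable.of_nonneg_of_le (fun p => tsum_nonneg fun _ => norm_nonneg _)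
      (fun p => (hterm p).2) hsB⟩
  have hsum : Summable fun p : ℕ => dysonVec H₀ H₁ p w ψ :=
    Summable.of_norm (Summable.of_nonneg_of_le (fun _ => norm_nonneg _)
      (fun p => norm_dysonVec_le h₀ hb.le hC h₁ hd0 hd p w) hsB)
  -- the summations over the number `N` of letters and the order `p` can be interchanged by absolute
  -- convergence; at fixed `N` the sum over `p` is finite and yields `(H₀ + H₁)ᴺ`
  have key : ∑' p, dysonVec H₀ H₁ p w ψ - evolution (H₀ + H₁) w ψ = 0 := by
    refine eq_zero_of_proj_Icc_eq_zero h fun n => ?_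
    obtain ⟨Q, hQ⟩ : ∃ Q, Q = (spectralMeasure (H₀ + H₁)).proj (Set.Icc a n) := ⟨_, rfl⟩
    rw [← hQ]
    have hm : MeasurableSet (Set.Icc a (n : ℝ)) := measurableSet_Icc
    have habs : ∀ᵐ x ∂(spectralMeasure (H₀ + H₁)).measure (Q ψ), |x| ≤ |a| + n := by
      rw [hQ]
      filter_upwards [ae_mem_of_proj_eq hm (proj_idem hm ψ)] with x hx
      refine abs_le.mpr ⟨?_, ?_⟩
      · linarith [hx.1, neg_abs_le a, Nat.cast_nonneg (α := ℝ) n]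
      · linarith [hx.2, abs_nonneg a]
    have hQg : Summable fun x => Q (g x) := Q.summable hg.of_norm
    have e1 : Q (∑' p, dysonVec H₀ H₁ p w ψ) = ∑' N, ∑' p, Q (g (p, N)) := by
      rw [Q.map_tsum hsum, Summable.tsum_comm (f := fun p N => Q (g (p, N))) hQg]
      refine tsum_congr fun p => ?_
      rw [dysonVec, Q.map_tsum (hterm p).1.of_norm]
      simp only [hgdef]
    have e2 : ∀ N, ∑' p, Q (g (p, N)) = ((-Complex.I * w) ^ N / N.factorial : ℂ) •
        (spectralMeasure (H₀ + H₁)).fn (fun x : ℝ => (x : ℂ) ^ N) (Q ψ) := by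
      intro N
      have hzero : ∀ p ∉ Finset.range (N + 1), Q (g (p, N)) = 0 := by
        intro p hp
        have : N < p := by simpa using hp
        rw [hgdef, wordVec_eq_zero this, smul_zero, map_zero]
      rw [tsum_eq_sum hzero, hQ, ← proj_sum_wordVec h₀ hb.le h₁ h hd0 hd n N, map_sum,
        Finset.smul_sum]
      refine Finset.sum_congr rfl fun p _ => ?_
      rw [hgdef, map_smul]
    have e3 := (hasSum_exp_fn habs (-Complex.I * w)).tsum_eq
    have e4 : (fun x : ℝ => Complex.exp (-Complex.I * w * x)) =
        fun x : ℝ => Complex.exp (Complex.I * -w * x) := by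
      funext x
      ring_nf
    have hexp := h.memLp_exp hw ψ
    rw [map_sub, e1, tsum_congr e2, e3, e4, h.evolution_apply hw, hQ,
      proj_fn hm (measurable_cexp _) hexp, (proj_fn_comm hm (measurable_cexp _) hexp).1, sub_self]
  rw [← sub_eq_zero.mp key]
  exact hsum.hasSum

end DysonSeries

/-! ### Graded expansions of vectors -/

section GradedSeq

variable {H : Type*} [NormedAddCommGroup H] [InnerProductSpace ℂ H] [CompleteSpace H]
  {H₀ H₁ A : H →ₗ.[ℂ] H} {a b C E F : ℝ} {ψ φ : H} {w : ℂ} {f : ℕ → H}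

/-- The `n`-th term of the sequence `f` has energy at most `(n + d) b`, and its norm decays like
`1 / √n!`, up to a geometric factor.  The sums of such sequences are the vectors on which products of
`C₀`-class operators and of complex time evolutions can be expanded. -/
def IsGradedSeq (H₀ : H →ₗ.[ℂ] H) (b : ℝ) (f : ℕ → H) : Prop :=
  ∃ d : ℕ, ∃ M : ℝ, 0 ≤ M ∧ ∀ n : ℕ, f n ∈ VE H₀ ((n + d : ℕ) * b) ∧
    ‖f n‖ ≤ M ^ (n + 1) / √(n.factorial : ℝ)

theorem summable_pow_succ_div_sqrt_factorial {M : ℝ} (hM : 0 ≤ M) :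
    Summable fun n : ℕ => M ^ (n + 1) / √(n.factorial : ℝ) := by
  refine ((summable_pow_div_sqrt_factorial hM).mul_left M).congr fun n => ?_
  rw [pow_succ', mul_div_assoc]

theorem IsGradedSeq.summable_norm (hf : IsGradedSeq H₀ b f) : Summable fun n => ‖f n‖ := by
  obtain ⟨d, M, hM, h⟩ := hf
  exact Summable.of_nonneg_of_le (fun _ => norm_nonneg _) (fun n => (h n).2)
    (summable_pow_succ_div_sqrt_factorial hM)

/-- A sequence of vectors whose norms exceed those of a graded sequence by a geometric factor, with
a bounded increase of the energy, is graded. -/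
theorem IsGradedSeq.of_le (hf : IsGradedSeq H₀ b f) (e : ℕ) {g : ℕ → H}
    (hg : ∀ n d : ℕ, f n ∈ VE H₀ ((n + d : ℕ) * b) → g n ∈ VE H₀ ((n + (d + e) : ℕ) * b))
    (hle : ∀ d : ℕ, ∃ K : ℝ, 0 ≤ K ∧ ∀ n : ℕ, f n ∈ VE H₀ ((n + d : ℕ) * b) →
      ‖g n‖ ≤ K ^ (n + 1) * ‖f n‖) : IsGradedSeq H₀ b g := by
  obtain ⟨d, M, hM, h⟩ := hf
  obtain ⟨K, hK, hKg⟩ := hle d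
  refine ⟨d + e, K * M, by positivity, fun n => ⟨hg n d (h n).1, ?_⟩⟩
  calc ‖g n‖ ≤ K ^ (n + 1) * ‖f n‖ := hKg n (h n).1
    _ ≤ K ^ (n + 1) * (M ^ (n + 1) / √(n.factorial : ℝ)) := by
      gcongr
      exact (h n).2
    _ = _ := by rw [mul_pow, mul_div_assoc]

theorem succ_le_two_pow_succ (n : ℕ) : (n : ℝ) + 1 ≤ 2 ^ (n + 1) := by
  have : n + 1 ≤ 2 ^ (n + 1) := Nat.lt_two_pow_self.le
  exact_mod_cast this

/-- An operator of the `C₀` class maps graded sequences to graded sequences. -/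
theorem IsGradedSeq.map_op (hf : IsGradedSeq H₀ b f) (hb : 0 ≤ b) (hC : 0 ≤ C)
    (hA : IsGradedOp H₀ A b C) : IsGradedSeq H₀ b fun n => opApply A (f n) := by
  refine hf.of_le 1 (fun n d h => ?_) fun d => ?_
  · have := (hA.mapsTo _ (by positivity)).opApply_mem h
    rwa [show ((n + (d + 1) : ℕ) : ℝ) * b = (n + d : ℕ) * b + b by push_cast; ring]
  · set κ : ℝ := C * (d * b + b + 1) with hκ
    have hκ0 : 0 ≤ κ := by positivity
    refine ⟨(κ + 1) * 2, by positivity, fun n h => ?_⟩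
    refine (hA.norm_le _ (by positivity) _ h).trans ?_
    gcongr
    have h1 : √(((n + d : ℕ) : ℝ) * b + 1) ≤ (d * b + b + 1) * (n + 1) := by
      have h2 : 1 ≤ ((n + d : ℕ) : ℝ) * b + 1 := by
        have : 0 ≤ ((n + d : ℕ) : ℝ) * b := by positivity
        linarith
      refine (Real.sqrt_le_iff.mpr ⟨by linarith, by nlinarith⟩ : _ ≤ ((n + d : ℕ) : ℝ) * b + 1).trans ?_
      push_cast
      have h3 : 0 ≤ (n : ℝ) * (d * b) := by positivity
      have h4 : 0 ≤ (n : ℝ) := by positivity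
      nlinarith
    calc C * √(((n + d : ℕ) : ℝ) * b + 1) ≤ C * ((d * b + b + 1) * (n + 1)) := by gcongr
      _ = κ * (n + 1) := by rw [hκ]; ring
      _ ≤ (κ + 1) ^ (n + 1) * 2 ^ (n + 1) := by
        refine mul_le_mul ?_ (succ_le_two_pow_succ n) (by positivity) (by positivity)
        exact (by linarith : κ ≤ κ + 1).trans (le_self_pow₀ (by linarith) (Nat.succ_ne_zero n))
      _ = _ := by rw [mul_pow]

theorem IsGradedSeq.map_opExp (hf : IsGradedSeq H₀ b f) (hb : 0 ≤ b) (z : ℂ) :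
    IsGradedSeq H₀ b fun n => opApply (opExp H₀ z) (f n) := by
  refine hf.of_le 0 (fun n d h => opApply_opExp_mem_VE h z) fun d => ?_
  refine ⟨Real.exp (‖z‖ * (d * b + b)), Real.exp_nonneg _, fun n h => ?_⟩
  refine (norm_opApply_opExp_le h z).trans ?_
  gcongr
  rw [← Real.exp_nat_mul]
  refine Real.exp_le_exp.mpr ?_
  have h3 : 0 ≤ (n : ℝ) * (d * b) := by positivity
  push_cast
  have h4 : ((n : ℝ) + d) * b ≤ (n + 1) * (d * b + b) := by nlinarith
  calc ‖z‖ * (((n : ℝ) + d) * b) ≤ ‖z‖ * ((n + 1) * (d * b + b)) := by gcongr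
    _ = _ := by ring

theorem isGradedSeq_single (hb : 0 < b) (hψ : ψ ∈ VE H₀ E) :
    IsGradedSeq H₀ b fun n => if n = 0 then ψ else 0 := by
  obtain ⟨d, hd⟩ := exists_mem_VE_nat_mul hb hψ
  refine ⟨d, ‖ψ‖, norm_nonneg ψ, fun n => ?_⟩
  cases n with
  | zero => simpa using hd
  | succ n =>
    simp only [Nat.succ_ne_zero, if_false, norm_zero]
    exact ⟨Submodule.zero_mem _, by positivity⟩

omit [CompleteSpace H] in
theorem mem_domain_of_tendsto {T : H →ₗ.[ℂ] H} (hT : T.IsClosed) {u : ℕ → H} {χ : H}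
    (hu : ∀ n, u n ∈ T.domain) (h : Tendsto u atTop (𝓝 φ))
    (h' : Tendsto (fun n => opApply T (u n)) atTop (𝓝 χ)) :
    φ ∈ T.domain ∧ opApply T φ = χ := by
  have hmem : (φ, χ) ∈ (T.graph : Set (H × H)) := by
    refine hT.mem_of_tendsto (h.prodMk_nhds h') (Eventually.of_forall fun n => ?_)
    rw [opApply_of_mem (hu n)]
    exact LinearPMap.mem_graph T ⟨u n, hu n⟩
  obtain ⟨⟨x, hx⟩, h1, h2⟩ := (LinearPMap.mem_graph_iff T).mp hmem
  have h1' : x = φ := h1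
  subst h1'
  exact ⟨hx, by rw [opApply_of_mem hx]; exact h2⟩

omit [CompleteSpace H] in
/-- A closed operator can be applied term by term to a convergent series if the resulting series
converges. -/
theorem hasSum_opApply {T : H →ₗ.[ℂ] H} (hT : T.IsClosed) (hf : ∀ n, f n ∈ T.domain)
    (h : HasSum f φ) (hs : Summable fun n => opApply T (f n)) :
    φ ∈ T.domain ∧ HasSum (fun n => opApply T (f n)) (opApply T φ) := by
  obtain ⟨h1, h2⟩ := mem_domain_of_tendsto hT (u := fun N => ∑ n ∈ Finset.range N, f n)
    (fun N => Submodule.sum_mem _ fun n _ => hf n) h.tendsto_sum_nat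
    (by simpa only [opApply_finset_sum _ fun n _ => hf n] using hs.hasSum.tendsto_sum_nat)
  exact ⟨h1, by rw [h2]; exact hs.hasSum⟩

theorem IsGradedSeq.hasSum_op (hf : IsGradedSeq H₀ b f) (hb : 0 ≤ b) (hC : 0 ≤ C)
    (hA : IsGradedOp H₀ A b C) (h : HasSum f φ) :
    φ ∈ A.domain ∧ HasSum (fun n => opApply A (f n)) (opApply A φ) := by
  refine hasSum_opApply hA.closed (fun n => ?_) h (hf.map_op hb hC hA).summable_norm.of_norm
  obtain ⟨d, M, -, hd⟩ := hf
  exact (hA.mapsTo _ (by positivity)).mem_domain (hd n).1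

omit [CompleteSpace H] in
theorem dysonVec_zero_right (p : ℕ) (w : ℂ) : dysonVec H₀ H₁ p w (0 : H) = 0 := by
  have h : ∀ N p, wordVec H₀ H₁ (0 : H) N p = 0 := by
    intro N
    induction N with
    | zero => intro p; cases p <;> rfl
    | succ N ih => intro p; cases p <;> simp [wordVec, ih, opApply_zero]
  simp [dysonVec, h]

/-- The terms `∑_{p+q=n} D_p f_q` of the expansion of `e^{-iw(H₀ + H₁)} ∑ f_q`. -/
def dysonConv (H₀ H₁ : H →ₗ.[ℂ] H) (w : ℂ) (f : ℕ → H) (n : ℕ) : H :=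
  ∑ pq ∈ Finset.HasAntidiagonal.antidiagonal n, dysonVec H₀ H₁ pq.1 w (f pq.2)

omit [CompleteSpace H] in
theorem dysonConv_single (w : ℂ) (ψ : H) (n : ℕ) :
    dysonConv H₀ H₁ w (fun n => if n = 0 then ψ else 0) n = dysonVec H₀ H₁ n w ψ := by
  rw [dysonConv, Finset.sum_eq_single_of_mem (n, 0) (by simp)]
  · simp
  · rintro ⟨p, q⟩ hpq hne
    have hq : q ≠ 0 := by
      rintro rfl
      simp only [Finset.HasAntidiagonal.mem_antidiagonal, add_zero] at hpq
      exact hne (by rw [hpq])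
    simp [hq, dysonVec_zero_right]

theorem IsGradedSeq.exists_norm_dysonVec_le (hf : IsGradedSeq H₀ b f) (h₀ : IsBoundedBelowBy H₀ 0)
    (hb : 0 ≤ b) (hC : 0 ≤ C) (h₁ : IsGradedOp H₀ H₁ b C) (w : ℂ) :
    ∃ d : ℕ, ∃ Λ : ℝ, 0 ≤ Λ ∧ ∀ p q : ℕ, dysonVec H₀ H₁ p w (f q) ∈ VE H₀ ((p + q + d : ℕ) * b) ∧
      ‖dysonVec H₀ H₁ p w (f q)‖ ≤ Λ ^ (p + q + 1) / √((p + q).factorial : ℝ) := by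
  obtain ⟨d, M, hM, h⟩ := hf
  obtain ⟨Λ, hΛ, hle⟩ := exists_dysonBound_le hb hC (norm_nonneg w) hM d
  refine ⟨d, Λ, hΛ, fun p q => ⟨?_, ?_⟩⟩
  · have := dysonVec_mem_VE h₀ hb h₁ (by positivity) (h q).1 p w
    rwa [show ((p + q + d : ℕ) : ℝ) * b = (q + d : ℕ) * b + p * b by push_cast; ring]
  · refine (norm_dysonVec_le h₀ hb hC h₁ (by positivity) (h q).1 p w).trans
      (le_trans (mul_le_mul_of_nonneg_left (h q).2 ?_) (hle p q))
    unfold dysonBound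
    positivity

omit [InnerProductSpace ℂ H] [CompleteSpace H] in
/-- The bound for graded sequences is stable under collecting the terms of total order `n`, of which
there are only `n + 1`. -/
theorem antidiagonal_sum_norm_le {Λ : ℝ} {g : ℕ × ℕ → H}
    (hg : ∀ p q : ℕ, ‖g (p, q)‖ ≤ Λ ^ (p + q + 1) / √((p + q).factorial : ℝ)) (hΛ : 0 ≤ Λ) (n : ℕ) :
    ∑ pq ∈ Finset.HasAntidiagonal.antidiagonal n, ‖g pq‖ ≤
      (2 * Λ) ^ (n + 1) / √(n.factorial : ℝ) := by
  have h1 : ∀ pq ∈ Finset.HasAntidiagonal.antidiagonal n, ‖g pq‖ ≤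
      Λ ^ (n + 1) / √(n.factorial : ℝ) := by
    rintro ⟨p, q⟩ hpq
    have h := hg p q
    rwa [Finset.HasAntidiagonal.mem_antidiagonal.mp hpq] at h
  refine (Finset.sum_le_card_nsmul _ _ _ h1).trans ?_
  rw [Finset.Nat.card_antidiagonal, nsmul_eq_mul, mul_pow, mul_div_assoc]
  push_cast
  gcongr
  exact succ_le_two_pow_succ n

omit [InnerProductSpace ℂ H] [CompleteSpace H] in
theorem summable_norm_of_le {Λ : ℝ} {g : ℕ × ℕ → H}
    (hg : ∀ p q : ℕ, ‖g (p, q)‖ ≤ Λ ^ (p + q + 1) / √((p + q).factorial : ℝ)) (hΛ : 0 ≤ Λ) :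
    Summable fun x => ‖g x‖ := by
  rw [← Finset.HasAntidiagonal.sigmaAntidiagonalEquivProd.summable_iff]
  refine (summable_sigma_of_nonneg fun x => norm_nonneg (g _)).mpr
    ⟨fun n => (hasSum_fintype _).summable, ?_⟩
  refine Summable.of_nonneg_of_le (fun n => tsum_nonneg fun _ => norm_nonneg _) (fun n => ?_)
    (summable_pow_succ_div_sqrt_factorial (M := 2 * Λ) (by positivity))
  rw [tsum_fintype]
  refine le_trans (le_of_eq ?_) (antidiagonal_sum_norm_le hg hΛ n)
  exact Finset.sum_coe_sort (Finset.HasAntidiagonal.antidiagonal n) fun x => ‖g x‖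

theorem IsGradedSeq.dysonConv (hf : IsGradedSeq H₀ b f) (h₀ : IsBoundedBelowBy H₀ 0)
    (hb : 0 ≤ b) (hC : 0 ≤ C) (h₁ : IsGradedOp H₀ H₁ b C) (w : ℂ) :
    IsGradedSeq H₀ b (dysonConv H₀ H₁ w f) := by
  obtain ⟨d, Λ, hΛ, h⟩ := hf.exists_norm_dysonVec_le h₀ hb hC h₁ w
  refine ⟨d, 2 * Λ, by positivity, fun n => ⟨Submodule.sum_mem _ ?_, ?_⟩⟩
  · rintro ⟨p, q⟩ hpq
    have := (h p q).1
    rwa [Finset.HasAntidiagonal.mem_antidiagonal.mp hpq] at this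
  · exact (norm_sum_le _ _).trans (antidiagonal_sum_norm_le
      (g := fun pq => dysonVec H₀ H₁ pq.1 w (f pq.2)) (fun p q => (h p q).2) hΛ n)

/-- The Dyson series converges to the complex time evolution on sums of graded sequences. -/
theorem IsGradedSeq.hasSum_dysonConv (hf : IsGradedSeq H₀ b f) (h₀ : IsBoundedBelowBy H₀ 0)
    (hb : 0 < b) (hC : 0 ≤ C) (h₁ : IsGradedOp H₀ H₁ b C) (h : IsBoundedBelowBy (H₀ + H₁) a)
    (hw : w.im ≤ 0) (hφ : HasSum f φ) :
    HasSum (GellMannLow.dysonConv H₀ H₁ w f) (evolution (H₀ + H₁) w φ) := by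
  obtain ⟨g, hgdef⟩ : ∃ g : ℕ × ℕ → H, ∀ p q, g (p, q) = dysonVec H₀ H₁ p w (f q) :=
    ⟨fun x => dysonVec H₀ H₁ x.1 w (f x.2), fun _ _ => rfl⟩
  have hg : Summable fun x => ‖g x‖ := by
    obtain ⟨d, Λ, hΛ, hle⟩ := hf.exists_norm_dysonVec_le h₀ hb.le hC h₁ w
    exact summable_norm_of_le (fun p q => by rw [hgdef]; exact (hle p q).2) hΛ
  have hgs := hg.of_norm
  have e1 : HasSum g (evolution (H₀ + H₁) w φ) := by
    have hswap : HasSum (fun x : ℕ × ℕ => g x.swap) (∑' x, g x) :=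
      (Equiv.prodComm ℕ ℕ).hasSum_iff.mpr hgs.hasSum
    obtain ⟨d, M, -, hd⟩ := hf
    have h2 := hswap.prod_fiberwise (g := fun q => evolution (H₀ + H₁) w (f q)) fun q => by
      simp only [Prod.swap, hgdef]
      exact hasSum_dysonVec h₀ hb hC h₁ h hw (hd q).1
    have h3 := (evolution (H₀ + H₁) w).hasSum hφ
    rw [h3.unique h2]
    exact hgs.hasSum
  have h4 := Finset.HasAntidiagonal.sigmaAntidiagonalEquivProd.hasSum_iff.mpr e1
  refine (h4.sigma fun n => hasSum_fintype _).congr_fun fun n => ?_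
  rw [GellMannLow.dysonConv, ← Finset.sum_coe_sort]
  exact Finset.sum_congr rfl fun x _ => (hgdef _ _).symm

end GradedSeq

/-! ### Time-ordered exponentials and the complex time evolution -/

section Chain

variable {H : Type*} [NormedAddCommGroup H] [InnerProductSpace ℂ H] [CompleteSpace H]
  {H₀ H₁ : H →ₗ.[ℂ] H} {a b C E F : ℝ} {ψ φ : H} {γ : ℝ → ℂ} {α : ℝ}
  {L : List (ℝ × (H →ₗ.[ℂ] H))}

/-- The term of order `n` in `H₁` of the expansion of
`e^{-i(w - z₁)H} A₁ e^{-i(z₁ - z₂)H} A₂ ⋯ A_m e^{-i(z_m - z₀)H} e^{-iz₀H₀} ψ`, where `H = H₀ + H₁`,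
`z₀ = γ α`, and `zⱼ = γ τⱼ` for the list `[(τ₁, A₁), …, (τ_m, A_m)]`. -/
def chainVec (H₀ H₁ : H →ₗ.[ℂ] H) (γ : ℝ → ℂ) (α : ℝ) (ψ : H) :
    List (ℝ × (H →ₗ.[ℂ] H)) → ℕ → ℂ → H
  | [], n, w => dysonVec H₀ H₁ n (w - γ α) (opApply (opExp H₀ (-γ α)) ψ)
  | (τ, A) :: L, n, w =>
    dysonConv H₀ H₁ (w - γ τ) (fun q => opApply A (chainVec H₀ H₁ γ α ψ L q (γ τ))) n

/-- The vector whose expansion is given by `chainVec`. -/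
def chainValue (H₀ H₁ : H →ₗ.[ℂ] H) (γ : ℝ → ℂ) (α : ℝ) (ψ : H) :
    List (ℝ × (H →ₗ.[ℂ] H)) → ℂ → H
  | [], w => evolution (H₀ + H₁) (w - γ α) (opApply (opExp H₀ (-γ α)) ψ)
  | (τ, A) :: L, w =>
    evolution (H₀ + H₁) (w - γ τ) (opApply A (chainValue H₀ H₁ γ α ψ L (γ τ)))

/-- The complex times `w, z₁, …, z_m, z₀` of `chainVec` have increasing imaginary parts. -/
def ChainImLe (γ : ℝ → ℂ) (α : ℝ) : List (ℝ × (H →ₗ.[ℂ] H)) → ℂ → Prop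
  | [], w => (w - γ α).im ≤ 0
  | (τ, _) :: L, w => (w - γ τ).im ≤ 0 ∧ ChainImLe γ α L (γ τ)

/-- The expansion `chainVec` of unbounded operators can be computed with truncated operators. -/
theorem chainVec_spec (h₀ : IsBoundedBelowBy H₀ 0) (hb : 0 ≤ b) (h₁ : IsGradedOp H₀ H₁ b C)
    (hL : ∀ x ∈ L, IsGradedOp H₀ x.2 b C) (hE : 0 ≤ E) (hψ : ψ ∈ VE H₀ E) {n : ℕ}
    (hF : E + (L.length + n : ℕ) * b ≤ F) (w : ℂ) :
    chainCoeff (trunc H₀ H₀ F) (trunc H₀ H₁ F) γ α (L.map fun x => (x.1, trunc H₀ x.2 F)) n w ψ =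
      chainVec H₀ H₁ γ α ψ L n w ∧
    chainVec H₀ H₁ γ α ψ L n w ∈ VE H₀ (E + (L.length + n : ℕ) * b) := by
  induction L generalizing n w with
  | nil =>
    have hF0 : E ≤ F := le_trans (le_add_of_nonneg_right (by positivity)) hF
    have h1 := opApply_opExp_mem_VE hψ (-γ α)
    have hF' : E + (n : ℝ) * b ≤ F := by simpa using hF
    constructor
    · rw [List.map_nil, chainCoeff, chainVec, mul_apply_eq_comp,
        h₀.expI_trunc_apply hψ hF0 (hE.trans hF0),
        dysonVec_eq_dysonCoeff h₀ hb h₁ hE h1 hF']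
    · have := dysonVec_mem_VE h₀ hb h₁ hE h1 n (w - γ α)
      simpa [chainVec] using this
  | cons x L ih =>
    obtain ⟨τ, A⟩ := x
    have hA : IsGradedOp H₀ A b C := hL (τ, A) (by simp)
    have hterm : ∀ pq ∈ Finset.HasAntidiagonal.antidiagonal n,
        (dysonCoeff (trunc H₀ H₀ F) (trunc H₀ H₁ F) pq.1 (w - γ τ) * (trunc H₀ A F *
          chainCoeff (trunc H₀ H₀ F) (trunc H₀ H₁ F) γ α (L.map fun x => (x.1, trunc H₀ x.2 F))
            pq.2 (γ τ))) ψ =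
        dysonVec H₀ H₁ pq.1 (w - γ τ) (opApply A (chainVec H₀ H₁ γ α ψ L pq.2 (γ τ))) ∧
        dysonVec H₀ H₁ pq.1 (w - γ τ) (opApply A (chainVec H₀ H₁ γ α ψ L pq.2 (γ τ))) ∈
          VE H₀ (E + (((τ, A) :: L).length + n : ℕ) * b) := by
      rintro ⟨p, q⟩ hpq
      have hn : p + q = n := Finset.HasAntidiagonal.mem_antidiagonal.mp hpq
      have hlen : E + (((τ, A) :: L).length + n : ℕ) * b =
          E + (L.length + q : ℕ) * b + b + p * b := by
        rw [← hn, List.length_cons]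
        push_cast
        ring
      rw [hlen] at hF ⊢
      have hpb : 0 ≤ (p : ℝ) * b := by positivity
      obtain ⟨h1, h2⟩ := ih (fun x hx => hL x (by simp [hx])) (n := q) (by linarith) (γ τ)
      have hE' : 0 ≤ E + (L.length + q : ℕ) * b := by positivity
      obtain ⟨h3, h4, h5⟩ := hA.agreesBelow_trunc (F := F) hb _ hE' (by linarith) _ h2
      have h6 : opApply A (chainVec H₀ H₁ γ α ψ L q (γ τ)) ∈
          VE H₀ (E + (L.length + q : ℕ) * b + b) := by rwa [h4]
      refine ⟨?_, dysonVec_mem_VE h₀ hb h₁ (by positivity) h6 p _⟩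
      rw [mul_apply_eq_comp, mul_apply_eq_comp, h1, ← h4,
        dysonVec_eq_dysonCoeff h₀ hb h₁ (by positivity) h6 hF]
    constructor
    · rw [List.map_cons, chainCoeff, sum_apply, chainVec, dysonConv]
      exact Finset.sum_congr rfl fun pq hpq => (hterm pq hpq).1
    · rw [chainVec, dysonConv]
      exact Submodule.sum_mem _ fun pq hpq => (hterm pq hpq).2

/-- The terms of the expansion decay factorially, as it is built from the operations that preserve graded
sequences. -/
theorem isGradedSeq_chainVec (h₀ : IsBoundedBelowBy H₀ 0) (hb : 0 < b) (hC : 0 ≤ C)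
    (h₁ : IsGradedOp H₀ H₁ b C) (hL : ∀ x ∈ L, IsGradedOp H₀ x.2 b C) (hψ : ψ ∈ VE H₀ E) (w : ℂ) :
    IsGradedSeq H₀ b fun n => chainVec H₀ H₁ γ α ψ L n w := by
  induction L generalizing w with
  | nil =>
    have h := (isGradedSeq_single hb (opApply_opExp_mem_VE hψ (-γ α))).dysonConv h₀ hb.le hC h₁
      (w - γ α)
    have he : dysonConv H₀ H₁ (w - γ α)
        (fun n => if n = 0 then opApply (opExp H₀ (-γ α)) ψ else 0) =
        fun n => chainVec H₀ H₁ γ α ψ [] n w := funext fun n => dysonConv_single _ _ _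
    rwa [he] at h
  | cons x L ih =>
    obtain ⟨τ, A⟩ := x
    exact ((ih (fun x hx => hL x (by simp [hx])) (γ τ)).map_op hb.le hC
      (hL (τ, A) (by simp))).dysonConv h₀ hb.le hC h₁ (w - γ τ)

/-- The expansion converges to the product of complex time evolutions and fixed operators. -/
theorem hasSum_chainVec (h₀ : IsBoundedBelowBy H₀ 0) (hb : 0 < b) (hC : 0 ≤ C)
    (h₁ : IsGradedOp H₀ H₁ b C) (h : IsBoundedBelowBy (H₀ + H₁) a)
    (hL : ∀ x ∈ L, IsGradedOp H₀ x.2 b C) (hψ : ψ ∈ VE H₀ E) {w : ℂ} (hw : ChainImLe γ α L w) :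
    HasSum (fun n => chainVec H₀ H₁ γ α ψ L n w) (chainValue H₀ H₁ γ α ψ L w) := by
  induction L generalizing w with
  | nil => exact hasSum_dysonVec h₀ hb hC h₁ h hw (opApply_opExp_mem_VE hψ (-γ α))
  | cons x L ih =>
    obtain ⟨τ, A⟩ := x
    have hL' : ∀ x ∈ L, IsGradedOp H₀ x.2 b C := fun x hx => hL x (by simp [hx])
    have hA : IsGradedOp H₀ A b C := hL (τ, A) (by simp)
    have hgr := isGradedSeq_chainVec (γ := γ) (α := α) h₀ hb hC h₁ hL' hψ (γ τ)
    exact (hgr.map_op hb.le hC hA).hasSum_dysonConv h₀ hb hC h₁ h hw.1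
      (hgr.hasSum_op hb.le hC hA (ih hL' hw.2)).2

/-- Vectors of finite energy are in the domain of the time-ordered exponential, and its value is
given by the expansion `chainVec`. -/
theorem timeOrderedExpWith_spec {γ : Curve} {k : ℕ} {A : Fin k → H →ₗ.[ℂ] H}
    (h₀ : IsBoundedBelowBy H₀ 0) (hb : 0 < b) (hC : 0 ≤ C)
    (h₁ : IsGradedOp H₀ H₁ b C) (hA : ∀ j, IsGradedOp H₀ (A j) b C) (hE : 0 ≤ E)
    (hψ : ψ ∈ VE H₀ E) (hγ : γ.IsSimpleCurve) {τ : Fin k → ℝ} (hτ : ∀ j, τ j ∈ γ.I)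
    (hτanti : StrictAnti τ) :
    ψ ∈ (timeOrderedExpWith H₀ H₁ γ A fun j => γ.toFun (τ j)).domain ∧
    HasSum (fun n => opApply (opExp H₀ (γ.toFun γ.β))
      (chainVec H₀ H₁ γ.toFun γ.α ψ (List.ofFn fun j => (τ j, A j)) n (γ.toFun γ.β)))
      (opApply (timeOrderedExpWith H₀ H₁ γ A fun j => γ.toFun (τ j)) ψ) := by
  have hL : ∀ x ∈ List.ofFn fun j => (τ j, A j), IsGradedOp H₀ x.2 b C := by
    intro x hx
    obtain ⟨j, rfl⟩ := (List.mem_ofFn' _ _).mp hx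
    exact hA j
  have hterm : ∀ n, dysonTerm γ (fun j ζ => evolved H₀ (A j) ζ) (fun j => γ.toFun (τ j))
      (fun ζ => (-Complex.I) • evolved H₀ H₁ ζ) n ψ = opApply (opExp H₀ (γ.toFun γ.β))
      (chainVec H₀ H₁ γ.toFun γ.α ψ (List.ofFn fun j => (τ j, A j)) n (γ.toFun γ.β)) := by
    intro n
    obtain ⟨F, hF⟩ : ∃ F, F = E + (k + n : ℕ) * b := ⟨_, rfl⟩
    have hF0 : 0 ≤ F := by rw [hF]; positivity
    have h1 := chainVec_spec (γ := γ.toFun) (α := γ.α) h₀ hb.le h₁ hL hE hψ (n := n) (F := F)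
      (by rw [List.length_ofFn]; exact hF.ge) (γ.toFun γ.β)
    rw [List.length_ofFn, ← hF, List.map_ofFn] at h1
    rw [(dysonTerm_spec h₀ hb.le h₁ hA hE hψ hF.ge hγ hτ hτanti).2, mul_apply_eq_comp,
      ← h₀.expI_trunc_apply h1.2 le_rfl hF0, ← h1.1]
    rfl
  have hsum : Summable fun n => ‖dysonTerm γ (fun j ζ => evolved H₀ (A j) ζ)
      (fun j => γ.toFun (τ j)) (fun ζ => (-Complex.I) • evolved H₀ H₁ ζ) n ψ‖ := by
    simp only [hterm]
    exact ((isGradedSeq_chainVec h₀ hb hC h₁ hL hψ _).map_opExp hb.le _).summable_norm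
  have hdom : ψ ∈ (timeOrderedExpWith H₀ H₁ γ A fun j => γ.toFun (τ j)).domain := by
    refine ⟨⟨mem_continuityDomain h₀ hb.le h₁ hA hE hψ, fun n => ⟨fun t _ => ?_, ?_⟩⟩, hsum⟩
    · exact (timeOrderedProd_spec h₀ hb.le h₁ hA hE hψ le_rfl _).1
    · exact (dysonTerm_spec h₀ hb.le h₁ hA hE hψ le_rfl hγ hτ hτanti).1
  refine ⟨hdom, ?_⟩
  have hval : opApply (timeOrderedExpWith H₀ H₁ γ A fun j => γ.toFun (τ j)) ψ =
      ∑' n, dysonTerm γ (fun j ζ => evolved H₀ (A j) ζ) (fun j => γ.toFun (τ j))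
        (fun ζ => (-Complex.I) • evolved H₀ H₁ ζ) n ψ := by
    rw [opApply_of_mem hdom]
    rfl
  rw [hval]
  have h := hsum.of_norm.hasSum
  simp only [hterm] at h ⊢
  exact h

end Chain

section ComplexEvolution

variable {H : Type*} [NormedAddCommGroup H] [InnerProductSpace ℂ H] [CompleteSpace H]
  {H₀ H₁ : H →ₗ.[ℂ] H} {a b C E : ℝ} {ψ φ : H} {z : ℂ} {f : ℕ → H}

open ProjValuedMeasure

theorem opApply_opExp_opExp (hψ : ψ ∈ VE H₀ E) (z z' : ℂ) :
    opApply (opExp H₀ z) (opApply (opExp H₀ z') ψ) = opApply (opExp H₀ (z + z')) ψ := by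
  have he : ((fun x : ℝ => Complex.exp (Complex.I * z * x)) *
      fun x : ℝ => Complex.exp (Complex.I * z' * x)) =
      fun x : ℝ => Complex.exp (Complex.I * (z + z') * x) := by
    funext x
    rw [Pi.mul_apply, ← Complex.exp_add]
    ring_nf
  rw [opApply_opExp_eq_fn, opApply_opExp_eq_fn, opApply_opExp_eq_fn, fn_fn (measurable_cexp z')
    (memLp_exp_of_mem_VE hψ z') (measurable_cexp z) (by
      rw [he]; exact memLp_exp_of_mem_VE hψ (z + z')), he]

theorem opApply_opExp_zero (ψ : H) : opApply (opExp H₀ 0) ψ = ψ := by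
  rw [opApply_opExp_eq_fn]
  simp only [mul_zero, zero_mul, Complex.exp_zero]
  exact fn_one ψ

theorem evolution_opExp (h₀ : IsBoundedBelowBy H₀ 0) (hz : z.im ≤ 0) (hψ : ψ ∈ VE H₀ E) :
    evolution H₀ z (opApply (opExp H₀ z) ψ) = ψ := by
  rw [← h₀.opApply_opExp hz, opApply_opExp_opExp hψ, neg_add_cancel, opApply_opExp_zero]

/-- The operator `e^{-izH₀}` has an inverse on each spectral subspace of bounded energy. -/
theorem evolution_injective (h₀ : IsBoundedBelowBy H₀ 0) (hz : z.im ≤ 0)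
    (h : evolution H₀ z ψ = 0) : ψ = 0 := by
  refine eq_zero_of_proj_Icc_eq_zero h₀ fun n => ?_
  have hm : MeasurableSet (Set.Icc 0 (n : ℝ)) := measurableSet_Icc
  have hexp := h₀.memLp_exp hz ψ
  have h1 : evolution H₀ z ((spectralMeasure H₀).proj (Set.Icc 0 n) ψ) = 0 := by
    rw [h₀.evolution_apply hz, (proj_fn_comm hm (measurable_cexp _) hexp).1,
      ← proj_fn hm (measurable_cexp _) hexp, ← h₀.evolution_apply hz, h, map_zero]
  have h2 := opApply_opExp_opExp (proj_mem_VE H₀ n ψ) z (-z)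
  rw [h₀.opApply_opExp hz, h1, opApply_zero, add_neg_cancel, opApply_opExp_zero] at h2
  exact h2.symm

/-- The case of no fixed operators of `timeOrderedExpWith_spec`. -/
theorem timeOrderedExpOf_spec {γ : Curve} (h₀ : IsBoundedBelowBy H₀ 0) (hb : 0 < b) (hC : 0 ≤ C)
    (h₁ : IsGradedOp H₀ H₁ b C) (hE : 0 ≤ E) (hψ : ψ ∈ VE H₀ E) (hγ : γ.IsSimpleCurve) :
    ψ ∈ (timeOrderedExpOf H₀ H₁ γ).domain ∧
    HasSum (fun n => opApply (opExp H₀ (γ.toFun γ.β))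
      (chainVec H₀ H₁ γ.toFun γ.α ψ [] n (γ.toFun γ.β)))
      (opApply (timeOrderedExpOf H₀ H₁ γ) ψ) := by
  have h := timeOrderedExpWith_spec (γ := γ) (A := (Fin.elim0 : Fin 0 → H →ₗ.[ℂ] H))
    (τ := Fin.elim0) h₀ hb hC h₁ (fun j => j.elim0) hE hψ hγ (fun j => j.elim0) fun j => j.elim0
  have h2 : (fun j : Fin 0 => γ.toFun (Fin.elim0 j)) = Fin.elim0 := funext fun j => j.elim0
  rw [h2] at h
  exact h

theorem propagator_spec (h₀ : IsBoundedBelowBy H₀ 0) (hb : 0 < b) (hC : 0 ≤ C)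
    (h₁ : IsGradedOp H₀ H₁ b C) (hE : 0 ≤ E) (hψ : ψ ∈ VE H₀ E) (z : ℂ) :
    ψ ∈ (propagator H₀ H₁ z 0).domain ∧
    HasSum (fun n => opApply (opExp H₀ z) (dysonVec H₀ H₁ n z ψ))
      (opApply (propagator H₀ H₁ z 0) ψ) := by
  obtain ⟨hs, h0, hz⟩ := Curve.segment_isSimpleFromTo 0 z
  obtain ⟨h1, h2⟩ := timeOrderedExpOf_spec h₀ hb hC h₁ hE hψ hs
  have hdom : ψ ∈ (propagator H₀ H₁ z 0).domain := ⟨⟨E, hE, hψ⟩, h1⟩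
  refine ⟨hdom, ?_⟩
  have hle : propagator H₀ H₁ z 0 ≤ timeOrderedExpOf H₀ H₁ (Curve.segment 0 z) :=
    LinearPMap.domRestrict_le
  rw [← opApply_eq_of_le hle hdom]
  simpa only [chainVec, h0, hz, sub_zero, neg_zero, opApply_opExp_zero] using h2

/-- On vectors of finite energy, `e^{-izH₀} U(z, 0) = e^{-iz(H₀ + H₁)}`. -/
theorem evolution_propagator (h₀ : IsBoundedBelowBy H₀ 0) (hb : 0 < b) (hC : 0 ≤ C)
    (h₁ : IsGradedOp H₀ H₁ b C) (h : IsBoundedBelowBy (H₀ + H₁) a) (hz : z.im ≤ 0)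
    (hE : 0 ≤ E) (hψ : ψ ∈ VE H₀ E) :
    evolution H₀ z (opApply (propagator H₀ H₁ z 0) ψ) = evolution (H₀ + H₁) z ψ := by
  have h2 := (evolution H₀ z).hasSum (propagator_spec h₀ hb hC h₁ hE hψ z).2
  have h3 := hasSum_dysonVec h₀ hb hC h₁ h hz hψ
  refine h2.unique (h3.congr_fun fun n => ?_)
  exact evolution_opExp h₀ hz (dysonVec_mem_VE h₀ hb.le h₁ hE hψ n z)

/-- On its domain, `U(z, 0)` followed by the injective operator `e^{-izH₀}` is bounded. -/
theorem isClosable_propagator (h₀ : IsBoundedBelowBy H₀ 0) (hb : 0 < b) (hC : 0 ≤ C)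
    (h₁ : IsGradedOp H₀ H₁ b C) (h : IsBoundedBelowBy (H₀ + H₁) a) (hz : z.im ≤ 0) :
    (propagator H₀ H₁ z 0).IsClosable := by
  have hsub : ∀ x ∈ (propagator H₀ H₁ z 0).graph.topologicalClosure,
      evolution H₀ z x.2 = evolution (H₀ + H₁) z x.1 := by
    have hcl : IsClosed {x : H × H | evolution H₀ z x.2 = evolution (H₀ + H₁) z x.1} :=
      isClosed_eq (by fun_prop) (by fun_prop)
    intro x hx
    refine closure_minimal (fun y hy => ?_) hcl hx
    obtain ⟨⟨u, hu⟩, h1, h2⟩ := (LinearPMap.mem_graph_iff _).mp hy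
    obtain ⟨E, hE, huE⟩ := hu.1
    have h3 := evolution_propagator h₀ hb hC h₁ h hz hE huE
    rw [opApply_of_mem hu, h2] at h3
    have h1' : u = y.1 := h1
    rw [h1'] at h3
    exact h3
  refine ⟨(propagator H₀ H₁ z 0).graph.topologicalClosure.toLinearPMap, ?_⟩
  refine (Submodule.toLinearPMap_graph_eq _ fun x hx hx1 => ?_).symm
  have h2 := hsub x hx
  rw [hx1, map_zero] at h2
  exact evolution_injective h₀ hz h2

theorem IsGradedSeq.summable_propagator (hf : IsGradedSeq H₀ b f) (h₀ : IsBoundedBelowBy H₀ 0)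
    (hb : 0 < b) (hC : 0 ≤ C) (h₁ : IsGradedOp H₀ H₁ b C) (z : ℂ) :
    Summable fun n => opApply (propagator H₀ H₁ z 0) (f n) := by
  have hf' := hf
  obtain ⟨d', M, -, hd'⟩ := hf'
  obtain ⟨d, Λ, hΛ, hle⟩ := hf.exists_norm_dysonVec_le h₀ hb.le hC h₁ z
  obtain ⟨g, hgdef⟩ : ∃ g : ℕ × ℕ → H, ∀ p q, g (p, q) =
      opApply (opExp H₀ z) (dysonVec H₀ H₁ p z (f q)) :=
    ⟨fun x => opApply (opExp H₀ z) (dysonVec H₀ H₁ x.1 z (f x.2)), fun _ _ => rfl⟩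
  have hg : Summable fun x => ‖g x‖ := by
    refine summable_norm_of_le (Λ := Real.exp (‖z‖ * (d * b + b)) * Λ) (fun p q => ?_)
      (by positivity)
    rw [hgdef, mul_pow, mul_div_assoc]
    refine (norm_opApply_opExp_le (hle p q).1 z).trans
      (mul_le_mul ?_ (hle p q).2 (norm_nonneg _) (by positivity))
    rw [← Real.exp_nat_mul]
    refine Real.exp_le_exp.mpr ?_
    have h3 : 0 ≤ ((p : ℝ) + q) * (d * b) := by positivity
    push_cast
    have h4 : ((p : ℝ) + q + d) * b ≤ (p + q + 1) * (d * b + b) := by nlinarith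
    calc ‖z‖ * (((p : ℝ) + q + d) * b) ≤ ‖z‖ * ((p + q + 1) * (d * b + b)) := by gcongr
      _ = _ := by ring
  have h1 : ∀ q, HasSum (fun p => g (p, q)) (opApply (propagator H₀ H₁ z 0) (f q)) := by
    intro q
    simp only [hgdef]
    exact (propagator_spec h₀ hb hC h₁ (by positivity) (hd' q).1 z).2
  have hswap : Summable fun x : ℕ × ℕ => g x.swap :=
    (Equiv.prodComm ℕ ℕ).summable_iff.mpr hg.of_norm
  exact (hswap.hasSum.prod_fiberwise h1).summable

/-- On sums of graded sequences, the complex evolution `W(z)` is `e^{-iz(H₀ + H₁)}`. -/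
theorem IsGradedSeq.complexEvolution (hf : IsGradedSeq H₀ b f) (h₀ : IsBoundedBelowBy H₀ 0)
    (hb : 0 < b) (hC : 0 ≤ C) (h₁ : IsGradedOp H₀ H₁ b C) (h : IsBoundedBelowBy (H₀ + H₁) a)
    (hz : z.im ≤ 0) (hφ : HasSum f φ) :
    φ ∈ (complexEvolution H₀ H₁ z).domain ∧
      opApply (complexEvolution H₀ H₁ z) φ = evolution (H₀ + H₁) z φ := by
  have hs := (hf.summable_propagator h₀ hb hC h₁ z).hasSum
  obtain ⟨d, M, -, hd⟩ := hf
  have hdom : ∀ n, f n ∈ (propagator H₀ H₁ z 0).domain := fun n =>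
    (propagator_spec h₀ hb hC h₁ (by positivity) (hd n).1 z).1
  have hle := LinearPMap.le_closure (propagator H₀ H₁ z 0)
  have hval : ∀ n, opApply (propagator H₀ H₁ z 0).closure (f n) =
      opApply (propagator H₀ H₁ z 0) (f n) := fun n => opApply_eq_of_le hle (hdom n)
  obtain ⟨h1, h2⟩ := hasSum_opApply
    (isClosable_propagator h₀ hb hC h₁ h hz).closure_isClosed (fun n => hle.1 (hdom n)) hφ
    (by simpa only [hval] using hs.summable)
  have h3 := h₀.mem_opExp_domain hz (opApply (propagator H₀ H₁ z 0).closure φ)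
  refine ⟨mem_opMul h1 h3, ?_⟩
  rw [GellMannLow.complexEvolution, opApply_opMul h1 h3, h₀.opApply_opExp hz]
  have h4 := (evolution H₀ z).hasSum h2
  refine h4.unique (((evolution (H₀ + H₁) z).hasSum hφ).congr_fun fun n => ?_)
  rw [hval]
  exact evolution_propagator h₀ hb hC h₁ h hz (by positivity) (hd n).1

end ComplexEvolution

/-! ### Decay of the ground state at large unperturbed energies -/

section GroundStateDecay

variable {H : Type*} [NormedAddCommGroup H] [InnerProductSpace ℂ H] [CompleteSpace H]
  {H₀ H₁ : H →ₗ.[ℂ] H} {b : ℝ} {ψ Ω : H}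

open ProjValuedMeasure

/-- The quadratic form of `H₀`. -/
theorem IsBoundedBelowBy.inner_opApply_self (h₀ : IsBoundedBelowBy H₀ 0) (hψ : ψ ∈ H₀.domain) :
    ⟪ψ, opApply H₀ ψ⟫_ℂ = ((‖opApply (opSqrt H₀) ψ‖ ^ 2 : ℝ) : ℂ) := by
  have hs : Measurable fun x : ℝ => ((√x : ℝ) : ℂ) := by fun_prop
  have hm := mem_opSqrt_domain.mp (h₀.domain_le_opSqrt hψ)
  have hx := h₀.spec.mem_domain.mp hψ
  have hae : ((fun x : ℝ => ((√x : ℝ) : ℂ)) * fun x : ℝ => ((√x : ℝ) : ℂ))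
      =ᵐ[(spectralMeasure H₀).measure ψ] fun x : ℝ => (x : ℂ) := by
    filter_upwards [h₀.ae_ge ψ] with x hx
    rw [Pi.mul_apply, ← Complex.ofReal_mul, Real.mul_self_sqrt hx]
  have hmm := hx.ae_eq hae.symm
  have hm2 := (memLp_measure_fn hs hm hs).mpr hmm
  have h1 := inner_fn hs hm hm2
  simp only [RCLike.star_def, Complex.conj_ofReal] at h1
  rw [fn_fn hs hm hs hmm, fn_congr_ae (hs.mul hs) Complex.measurable_ofReal hmm hae,
    ← h₀.spec.opApply_eq, ← opApply_opSqrt, inner_self_eq_norm_sq_to_K] at h1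
  rw [← h1]
  norm_cast

/-- On vectors of energy at least `K`, the operator `H₀^{1/2}` is bounded below by `√K`. -/
theorem sqrt_mul_norm_le (hψ : ψ ∈ (opSqrt H₀).domain) {K : ℝ}
    (hK : ∀ᵐ x ∂(spectralMeasure H₀).measure ψ, K ≤ x) :
    √K * ‖ψ‖ ≤ ‖opApply (opSqrt H₀) ψ‖ := by
  have h1 := norm_fn_le_of_le (P := spectralMeasure H₀) (ψ := ψ)
    (f := Set.univ.indicator fun _ => ((√K : ℝ) : ℂ))
    (measurable_const.indicator MeasurableSet.univ) (by fun_prop) (mem_opSqrt_domain.mp hψ) (by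
      filter_upwards [hK] with x hx
      rw [Set.indicator_univ, Complex.norm_real, Complex.norm_real,
        Real.norm_of_nonneg (Real.sqrt_nonneg _), Real.norm_of_nonneg (Real.sqrt_nonneg _)]
      exact Real.sqrt_le_sqrt hx)
  rw [fn_indicator_const MeasurableSet.univ, (spectralMeasure H₀).proj_univ, one_apply_eq_self,
    norm_smul, Complex.norm_real, Real.norm_of_nonneg (Real.sqrt_nonneg _)] at h1
  rwa [opApply_opSqrt]

theorem IsBoundedBelowBy.proj_Ioi_eq (h₀ : IsBoundedBelowBy H₀ 0) (K : ℝ) (ψ : H) :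
    ψ = (spectralMeasure H₀).proj (Set.Icc 0 K) ψ + (spectralMeasure H₀).proj (Set.Ioi K) ψ := by
  by_cases hK : 0 ≤ K
  · rw [← proj_union _ measurableSet_Icc measurableSet_Ioi
      (Set.disjoint_left.mpr fun x hx hx' => not_lt.mpr hx.2 hx')]
    refine (proj_eq_of_ae_mem (measurableSet_Icc.union measurableSet_Ioi) ?_).symm
    filter_upwards [h₀.ae_ge ψ] with x hx
    rcases le_or_gt x K with h | h
    · exact Or.inl ⟨hx, h⟩
    · exact Or.inr h
  · rw [Set.Icc_eq_empty hK, ProjValuedMeasure.proj_empty, zero_apply, zero_add]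
    refine (proj_eq_of_ae_mem measurableSet_Ioi ?_).symm
    filter_upwards [h₀.ae_ge ψ] with x hx
    exact lt_of_lt_of_le (not_le.mp hK) hx

/-- The part of an eigenvector of `H₀ + H₁` above the energy `K` is controlled by its part above
`K - b`: since `H₁` raises the energy by at most `b`, only the latter is coupled to the former by
`H₁`, and the coupling is compensated by `H₀ ≥ K`, which dominates `H₁` in the form sense. -/
theorem exists_norm_proj_Ioi_le (h₀ : IsBoundedBelowBy H₀ 0) (h₁ : RelBounded H₁ (opSqrt H₀))
    (hsymm : H₁.IsFormalAdjoint H₁) (hshift : ∀ E, 0 ≤ E → OpMapsTo H₁ (VE H₀ E) (VE H₀ (E + b)))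
    {e : ℝ} (hΩ : Ω ∈ (H₀ + H₁).domain) (heig : opApply (H₀ + H₁) Ω = (e : ℂ) • Ω) :
    ∃ D K₀ : ℝ, 0 ≤ D ∧ 0 < K₀ ∧ ∀ K, K₀ ≤ K → b ≤ K →
      √K * ‖(spectralMeasure H₀).proj (Set.Ioi K) Ω‖ ≤
        D * ‖(spectralMeasure H₀).proj (Set.Ioi (K - b)) Ω‖ := by
  obtain ⟨hdom, a, c, hac⟩ := h₁
  obtain ⟨hΩ₀, hΩ₁⟩ : Ω ∈ H₀.domain ∧ Ω ∈ H₁.domain := hΩ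
  refine ⟨2 * (|a| + |c|), 1 + 2 * |e|, by positivity, by positivity, fun K hK hbK => ?_⟩
  have he := abs_nonneg e
  have hK1 : 1 ≤ K := by linarith
  obtain ⟨ψ, hψ⟩ : ∃ ψ, ψ = (spectralMeasure H₀).proj (Set.Ioi K) Ω := ⟨_, rfl⟩
  obtain ⟨η, hη⟩ : ∃ η, η = (spectralMeasure H₀).proj (Set.Ioi (K - b)) Ω := ⟨_, rfl⟩
  obtain ⟨χ, hχ⟩ : ∃ χ, χ = (spectralMeasure H₀).proj (Set.Icc 0 (K - b)) Ω := ⟨_, rfl⟩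
  rw [← hψ, ← hη]
  have hΩsum : Ω = χ + η := by rw [hχ, hη]; exact h₀.proj_Ioi_eq (K - b) Ω
  have hx := Complex.measurable_ofReal
  have hΩm := h₀.spec.mem_domain.mp hΩ₀
  have hψ0 : ψ ∈ H₀.domain := by
    rw [h₀.spec.mem_domain, hψ]
    exact (proj_fn_comm measurableSet_Ioi hx hΩm).2
  have hη0 : η ∈ H₀.domain := by
    rw [h₀.spec.mem_domain, hη]
    exact (proj_fn_comm measurableSet_Ioi hx hΩm).2
  have hψs := h₀.domain_le_opSqrt hψ0
  have hψ1 := hdom hψs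
  have hη1 := hdom (h₀.domain_le_opSqrt hη0)
  have hχV : χ ∈ VE H₀ (K - b) := by rw [hχ]; exact proj_mem_VE H₀ _ Ω
  have hKb : 0 ≤ K - b := by linarith
  have hχ1 := (hshift _ hKb).mem_domain hχV
  have hχ2 := (hshift _ hKb).opApply_mem hχV
  rw [sub_add_cancel] at hχ2
  have hidem : (spectralMeasure H₀).proj (Set.Ioi K) ψ = ψ := by
    rw [hψ]; exact proj_idem measurableSet_Ioi Ω
  -- the vector `ψ` is orthogonal to everything of energy at most `K`
  have horth : ⟪ψ, opApply H₁ χ⟫_ℂ = 0 := by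
    have h2 := mem_VE_iff.mp hχ2
    rw [← hidem, ← h2, inner_proj _ measurableSet_Ioi measurableSet_Icc,
      show Set.Ioi K ∩ Set.Icc 0 K = ∅ from
        Set.eq_empty_of_forall_notMem fun x hx => not_lt.mpr hx.2.2 hx.1,
      ProjValuedMeasure.proj_empty, zero_apply, inner_zero_right]
  -- only the part `η` of `Ω` above `K - b` is coupled to `ψ`
  have hcoup : ⟪ψ, opApply H₁ Ω⟫_ℂ = ⟪opApply H₁ ψ, η⟫_ℂ := by
    rw [hΩsum, opApply_add hχ1 hη1, inner_add_right, horth, zero_add, opApply_of_mem hη1,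
      opApply_of_mem hψ1]
    exact (hsymm ⟨ψ, hψ1⟩ ⟨η, hη1⟩).symm
  have hψψ : ⟪ψ, Ω⟫_ℂ = ((‖ψ‖ ^ 2 : ℝ) : ℂ) := by
    rw [← hidem, proj_inner_symm measurableSet_Ioi, ← hψ, hidem, inner_self_eq_norm_sq_to_K]
    norm_cast
  have hH0 : ⟪ψ, opApply H₀ Ω⟫_ℂ = ((‖opApply (opSqrt H₀) ψ‖ ^ 2 : ℝ) : ℂ) := by
    rw [← h₀.inner_opApply_self hψ0]
    conv_lhs => rw [← hidem]
    rw [proj_inner_symm measurableSet_Ioi, h₀.spec.opApply_eq, h₀.spec.opApply_eq, hψ,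
      proj_fn measurableSet_Ioi hx hΩm, (proj_fn_comm measurableSet_Ioi hx hΩm).1]
  -- the eigenvalue equation, tested with `ψ`
  have hid : ((‖opApply (opSqrt H₀) ψ‖ ^ 2 - e * ‖ψ‖ ^ 2 : ℝ) : ℂ) = -⟪opApply H₁ ψ, η⟫_ℂ := by
    have h3 : ⟪ψ, opApply (H₀ + H₁) Ω⟫_ℂ = ⟪ψ, (e : ℂ) • Ω⟫_ℂ := by rw [heig]
    rw [opApply_add_op hΩ₀ hΩ₁, inner_add_right, hH0, hcoup, inner_smul_right, hψψ] at h3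
    push_cast at h3 ⊢
    linear_combination h3
  obtain ⟨s, hs⟩ : ∃ s, s = ‖opApply (opSqrt H₀) ψ‖ := ⟨_, rfl⟩
  have hs0 : 0 ≤ s := hs ▸ norm_nonneg _
  have hKs : √K * ‖ψ‖ ≤ s := by
    rw [hs]
    refine sqrt_mul_norm_le hψs ?_
    filter_upwards [ae_mem_of_proj_eq measurableSet_Ioi hidem] with x hx using le_of_lt hx
  have hψ_le : ‖ψ‖ ≤ s := by
    refine le_trans ?_ hKs
    exact le_mul_of_one_le_left (norm_nonneg _) (Real.one_le_sqrt.mpr hK1)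
  have hle : s ^ 2 - e * ‖ψ‖ ^ 2 ≤ (|a| + |c|) * s * ‖η‖ := by
    calc s ^ 2 - e * ‖ψ‖ ^ 2 ≤ |s ^ 2 - e * ‖ψ‖ ^ 2| := le_abs_self _
      _ = ‖⟪opApply H₁ ψ, η⟫_ℂ‖ := by
        rw [← norm_neg ⟪opApply H₁ ψ, η⟫_ℂ, ← hid, Complex.norm_real, Real.norm_eq_abs, hs]
      _ ≤ ‖opApply H₁ ψ‖ * ‖η‖ := norm_inner_le_norm _ _
      _ ≤ (|a| + |c|) * s * ‖η‖ := by
        gcongr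
        have h4 := hac ψ hψs
        rw [← hs] at h4
        have h5 : a * s ≤ |a| * s := by gcongr; exact le_abs_self a
        have h6 : c * ‖ψ‖ ≤ |c| * s := by
          calc c * ‖ψ‖ ≤ |c| * ‖ψ‖ := by gcongr; exact le_abs_self c
            _ ≤ |c| * s := by gcongr
        linarith
  -- for `K ≥ 2 |e|`, half of the quadratic form of `H₀` absorbs the eigenvalue
  have hhalf : e * ‖ψ‖ ^ 2 ≤ s ^ 2 / 2 := by
    have h7 : K * ‖ψ‖ ^ 2 ≤ s ^ 2 := by
      calc K * ‖ψ‖ ^ 2 = (√K * ‖ψ‖) ^ 2 := by rw [mul_pow, Real.sq_sqrt (by linarith)]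
        _ ≤ s ^ 2 := pow_le_pow_left₀ (by positivity) hKs 2
    have h8 : 2 * e * ‖ψ‖ ^ 2 ≤ K * ‖ψ‖ ^ 2 := by
      gcongr
      linarith [le_abs_self e]
    linarith
  refine hKs.trans ?_
  rcases hs0.eq_or_lt with h9 | h9
  · rw [← h9]; positivity
  · refine le_of_mul_le_mul_left ?_ h9
    nlinarith

/-- An eigenvector of `H₀ + H₁` is the sum of a graded sequence, namely of its components in energy
shells of width `b`. -/
theorem exists_isGradedSeq_eigenvector (h₀ : IsBoundedBelowBy H₀ 0)
    (h₁ : RelBounded H₁ (opSqrt H₀)) (hsymm : H₁.IsFormalAdjoint H₁) (hb : 0 < b)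
    (hshift : ∀ E, 0 ≤ E → OpMapsTo H₁ (VE H₀ E) (VE H₀ (E + b)))
    {e : ℝ} (hΩ : Ω ∈ (H₀ + H₁).domain) (heig : opApply (H₀ + H₁) Ω = (e : ℂ) • Ω) :
    ∃ f : ℕ → H, IsGradedSeq H₀ b f ∧ HasSum f Ω := by
  obtain ⟨D, K₀, hD, hK₀, hle⟩ := exists_norm_proj_Ioi_le h₀ h₁ hsymm hshift hΩ heig
  obtain ⟨r, hr⟩ : ∃ r : ℕ → H, ∀ n, r n =
    (spectralMeasure H₀).proj (Set.Ioi ((n : ℝ) * b - b)) Ω := ⟨fun n => _, fun n => rfl⟩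
  obtain ⟨f, hf⟩ : ∃ f : ℕ → H, ∀ n, f n =
    (spectralMeasure H₀).proj (Set.Ioc ((n : ℝ) * b - b) (n * b)) Ω := ⟨fun n => _, fun n => rfl⟩
  obtain ⟨N, hN⟩ := exists_nat_ge (K₀ / b)
  have hN' : K₀ ≤ N * b := (div_le_iff₀ hb).mp hN
  -- `√n! ‖r n‖` grows at most geometrically
  obtain ⟨M, hM⟩ : ∃ M, M = 1 + 2 * D / √b + √(N.factorial : ℝ) * ‖Ω‖ := ⟨_, rfl⟩
  have hM1 : 1 ≤ M := by
    have : 0 ≤ 2 * D / √b + √(N.factorial : ℝ) * ‖Ω‖ := by positivity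
    linarith
  have hMD : 2 * D / √b ≤ M := by
    have : 0 ≤ √(N.factorial : ℝ) * ‖Ω‖ := by positivity
    linarith
  have hbound : ∀ n, √(n.factorial : ℝ) * ‖r n‖ ≤ M ^ (n + 1) := by
    intro n
    induction n with
    | zero =>
      refine le_trans ?_ (le_self_pow₀ hM1 (Nat.succ_ne_zero 0))
      have h2 : ‖r 0‖ ≤ ‖Ω‖ := by rw [hr]; exact norm_proj_le measurableSet_Ioi Ω
      have h3 : √((0 : ℕ).factorial : ℝ) ≤ √(N.factorial : ℝ) :=
        Real.sqrt_le_sqrt (by exact_mod_cast Nat.factorial_le (Nat.zero_le N))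
      have h4 : 0 ≤ 2 * D / √b := by positivity
      have h5 : √((0 : ℕ).factorial : ℝ) * ‖r 0‖ ≤ √(N.factorial : ℝ) * ‖Ω‖ := by gcongr
      linarith
    | succ n ih =>
      rcases lt_or_ge n N with hlt | hge
      · refine le_trans ?_ (le_self_pow₀ hM1 (Nat.succ_ne_zero (n + 1)))
        have h2 : ‖r (n + 1)‖ ≤ ‖Ω‖ := by rw [hr]; exact norm_proj_le measurableSet_Ioi Ω
        have h3 : √((n + 1).factorial : ℝ) ≤ √(N.factorial : ℝ) :=
          Real.sqrt_le_sqrt (by exact_mod_cast Nat.factorial_le hlt)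
        have h4 : 0 ≤ 2 * D / √b := by positivity
        have h5 : √((n + 1).factorial : ℝ) * ‖r (n + 1)‖ ≤ √(N.factorial : ℝ) * ‖Ω‖ := by gcongr
        linarith
      · have hn1 : 1 ≤ n := by
          rcases Nat.eq_zero_or_pos n with rfl | h
          · have hN0 : N = 0 := by omega
            rw [hN0, Nat.cast_zero, zero_mul] at hN'
            exact absurd hN' (not_le.mpr hK₀)
          · exact h
        have hn1' : (1 : ℝ) ≤ n := by exact_mod_cast hn1
        have h1 := hle (n * b) (hN'.trans (by gcongr)) (by nlinarith)
        have h2 : ((n + 1 : ℕ) : ℝ) * b - b = n * b := by push_cast; ring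
        have h3 : √((n : ℝ) * b) * ‖r (n + 1)‖ ≤ D * ‖r n‖ := by
          rw [hr, hr, h2]
          exact h1
        rw [Real.sqrt_mul (by positivity)] at h3
        have h4 : √((n : ℝ) + 1) ≤ 2 * √(n : ℝ) := by
          rw [Real.sqrt_le_left (by positivity), mul_pow, Real.sq_sqrt (by positivity)]
          linarith
        have hsb : 0 < √b := Real.sqrt_pos.mpr hb
        calc √((n + 1).factorial : ℝ) * ‖r (n + 1)‖
            = √(n.factorial : ℝ) * (√((n : ℝ) + 1) * ‖r (n + 1)‖) := by
              rw [Nat.factorial_succ, Nat.cast_mul, Nat.cast_succ, Real.sqrt_mul (by positivity)]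
              ring
          _ ≤ √(n.factorial : ℝ) * (2 * D / √b * ‖r n‖) := by
              refine mul_le_mul_of_nonneg_left ?_ (Real.sqrt_nonneg _)
              rw [div_mul_eq_mul_div, le_div_iff₀ hsb]
              calc √((n : ℝ) + 1) * ‖r (n + 1)‖ * √b ≤ 2 * √(n : ℝ) * ‖r (n + 1)‖ * √b := by gcongr
                _ = 2 * (√(n : ℝ) * √b * ‖r (n + 1)‖) := by ring
                _ ≤ 2 * (D * ‖r n‖) := by gcongr
                _ = _ := by ring
          _ = 2 * D / √b * (√(n.factorial : ℝ) * ‖r n‖) := by ring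
          _ ≤ M * M ^ (n + 1) := by gcongr
          _ = M ^ (n + 1 + 1) := by ring
  have hrle : ∀ n, ‖r n‖ ≤ M ^ (n + 1) / √(n.factorial : ℝ) := fun n => by
    rw [le_div_iff₀ (Real.sqrt_pos.mpr (by positivity)), mul_comm]
    exact hbound n
  have hsplit : ∀ n, r n = f n + r (n + 1) := by
    intro n
    rw [hr, hr, hf, show ((n + 1 : ℕ) : ℝ) * b - b = n * b by push_cast; ring,
      ← proj_union _ measurableSet_Ioc measurableSet_Ioi
        (Set.disjoint_left.mpr fun x hx hx' => not_lt.mpr hx.2 hx'),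
      Set.Ioc_union_Ioi_eq_Ioi (by linarith)]
  have hgr : IsGradedSeq H₀ b f := by
    refine ⟨0, M, by linarith, fun n => ⟨mem_VE_iff_ae.mpr ?_, le_trans ?_ (hrle n)⟩⟩
    · have hid : (spectralMeasure H₀).proj (Set.Ioc ((n : ℝ) * b - b) (n * b)) (f n) = f n := by
        rw [hf]; exact proj_idem measurableSet_Ioc Ω
      filter_upwards [h₀.ae_ge (f n), ae_mem_of_proj_eq measurableSet_Ioc hid] with x hx hx'
      exact ⟨hx, hx'.2⟩
    · have h1 : f n = (spectralMeasure H₀).proj (Set.Ioc ((n : ℝ) * b - b) (n * b)) (r n) := by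
        rw [hf, hr, ← mul_apply_eq_comp, ← proj_inter _ _ _ measurableSet_Ioc measurableSet_Ioi,
          Set.inter_eq_left.mpr Set.Ioc_subset_Ioi_self]
      rw [h1]
      exact norm_proj_le measurableSet_Ioc _
  refine ⟨f, hgr, ?_⟩
  have hsum := hgr.summable_norm.of_norm
  have hr0 : r 0 = Ω := by
    rw [hr]
    refine proj_eq_of_ae_mem measurableSet_Ioi ?_
    filter_upwards [h₀.ae_ge Ω] with x hx
    simp only [Nat.cast_zero, zero_mul, zero_sub, Set.mem_Ioi]
    linarith
  have hpart : ∀ n, ∑ i ∈ Finset.range n, f i = Ω - r n := by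
    intro n
    induction n with
    | zero => simp [hr0]
    | succ n ih => rw [Finset.sum_range_succ, ih, hsplit n]; abel
  have hrlim : Tendsto r atTop (𝓝 0) :=
    squeeze_zero_norm hrle
      (summable_pow_succ_div_sqrt_factorial (M := M) (by linarith)).tendsto_atTop_zero
  have h1 := hsum.hasSum.tendsto_sum_nat
  simp only [hpart] at h1
  have h2 := tendsto_nhds_unique h1 (tendsto_const_nhds.sub hrlim)
  rw [sub_zero] at h2
  rw [← h2]
  exact hsum.hasSum

end GroundStateDecay

/-! ### Smooth vectors -/

section SmoothVectors

variable {H : Type*} [NormedAddCommGroup H] [InnerProductSpace ℂ H] [CompleteSpace H]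
  {T A : H →ₗ.[ℂ] H} {a : ℝ} {ψ : H} {w : ℂ}

open ProjValuedMeasure

/-- `ψ` is in `⋂ₙ D(Tⁿ)`. -/
def IsSmoothVector (T : H →ₗ.[ℂ] H) (ψ : H) : Prop := ∀ n : ℕ, ψ ∈ (opPow T n).domain

omit [CompleteSpace H] in
theorem mem_opPow_succ {n : ℕ} : ψ ∈ (opPow T (n + 1)).domain ↔
    ψ ∈ (opPow T n).domain ∧ opApply (opPow T n) ψ ∈ T.domain := by
  constructor
  · intro h
    obtain ⟨h1, h2⟩ := mem_opMul_domain.mp (show ψ ∈ (opMul T (opPow T n)).domain from h)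
    have h1' : ψ ∈ (opPow T n).domain := h1
    exact ⟨h1', by rw [opApply_of_mem h1']; exact h2⟩
  · rintro ⟨h1, h2⟩
    exact mem_opMul h1 h2

omit [CompleteSpace H] in
theorem opApply_opPow_succ {n : ℕ} (h : ψ ∈ (opPow T (n + 1)).domain) :
    opApply (opPow T (n + 1)) ψ = opApply T (opApply (opPow T n) ψ) :=
  opApply_opMul (mem_opPow_succ.mp h).1 (mem_opPow_succ.mp h).2

/-- The complex time evolution commutes with its generator. -/
theorem IsBoundedBelowBy.opApply_evolution (hT : IsBoundedBelowBy T a) (hw : w.im ≤ 0)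
    (hψ : ψ ∈ T.domain) :
    evolution T w ψ ∈ T.domain ∧ opApply T (evolution T w ψ) = evolution T w (opApply T ψ) := by
  have hx := hT.spec.mem_domain.mp hψ
  have he := hT.memLp_exp hw ψ
  have hme := measurable_cexp (-w)
  have hmx := Complex.measurable_ofReal
  obtain ⟨C, hC0, hC⟩ : ∃ C : ℝ, 0 ≤ C ∧ ∀ ψ, ∀ᵐ x : ℝ ∂(spectralMeasure T).measure ψ,
      ‖Complex.exp (Complex.I * -w * x)‖ ≤ C := ⟨_, Real.exp_nonneg _, hT.exp_bound hw⟩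
  have hm : MemLp ((fun x : ℝ => (x : ℂ)) * fun x : ℝ => Complex.exp (Complex.I * -w * x)) 2
      ((spectralMeasure T).measure ψ) := by
    refine (hx.const_mul (C : ℂ)).of_le (hmx.mul hme).aestronglyMeasurable ?_
    filter_upwards [hC ψ] with x hx
    rw [Pi.mul_apply, norm_mul, norm_mul, mul_comm, Complex.norm_real C, Real.norm_of_nonneg hC0]
    gcongr
  have hdom : evolution T w ψ ∈ T.domain := by
    rw [hT.spec.mem_domain, hT.evolution_apply hw, memLp_measure_fn hme he hmx]
    exact hm
  refine ⟨hdom, ?_⟩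
  rw [hT.spec.opApply_eq, hT.evolution_apply hw, hT.evolution_apply hw, hT.spec.opApply_eq,
    fn_fn hme he hmx hm, fn_fn hmx hx hme (by rwa [mul_comm]), mul_comm]

theorem IsBoundedBelowBy.opApply_opPow_evolution (hT : IsBoundedBelowBy T a) (hw : w.im ≤ 0)
    {n : ℕ} (hψ : ψ ∈ (opPow T n).domain) :
    evolution T w ψ ∈ (opPow T n).domain ∧
      opApply (opPow T n) (evolution T w ψ) = evolution T w (opApply (opPow T n) ψ) := by
  induction n with
  | zero => exact ⟨mem_opOne _, (opApply_opOne _).trans (congrArg _ (opApply_opOne ψ).symm)⟩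
  | succ n ih =>
    obtain ⟨h1, h2⟩ := mem_opPow_succ.mp hψ
    obtain ⟨h3, h4⟩ := ih h1
    obtain ⟨h5, h6⟩ := hT.opApply_evolution hw h2
    have h7 : evolution T w ψ ∈ (opPow T (n + 1)).domain :=
      mem_opPow_succ.mpr ⟨h3, by rw [h4]; exact h5⟩
    exact ⟨h7, by rw [opApply_opPow_succ h7, h4, h6, opApply_opPow_succ hψ]⟩

theorem IsSmoothVector.evolution (hψ : IsSmoothVector T ψ) (hT : IsBoundedBelowBy T a)
    (hw : w.im ≤ 0) : IsSmoothVector T (evolution T w ψ) :=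
  fun n => (hT.opApply_opPow_evolution hw (hψ n)).1

theorem abs_mul_exp_neg_le {c x : ℝ} (hc : 0 < c) (hx : a ≤ x) :
    |x| * Real.exp (-c * x) ≤ c⁻¹ + |a| * Real.exp (c * |a|) := by
  rcases le_total 0 x with h | h
  · have h1 : x * Real.exp (-c * x) ≤ c⁻¹ := by
      have h2 := Real.add_one_le_exp (c * x)
      rw [neg_mul, Real.exp_neg, ← div_eq_mul_inv, div_le_iff₀ (Real.exp_pos _)]
      rw [← div_eq_inv_mul, le_div_iff₀ hc]
      linarith
    rw [abs_of_nonneg h]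
    have : 0 ≤ |a| * Real.exp (c * |a|) := by positivity
    linarith
  · have h1 : |x| ≤ |a| := by
      rw [abs_of_nonpos h, abs_of_nonpos (hx.trans h)]
      linarith
    have h2 : Real.exp (-c * x) ≤ Real.exp (c * |a|) := by
      refine Real.exp_le_exp.mpr ?_
      rw [abs_of_nonpos h] at h1
      nlinarith
    have h3 : |x| * Real.exp (-c * x) ≤ |a| * Real.exp (c * |a|) := by gcongr
    have : 0 < c⁻¹ := by positivity
    linarith

/-- The function `x e^{-cx}` is bounded on half-lines `[a, ∞)`. -/
theorem IsBoundedBelowBy.evolution_mem_domain (hT : IsBoundedBelowBy T a) {c : ℝ} (hc : 0 < c)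
    (ψ : H) : GellMannLow.evolution T (-(Complex.I * c)) ψ ∈ T.domain := by
  have hw : (-(Complex.I * c)).im ≤ 0 := by simpa using hc.le
  rw [hT.spec.mem_domain, hT.evolution_apply hw,
    memLp_measure_fn (measurable_cexp _) (hT.memLp_exp hw ψ) Complex.measurable_ofReal]
  refine memLp_of_ae_bounded (Complex.measurable_ofReal.mul (measurable_cexp _))
    (C := c⁻¹ + |a| * Real.exp (c * |a|)) ?_
  filter_upwards [hT.ae_ge ψ] with x hx
  rw [Pi.mul_apply, norm_mul, Complex.norm_real, Real.norm_eq_abs, Complex.norm_exp]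
  have h1 : (Complex.I * -(-(Complex.I * (c : ℂ))) * (x : ℂ)).re = -c * x := by
    have : Complex.I * -(-(Complex.I * (c : ℂ))) * (x : ℂ) = ((-c * x : ℝ) : ℂ) := by
      push_cast
      linear_combination (c : ℂ) * x * Complex.I_mul_I
    rw [this, Complex.ofReal_re]
  rw [h1]
  exact abs_mul_exp_neg_le hc hx

/-- The operators `e^{-cT}` with `c > 0` are smoothing. -/
theorem IsBoundedBelowBy.isSmoothVector_evolution (hT : IsBoundedBelowBy T a) {c : ℝ} (hc : 0 < c)
    (ψ : H) : IsSmoothVector T (GellMannLow.evolution T (-(Complex.I * c)) ψ) := by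
  intro n
  induction n generalizing c ψ with
  | zero => exact mem_opOne _
  | succ n ih =>
    have hc2 : 0 < c / 2 := by positivity
    have hw : (-(Complex.I * ((c / 2 : ℝ) : ℂ))).im ≤ 0 := by
      rw [Complex.neg_im, Complex.I_mul_im, Complex.ofReal_re]
      linarith
    have h1 : GellMannLow.evolution T (-(Complex.I * c)) ψ =
        GellMannLow.evolution T (-(Complex.I * ((c / 2 : ℝ) : ℂ)))
          (GellMannLow.evolution T (-(Complex.I * ((c / 2 : ℝ) : ℂ))) ψ) := by
      rw [hT.evolution_add hw hw, show -(Complex.I * ((c / 2 : ℝ) : ℂ)) +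
        -(Complex.I * ((c / 2 : ℝ) : ℂ)) = -(Complex.I * c) by push_cast; ring]
    obtain ⟨h2, h3⟩ := hT.opApply_opPow_evolution hw (ih hc2 ψ)
    rw [h1]
    refine mem_opPow_succ.mpr ⟨h2, ?_⟩
    rw [h3]
    exact hT.evolution_mem_domain hc2 _

omit [CompleteSpace H] in
theorem isSmoothVector_opApply (hA : ∃ r : ℕ, ∀ n : ℕ,
    OpMapsTo A (opPow T (n + r)).domain (opPow T n).domain) (hψ : IsSmoothVector T ψ) :
    ψ ∈ A.domain ∧ IsSmoothVector T (opApply A ψ) := by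
  obtain ⟨r, hr⟩ := hA
  exact ⟨(hr 0).mem_domain (hψ _), fun n => (hr n).opApply_mem (hψ _)⟩

/-- The product of a closed operator and a bounded operator with range in its domain is bounded, by
the closed graph theorem. -/
theorem exists_clm_opApply (hA : A.IsClosed) (Y : H →L[ℂ] H) (hY : ∀ ψ, Y ψ ∈ A.domain) :
    ∃ Z : H →L[ℂ] H, ∀ ψ, Z ψ = opApply A (Y ψ) := by
  obtain ⟨g, hg⟩ : ∃ g : H →ₗ[ℂ] H, ∀ ψ, g ψ = opApply A (Y ψ) :=
    ⟨{ toFun := fun ψ => opApply A (Y ψ)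
       map_add' := fun ψ φ => by rw [map_add, opApply_add (hY ψ) (hY φ)]
       map_smul' := fun c ψ => by rw [map_smul, opApply_smul c (hY ψ), RingHom.id_apply] },
      fun _ => rfl⟩
  refine ⟨ContinuousLinearMap.ofSeqClosedGraph (g := g) fun u x y hu hgu => ?_, hg⟩
  rw [hg]
  exact (mem_domain_of_tendsto hA (fun n => hY (u n)) ((Y.continuous.tendsto x).comp hu)
    (hgu.congr fun n => hg (u n))).2.symm

end SmoothVectors

/-! ### The vectors `A₁ e^{-i(z₁-z₂)H} A₂ ⋯ A_m φ` -/

section GreenVec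

variable {H : Type*} [NormedAddCommGroup H] [InnerProductSpace ℂ H] [CompleteSpace H]
  {H₀ H₁ T : H →ₗ.[ℂ] H} {a b C : ℝ} {φ ψ : H}

/-- The vector `A₁ e^{-i(z₁-z₂)T} A₂ ⋯ e^{-i(z_{m-1}-z_m)T} A_m φ`, where `m = l + 1` and the indices
start at `0`. -/
def greenVec (T : H →ₗ.[ℂ] H) :
    (l : ℕ) → (Fin (l + 1) → H →ₗ.[ℂ] H) → (Fin (l + 1) → ℂ) → H → H
  | 0, A, _, φ => opApply (A 0) φ
  | l + 1, A, z, φ => opApply (A 0) (evolution T (z 0 - z 1)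
      (greenVec T l (fun j => A j.succ) (fun j => z j.succ) φ))

omit [CompleteSpace H] in
/-- This also holds off the domain of `T`, where both sides are `0` by the convention for `opApply`. -/
theorem opApply_smul_of_ne_zero {c : ℂ} (hc : c ≠ 0) (ψ : H) :
    opApply T (c • ψ) = c • opApply T ψ := by
  by_cases h : ψ ∈ T.domain
  · exact opApply_smul c h
  · have h' : c • ψ ∉ T.domain := fun h' => h (by
      simpa [smul_smul, inv_mul_cancel₀ hc] using T.domain.smul_mem c⁻¹ h')
    simp [opApply, h, h']

theorem greenVec_smul {c : ℂ} (hc : c ≠ 0) {l : ℕ} (A : Fin (l + 1) → H →ₗ.[ℂ] H)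
    (z : Fin (l + 1) → ℂ) (φ : H) : greenVec T l A z (c • φ) = c • greenVec T l A z φ := by
  induction l with
  | zero => exact opApply_smul_of_ne_zero hc φ
  | succ l ih => rw [greenVec, ih, map_smul, opApply_smul_of_ne_zero hc, greenVec]

theorem sub_im_nonpos {l : ℕ} {z : Fin (l + 2) → ℂ} (hz : Monotone fun k => (z k).im) :
    (z 0 - z 1).im ≤ 0 := by
  have := hz (Fin.zero_le (1 : Fin (l + 2)))
  rw [Complex.sub_im]
  linarith

theorem monotone_im_succ {l : ℕ} {z : Fin (l + 2) → ℂ} (hz : Monotone fun k => (z k).im) :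
    Monotone fun k : Fin (l + 1) => (z k.succ).im := fun _ _ h => hz (Fin.succ_le_succ_iff.mpr h)

/-- On sums of graded sequences, the operator in the Green's function is defined, and the operators
`W(z)` act as the complex time evolution. -/
theorem greenOp_spec (h₀ : IsBoundedBelowBy H₀ 0) (hb : 0 < b) (hC : 0 ≤ C)
    (h₁ : IsGradedOp H₀ H₁ b C) (h : IsBoundedBelowBy (H₀ + H₁) a) {l : ℕ}
    {A : Fin (l + 1) → H →ₗ.[ℂ] H} (hA : ∀ j, IsGradedOp H₀ (A j) b C) {z : Fin (l + 1) → ℂ}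
    (hz : Monotone fun k => (z k).im) {f : ℕ → H} (hf : IsGradedSeq H₀ b f) (hφ : HasSum f φ) :
    φ ∈ (greenOp H₀ H₁ A z).domain ∧
      opApply (greenOp H₀ H₁ A z) φ = greenVec (H₀ + H₁) l A z φ ∧
      ∃ g : ℕ → H, IsGradedSeq H₀ b g ∧ HasSum g (greenVec (H₀ + H₁) l A z φ) := by
  induction l with
  | zero =>
    obtain ⟨h1, h2⟩ := hf.hasSum_op hb.le hC (hA 0) hφ
    have h3 : opApply (opProd ([] : List (H →ₗ.[ℂ] H))) φ = φ := opApply_opProd_nil φ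
    have h4 : opApply (opProd ([] : List (H →ₗ.[ℂ] H))) φ ∈ (A 0).domain := by rwa [h3]
    refine ⟨mem_opProd_cons (mem_opProd_nil φ) h4, ?_, _, hf.map_op hb.le hC (hA 0), h2⟩
    exact (opApply_opProd_cons (mem_opProd_nil φ) h4).trans (by rw [h3]; rfl)
  | succ l ih =>
    obtain ⟨h1, h2, g, hg, hgs⟩ := ih (fun j => hA j.succ) (monotone_im_succ hz)
    have hw := sub_im_nonpos hz
    obtain ⟨h3, h4⟩ := hg.complexEvolution h₀ hb hC h₁ h hw hgs
    have h5 := hg.hasSum_dysonConv h₀ hb hC h₁ h hw hgs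
    have hg' := hg.dysonConv h₀ hb.le hC h₁ (z 0 - z 1)
    obtain ⟨h6, h7⟩ := hg'.hasSum_op hb.le hC (hA 0) h5
    have hcons : greenOp H₀ H₁ A z = opMul (opMul (A 0) (complexEvolution H₀ H₁ (z 0 - z 1)))
        (greenOp H₀ H₁ (fun j => A j.succ) fun j => z j.succ) := by
      rw [greenOp, List.ofFn_succ]
      rfl
    rw [← h4] at h6
    have h8 := mem_opMul h3 h6
    have h9 := opApply_opMul h3 h6
    rw [← h2] at h8 h9
    rw [hcons]
    refine ⟨mem_opMul h1 h8, ?_, _, hg'.map_op hb.le hC (hA 0), h7⟩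
    rw [opApply_opMul h1 h8, h9, h2, h4]
    rfl

/-- Applied to smooth vectors that depend boundedly on `ψ`, the unbounded operators in `greenVec` yield
a bounded operator: all the intermediate vectors remain smooth, and each factor is closed. -/
theorem exists_clm_greenVec (hT : IsBoundedBelowBy T a) {l : ℕ} {A : Fin (l + 1) → H →ₗ.[ℂ] H}
    (hA : ∀ k, (A k).IsClosed) (hAmap : ∀ k, ∃ r : ℕ, ∀ n : ℕ,
      OpMapsTo (A k) (opPow T (n + r)).domain (opPow T n).domain)
    {z : Fin (l + 1) → ℂ} (hz : Monotone fun k => (z k).im) {Y : H →L[ℂ] H}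
    (hY : ∀ ψ, IsSmoothVector T (Y ψ)) :
    ∃ Z : H →L[ℂ] H, ∀ ψ, Z ψ = greenVec T l A z (Y ψ) ∧ IsSmoothVector T (Z ψ) := by
  induction l with
  | zero =>
    have h := fun ψ => isSmoothVector_opApply (hAmap 0) (hY ψ)
    obtain ⟨Z, hZ⟩ := exists_clm_opApply (hA 0) Y fun ψ => (h ψ).1
    exact ⟨Z, fun ψ => ⟨hZ ψ, by rw [hZ]; exact (h ψ).2⟩⟩
  | succ l ih =>
    obtain ⟨Z', hZ'⟩ := ih (fun j => hA j.succ) (fun j => hAmap j.succ) (monotone_im_succ hz)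
    have h := fun ψ => isSmoothVector_opApply (hAmap 0) ((hZ' ψ).2.evolution hT (sub_im_nonpos hz))
    obtain ⟨Z, hZ⟩ := exists_clm_opApply (hA 0) (evolution T (z 0 - z 1) * Z') fun ψ => (h ψ).1
    refine ⟨Z, fun ψ => ⟨?_, by rw [hZ]; exact (h ψ).2⟩⟩
    rw [hZ, mul_apply_eq_comp, (hZ' ψ).1]
    rfl

/-- The latest and the earliest evolution factors split off from `chainValue`. -/
theorem chainValue_ofFn (γ : ℝ → ℂ) (α : ℝ) (ψ : H) {l : ℕ} (A : Fin (l + 1) → H →ₗ.[ℂ] H)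
    (τ : Fin (l + 1) → ℝ) (w : ℂ) :
    chainValue H₀ H₁ γ α ψ (List.ofFn fun j => (τ j, A j)) w =
      evolution (H₀ + H₁) (w - γ (τ 0)) (greenVec (H₀ + H₁) l A (fun j => γ (τ j))
        (evolution (H₀ + H₁) (γ (τ (Fin.last l)) - γ α) (opApply (opExp H₀ (-γ α)) ψ))) := by
  induction l generalizing w with
  | zero => rfl
  | succ l ih =>
    rw [List.ofFn_succ, chainValue, ih (fun j => A j.succ) (fun j => τ j.succ)]
    rfl

omit [CompleteSpace H] in
theorem chainImLe_ofFn {γ : ℝ → ℂ} {α : ℝ} {l : ℕ} (A : Fin (l + 1) → H →ₗ.[ℂ] H)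
    {τ : Fin (l + 1) → ℝ} {w : ℂ} (hw : (w - γ (τ 0)).im ≤ 0)
    (hτ : Monotone fun k => (γ (τ k)).im) (hα : (γ (τ (Fin.last l)) - γ α).im ≤ 0) :
    ChainImLe γ α (List.ofFn fun j => (τ j, A j)) w := by
  induction l generalizing w with
  | zero => exact ⟨hw, hα⟩
  | succ l ih =>
    rw [List.ofFn_succ]
    exact ⟨hw, ih (fun j => A j.succ) (sub_im_nonpos hτ) (monotone_im_succ hτ) hα⟩

end GreenVec

/-! ### Matrix elements between ground states -/

section MatrixElements

variable {H : Type*} [NormedAddCommGroup H] [InnerProductSpace ℂ H] [CompleteSpace H]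
  {H₀ H₁ T : H →ₗ.[ℂ] H} {a b C E : ℝ} {ψ φ Ω Ω₀ : H} {w : ℂ}

open ProjValuedMeasure

theorem proj_singleton_fn {P : ProjValuedMeasure H} {f : ℝ → ℂ} (hf : Measurable f)
    (h : MemLp f 2 (P.measure ψ)) (c : ℝ) : P.proj {c} (P.fn f ψ) = f c • P.proj {c} ψ := by
  rw [proj_fn (measurableSet_singleton c) hf h,
    ← fn_indicator_const (measurableSet_singleton c) (f c) ψ]
  congr 1
  funext x
  by_cases hx : x = c <;> simp [hx]

theorem evolution_groundState (hT : IsBoundedBelowBy T (groundEnergy T))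
    (hΩ : IsUniqueGroundState T Ω) (hw : w.im ≤ 0) :
    evolution T w Ω = Complex.exp (Complex.I * -w * groundEnergy T) • Ω := by
  have hm := measurableSet_singleton (groundEnergy T)
  have h1 : (spectralMeasure T).proj {groundEnergy T} Ω = Ω := by
    rw [proj_groundEnergy hT.spec hΩ, inner_self_eq_norm_sq_to_K, hΩ.1]
    simp
  have hexp := hT.memLp_exp hw Ω
  have h2 := (proj_fn_comm hm (measurable_cexp (-w)) hexp).1
  rw [h1, ← proj_fn hm (measurable_cexp (-w)) hexp,
    proj_singleton_fn (measurable_cexp (-w)) hexp, h1] at h2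
  rw [hT.evolution_apply hw, h2]

theorem proj_zero_groundState (h₀ : IsBoundedBelowBy H₀ 0) (hΩ₀ : IsUniqueGroundState H₀ Ω₀)
    (hE₀ : groundEnergy H₀ = 0) : (spectralMeasure H₀).proj {0} Ω₀ = Ω₀ := by
  have h := proj_groundEnergy h₀.spec hΩ₀ Ω₀
  rw [hE₀, inner_self_eq_norm_sq_to_K, hΩ₀.1] at h
  simpa using h

theorem mem_VE_of_proj_zero (h : (spectralMeasure H₀).proj {0} Ω₀ = Ω₀) : Ω₀ ∈ VE H₀ 0 := by
  rw [mem_VE_iff, Set.Icc_self, h]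

theorem opApply_opExp_of_proj_zero (h : (spectralMeasure H₀).proj {0} Ω₀ = Ω₀) (z : ℂ) :
    opApply (opExp H₀ z) Ω₀ = Ω₀ := by
  have hm := measurableSet_singleton (0 : ℝ)
  have hexp := memLp_exp_of_mem_VE (mem_VE_of_proj_zero h) z
  have h2 := (proj_fn_comm hm (measurable_cexp z) hexp).1
  rw [h, ← proj_fn hm (measurable_cexp z) hexp, proj_singleton_fn (measurable_cexp z) hexp, h] at h2
  rw [opApply_opExp_eq_fn, h2]
  simp

/-- As `e^{izH₀}` may be unbounded, it is not moved to `Ω₀` as an adjoint; instead the bounded projection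
onto the energy `0` is moved to `ψ`. -/
theorem inner_opExp_of_proj_zero (h : (spectralMeasure H₀).proj {0} Ω₀ = Ω₀) (z : ℂ)
    (hψ : ψ ∈ VE H₀ E) : ⟪Ω₀, opApply (opExp H₀ z) ψ⟫_ℂ = ⟪Ω₀, ψ⟫_ℂ := by
  have hm := measurableSet_singleton (0 : ℝ)
  have hexp := memLp_exp_of_mem_VE hψ z
  calc ⟪Ω₀, opApply (opExp H₀ z) ψ⟫_ℂ
      = ⟪(spectralMeasure H₀).proj {0} Ω₀, opApply (opExp H₀ z) ψ⟫_ℂ := by rw [h]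
    _ = ⟪Ω₀, (spectralMeasure H₀).proj {0} ψ⟫_ℂ := by
      rw [proj_inner_symm hm, opApply_opExp_eq_fn, proj_singleton_fn (measurable_cexp z) hexp]
      simp
    _ = ⟪(spectralMeasure H₀).proj {0} Ω₀, ψ⟫_ℂ := (proj_inner_symm hm _ _).symm
    _ = ⟪Ω₀, ψ⟫_ℂ := by rw [h]

/-- In expectation values in the ground state of `H₀`, the free evolution factors at both ends of
the Dyson expansion are trivial. -/
theorem inner_eq_inner_chainValue (h₀ : IsBoundedBelowBy H₀ 0) (hb : 0 < b) (hC : 0 ≤ C)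
    (h₁ : IsGradedOp H₀ H₁ b C) (h : IsBoundedBelowBy (H₀ + H₁) a)
    (hΩ₀ : (spectralMeasure H₀).proj {0} Ω₀ = Ω₀) {γ : ℝ → ℂ} {α : ℝ}
    {L : List (ℝ × (H →ₗ.[ℂ] H))} (hL : ∀ x ∈ L, IsGradedOp H₀ x.2 b C) (hw : ChainImLe γ α L w)
    {z : ℂ} {χ : H}
    (hχ : HasSum (fun n => opApply (opExp H₀ z) (chainVec H₀ H₁ γ α Ω₀ L n w)) χ) :
    ⟪Ω₀, χ⟫_ℂ = ⟪Ω₀, chainValue H₀ H₁ γ α Ω₀ L w⟫_ℂ := by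
  have hV := mem_VE_of_proj_zero hΩ₀
  have h2 := (innerSL ℂ Ω₀).hasSum hχ
  have h3 := (innerSL ℂ Ω₀).hasSum (hasSum_chainVec h₀ hb hC h₁ h hL hV hw)
  refine h2.unique (h3.congr_fun fun n => ?_)
  exact inner_opExp_of_proj_zero hΩ₀ z
    (chainVec_spec (α := α) (γ := γ) h₀ hb.le h₁ hL le_rfl hV le_rfl w).2

/-- Bounded operators between complex time evolutions by `e^{-iwT}` with `Im w → -∞` are projected to
their expectation values in the ground state. -/
theorem tendsto_inner_evolution (hT : IsBoundedBelowBy T (groundEnergy T))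
    (hΩ : IsUniqueGroundState T Ω) (Z : H →L[ℂ] H) {v w : ℝ → ℂ}
    (hv : Tendsto (fun t => (v t).im) atTop atBot) (hw : Tendsto (fun t => (w t).im) atTop atBot)
    (ψ φ : H) :
    Tendsto (fun t => Complex.exp (Complex.I * (v t + w t) * groundEnergy T) *
      ⟪ψ, evolution T (v t) (Z (evolution T (w t) φ))⟫_ℂ) atTop
      (𝓝 (⟪ψ, Ω⟫_ℂ * ⟪Ω, φ⟫_ℂ * ⟪Ω, Z Ω⟫_ℂ)) := by
  -- the evolution on the left is moved to the other side of the inner product as its adjoint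
  have hv' : Tendsto (fun t => (-star (v t)).im) atTop atBot := by simpa using hv
  have h1 := tendsto_evolution hT hΩ hv' ψ
  have h2 := (Z.continuous.tendsto _).comp (tendsto_evolution hT hΩ hw φ)
  have h3 := h1.inner h2 (𝕜 := ℂ)
  have e : ⟪⟪Ω, ψ⟫_ℂ • Ω, Z (⟪Ω, φ⟫_ℂ • Ω)⟫_ℂ = ⟪ψ, Ω⟫_ℂ * ⟪Ω, φ⟫_ℂ * ⟪Ω, Z Ω⟫_ℂ := by
    rw [map_smul, inner_smul_left, inner_smul_right, inner_conj_symm]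
    ring
  rw [e] at h3
  refine h3.congr' ?_
  filter_upwards [hv.eventually_le_atBot 0] with t ht
  rw [Function.comp_apply, map_smul, inner_smul_left, inner_smul_right, hT.inner_evolution ht,
    ← mul_assoc, ← Complex.exp_conj, ← Complex.exp_add]
  congr 2
  simp only [map_mul, map_neg, Complex.conj_I, Complex.conj_ofReal, RCLike.star_def,
    Complex.conj_conj]
  ring

/-- The sum of `H₀` and a symmetric perturbation that is bounded relative to `H₀^{1/2}` has a spectral
measure, and is bounded below by its ground energy. -/
theorem isBoundedBelowBy_add (h₀ : IsBoundedBelowBy H₀ 0) (hsymm : H₀.IsFormalAdjoint H₀)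
    (h₁ : RelBounded H₁ (opSqrt H₀)) (hsymm₁ : H₁.IsFormalAdjoint H₁) :
    IsBoundedBelowBy (H₀ + H₁) (groundEnergy (H₀ + H₁)) := by
  obtain ⟨κ₀, -, hκ⟩ := exists_inResolventSet_add h₀ h₁
  exact isBoundedBelowBy_groundEnergy (isSpectralMeasure_spectralMeasure
    (exists_isSpectralMeasure (isFormalAdjoint_add hsymm hsymm₁) (hκ κ₀ le_rfl))) hκ

end MatrixElements

/-! ### Time-ordered expectation values as matrix elements of `e^{-iwH}` -/

section Expectations

variable {H : Type*} [NormedAddCommGroup H] [InnerProductSpace ℂ H] [CompleteSpace H]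
  {H₀ H₁ : H →ₗ.[ℂ] H} {a b C : ℝ} {Ω₀ : H} {γ : Curve} {z' z'' : ℂ}

/-- Points on a simple curve, listed from the latest to the earliest one, have strictly decreasing
parameters. -/
theorem Curve.IsSimpleCurve.exists_strictAnti (hγ : γ.IsSimpleCurve) {k : ℕ} {z : Fin k → ℂ}
    (hz : ∀ j, z j ∈ γ.points) (hlater : ∀ i j, i < j → γ.Later (z i) (z j)) :
    ∃ τ : Fin k → ℝ, (∀ j, τ j ∈ γ.I) ∧ StrictAnti τ ∧ z = fun j => γ.toFun (τ j) := by
  choose τ hτ hτz using hz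
  refine ⟨τ, hτ, fun i j hij => ?_, funext fun j => (hτz j).symm⟩
  have h := hlater i j hij
  rwa [← hτz i, ← hτz j, hγ.later_iff (hτ i) (hτ j)] at h

/-- The numerator of the Gell-Mann–Low quotient as a matrix element of complex time evolutions. -/
theorem inner_timeOrderedExpWith (h₀ : IsBoundedBelowBy H₀ 0) (hb : 0 < b) (hC : 0 ≤ C)
    (h₁ : IsGradedOp H₀ H₁ b C) (h : IsBoundedBelowBy (H₀ + H₁) a)
    (hΩ₀ : (spectralMeasure H₀).proj {0} Ω₀ = Ω₀) {l : ℕ} {A : Fin (l + 1) → H →ₗ.[ℂ] H}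
    (hA : ∀ j, IsGradedOp H₀ (A j) b C) {z : Fin (l + 1) → ℂ} (hz : Monotone fun k => (z k).im)
    (hγ : γ.IsSimpleFromTo z' z'') (hmem : ∀ j, z j ∈ γ.points)
    (hlater : ∀ i j, i < j → γ.Later (z i) (z j)) (h1 : (z'' - z 0).im ≤ 0)
    (h2 : (z (Fin.last l) - z').im ≤ 0) :
    Ω₀ ∈ (timeOrderedExpWith H₀ H₁ γ A z).domain ∧
      ⟪Ω₀, opApply (timeOrderedExpWith H₀ H₁ γ A z) Ω₀⟫_ℂ =
        ⟪Ω₀, evolution (H₀ + H₁) (z'' - z 0) (greenVec (H₀ + H₁) l A z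
          (evolution (H₀ + H₁) (z (Fin.last l) - z') Ω₀))⟫_ℂ := by
  obtain ⟨hγ, rfl, rfl⟩ := hγ
  obtain ⟨τ, hτ, hanti, rfl⟩ := hγ.exists_strictAnti hmem hlater
  obtain ⟨h3, h4⟩ := timeOrderedExpWith_spec h₀ hb hC h₁ hA le_rfl (mem_VE_of_proj_zero hΩ₀) hγ hτ
    hanti
  refine ⟨h3, ?_⟩
  have hL : ∀ x ∈ List.ofFn fun j => (τ j, A j), IsGradedOp H₀ x.2 b C := by
    intro x hx
    obtain ⟨j, rfl⟩ := (List.mem_ofFn' _ _).mp hx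
    exact hA j
  rw [inner_eq_inner_chainValue h₀ hb hC h₁ h hΩ₀ hL (chainImLe_ofFn A h1 hz h2) h4,
    chainValue_ofFn, opApply_opExp_of_proj_zero hΩ₀]

/-- The denominator of the Gell-Mann–Low quotient as a matrix element of the complex time evolution. -/
theorem inner_timeOrderedExpOf (h₀ : IsBoundedBelowBy H₀ 0) (hb : 0 < b) (hC : 0 ≤ C)
    (h₁ : IsGradedOp H₀ H₁ b C) (h : IsBoundedBelowBy (H₀ + H₁) a)
    (hΩ₀ : (spectralMeasure H₀).proj {0} Ω₀ = Ω₀) (hγ : γ.IsSimpleFromTo z' z'')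
    (h1 : (z'' - z').im ≤ 0) :
    Ω₀ ∈ (timeOrderedExpOf H₀ H₁ γ).domain ∧
      ⟪Ω₀, opApply (timeOrderedExpOf H₀ H₁ γ) Ω₀⟫_ℂ =
        ⟪Ω₀, evolution (H₀ + H₁) (z'' - z') Ω₀⟫_ℂ := by
  obtain ⟨hγ, rfl, rfl⟩ := hγ
  obtain ⟨h3, h4⟩ := timeOrderedExpOf_spec h₀ hb hC h₁ le_rfl (mem_VE_of_proj_zero hΩ₀) hγ
  refine ⟨h3, ?_⟩
  have hchain : ChainImLe γ.toFun γ.α ([] : List (ℝ × (H →ₗ.[ℂ] H))) (γ.toFun γ.β) := h1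
  rw [inner_eq_inner_chainValue h₀ hb hC h₁ h hΩ₀ (by simp) hchain h4, chainValue,
    opApply_opExp_of_proj_zero hΩ₀]

end Expectations

end GellMannLow

end

theorem mainTheorem1 {H : Type*} [NormedAddCommGroup H] [InnerProductSpace ℂ H] [CompleteSpace H]
    -- `H₀` is a non-negative self-adjoint operator, `H₁` is symmetric and in the `C₀` class
    (H₀ H₁ : H →ₗ.[ℂ] H) (hH₀ : IsSelfAdjoint H₀) (hH₀nonneg : IsNonnegOp H₀)
    (hH₁ : IsCZero H₀ H₁) (hH₁symm : IsSymmetricOp H₁)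
    -- ground states of `H₀` and of `H = H₀ + H₁`
    (Ω₀ Ω : H) (hΩ₀ : IsUniqueGroundState H₀ Ω₀) (hE₀ : groundEnergy H₀ = 0)
    (hΩ : IsUniqueGroundState (H₀ + H₁) Ω) (hoverlap : inner ℂ Ω Ω₀ ≠ 0)
    -- the operators `A₁, …, A_m`, with `m = l + 1 ≥ 1`, indexed from `0` to `l`
    {l : ℕ} (A : Fin (l + 1) → H →ₗ.[ℂ] H) (hA : ∀ k, IsCZero H₀ (A k))
    (hAmap : ∀ k, ∃ r : ℕ, ∀ n : ℕ,
      OpMapsTo (A k) (opPow (H₀ + H₁) (n + r)).domain (opPow (H₀ + H₁) n).domain)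
    (z : Fin (l + 1) → ℂ) (hz : Monotone fun k => (z k).im) :
    -- the Green's function is well defined
    Ω ∈ (greenOp H₀ H₁ A z).domain ∧
    ∀ (ε : ℝ), 0 < ε → ∀ Γ : ℝ → Curve,
      -- for large `T`, `Γ T` is a simple curve from `-T(1-iε)` to `T(1-iε)`, with `z₁ ≻ ⋯ ≻ z_m`
      (∀ᶠ T : ℝ in Filter.atTop,
        (Γ T).IsSimpleFromTo (-(T * (1 - Complex.I * ε))) (T * (1 - Complex.I * ε)) ∧
        (∀ k, z k ∈ (Γ T).points) ∧ ∀ j k, j < k → (Γ T).Later (z j) (z k)) →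
      -- the expectation values are well defined, and the denominator does not vanish
      (∀ᶠ T : ℝ in Filter.atTop,
        Ω₀ ∈ (timeOrderedExpWith H₀ H₁ (Γ T) A z).domain ∧
        Ω₀ ∈ (timeOrderedExpOf H₀ H₁ (Γ T)).domain ∧
        inner ℂ Ω₀ (opApply (timeOrderedExpOf H₀ H₁ (Γ T)) Ω₀) ≠ 0) ∧
      Filter.Tendsto
        (fun T : ℝ => inner ℂ Ω₀ (opApply (timeOrderedExpWith H₀ H₁ (Γ T) A z) Ω₀) /
          inner ℂ Ω₀ (opApply (timeOrderedExpOf H₀ H₁ (Γ T)) Ω₀))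
        Filter.atTop (nhds (greenFunction H₀ H₁ Ω A z)) := by
  have h₀ := isBoundedBelowBy_zero hH₀ hH₀nonneg
  have hsymm₀ : H₀.IsFormalAdjoint H₀ := by
    have h := LinearPMap.adjoint_isFormalAdjoint (T := H₀) hH₀.dense_domain
    rwa [LinearPMap.isSelfAdjoint_def.mp hH₀] at h
  have h := isBoundedBelowBy_add h₀ hsymm₀ hH₁.relBounded hH₁symm.2
  have hP₀ := proj_zero_groundState h₀ hΩ₀ hE₀
  obtain ⟨b, C, hb, hC, hgr⟩ := exists_isGradedOp_common (H₀ := H₀)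
    (A := fun i : Option (Fin (l + 1)) => i.elim H₁ A) (fun i => by
      cases i with
      | none => exact hH₁
      | some k => exact hA k)
  have h₁ : IsGradedOp H₀ H₁ b C := hgr none
  have hAgr : ∀ k, IsGradedOp H₀ (A k) b C := fun k => hgr (some k)
  obtain ⟨hΩdom, hΩeig⟩ := mem_opEigenspace.mp hΩ.2.1
  rw [← opApply_of_mem hΩdom] at hΩeig
  obtain ⟨f, hf, hfs⟩ := exists_isGradedSeq_eigenvector h₀ hH₁.relBounded hH₁symm.2 hb h₁.mapsTo
    hΩdom hΩeig
  obtain ⟨hgreen, hgreenval, -⟩ := greenOp_spec h₀ hb hC h₁ h hAgr hz hf hfs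
  refine ⟨hgreen, fun ε hε Γ hΓ => ?_⟩
  obtain ⟨E, hE⟩ : ∃ E, E = groundEnergy (H₀ + H₁) := ⟨_, rfl⟩
  obtain ⟨u, hu⟩ : ∃ u : ℝ → ℂ, ∀ T : ℝ, u T = T * (1 - Complex.I * ε) := ⟨_, fun _ => rfl⟩
  have huim : ∀ T, (u T).im = -(T * ε) := fun T => by rw [hu]; simp
  have hulim : Filter.Tendsto (fun T => (u T).im) Filter.atTop Filter.atBot := by
    simp only [huim]
    exact Filter.tendsto_neg_atTop_atBot.comp (Filter.tendsto_id.atTop_mul_const hε)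
  have hushift : ∀ c : ℂ, Filter.Tendsto (fun T => (u T + c).im) Filter.atTop Filter.atBot :=
    fun c => by
      simp only [Complex.add_im]
      exact Filter.tendsto_atBot_add_const_right _ _ hulim
  -- a factor `e^{-H}` split off from the evolution makes the operators between the evolutions bounded
  have hIim : (-(Complex.I * ((1 : ℝ) : ℂ))).im ≤ 0 := by simp
  obtain ⟨Z, hZ⟩ := exists_clm_greenVec h (fun k => (hA k).closed) hAmap hz
    (fun ψ => h.isSmoothVector_evolution one_pos ψ)
  have hZΩ : Z Ω = Complex.exp (-E) • greenVec (H₀ + H₁) l A z Ω := by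
    rw [(hZ Ω).1, evolution_groundState h hΩ hIim, greenVec_smul (Complex.exp_ne_zero _), ← hE]
    congr 2
    push_cast
    linear_combination (E : ℂ) * Complex.I_mul_I
  have hnum : ∀ᶠ T : ℝ in Filter.atTop,
      Ω₀ ∈ (timeOrderedExpWith H₀ H₁ (Γ T) A z).domain ∧
      inner ℂ Ω₀ (opApply (timeOrderedExpWith H₀ H₁ (Γ T) A z) Ω₀) =
        inner ℂ Ω₀ (evolution (H₀ + H₁) (u T + -z 0)
          (Z (evolution (H₀ + H₁) (u T + (z (Fin.last l) + Complex.I)) Ω₀))) := by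
    filter_upwards [hΓ, (hushift (-z 0)).eventually_le_atBot 0,
      (hushift (z (Fin.last l) + Complex.I)).eventually_le_atBot 0,
      (hushift (z (Fin.last l))).eventually_le_atBot 0] with T hT h1 h2 h3
    rw [← hu] at hT
    obtain ⟨h4, h5⟩ := inner_timeOrderedExpWith h₀ hb hC h₁ h hP₀ hAgr hz hT.1 hT.2.1 hT.2.2
      (by rwa [sub_eq_add_neg]) (by rwa [sub_neg_eq_add, add_comm])
    refine ⟨h4, ?_⟩
    rw [h5, (hZ _).1, h.evolution_add hIim h2, sub_eq_add_neg, sub_neg_eq_add,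
      show -(Complex.I * ((1 : ℝ) : ℂ)) + (u T + (z (Fin.last l) + Complex.I)) =
        z (Fin.last l) + u T by push_cast; ring]
  have hden : ∀ᶠ T : ℝ in Filter.atTop,
      Ω₀ ∈ (timeOrderedExpOf H₀ H₁ (Γ T)).domain ∧
      inner ℂ Ω₀ (opApply (timeOrderedExpOf H₀ H₁ (Γ T)) Ω₀) =
        inner ℂ Ω₀ (evolution (H₀ + H₁) (u T)
          ((1 : H →L[ℂ] H) (evolution (H₀ + H₁) (u T) Ω₀))) := by
    filter_upwards [hΓ, hulim.eventually_le_atBot 0] with T hT h1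
    rw [← hu] at hT
    obtain ⟨h4, h5⟩ := inner_timeOrderedExpOf h₀ hb hC h₁ h hP₀ hT.1 (by
      rw [sub_neg_eq_add, Complex.add_im]
      linarith)
    refine ⟨h4, ?_⟩
    rw [h5, one_apply_eq_self, h.evolution_add h1 h1, sub_neg_eq_add]
  have hlimnum := tendsto_inner_evolution h hΩ Z (hushift (-z 0))
    (hushift (z (Fin.last l) + Complex.I)) Ω₀ Ω₀
  have hlimden := tendsto_inner_evolution h hΩ 1 hulim hulim Ω₀ Ω₀
  have hΩΩ : inner ℂ Ω Ω = (1 : ℂ) := by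
    rw [inner_self_eq_norm_sq_to_K, hΩ.1]
    simp
  rw [one_apply_eq_self, hΩΩ, mul_one] at hlimden
  have hc : inner ℂ Ω₀ Ω * inner ℂ Ω Ω₀ ≠ (0 : ℂ) := by
    refine mul_ne_zero (fun h0 => hoverlap ?_) hoverlap
    rw [← inner_conj_symm, h0, map_zero]
  constructor
  · filter_upwards [hnum, hden, hlimden.eventually_ne hc] with T h1 h2 h3
    exact ⟨h1.1, h2.1, by rw [h2.2]; exact right_ne_zero_of_mul h3⟩
  · have hquot := (hlimnum.div hlimden hc).const_mul
      (Complex.exp (Complex.I * (z 0 - z (Fin.last l) - Complex.I) * E))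
    have hval : Complex.exp (Complex.I * (z 0 - z (Fin.last l) - Complex.I) * E) *
        (inner ℂ Ω₀ Ω * inner ℂ Ω Ω₀ * inner ℂ Ω (Z Ω) / (inner ℂ Ω₀ Ω * inner ℂ Ω Ω₀)) =
        greenFunction H₀ H₁ Ω A z := by
      rw [mul_div_cancel_left₀ _ hc, greenFunction, hgreenval, hZΩ, inner_smul_right, ← mul_assoc,
        ← Complex.exp_add, ← hE]
      congr 2
      linear_combination (-E : ℂ) * Complex.I_mul_I
    rw [hval] at hquot
    refine hquot.congr' ?_
    filter_upwards [hnum, hden] with T h1 h2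
    rw [h1.2, h2.2, Pi.div_apply, mul_div_assoc', ← mul_assoc, ← Complex.exp_add,
      mul_div_mul_comm, ← Complex.exp_sub, ← hE]
    -- the phases cancel
    rw [show Complex.I * (z 0 - z (Fin.last l) - Complex.I) * E +
      Complex.I * (u T + -z 0 + (u T + (z (Fin.last l) + Complex.I))) * E -
      Complex.I * (u T + u T) * E = 0 by ring, Complex.exp_zero, one_mul]
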